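/- Work over $\mathbb{C}[[t]]$ with $t$ real (bar denotes conjugation of coefficients, and $*$-structures are conjugate-linear); Hopf algebras have invertible antipodes, and tensor products and algebras are $t$-adically completed. Let $H$ be a $t$-adically complete real-quasitriangular Hopf $*$-algebra, $\mathcal R^{*\otimes *}=\mathcal R_{21}$, dually paired with a Hopf $*$-algebra $A$, with $\overline{\langle h,a\rangle}=\langle (Sh)^*,a^*\rangle$. Let $A$ be generated by a matrix $\mathbf t=(t^i{}_j)_{1\le i,j\le n}$ with $\Delta t^i{}_j=\sum_a t^i{}_a\otimes t^a{}_j$, $\epsilon(t^i{}_j)=\delta^i_j$, $R\mathbf t_1\mathbf t_2=\mathbf t_2\mathbf t_1R$, $t^i{}_j{}^*=St^j{}_i$ and $\langle \mathbf t_1\otimes\mathbf t_2,\mathcal R\rangle=\nu R$, where $R\in M_n\otimes M_n$ is of real type I, i.e. $\overline{R^i{}_j{}^k{}_l}=R^l{}_k{}^j{}_i$, and $\nu=e^{\ell}$ with $\ell=\bar\ell\in t\,\mathbb{C}[[t]]$. Put $\mathbf l^+=\langle \mathrm{id}\otimes\mathbf t,\mathcal R\rangle$ and $\mathbf l^-=\langle\mathbf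 t\otimes\mathrm{id},\mathcal R^{-1}\rangle$. For a background quasitriangular Hopf algebra $(X,\mathcal R_X)$ acting on generators $p$ of an algebra $B$, and a constant $\lambda=e^{\ell'}$, the inhomogeneous quantum group $B\rtimes\widetilde X$ is generated by $X$, $B$ and $\xi$, where $\xi$ is primitive and commutes with $X$, with cross relations $\xi p=p\xi-p$ and $h\,p=(h_{(1)}\triangleright p)h_{(2)}$ for $h\in X$; $X$ with its coproduct is a sub-Hopf algebra, $\Delta p=p\otimes1+\lambda^{\xi}\mathcal R_X^{(2)}\otimes\mathcal R_X^{(1)}\triangleright p$ and $\epsilon(p)=0$; put $\widetilde{\mathcal R}=\mathcal R_X\,\lambda^{-\xi\otimes\xi}$. A quasi-$*$ Hopf algebra is a Hopf algebra which is a $*$-algebra, with an invertible $\mathcal R$ such that $(\mathrm{id}\otimes\Delta)\mathcal R=\mathcal R_{13}\mathcal R_{12}$, $(\Delta\otimes\mathrm{id})\mathcal R=\mathcal R_{13}\mathcal R_{23}$, $(*\otimes *)\circ\Delta\circ *=\mathcal R^{-1}(\tau\circ\Delta)\mathcal R$, $\overline{\epsilon(\cdot)}=\epsilon\circ *$ and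 $\mathcal R^{*\otimes *}=\mathcal R_{21}$. In (1) and (3) denote by $\mathbf l^\pm$, $\mathbf m^\pm$ the matrices $\mathbf l^\pm$ in the first and in the second copy of $H$, and let $H\otimes H$ act on the span of the $p^i{}_j$ by $(h\otimes g)\triangleright p^i{}_j=\sum_{a,b}p^a{}_b\langle h,St^i{}_a\rangle\langle g,t^b{}_j\rangle$. In each of the following cases the inhomogeneous quantum group is well defined as a Hopf algebra and is, for $\mathcal R=\widetilde{\mathcal R}$, a quasi-$*$ Hopf algebra whose $*$-structure extends the stated one on $X$ and has the stated values. (1) ($q$-Minkowski) Let $R$ be $q$-Hecke, $(PR-q)(PR+q^{-1})=0$. Let $B=B(R)$ be the algebra with generators $p^i{}_j$ and relations $R_{21}\mathbf p_1R\mathbf p_2=\mathbf p_2R_{21}\mathbf p_1R$, let $X=H\bowtie H$ be the twist of $H\otimes H$ by $\chi=(\mathcal R^{-1})_{23}$, that is $\Delta_\chi=\chi\Delta\chi^{-1}$, $S_\chi=U(S\otimes S)(\cdot)U^{-1}$ with $U=\chi^{(1)}S\chi^{(2)}$, $\mathcal R_X=\chi_{21}\mathcal R_{H\otimes H}\chi^{-1}$,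 with $(h\otimes g)^*=U(g^*\otimes h^*)U^{-1}$, and let $\lambda=\nu^2$. Then $$l^{\pm i}{}_j{}^*=Sm^{\mp j}{}_i,\quad m^{\pm i}{}_j{}^*=Sl^{\mp j}{}_i,\quad p^i{}_j{}^*=p^j{}_i,\quad \xi^*=-\xi .$$ (2) (vectorial) Let $R'\in M_n\otimes M_n$ be of real type I, with $R'\mathbf t_1\mathbf t_2=\mathbf t_2\mathbf t_1R'$, $R'_{12}R_{13}R_{23}=R_{23}R_{13}R'_{12}$, $R_{12}R_{13}R'_{23}=R'_{23}R_{13}R_{12}$, $R_{12}R_{13}R_{23}=R_{23}R_{13}R_{12}$ and $(PR+1)(PR'-1)=0$. Let $\eta$ be a quantum metric: an invertible matrix with $\sum_{a,b}\eta_{ab}t^a{}_it^b{}_j=\eta_{ij}$, such that $p_i\mapsto\sum_a\eta_{ia}p^a$ is an isomorphism from the algebra of braided covectors ($\mathbf p_1\mathbf p_2=\mathbf p_2\mathbf p_1R'$) to the algebra of braided vectors $V(R',R)$ ($\mathbf p_1\mathbf p_2=R'\mathbf p_2\mathbf p_1$), and with $\overline{\eta_{ij}}=\eta^{ji}$, where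 $(\eta^{ij})$ is the inverse transpose of $\eta$. Let $B=V(R',R)$, $X=H$ with its given $*$-structure, $h\triangleright p^i=\sum_ap^a\langle h,St^i{}_a\rangle$ and $\lambda=\nu$. Then $$l^{\pm i}{}_j{}^*=Sl^{\mp j}{}_i,\quad p^i{}^*=p_i=\sum_a\eta_{ia}p^a,\quad \xi^*=-\xi .$$ (3) (spinorial $q$-Euclidean) Let $R$ be $q$-Hecke, and let $\varepsilon=(\varepsilon^{ij})$ be an invertible matrix with inverse transpose $(\varepsilon_{ij})$ such that $t^i{}_j{}^*=\sum_{a,b}\varepsilon_{ai}t^a{}_b\varepsilon^{bj}$ and $\varepsilon\bar\varepsilon$ is a multiple of the identity. Let $B=\bar A(R)$ be the algebra with generators $p^i{}_j$ and relations $R_{21}\mathbf p_1\mathbf p_2=\mathbf p_2\mathbf p_1R$, let $X=H\otimes H$ be the tensor product quasitriangular Hopf algebra with $(h\otimes g)^*=S^{-2}(h^*)\otimes g^*$, and let $\lambda=\nu^2$. Then $$l^{\pm i}{}_j{}^*=S^{-1}l^{\mp j}{}_i,\quad m^{\pm i}{}_j{}^*=Sm^{\mp j}{}_i,\quad p^i{}_j{}^*=\sum_{a,b}\varepsilon_{ai}p^a{}_b\varepsilon^{bj},\quad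 \xi^*=-\xi .$$ -/

import Mathlib

open scoped TensorProduct Kronecker

noncomputable section

namespace QStar

/-! ### The ground ring and `t`-adic completions -/

/-- The ground ring `ℂ[[t]]` of formal power series in the deformation parameter. -/
abbrev K : Type := PowerSeries ℂ

/-- The ideal `(t)`. -/
abbrev tIdeal : Ideal K := Ideal.span {PowerSeries.X}

/-- Complex conjugation of the coefficients (the deformation parameter `t` is real). -/
def conjK : K →+* K := PowerSeries.map (starRingEnd ℂ)

theorem conjK_mem {a : K} (ha : a ∈ tIdeal) : conjK a ∈ tIdeal := by
  rw [Ideal.mem_span_singleton] at ha ⊢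
  obtain ⟨b, rfl⟩ := ha
  exact ⟨conjK b, by simp [conjK]⟩

/-- The `t`-adic completion of a `ℂ[[t]]`-module. -/
def Cpl (M : Type*) [AddCommGroup M] [Module K M] : Type _ := AdicCompletion tIdeal M

section Module

variable {M N Q : Type*} [AddCommGroup M] [Module K M] [AddCommGroup N] [Module K N]
  [AddCommGroup Q] [Module K Q]

instance : AddCommGroup (Cpl M) := inferInstanceAs (AddCommGroup (AdicCompletion tIdeal M))

instance : Module K (Cpl M) := inferInstanceAs (Module K (AdicCompletion tIdeal M))

instance : IsAdicComplete tIdeal (Cpl M) :=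
  AdicCompletion.isAdicComplete (I := tIdeal) (M := M) ⟨{PowerSeries.X}, by simp⟩

/-- The canonical map into the completion. -/
def of (M : Type*) [AddCommGroup M] [Module K M] : M →ₗ[K] Cpl M := AdicCompletion.of tIdeal M

/-- A complete module is its own completion. -/
def uncpl (M : Type*) [AddCommGroup M] [Module K M] [IsAdicComplete tIdeal M] : Cpl M →ₗ[K] M :=
  (AdicCompletion.ofLinearEquiv tIdeal M).symm.toLinearMap

/-- Reduction modulo `t ^ n`. -/
def red (M : Type*) [AddCommGroup M] [Module K M] (n : ℕ) :
    Cpl M →ₗ[K] M ⧸ (tIdeal ^ n • ⊤ : Submodule K M) := AdicCompletion.eval tIdeal M n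

theorem Cpl.ext {x y : Cpl M} (h : ∀ n, red M n x = red M n y) : x = y :=
  AdicCompletion.ext h

theorem smul_quot_eq_zero {n : ℕ} {a : K} (ha : a ∈ tIdeal ^ n)
    (y : M ⧸ (tIdeal ^ n • ⊤ : Submodule K M)) : a • y = 0 := by
  induction y using Submodule.Quotient.induction_on with
  | _ y =>
    rw [← Submodule.Quotient.mk_smul, Submodule.Quotient.mk_eq_zero]
    exact Submodule.smul_mem_smul ha trivial

theorem map_mem_pow {σ : K →+* K} (hσ : ∀ a ∈ tIdeal, σ a ∈ tIdeal) {n : ℕ} {a : K}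
    (ha : a ∈ tIdeal ^ n) : σ a ∈ tIdeal ^ n := by
  have h : (tIdeal ^ n).map σ ≤ tIdeal ^ n := by
    rw [Ideal.map_pow]
    exact Ideal.pow_right_mono (Ideal.map_le_iff_le_comap.2 hσ) n
  exact h (Ideal.mem_map_of_mem σ ha)

theorem le_ker_of_semilinear {σ : K →+* K} (hσ : ∀ a ∈ tIdeal, σ a ∈ tIdeal) (n : ℕ)
    (f : M →ₛₗ[σ] N ⧸ (tIdeal ^ n • ⊤ : Submodule K N)) :
    (tIdeal ^ n • ⊤ : Submodule K M) ≤ LinearMap.ker f := by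
  rw [Submodule.smul_le]
  intro r hr m _
  rw [LinearMap.mem_ker, LinearMap.map_smulₛₗ]
  exact smul_quot_eq_zero (map_mem_pow hσ hr) _

/-- Reduction modulo `t ^ n` of a (semi)linear map `M → Cpl N`. -/
def redσ {σ : K →+* K} (hσ : ∀ a ∈ tIdeal, σ a ∈ tIdeal) (f : M →ₛₗ[σ] Cpl N) (n : ℕ) :
    (M ⧸ (tIdeal ^ n • ⊤ : Submodule K M)) →ₛₗ[σ] N ⧸ (tIdeal ^ n • ⊤ : Submodule K N) :=
  Submodule.liftQ _ ((red N n).comp f) (le_ker_of_semilinear hσ n _)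

/-- Extension by continuity of a (semi)linear map `M → Cpl N` to the completion of `M`. -/
def cextσ {σ : K →+* K} (hσ : ∀ a ∈ tIdeal, σ a ∈ tIdeal) (f : M →ₛₗ[σ] Cpl N) :
    Cpl M →ₛₗ[σ] Cpl N where
  toFun x := ⟨fun n => redσ hσ f n (red M n x), by
    intro m n hmn
    obtain ⟨y, hy⟩ := Submodule.Quotient.mk_surjective _ (red M n x)
    have hx : red M m x = Submodule.Quotient.mk y := by
      have := AdicCompletion.transitionMap_comp_eval_apply tIdeal M hmn x
      change AdicCompletion.transitionMap tIdeal M hmn (red M n x) = red M m x at this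
      rw [← this, ← hy]
      rfl
    beta_reduce
    rw [hx, ← hy]
    exact AdicCompletion.transitionMap_comp_eval_apply tIdeal N hmn (f y)⟩
  map_add' x y := Cpl.ext fun n => by
    change redσ hσ f n (red M n (x + y)) = redσ hσ f n (red M n x) + redσ hσ f n (red M n y)
    rw [map_add, map_add]
  map_smul' a x := Cpl.ext fun n => by
    change redσ hσ f n (red M n (a • x)) = σ a • redσ hσ f n (red M n x)
    rw [map_smul, LinearMap.map_smulₛₗ]

/-- Extension by continuity of a linear map `M → Cpl N`. -/
def cext (f : M →ₗ[K] Cpl N) : Cpl M →ₗ[K] Cpl N := cextσ (fun _ h => h) f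

/-- The completion of a linear map. -/
def cmap (f : M →ₗ[K] N) : Cpl M →ₗ[K] Cpl N := cext ((of N).comp f)

/-- The completion of a conjugate-linear map. -/
def cmapConj (f : M →ₛₗ[conjK] N) : Cpl M →ₛₗ[conjK] Cpl N :=
  cextσ (fun _ h => conjK_mem h) ((of N).comp f)

/-- Reduction of a bilinear map modulo `t ^ n`. -/
def bilinRed (f : M →ₗ[K] N →ₗ[K] Q) (n : ℕ) :
    (M ⧸ (tIdeal ^ n • ⊤ : Submodule K M)) →ₗ[K] (N ⧸ (tIdeal ^ n • ⊤ : Submodule K N)) →ₗ[K]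
      (Q ⧸ (tIdeal ^ n • ⊤ : Submodule K Q)) :=
  LinearMap.liftQ₂ _ _ (f.compr₂ (Submodule.mkQ (tIdeal ^ n • ⊤ : Submodule K Q)))
    (by
      rw [Submodule.smul_le]
      intro r hr m _
      rw [LinearMap.mem_ker]
      ext y
      simp only [map_smul, LinearMap.smul_apply]
      exact smul_quot_eq_zero hr _)
    (by
      rw [Submodule.smul_le]
      intro r hr m _
      rw [LinearMap.mem_ker]
      ext y
      simp only [map_smul, LinearMap.smul_apply]
      exact smul_quot_eq_zero hr _)

/-- The completion of a bilinear map. -/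
def cmap₂ (f : M →ₗ[K] N →ₗ[K] Q) : Cpl M →ₗ[K] Cpl N →ₗ[K] Cpl Q :=
  LinearMap.mk₂ K
    (fun x y => (⟨fun n => bilinRed f n (red M n x) (red N n y), by
      intro m n hmn
      obtain ⟨u, hu⟩ := Submodule.Quotient.mk_surjective _ (red M n x)
      obtain ⟨v, hv⟩ := Submodule.Quotient.mk_surjective _ (red N n y)
      have hx : red M m x = Submodule.Quotient.mk u := by
        have := AdicCompletion.transitionMap_comp_eval_apply tIdeal M hmn x
        change AdicCompletion.transitionMap tIdeal M hmn (red M n x) = red M m x at this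
        rw [← this, ← hu]
        rfl
      have hy : red N m y = Submodule.Quotient.mk v := by
        have := AdicCompletion.transitionMap_comp_eval_apply tIdeal N hmn y
        change AdicCompletion.transitionMap tIdeal N hmn (red N n y) = red N m y at this
        rw [← this, ← hv]
        rfl
      beta_reduce
      rw [hx, hy, ← hu, ← hv]
      rfl⟩ : Cpl Q))
    (fun x x' y => Cpl.ext fun n => by
      change bilinRed f n (red M n (x + x')) (red N n y) =
        bilinRed f n (red M n x) (red N n y) + bilinRed f n (red M n x') (red N n y)
      simp only [map_add, LinearMap.add_apply])
    (fun a x y => Cpl.ext fun n => by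
      change bilinRed f n (red M n (a • x)) (red N n y) = a • bilinRed f n (red M n x) (red N n y)
      simp only [map_smul, LinearMap.smul_apply])
    (fun x y y' => Cpl.ext fun n => by
      change bilinRed f n (red M n x) (red N n (y + y')) =
        bilinRed f n (red M n x) (red N n y) + bilinRed f n (red M n x) (red N n y')
      simp only [map_add])
    (fun a x y => Cpl.ext fun n => by
      change bilinRed f n (red M n x) (red N n (a • y)) = a • bilinRed f n (red M n x) (red N n y)
      simp only [map_smul])

theorem red_cmap₂ (f : M →ₗ[K] N →ₗ[K] Q) (n : ℕ) (x : Cpl M) (y : Cpl N) :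
    red Q n (cmap₂ f x y) = bilinRed f n (red M n x) (red N n y) := rfl

theorem red_of (n : ℕ) (x : M) : red M n (of M x) = Submodule.Quotient.mk x := rfl

/-- The tensor product of elements of two completions. -/
def tens : Cpl M →ₗ[K] Cpl N →ₗ[K] Cpl (M ⊗[K] N) := cmap₂ (TensorProduct.mk K M N)

end Module

/-- The completed tensor product. -/
abbrev CTensor (M N : Type*) [AddCommGroup M] [Module K M] [AddCommGroup N] [Module K N] : Type _ :=
  Cpl (M ⊗[K] N)

section Algebra

variable {A : Type*} [Ring A] [Algebra K A]

instance : Mul (Cpl A) := ⟨fun x y => cmap₂ (LinearMap.mul K A) x y⟩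

instance : One (Cpl A) := ⟨of A 1⟩

theorem red_mul (n : ℕ) (x y : Cpl A) :
    red A n (x * y) = bilinRed (LinearMap.mul K A) n (red A n x) (red A n y) := rfl

theorem red_one (n : ℕ) : red A n (1 : Cpl A) = Submodule.Quotient.mk 1 := rfl

theorem bilinRed_mk (n : ℕ) (x y : A) :
    bilinRed (LinearMap.mul K A) n (Submodule.Quotient.mk x) (Submodule.Quotient.mk y) =
      Submodule.Quotient.mk (x * y) := rfl

instance : Ring (Cpl A) where
  __ := (inferInstance : AddCommGroup (Cpl A))
  mul := (· * ·)
  one := 1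
  mul_assoc x y z := Cpl.ext fun n => by
    simp only [red_mul]
    obtain ⟨a, ha⟩ := Submodule.Quotient.mk_surjective _ (red A n x)
    obtain ⟨b, hb⟩ := Submodule.Quotient.mk_surjective _ (red A n y)
    obtain ⟨c, hc⟩ := Submodule.Quotient.mk_surjective _ (red A n z)
    rw [← ha, ← hb, ← hc]
    simp only [bilinRed_mk, mul_assoc]
  one_mul x := Cpl.ext fun n => by
    obtain ⟨a, ha⟩ := Submodule.Quotient.mk_surjective _ (red A n x)
    rw [red_mul, red_one, ← ha, bilinRed_mk, one_mul]
  mul_one x := Cpl.ext fun n => by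
    obtain ⟨a, ha⟩ := Submodule.Quotient.mk_surjective _ (red A n x)
    rw [red_mul, red_one, ← ha, bilinRed_mk, mul_one]
  left_distrib x y z := map_add (cmap₂ (LinearMap.mul K A) x) y z
  right_distrib x y z := LinearMap.map_add₂ (cmap₂ (LinearMap.mul K A)) x y z
  zero_mul x := LinearMap.map_zero₂ (cmap₂ (LinearMap.mul K A)) x
  mul_zero x := map_zero (cmap₂ (LinearMap.mul K A) x)
  zsmul := fun n x => n • x
  neg_add_cancel := neg_add_cancel

instance : Algebra K (Cpl A) :=
  Algebra.ofModule (fun a x y => LinearMap.map_smul₂ (cmap₂ (LinearMap.mul K A)) a x y)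
    (fun a x y => map_smul (cmap₂ (LinearMap.mul K A) x) a y)

/-- The product of the completed algebra, as a bilinear map. -/
def mulB : Cpl A →ₗ[K] Cpl A →ₗ[K] Cpl A := cmap₂ (LinearMap.mul K A)

/-- `x ↦ a x b` on a `K`-algebra. -/
def mulLR (a b : A) : A →ₗ[K] A where
  toFun x := a * x * b
  map_add' x y := by rw [mul_add, add_mul]
  map_smul' c x := by rw [RingHom.id_apply, Algebra.mul_smul_comm, Algebra.smul_mul_assoc]

/-- The exponential `exp (ℓ x) = ∑ ℓ ^ k x ^ k / k!` for `ℓ ∈ (t)`. -/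
def texp (ℓ : tIdeal) (x : A) : Cpl A :=
  AdicCompletion.mk tIdeal A (AdicCompletion.AdicCauchySequence.mk tIdeal A
    (fun n => ∑ k ∈ Finset.range n,
      (PowerSeries.C ((k.factorial : ℂ)⁻¹) * (ℓ : K) ^ k) • x ^ k)
    (fun n => by
      rw [SModEq.comm, SModEq.sub_mem, Finset.sum_range_succ, add_sub_cancel_left]
      exact Submodule.smul_mem_smul
        (Ideal.mul_mem_left _ _ (Ideal.pow_mem_pow ℓ.2 n)) trivial))

end Algebra

/-- `e ^ ℓ ∈ ℂ[[t]]` for `ℓ ∈ (t)`. -/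
def expK (ℓ : tIdeal) : K := uncpl K (texp ℓ (1 : K))


/-! ### Topological Hopf algebras over `ℂ[[t]]` -/

/-- The coalgebra operations and the antipode of a topological Hopf algebra, without axioms. -/
structure HopfData (A : Type*) [Ring A] [Algebra K A] where
  comul : A →ₗ[K] CTensor A A
  counit : A →ₗ[K] K
  antipode : A →ₗ[K] A

section Hopf

variable {A : Type*} [Ring A] [Algebra K A]

/-- The transposition `τ` on the completed tensor square. -/
def flip : CTensor A A →ₗ[K] CTensor A A := cmap (TensorProduct.comm K A A).toLinearMap

/-- `x ⊗ y ↦ x ⊗ y ⊗ 1`. -/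
def leg12 : CTensor A A →ₗ[K] CTensor A (A ⊗[K] A) :=
  cmap (TensorProduct.map LinearMap.id ((TensorProduct.mk K A A).flip 1))

/-- `x ⊗ y ↦ x ⊗ 1 ⊗ y`. -/
def leg13 : CTensor A A →ₗ[K] CTensor A (A ⊗[K] A) :=
  cmap (TensorProduct.map LinearMap.id (TensorProduct.mk K A A 1))

/-- `x ⊗ y ↦ 1 ⊗ x ⊗ y`. -/
def leg23 : CTensor A A →ₗ[K] CTensor A (A ⊗[K] A) := cmap (TensorProduct.mk K A (A ⊗[K] A) 1)

/-- `id ⊗ Δ`. -/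
def HopfData.comulRight (D : HopfData A) : CTensor A A →ₗ[K] CTensor A (A ⊗[K] A) :=
  cext (TensorProduct.lift (tens.compl₁₂ (of A) D.comul))

/-- `Δ ⊗ id`. -/
def HopfData.comulLeft (D : HopfData A) : CTensor A A →ₗ[K] CTensor A (A ⊗[K] A) :=
  (cmap (TensorProduct.assoc K A A A).toLinearMap).comp
    (cext (TensorProduct.lift (tens.compl₁₂ D.comul (of A))))

/-- The product, extended to the completed tensor square. -/
def cmul : CTensor A A →ₗ[K] Cpl A := cmap (LinearMap.mul' K A)

/-- The axioms of a (topological) Hopf algebra with invertible antipode. -/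
structure HopfData.IsHopf (D : HopfData A) : Prop where
  comul_one : D.comul 1 = 1
  comul_mul : ∀ x y, D.comul (x * y) = D.comul x * D.comul y
  counit_one : D.counit 1 = 1
  counit_mul : ∀ x y, D.counit (x * y) = D.counit x * D.counit y
  coassoc : ∀ x, D.comulLeft (D.comul x) = D.comulRight (D.comul x)
  counit_left : ∀ x, cmap ((TensorProduct.lid K A).toLinearMap.comp
    (TensorProduct.map D.counit LinearMap.id)) (D.comul x) = of A x
  counit_right : ∀ x, cmap ((TensorProduct.rid K A).toLinearMap.comp
    (TensorProduct.map LinearMap.id D.counit)) (D.comul x) = of A x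
  antipode_left : ∀ x, cmul (cmap (TensorProduct.map D.antipode LinearMap.id) (D.comul x)) =
    of A (algebraMap K A (D.counit x))
  antipode_right : ∀ x, cmul (cmap (TensorProduct.map LinearMap.id D.antipode) (D.comul x)) =
    of A (algebraMap K A (D.counit x))
  antipode_bijective : Function.Bijective D.antipode

/-- The hexagon identities `(id ⊗ Δ) 𝓡 = 𝓡₁₃ 𝓡₁₂` and `(Δ ⊗ id) 𝓡 = 𝓡₁₃ 𝓡₂₃`. -/
structure HopfData.IsBicharacter (D : HopfData A) (RR : CTensor A A) : Prop where
  comulRight : D.comulRight RR = leg13 RR * leg12 RR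
  comulLeft : D.comulLeft RR = leg13 RR * leg23 RR

/-- Quasitriangular structures in the sense of Drinfeld. -/
structure HopfData.IsQuasitriangular (D : HopfData A) (RR : (CTensor A A)ˣ) : Prop
    extends D.IsBicharacter RR.val where
  comul_op : ∀ x, flip (D.comul x) = RR.val * D.comul x * RR⁻¹.val

/-- `*`-algebra structures over `ℂ[[t]]`. -/
structure IsStarAlgebra (st : A →ₛₗ[conjK] A) : Prop where
  star_star : ∀ x, st (st x) = x
  star_mul : ∀ x y, st (x * y) = st y * st x

/-- `* ⊗ *` on the completed tensor square. -/
def starT (st : A →ₛₗ[conjK] A) : CTensor A A →ₛₗ[conjK] CTensor A A :=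
  cmapConj (TensorProduct.map st st)

/-- Hopf `*`-algebras. The last axiom is `* ∘ S = S⁻¹ ∘ *`. -/
structure HopfData.IsHopfStar (D : HopfData A) (st : A →ₛₗ[conjK] A) : Prop
    extends IsStarAlgebra st where
  star_comul : ∀ x, starT st (D.comul x) = D.comul (st x)
  star_counit : ∀ x, conjK (D.counit x) = D.counit (st x)
  antipode_star : ∀ x, D.antipode (st (D.antipode (st x))) = x

/-- Quasi-`*` Hopf algebras: a Hopf algebra which is a `*`-algebra, with an invertible `𝓡` such that
`(* ⊗ *) ∘ Δ ∘ * = 𝓡⁻¹ (τ ∘ Δ) 𝓡`, `conj ∘ ε = ε ∘ *`, `(id ⊗ Δ) 𝓡 = 𝓡₁₃ 𝓡₁₂`,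
`(Δ ⊗ id) 𝓡 = 𝓡₁₃ 𝓡₂₃` and `𝓡^{* ⊗ *} = 𝓡₂₁`. -/
structure IsQuasiStarHopf (D : HopfData A) (st : A →ₛₗ[conjK] A) (RR : (CTensor A A)ˣ) : Prop
    extends D.IsHopf, IsStarAlgebra st, D.IsBicharacter RR.val where
  star_comul_star : ∀ x, starT st (D.comul (st x)) = RR⁻¹.val * flip (D.comul x) * RR.val
  star_counit : ∀ x, conjK (D.counit x) = D.counit (st x)
  real : starT st RR.val = flip RR.val

end Hopf

section Complete

variable {A : Type*} [Ring A] [Algebra K A] [IsAdicComplete tIdeal A]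

/-- `x ⊗ y ↦ φ(x) y`, on the completed tensor square of a complete algebra. -/
def sliceLeft (φ : A →ₗ[K] K) : CTensor A A →ₗ[K] A :=
  (uncpl A).comp (cmap ((TensorProduct.lid K A).toLinearMap.comp
    (TensorProduct.map φ LinearMap.id)))

/-- `x ⊗ y ↦ x φ(y)`, on the completed tensor square of a complete algebra. -/
def sliceRight (φ : A →ₗ[K] K) : CTensor A A →ₗ[K] A :=
  (uncpl A).comp (cmap ((TensorProduct.rid K A).toLinearMap.comp
    (TensorProduct.map LinearMap.id φ)))

end Complete

/-- `x ⊗ y ↦ φ(x) ψ(y)`, on a completed tensor product. -/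
def evalT {M N : Type*} [AddCommGroup M] [Module K M] [AddCommGroup N] [Module K N]
    (φ : M →ₗ[K] K) (ψ : N →ₗ[K] K) : CTensor M N →ₗ[K] K :=
  (uncpl K).comp (cmap ((LinearMap.mul' K K).comp (TensorProduct.map φ ψ)))

/-! ### Tensor square and twisting -/

section Twist

variable {H : Type*} [Ring H] [Algebra K H]

/-- The algebra `H ⊗ H`, completed. -/
def Sq (H : Type*) [Ring H] [Algebra K H] : Type _ := Cpl (H ⊗[K] H)

instance : Ring (Sq H) := inferInstanceAs (Ring (Cpl (H ⊗[K] H)))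

instance : Algebra K (Sq H) := inferInstanceAs (Algebra K (Cpl (H ⊗[K] H)))

instance : IsAdicComplete tIdeal (Sq H) :=
  inferInstanceAs (IsAdicComplete tIdeal (Cpl (H ⊗[K] H)))

/-- The first copy of `H` in `H ⊗ H` (with generators `l^±`). -/
def inl : H →ₗ[K] Sq H := (of (H ⊗[K] H)).comp ((TensorProduct.mk K H H).flip 1)

/-- The second copy of `H` in `H ⊗ H` (with generators `m^±`). -/
def inr : H →ₗ[K] Sq H := (of (H ⊗[K] H)).comp (TensorProduct.mk K H H 1)

/-- The tensor product Hopf algebra structure on `H ⊗ H`. -/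
def HopfData.square (D : HopfData H) : HopfData (Sq H) where
  comul := cext (TensorProduct.lift (mulB.compl₁₂
    ((cmap (TensorProduct.map inl inl)).comp D.comul)
    ((cmap (TensorProduct.map inr inr)).comp D.comul)))
  counit := evalT D.counit D.counit
  antipode := cmap (TensorProduct.map D.antipode D.antipode)

/-- The tensor product quasitriangular structure `𝓡₁₃ 𝓡₂₄` on `H ⊗ H`. -/
def squareR (RR : CTensor H H) : CTensor (Sq H) (Sq H) :=
  cmap (TensorProduct.map inl inl) RR * cmap (TensorProduct.map inr inr) RR

/-- For `x ∈ H ⊗ H`, the element `x₂₃` of `(H ⊗ H) ⊗ (H ⊗ H)`. -/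
def leg23Square (x : CTensor H H) : CTensor (Sq H) (Sq H) :=
  cmap (TensorProduct.map inr inl) x

variable {X : Type*} [Ring X] [Algebra K X] [IsAdicComplete tIdeal X]

/-- `U = χ⁽¹⁾ S χ⁽²⁾`. -/
def HopfData.twistU (D : HopfData X) (χ : CTensor X X) : X :=
  uncpl X (cmul (cmap (TensorProduct.map LinearMap.id D.antipode) χ))

/-- `U⁻¹ = (S χ⁻⁽¹⁾) χ⁻⁽²⁾`, as a function of `χ⁻¹`. -/
def HopfData.twistUinv (D : HopfData X) (χinv : CTensor X X) : X :=
  uncpl X (cmul (cmap (TensorProduct.map D.antipode LinearMap.id) χinv))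

/-- Twisting by a 2-cocycle `χ` with inverse `χinv`:
`Δ_χ = χ Δ χ⁻¹`, `ε_χ = ε`, `S_χ = U S U⁻¹`. -/
def HopfData.twist (D : HopfData X) (χ χinv : CTensor X X) : HopfData X where
  comul := (mulLR χ χinv).comp D.comul
  counit := D.counit
  antipode := (mulLR (D.twistU χ) (D.twistUinv χinv)).comp D.antipode

/-- The twisted quasitriangular structure `χ₂₁ 𝓡 χ⁻¹`. -/
def twistR (RR χ χinv : CTensor X X) : CTensor X X := flip χ * RR * χinv

/-- The Hopf algebra `H ⋈ H`: the twist of `H ⊗ H` by `χ = (𝓡⁻¹)₂₃`. -/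
def HopfData.bowtie (D : HopfData H) (RR : (CTensor H H)ˣ) : HopfData (Sq H) :=
  D.square.twist (leg23Square RR⁻¹.val) (leg23Square RR.val)

/-- The quasitriangular structure of `H ⋈ H`. -/
def bowtieR (RR : (CTensor H H)ˣ) : CTensor (Sq H) (Sq H) :=
  twistR (squareR RR.val) (leg23Square RR⁻¹.val) (leg23Square RR.val)

/-- The `*`-structure `(h ⊗ g)^* = U (g^* ⊗ h^*) U⁻¹` of `H ⋈ H`. -/
def bowtieStar (D : HopfData H) (RR : (CTensor H H)ˣ) (st : H →ₛₗ[conjK] H) :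
    Sq H →ₛₗ[conjK] Sq H :=
  (mulLR (D.square.twistU (leg23Square RR⁻¹.val))
    (D.square.twistUinv (leg23Square RR.val))).comp (flip.comp (starT st))

/-- The `*`-structure `(h ⊗ g)^* = S⁻²(h^*) ⊗ g^*` of `H ⊗ H`; note `S⁻²(h^*) = (S² h)^*`. -/
def squareStar (D : HopfData H) (st : H →ₛₗ[conjK] H) : Sq H →ₛₗ[conjK] Sq H :=
  cmapConj (TensorProduct.map (st.comp (D.antipode.comp D.antipode)) st)

end Twist

/-! ### Bosonisation with a dilaton

Let `X` be a background quantum group, acting on the span of generators `p i` (`i : ι`) by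
`x ▷ p i = ∑ a, ρ i a x • p a`, and let `B` be the algebra generated by the `p i` with the relations
`rel`. The dilatonic extension of `X` has an additional central primitive generator `ξ`, with
`ξ ▷ p i = - p i`, and the quasitriangular structure of `X` is multiplied by
`λ ^ (- ξ ⊗ ξ) = exp (- ℓ ξ ⊗ ξ)`, `λ = exp ℓ`. -/

section Boson

variable (X : Type*) (ι : Type*)

/-- The generators of the inhomogeneous quantum group. -/
inductive BosGen
  | bg (x : X)
  | mom (i : ι)
  | dil

variable {X ι} [Ring X] [Algebra K X] [IsAdicComplete tIdeal X] [Fintype ι]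

/-- The relations of the inhomogeneous quantum group: those of `X`, those of `B`, centrality of `ξ`
in the extension of `X`, and the cross relations `h b = (h₍₁₎ ▷ b) h₍₂₎`. -/
inductive BosRel (D : HopfData X) (ρ : ι → ι → X →ₗ[K] K)
    (rel : FreeAlgebra K ι → FreeAlgebra K ι → Prop) :
    FreeAlgebra K (BosGen X ι) → FreeAlgebra K (BosGen X ι) → Prop
  | bg_add (x y : X) : BosRel D ρ rel (FreeAlgebra.ι K (.bg (x + y)))
      (FreeAlgebra.ι K (.bg x) + FreeAlgebra.ι K (.bg y))
  | bg_mul (x y : X) : BosRel D ρ rel (FreeAlgebra.ι K (.bg (x * y)))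
      (FreeAlgebra.ι K (.bg x) * FreeAlgebra.ι K (.bg y))
  | bg_scalar (a : K) : BosRel D ρ rel (FreeAlgebra.ι K (.bg (algebraMap K X a)))
      (algebraMap K _ a)
  | mom (a b : FreeAlgebra K ι) : rel a b →
      BosRel D ρ rel (FreeAlgebra.lift K (fun i => FreeAlgebra.ι K (BosGen.mom i)) a)
        (FreeAlgebra.lift K (fun i => FreeAlgebra.ι K (BosGen.mom i)) b)
  | dil_bg (x : X) : BosRel D ρ rel (FreeAlgebra.ι K .dil * FreeAlgebra.ι K (.bg x))
      (FreeAlgebra.ι K (.bg x) * FreeAlgebra.ι K .dil)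
  | dil_mom (i : ι) : BosRel D ρ rel (FreeAlgebra.ι K .dil * FreeAlgebra.ι K (.mom i))
      (FreeAlgebra.ι K (.mom i) * FreeAlgebra.ι K .dil - FreeAlgebra.ι K (.mom i))
  | cross (x : X) (i : ι) : BosRel D ρ rel (FreeAlgebra.ι K (.bg x) * FreeAlgebra.ι K (.mom i))
      (∑ a, FreeAlgebra.ι K (.mom a) * FreeAlgebra.ι K (.bg (sliceLeft (ρ i a) (D.comul x))))

/-- The inhomogeneous quantum group as an algebra. -/
abbrev Bos (D : HopfData X) (ρ : ι → ι → X →ₗ[K] K)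
    (rel : FreeAlgebra K ι → FreeAlgebra K ι → Prop) : Type _ := Cpl (RingQuot (BosRel D ρ rel))

variable (D : HopfData X) (ρ : ι → ι → X →ₗ[K] K)
  (rel : FreeAlgebra K ι → FreeAlgebra K ι → Prop)

/-- A generator as an element of the inhomogeneous quantum group. -/
def bosGen (g : BosGen X ι) : Bos D ρ rel :=
  of _ (RingQuot.mkAlgHom K (BosRel D ρ rel) (FreeAlgebra.ι K g))

/-- The map from the background quantum group to the inhomogeneous quantum group. -/
def bgMap : X →ₗ[K] Bos D ρ rel where
  toFun x := bosGen D ρ rel (.bg x)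
  map_add' x y := by
    have h := RingQuot.mkAlgHom_rel K (BosRel.bg_add (D := D) (ρ := ρ) (rel := rel) x y)
    simp only [bosGen, h, map_add]
  map_smul' a x := by
    have h := RingQuot.mkAlgHom_rel K
      (BosRel.bg_mul (D := D) (ρ := ρ) (rel := rel) (algebraMap K X a) x)
    have h' := RingQuot.mkAlgHom_rel K (BosRel.bg_scalar (D := D) (ρ := ρ) (rel := rel) a)
    rw [Algebra.smul_def]
    simp only [bosGen, h, map_mul, h', RingHom.id_apply, AlgHom.commutes]
    rw [← Algebra.smul_def, map_smul]

/-- The momentum generators. -/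
def bosP (i : ι) : Bos D ρ rel := bosGen D ρ rel (.mom i)

/-- The dilaton generator `ξ`. -/
def bosXi : Bos D ρ rel := bosGen D ρ rel .dil

/-- The element `λ ^ ξ = exp (ℓ ξ)`. -/
def bosLamXi (ℓ : tIdeal) : Bos D ρ rel := uncpl _ (texp ℓ (bosXi D ρ rel))

/-- The quasitriangular structure of the dilatonic extension of `X`, in the inhomogeneous quantum
group. -/
def bosR (RR : CTensor X X) (ℓ : tIdeal) : CTensor (Bos D ρ rel) (Bos D ρ rel) :=
  cmap (TensorProduct.map (bgMap D ρ rel) (bgMap D ρ rel)) RR *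
    texp (-ℓ) (bosXi D ρ rel ⊗ₜ[K] bosXi D ρ rel)

/-- The coproduct and the counit are those of the bosonisation: the extended background quantum
group is a sub-Hopf algebra with `ξ` primitive, and `Δ b = b₍₁₎ 𝓡⁽²⁾ ⊗ 𝓡⁽¹⁾ ▷ b₍₂₎` on `B`, that is
`Δ p = p ⊗ 1 + 𝓡⁽²⁾ ⊗ 𝓡⁽¹⁾ ▷ p` on the braided-primitive generators. (The antipode of a Hopf algebra
is determined by the coproduct.) -/
structure IsBosonisation (RR : CTensor X X) (ℓ : tIdeal) (E : HopfData (Bos D ρ rel)) : Prop where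
  comul_bg : ∀ x, E.comul (bgMap D ρ rel x) =
    cmap (TensorProduct.map (bgMap D ρ rel) (bgMap D ρ rel)) (D.comul x)
  comul_xi : E.comul (bosXi D ρ rel) =
    of _ (bosXi D ρ rel ⊗ₜ[K] 1 + 1 ⊗ₜ[K] bosXi D ρ rel)
  comul_mom : ∀ i, E.comul (bosP D ρ rel i) = of _ (bosP D ρ rel i ⊗ₜ[K] 1 +
    ∑ a, (bosLamXi D ρ rel ℓ * bgMap D ρ rel (sliceLeft (ρ i a) RR)) ⊗ₜ[K] bosP D ρ rel a)
  counit_bg : ∀ x, E.counit (bgMap D ρ rel x) = D.counit x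
  counit_xi : E.counit (bosXi D ρ rel) = 0
  counit_mom : ∀ i, E.counit (bosP D ρ rel i) = 0

/-- The inhomogeneous quantum group with the Hopf algebra structure `E` of the bosonisation is a
quasi-`*` Hopf algebra, for the `*`-structure `s` and the quasitriangular structure of the extended
background quantum group, and `s` restricts to the `*`-structure `stX` of the background. -/
structure IsQuasiStarBosonisation (RR : CTensor X X) (ℓ : tIdeal) (stX : X →ₛₗ[conjK] X)
    (E : HopfData (Bos D ρ rel)) (s : Bos D ρ rel →ₛₗ[conjK] Bos D ρ rel) : Prop where
  bosonisation : IsBosonisation D ρ rel RR ℓ E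
  quasiStar : ∃ RE : (CTensor (Bos D ρ rel) (Bos D ρ rel))ˣ,
    RE.val = bosR D ρ rel RR ℓ ∧ IsQuasiStarHopf E s RE
  star_bg : ∀ x, s (bgMap D ρ rel x) = bgMap D ρ rel (stX x)

end Boson

/-! ### R-matrices and quantum groups of FRT type

A matrix `R ∈ M_n ⊗ M_n` is indexed so that `R (i, k) (j, l)` is `R^i_j^k_l`. -/

section RMatrix

variable {n : ℕ}

/-- Matrices in `M_n ⊗ M_n`. -/
abbrev Mat2 (n : ℕ) : Type := Matrix (Fin n × Fin n) (Fin n × Fin n) K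

/-- The permutation matrix `P`. -/
def permP (n : ℕ) : Mat2 n := fun x y => if x = y.swap then 1 else 0

/-- `R₂₁`. -/
def R21 (R : Mat2 n) : Mat2 n := R.submatrix Prod.swap Prod.swap

/-- `R₁₂ ∈ M_n ⊗ M_n ⊗ M_n`. -/
def R12' (R : Mat2 n) : Matrix (Fin n × Fin n × Fin n) (Fin n × Fin n × Fin n) K :=
  fun x y => R (x.1, x.2.1) (y.1, y.2.1) * if x.2.2 = y.2.2 then 1 else 0

/-- `R₁₃ ∈ M_n ⊗ M_n ⊗ M_n`. -/
def R13' (R : Mat2 n) : Matrix (Fin n × Fin n × Fin n) (Fin n × Fin n × Fin n) K :=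
  fun x y => R (x.1, x.2.2) (y.1, y.2.2) * if x.2.1 = y.2.1 then 1 else 0

/-- `R₂₃ ∈ M_n ⊗ M_n ⊗ M_n`. -/
def R23' (R : Mat2 n) : Matrix (Fin n × Fin n × Fin n) (Fin n × Fin n × Fin n) K :=
  fun x y => R x.2 y.2 * if x.1 = y.1 then 1 else 0

/-- Real type I: the complex conjugate of `R^i_j^k_l` is `R^l_k^j_i`. -/
def IsRealTypeI (R : Mat2 n) : Prop :=
  ∀ i j k l, conjK (R (i, k) (j, l)) = R (l, j) (k, i)

/-- The `q`-Hecke condition `(P R - q) (P R + q⁻¹) = 0`. -/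
def IsHecke (q : Kˣ) (R : Mat2 n) : Prop :=
  (permP n * R - (q : K) • (1 : Mat2 n)) * (permP n * R + ((q⁻¹ : Kˣ) : K) • (1 : Mat2 n)) = 0

/-- `M₁ = M ⊗ 1` for a matrix with entries in an algebra. -/
def leg1 {B : Type*} [Ring B] (M : Matrix (Fin n) (Fin n) B) :
    Matrix (Fin n × Fin n) (Fin n × Fin n) B := M ⊗ₖ (1 : Matrix (Fin n) (Fin n) B)

/-- `M₂ = 1 ⊗ M` for a matrix with entries in an algebra. -/
def leg2 {B : Type*} [Ring B] (M : Matrix (Fin n) (Fin n) B) :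
    Matrix (Fin n × Fin n) (Fin n × Fin n) B := (1 : Matrix (Fin n) (Fin n) B) ⊗ₖ M

/-- A numerical matrix with entries regarded in an algebra. -/
def toAlg (B : Type*) [Ring B] [Algebra K B] (R : Mat2 n) :
    Matrix (Fin n × Fin n) (Fin n × Fin n) B := R.map (algebraMap K B)

/-- The equations for the data `(R', R)` of a braided linear space. -/
structure IsBraidedData (R' R : Mat2 n) : Prop where
  eq₁ : R12' R' * R13' R * R23' R = R23' R * R13' R * R12' R'
  eq₂ : R12' R * R13' R * R23' R' = R23' R' * R13' R * R12' R
  qybe : R12' R * R13' R * R23' R = R23' R * R13' R * R12' R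
  add : (permP n * R + 1) * (permP n * R' - 1) = 0

/-- The relations `p₁ p₂ = R' p₂ p₁` of the braided vectors `V(R', R)`. -/
def VecRel (R' : Mat2 n) (x y : FreeAlgebra K (Fin n)) : Prop :=
  ∃ i k, x = FreeAlgebra.ι K i * FreeAlgebra.ι K k ∧
    y = ∑ a, ∑ b, R' (i, k) (a, b) • (FreeAlgebra.ι K b * FreeAlgebra.ι K a)

/-- The relations `p₁ p₂ = p₂ p₁ R'` of the braided covectors. -/
def CovRel (R' : Mat2 n) (x y : FreeAlgebra K (Fin n)) : Prop :=
  ∃ i k, x = FreeAlgebra.ι K i * FreeAlgebra.ι K k ∧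
    y = ∑ a, ∑ b, R' (a, b) (i, k) • (FreeAlgebra.ι K b * FreeAlgebra.ι K a)

/-- The matrix of generators `p^i_j` of a free algebra. -/
def genMat (n : ℕ) : Matrix (Fin n) (Fin n) (FreeAlgebra K (Fin n × Fin n)) :=
  fun i j => FreeAlgebra.ι K (i, j)

/-- The relations `R₂₁ p₁ p₂ = p₂ p₁ R` of `Ā(R)`. -/
def EucRel (R : Mat2 n) (x y : FreeAlgebra K (Fin n × Fin n)) : Prop :=
  ∃ u v, x = (toAlg (FreeAlgebra K (Fin n × Fin n)) (R21 R) * leg1 (genMat n) * leg2 (genMat n)) u v ∧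
    y = (leg2 (genMat n) * leg1 (genMat n) * toAlg (FreeAlgebra K (Fin n × Fin n)) R) u v

/-- The relations `R₂₁ p₁ R p₂ = p₂ R₂₁ p₁ R` of the braided matrices `B(R)`. -/
def MinkRel (R : Mat2 n) (x y : FreeAlgebra K (Fin n × Fin n)) : Prop :=
  ∃ u v, x = (toAlg (FreeAlgebra K (Fin n × Fin n)) (R21 R) * leg1 (genMat n) * toAlg (FreeAlgebra K (Fin n × Fin n)) R * leg2 (genMat n)) u v ∧
    y = (leg2 (genMat n) * toAlg (FreeAlgebra K (Fin n × Fin n)) (R21 R) * leg1 (genMat n) * toAlg (FreeAlgebra K (Fin n × Fin n)) R) u v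

end RMatrix

section QuantumGroup

variable {n : ℕ} {H A : Type*} [Ring H] [Algebra K H] [IsAdicComplete tIdeal H]
  [Ring A] [HopfAlgebra K A]

/-- The background data: a real-quasitriangular Hopf `*`-algebra `H` over `ℂ[[t]]` (complete), dually
paired with a Hopf `*`-algebra `A` which is a quotient of the quantum matrix bialgebra `A(ν R)` with
matrix generator `𝐭`, such that the quasitriangular structure of `H` evaluates on `𝐭 ⊗ 𝐭` to `ν R`
(`ν` is the quantum group normalisation constant) and the `*`-structure of `A` has the compact form
`(t^i_j)^* = S t^j_i`. -/
structure IsQuantumGroup (D : HopfData H) (RR : (CTensor H H)ˣ) (st : H →ₛₗ[conjK] H)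
    (t : Matrix (Fin n) (Fin n) A) (stA : A →ₛₗ[conjK] A) (pair : H →ₗ[K] A →ₗ[K] K)
    (R : Mat2 n) (ν : K) : Prop where
  hopf : D.IsHopf
  quasitriangular : D.IsQuasitriangular RR
  hopfStar : D.IsHopfStar st
  real : starT st RR.val = flip RR.val
  comul_t : ∀ i j, Coalgebra.comul (R := K) (t i j) = ∑ a, t i a ⊗ₜ[K] t a j
  counit_t : ∀ i j, Coalgebra.counit (R := K) (t i j) = if i = j then 1 else 0
  adjoin_t : Algebra.adjoin K (Set.range fun x : Fin n × Fin n => t x.1 x.2) = ⊤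
  frt : toAlg A R * leg1 t * leg2 t = leg2 t * leg1 t * toAlg A R
  starA : IsStarAlgebra stA
  starA_comul : ∀ a, TensorProduct.map stA stA (Coalgebra.comul (R := K) a) =
    Coalgebra.comul (R := K) (stA a)
  starA_counit : ∀ a, conjK (Coalgebra.counit (R := K) a) = Coalgebra.counit (R := K) (stA a)
  starA_antipode : ∀ a,
    HopfAlgebra.antipode K (stA (HopfAlgebra.antipode K (stA a))) = a
  starA_t : ∀ i j, stA (t i j) = HopfAlgebra.antipode K (t j i)
  pair_mul : ∀ h a b, pair h (a * b) = evalT (pair.flip a) (pair.flip b) (D.comul h)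
  pair_one : ∀ h, pair h 1 = D.counit h
  mul_pair : ∀ h g a, pair (h * g) a =
    LinearMap.mul' K K (TensorProduct.map (pair h) (pair g) (Coalgebra.comul (R := K) a))
  one_pair : ∀ a, pair 1 a = Coalgebra.counit (R := K) a
  pair_antipode : ∀ h a, pair h (HopfAlgebra.antipode K a) = pair (D.antipode h) a
  pair_star : ∀ h a, conjK (pair h a) = pair (st (D.antipode h)) (stA a)
  pair_R : ∀ i j k l, evalT (pair.flip (t i j)) (pair.flip (t k l)) RR.val = ν * R (i, k) (j, l)

/-- `𝐥⁺ = ⟨id ⊗ 𝐭, 𝓡⟩`. -/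
def lPlus (RR : (CTensor H H)ˣ) (t : Matrix (Fin n) (Fin n) A) (pair : H →ₗ[K] A →ₗ[K] K)
    (i j : Fin n) : H := sliceRight (pair.flip (t i j)) RR.val

/-- `𝐥⁻ = ⟨𝐭 ⊗ id, 𝓡⁻¹⟩`. -/
def lMinus (RR : (CTensor H H)ˣ) (t : Matrix (Fin n) (Fin n) A) (pair : H →ₗ[K] A →ₗ[K] K)
    (i j : Fin n) : H := sliceLeft (pair.flip (t i j)) RR⁻¹.val

/-- The action `h ▷ p^i = p^a ⟨h, S t^i_a⟩`. -/
def vecAct (t : Matrix (Fin n) (Fin n) A) (pair : H →ₗ[K] A →ₗ[K] K) (i a : Fin n) : H →ₗ[K] K :=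
  pair.flip (HopfAlgebra.antipode K (t i a))

/-- The action `(h ⊗ g) ▷ p^i_j = p^a_b ⟨h, S t^i_a⟩ ⟨g, t^b_j⟩`. -/
def matAct (t : Matrix (Fin n) (Fin n) A) (pair : H →ₗ[K] A →ₗ[K] K) (x y : Fin n × Fin n) :
    Sq H →ₗ[K] K :=
  evalT (pair.flip (HopfAlgebra.antipode K (t x.1 y.1))) (pair.flip (t y.2 x.2))

/-- A quantum metric `η = (η_{ij})` for `V(R', R)`: an invertible invariant tensor such that
`p_i ↦ η_{ia} p^a` is an isomorphism from the braided covectors to the braided vectors, with the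
reality condition `conj η_{ij} = η^{ji}`, where `(η^{ij})` is the inverse transpose of `η`. -/
structure IsQuantumMetric (t : Matrix (Fin n) (Fin n) A) (R' : Mat2 n)
    (η : Matrix (Fin n) (Fin n) K) : Prop where
  isUnit : IsUnit η.det
  invariant : ∀ i j, ∑ a, ∑ b, η a b • (t a i * t b j) = algebraMap K A (η i j)
  iso : ∃ e : RingQuot (CovRel R') ≃ₐ[K] RingQuot (VecRel R'), ∀ i,
    e (RingQuot.mkAlgHom K (CovRel R') (FreeAlgebra.ι K i)) =
      ∑ a, η i a • RingQuot.mkAlgHom K (VecRel R') (FreeAlgebra.ι K a)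
  real : η.map conjK = η⁻¹

/-- The inverse transpose of a matrix. -/
def invT (ε : Matrix (Fin n) (Fin n) K) : Matrix (Fin n) (Fin n) K := ε⁻¹.transpose

/-- An invariant tensor `ε = (ε^{ij})`, with inverse transpose `(ε_{ij})`, through which the
`*`-structure of `A` is `(t^i_j)^* = ε_{ai} t^a_b ε^{bj}`; the last condition says that
`p^i_j ↦ ε_{ai} p^a_b ε^{bj}` defines a conjugate-linear involution. -/
structure IsSpinorMetric (t : Matrix (Fin n) (Fin n) A) (stA : A →ₛₗ[conjK] A)
    (ε : Matrix (Fin n) (Fin n) K) : Prop where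
  isUnit : IsUnit ε.det
  star_t : ∀ i j, stA (t i j) = ∑ a, ∑ b, (invT ε a i * ε b j) • t a b
  real : ∃ c : K, ε * ε.map conjK = c • (1 : Matrix (Fin n) (Fin n) K)

end QuantumGroup

end QStar

end

open QStar

set_option maxSynthPendingDepth 3
set_option linter.unusedSectionVars false

noncomputable section

namespace QStar

/-! ### Density in `t`-adic completions -/

section Density

variable {M N Q Z : Type*} [AddCommGroup M] [Module K M] [AddCommGroup N] [Module K N]
  [AddCommGroup Q] [Module K Q] [AddCommGroup Z] [Module K Z]

/-! Every algebra involved is `t`-adically complete, and a linear or conjugate-linear map into a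
Hausdorff module is automatically continuous, hence fixed by its values on pure tensors or on words
in generators (`Cpl.semilinear_ext`, `BB.linear_ext`). The inhomogeneous quantum group is presented
by generators and relations, so each structure map comes from a realisation of those relations
(`BosData`) in a suitable complete algebra: the coproduct in the tensor square, the counit in
`ℂ[[t]]`, the antipode and its inverse in the opposite algebra, the `*`-operation in the opposite
algebra with conjugated scalars.

Write the momentum relations as `∑ c k i j p i p j = 0`, and let `g` be the matrix of elements `λ^ξ
𝓡⁽²⁾ ρ(𝓡⁽¹⁾)`. Two facts are needed (`IsCompatible`): the slices of `𝓡` preserve the row space of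
`c`, and `λ⁻¹` times the braiding defined by `𝓡` acts on it as `-1`. The first kills the terms `g g
⊗ p p` in `Δ(p p)`, the second cancels the mixed terms; the dilaton is there so that `λ` can absorb
the normalisation of `𝓡`. For the `*`-operation, `p ↦ p^*` must in addition intertwine the action of
`x` with that of `(S x)^*` and respect the relations.

The quasi-`*` identity is multiplicative in its argument, so only generators matter. On the
background it is the intertwining property of `𝓡`. On `p`, the reality of `𝓡` together with `(S ⊗
id)𝓡 = 𝓡⁻¹` yields `(* ⊗ *)Δ(p^*) = p ⊗ 1 + 𝓡⁻⁽¹⁾λ^{-ξ} ⊗ 𝓡⁻⁽²⁾ ▷ p` (`BB.star_Δ_star_mom`); the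
hexagons then carry `𝓡 λ^{-ξ⊗ξ}` across `p ⊗ 1` and `1 ⊗ p`, which produces the opposite coproduct
(`BosData.dilR_mul_star_mom`). The hexagons for `𝓡 λ^{-ξ⊗ξ}` are inherited from `X`, because
`λ^{-ξ⊗ξ}` is a bicharacter commuting with `X`.

What remains is R-matrix algebra. In the vectorial case `λ = ν` and the braiding condition is `(PR'
- 1)(PR + 1) = 0`, the Hermitian adjoint of the given identity. In the Euclidean case the braiding
contains two copies of `R`, so `λ = ν²`, and the Hecke relation gives `-1` because its linear terms
cancel (`FRT.braided_euc`). In the Minkowski case the relations are those of the Euclidean case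
transformed by the cocycle `χ` (`FRT.coeffMat_mink`), and compatibility survives twisting
(`IsCompatible.twist`). The real structure survives as well, since `U = 𝓡₂₁` is self-adjoint and has
the right coproduct (`QT.sqΔ_swapSq_R`). -/

theorem tIdeal_fg : tIdeal.FG := ⟨{PowerSeries.X}, by simp⟩

theorem conjK_conjK (a : K) : conjK (conjK a) = a := by
  ext n
  simp [conjK]

theorem map_mem_pow_smul {σ : K →+* K} (hσ : ∀ a ∈ tIdeal, σ a ∈ tIdeal) (f : M →ₛₗ[σ] N) {n : ℕ}
    {x : M} (hx : x ∈ (tIdeal ^ n • ⊤ : Submodule K M)) :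
    f x ∈ (tIdeal ^ n • ⊤ : Submodule K N) := by
  refine Submodule.smul_induction_on hx (fun r hr m _ => ?_) fun x y hx hy => ?_
  · rw [LinearMap.map_smulₛₗ]
    exact Submodule.smul_mem_smul (map_mem_pow hσ hr) trivial
  · rw [map_add]
    exact add_mem hx hy

theorem eq_of_forall_sub_mem [IsHausdorff tIdeal Z] {x y : Z}
    (h : ∀ n, x - y ∈ (tIdeal ^ n • ⊤ : Submodule K Z)) : x = y := by
  rw [← sub_eq_zero]
  refine IsHausdorff.haus (I := tIdeal) inferInstance _ fun n => ?_
  rw [SModEq.sub_mem, sub_zero]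
  exact h n

/-- A bilinear map is a linear map into a module of linear maps, so this instance is what allows
density arguments in one variable after another. -/
instance {σ : K →+* K} [IsHausdorff tIdeal Z] : IsHausdorff tIdeal (M →ₛₗ[σ] Z) where
  haus' f hf := by
    ext x
    refine eq_of_forall_sub_mem fun n => ?_
    have h := hf n
    rw [SModEq.sub_mem, sub_zero] at h
    rw [LinearMap.zero_apply, sub_zero]
    exact map_mem_pow_smul (σ := RingHom.id K) (fun _ h => h)
      ({ toFun := fun f => f x, map_add' := fun _ _ => rfl, map_smul' := fun _ _ => rfl } :
        (M →ₛₗ[σ] Z) →ₗ[K] Z) h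

/-- Density: lift the class modulo `t ^ n`. The kernel of the reduction is exactly `t ^ n` times the
completion because the ideal `(t)` is finitely generated. -/
theorem exists_sub_of_mem (x : Cpl M) (n : ℕ) :
    ∃ m, x - of M m ∈ (tIdeal ^ n • ⊤ : Submodule K (Cpl M)) := by
  obtain ⟨m, hm⟩ := Submodule.Quotient.mk_surjective _ (red M n x)
  refine ⟨m, ?_⟩
  have h := AdicCompletion.pow_smul_top_eq_ker_eval (I := tIdeal) (M := M) (n := n) tIdeal_fg
  have h' : x - of M m ∈ LinearMap.ker (red M n) := by
    rw [LinearMap.mem_ker, map_sub, red_of, hm, sub_self]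
  exact h.ge h'

/-- A semilinear map whose ring map preserves `(t)` sends `t ^ n M` into `t ^ n Z`. It is therefore
continuous and determined on a dense submodule. -/
theorem Cpl.semilinear_ext {σ : K →+* K} (hσ : ∀ a ∈ tIdeal, σ a ∈ tIdeal) [IsHausdorff tIdeal Z]
    {f g : Cpl M →ₛₗ[σ] Z} (h : ∀ m, f (of M m) = g (of M m)) : f = g := by
  ext x
  refine eq_of_forall_sub_mem fun n => ?_
  obtain ⟨m, hm⟩ := exists_sub_of_mem x n
  have h₁ := map_mem_pow_smul hσ (f - g) hm
  rwa [map_sub, LinearMap.sub_apply, LinearMap.sub_apply, h, sub_self, sub_zero] at h₁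

@[ext]
theorem Cpl.linear_ext [IsHausdorff tIdeal Z] {f g : Cpl M →ₗ[K] Z}
    (h : f.comp (of M) = g.comp (of M)) : f = g :=
  Cpl.semilinear_ext (fun _ h => h) fun m => LinearMap.congr_fun h m

@[ext]
theorem Cpl.conj_ext [IsHausdorff tIdeal Z] {f g : Cpl M →ₛₗ[conjK] Z}
    (h : f.comp (of M) = g.comp (of M)) : f = g :=
  Cpl.semilinear_ext (fun _ h => conjK_mem h) fun m => LinearMap.congr_fun h m

@[simp] theorem cext_of (f : M →ₗ[K] Cpl N) (x : M) : cext f (of M x) = f x := rfl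

@[simp] theorem cmap_of (f : M →ₗ[K] N) (x : M) : cmap f (of M x) = of N (f x) := rfl

@[simp] theorem cmapConj_of (f : M →ₛₗ[conjK] N) (x : M) : cmapConj f (of M x) = of N (f x) := rfl

@[simp] theorem tens_of_of (x : M) (y : N) : tens (of M x) (of N y) = of _ (x ⊗ₜ[K] y) := rfl

@[simp] theorem uncpl_of [IsAdicComplete tIdeal M] (x : M) : uncpl M (of M x) = x :=
  AdicCompletion.ofLinearEquiv_symm_of (I := tIdeal) (M := M) x

@[simp] theorem of_uncpl [IsAdicComplete tIdeal M] (x : Cpl M) : of M (uncpl M x) = x :=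
  AdicCompletion.of_ofLinearEquiv_symm (I := tIdeal) (M := M) x

theorem of_injective [IsHausdorff tIdeal M] : Function.Injective (of M) :=
  AdicCompletion.of_injective (I := tIdeal) (M := M)

/-- Extension by continuity of a linear map into a complete module. -/
def cplLift [IsAdicComplete tIdeal Z] (f : M →ₗ[K] Z) : Cpl M →ₗ[K] Z := (uncpl Z).comp (cmap f)

@[simp] theorem cplLift_of [IsAdicComplete tIdeal Z] (f : M →ₗ[K] Z) (x : M) :
    cplLift f (of M x) = f x := by
  simp [cplLift]

@[simp] theorem evalT_of (φ : M →ₗ[K] K) (ψ : N →ₗ[K] K) (x : M) (y : N) :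
    evalT φ ψ (of _ (x ⊗ₜ[K] y)) = φ x * ψ y := by
  simp [evalT]

end Density

end QStar
namespace QStar

/-! ### The completed tensor product of two algebras -/

/-- The completed tensor product of two algebras, as an algebra. -/
def CT (A B : Type*) [Ring A] [Algebra K A] [Ring B] [Algebra K B] : Type _ := Cpl (A ⊗[K] B)

theorem of_mul_of {A : Type*} [Ring A] [Algebra K A] (x y : A) :
    of A x * of A y = of A (x * y) := rfl

section CT

variable {A B A' B' Z : Type*} [Ring A] [Algebra K A] [Ring B] [Algebra K B] [Ring A']
  [Algebra K A'] [Ring B'] [Algebra K B'] [AddCommGroup Z] [Module K Z]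

instance : Ring (CT A B) := inferInstanceAs (Ring (Cpl (A ⊗[K] B)))

instance : Algebra K (CT A B) := inferInstanceAs (Algebra K (Cpl (A ⊗[K] B)))

instance : IsAdicComplete tIdeal (CT A B) :=
  inferInstanceAs (IsAdicComplete tIdeal (Cpl (A ⊗[K] B)))

/-- The canonical map from the tensor product to the completed tensor product. -/
def CT.of : A ⊗[K] B →ₗ[K] CT A B := QStar.of (A ⊗[K] B)

/-- Pure tensors in the completed tensor product. -/
def tmL : A →ₗ[K] B →ₗ[K] CT A B := (TensorProduct.mk K A B).compr₂ CT.of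

/-- Pure tensors in the completed tensor product. -/
notation:100 a:100 "⊠" b:101 => tmL a b

-- The curried form makes `ext` reduce an identity of maps to pure tensors, and it can be iterated
-- for maps of several arguments.
@[ext]
theorem CT.linear_ext [IsHausdorff tIdeal Z] {f g : CT A B →ₗ[K] Z}
    (h : (tmL (A := A) (B := B)).compr₂ f = tmL.compr₂ g) : f = g := by
  have h₀ : f.comp CT.of = g.comp CT.of := TensorProduct.ext h
  exact Cpl.linear_ext (M := A ⊗[K] B) (Z := Z) h₀

theorem CT.conj_ext [IsHausdorff tIdeal Z] {f g : CT A B →ₛₗ[conjK] Z}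
    (h : ∀ a b, f (a ⊠ b) = g (a ⊠ b)) : f = g := by
  have h₀ : f.comp CT.of = g.comp CT.of := by
    ext a b
    exact h a b
  exact Cpl.conj_ext (M := A ⊗[K] B) (Z := Z) h₀

/-- The linear map on a completed tensor product defined by a bilinear map. -/
def CT.lift [IsAdicComplete tIdeal Z] (φ : A →ₗ[K] B →ₗ[K] Z) : CT A B →ₗ[K] Z :=
  cplLift (M := A ⊗[K] B) (TensorProduct.lift φ)

@[simp] theorem CT.lift_tm [IsAdicComplete tIdeal Z] (φ : A →ₗ[K] B →ₗ[K] Z) (a : A) (b : B) :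
    CT.lift φ (a ⊠ b) = φ a b :=
  (cplLift_of (TensorProduct.lift φ) (a ⊗ₜ[K] b)).trans (TensorProduct.lift.tmul a b)

@[simp] theorem tm_mul_tm (a a' : A) (b b' : B) :
    (a ⊠ b : CT A B) * a' ⊠ b' = (a * a') ⊠ (b * b') :=
  (of_mul_of (A := A ⊗[K] B) _ _).trans
    (congrArg CT.of (Algebra.TensorProduct.tmul_mul_tmul a a' b b'))

theorem CT.one_def : (1 : CT A B) = 1 ⊠ 1 := rfl

variable {Y W : Type*} [Ring Y] [Algebra K Y] [Ring W] [Algebra K W]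

/-- Both sides are bilinear in `(x, y)` with values in a Hausdorff algebra, so density applies in
each argument separately. -/
theorem CT.map_mul_of_pure [IsHausdorff tIdeal Y] (F : CT A B →ₗ[K] Y)
    (h : ∀ a b a' b', F ((a * a') ⊠ (b * b')) = F (a ⊠ b) * F (a' ⊠ b')) (x y : CT A B) :
    F (x * y) = F x * F y := by
  have : (LinearMap.mul K (CT A B)).compr₂ F = (LinearMap.mul K Y).compl₁₂ F F := by
    ext a b a' b'
    simpa using h a b a' b'
  exact LinearMap.congr_fun₂ this x y

theorem CT.map_mul_rev_of_pure [IsHausdorff tIdeal Y] (F : CT A B →ₗ[K] Y)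
    (h : ∀ a b a' b', F ((a * a') ⊠ (b * b')) = F (a' ⊠ b') * F (a ⊠ b)) (x y : CT A B) :
    F (x * y) = F y * F x := by
  have : (LinearMap.mul K (CT A B)).compr₂ F = (LinearMap.mul K Y).flip.compl₁₂ F F := by
    ext a b a' b'
    simpa using h a b a' b'
  exact LinearMap.congr_fun₂ this x y

/-- The algebra map on a completed tensor product defined by commuting algebra maps. -/
def CT.liftAlg [IsAdicComplete tIdeal Y] (f : A →ₐ[K] Y) (g : B →ₐ[K] Y)
    (h : ∀ a b, Commute (f a) (g b)) : CT A B →ₐ[K] Y :=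
  AlgHom.ofLinearMap (CT.lift ((LinearMap.mul K Y).compl₁₂ f.toLinearMap g.toLinearMap))
    (by simp [CT.one_def])
    (CT.map_mul_of_pure _ fun a b a' b' => by
      simp only [CT.lift_tm, LinearMap.compl₁₂_apply, LinearMap.mul_apply', AlgHom.toLinearMap_apply,
        map_mul]
      rw [mul_assoc, ← mul_assoc (f a'), (h a' b).eq, mul_assoc, mul_assoc])

@[simp] theorem CT.liftAlg_tm [IsAdicComplete tIdeal Y] (f : A →ₐ[K] Y) (g : B →ₐ[K] Y)
    (h : ∀ a b, Commute (f a) (g b)) (a : A) (b : B) :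
    CT.liftAlg f g h (a ⊠ b) = f a * g b :=
  CT.lift_tm _ a b

/-- The first factor of a completed tensor product. -/
def CT.inl : A →ₐ[K] CT A B :=
  AlgHom.ofLinearMap ((tmL (A := A) (B := B)).flip 1) rfl fun x y => by simp

/-- The second factor of a completed tensor product. -/
def CT.inr : B →ₐ[K] CT A B :=
  AlgHom.ofLinearMap (tmL (A := A) (B := B) 1) rfl fun x y => by simp

theorem CT.inl_apply (a : A) : (CT.inl a : CT A B) = a ⊠ 1 := rfl

theorem CT.inr_apply (b : B) : (CT.inr b : CT A B) = 1 ⊠ b := rfl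

theorem CT.commute (a : A) (b : B) : Commute (CT.inl a : CT A B) (CT.inr b) := by
  simp [Commute, SemiconjBy, CT.inl_apply, CT.inr_apply]

/-- The completed tensor product of algebra maps. -/
def CT.map (f : A →ₐ[K] A') (g : B →ₐ[K] B') : CT A B →ₐ[K] CT A' B' :=
  CT.liftAlg (CT.inl.comp f) (CT.inr.comp g) fun a b => CT.commute (f a) (g b)

@[simp] theorem CT.map_tm (f : A →ₐ[K] A') (g : B →ₐ[K] B') (a : A) (b : B) :
    CT.map f g (a ⊠ b) = f a ⊠ g b :=
  (CT.liftAlg_tm _ _ _ a b).trans (by simp [CT.inl_apply, CT.inr_apply])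

/-- The completed tensor product of linear maps. -/
def CT.lmap (f : A →ₗ[K] A') (g : B →ₗ[K] B') : CT A B →ₗ[K] CT A' B' :=
  CT.lift (tmL.compl₁₂ f g)

@[simp] theorem CT.lmap_tm (f : A →ₗ[K] A') (g : B →ₗ[K] B') (a : A) (b : B) :
    CT.lmap f g (a ⊠ b) = f a ⊠ g b := by
  simp [CT.lmap]

/-- The transposition. -/
def CT.swap : CT A B →ₐ[K] CT B A :=
  CT.liftAlg CT.inr CT.inl fun a b => (CT.commute b a).symm

@[simp] theorem CT.swap_tm (a : A) (b : B) : CT.swap (a ⊠ b) = b ⊠ a := by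
  simp [CT.swap, CT.inl_apply, CT.inr_apply]

/-- Slicing with functionals. -/
def CT.eval (φ : A →ₗ[K] K) (ψ : B →ₗ[K] K) : CT A B →ₗ[K] K :=
  CT.lift ((LinearMap.mul K K).compl₁₂ φ ψ)

@[simp] theorem CT.eval_tm (φ : A →ₗ[K] K) (ψ : B →ₗ[K] K) (a : A) (b : B) :
    CT.eval φ ψ (a ⊠ b) = φ a * ψ b := by
  simp [CT.eval]

/-- `x ⊗ y ↦ φ(x) y`. -/
def CT.sliceL [IsAdicComplete tIdeal B] (φ : A →ₗ[K] K) : CT A B →ₗ[K] B :=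
  CT.lift ((LinearMap.lsmul K B).comp φ)

@[simp] theorem CT.sliceL_tm [IsAdicComplete tIdeal B] (φ : A →ₗ[K] K) (a : A) (b : B) :
    CT.sliceL φ (a ⊠ b) = φ a • b := by
  simp [CT.sliceL]

/-- `x ⊗ y ↦ φ(y) x`. -/
def CT.sliceR [IsAdicComplete tIdeal A] (φ : B →ₗ[K] K) : CT A B →ₗ[K] A :=
  CT.lift ((LinearMap.lsmul K A).comp φ).flip

@[simp] theorem CT.sliceR_tm [IsAdicComplete tIdeal A] (φ : B →ₗ[K] K) (a : A) (b : B) :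
    CT.sliceR φ (a ⊠ b) = φ b • a := by
  simp [CT.sliceR]

theorem CT.alg_ext [IsHausdorff tIdeal Y] {f g : CT A B →ₐ[K] Y}
    (h₁ : ∀ a, f (CT.inl a) = g (CT.inl a)) (h₂ : ∀ b, f (CT.inr b) = g (CT.inr b)) : f = g := by
  have : f.toLinearMap = g.toLinearMap := by
    ext a b
    have : (a ⊠ b : CT A B) = CT.inl a * CT.inr b := by simp [CT.inl_apply, CT.inr_apply]
    simp [this, h₁, h₂]
  exact AlgHom.ext fun x => LinearMap.congr_fun this x

end CT

/-! ### The completed tensor cube of an algebra -/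

/-- The completed tensor cube of an algebra. -/
def CT3 (A : Type*) [Ring A] [Algebra K A] : Type _ := Cpl (A ⊗[K] (A ⊗[K] A))

section CT3

variable {A B Z Y : Type*} [Ring A] [Algebra K A] [Ring B] [Algebra K B] [AddCommGroup Z]
  [Module K Z] [Ring Y] [Algebra K Y]

instance : Ring (CT3 A) := inferInstanceAs (Ring (Cpl (A ⊗[K] (A ⊗[K] A))))

instance : Algebra K (CT3 A) := inferInstanceAs (Algebra K (Cpl (A ⊗[K] (A ⊗[K] A))))

instance : IsAdicComplete tIdeal (CT3 A) :=
  inferInstanceAs (IsAdicComplete tIdeal (Cpl (A ⊗[K] (A ⊗[K] A))))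

/-- The canonical map to the completed tensor cube. -/
def CT3.of : A ⊗[K] (A ⊗[K] A) →ₗ[K] CT3 A := QStar.of (A ⊗[K] (A ⊗[K] A))

/-- Pure tensors in the completed tensor cube. -/
def tm3 (a b c : A) : CT3 A := CT3.of (a ⊗ₜ[K] (b ⊗ₜ[K] c))

theorem CT3.linear_ext [IsHausdorff tIdeal Z] {f g : CT3 A →ₗ[K] Z}
    (h : ∀ a b c, f (tm3 a b c) = g (tm3 a b c)) : f = g := by
  have h₀ : f.comp CT3.of = g.comp CT3.of := by
    ext a b c
    exact h a b c
  exact Cpl.linear_ext (M := A ⊗[K] (A ⊗[K] A)) (Z := Z) h₀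

/-- The linear map on the completed tensor cube defined by a trilinear map. -/
def CT3.lift [IsAdicComplete tIdeal Z] (φ : A →ₗ[K] (A ⊗[K] A) →ₗ[K] Z) : CT3 A →ₗ[K] Z :=
  cplLift (M := A ⊗[K] (A ⊗[K] A)) (TensorProduct.lift φ)

theorem CT3.lift_tm [IsAdicComplete tIdeal Z] (φ : A →ₗ[K] (A ⊗[K] A) →ₗ[K] Z) (a b c : A) :
    CT3.lift φ (tm3 a b c) = φ a (b ⊗ₜ[K] c) :=
  (cplLift_of (TensorProduct.lift φ) (a ⊗ₜ[K] (b ⊗ₜ[K] c))).trans (TensorProduct.lift.tmul _ _)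

@[simp] theorem tm3_mul_tm3 (a b c a' b' c' : A) :
    tm3 a b c * tm3 a' b' c' = tm3 (a * a') (b * b') (c * c') :=
  (of_mul_of (A := A ⊗[K] (A ⊗[K] A)) _ _).trans (congrArg CT3.of (by simp))

theorem CT3.one_def : (1 : CT3 A) = tm3 1 1 1 := rfl

theorem CT3.map_mul_of_pure [IsHausdorff tIdeal Y] (F : CT3 A →ₗ[K] Y)
    (h : ∀ a b c a' b' c', F (tm3 (a * a') (b * b') (c * c')) = F (tm3 a b c) * F (tm3 a' b' c'))
    (x y : CT3 A) : F (x * y) = F x * F y := by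
  have : (LinearMap.mul K (CT3 A)).compr₂ F = (LinearMap.mul K Y).compl₁₂ F F :=
    CT3.linear_ext fun a b c => CT3.linear_ext fun a' b' c' => by simpa using h a b c a' b' c'
  exact LinearMap.congr_fun₂ this x y

/-- The algebra map on the completed tensor cube defined by three commuting algebra maps. -/
def CT3.liftAlg [IsAdicComplete tIdeal Y] (f g h : A →ₐ[K] Y)
    (hfg : ∀ a b, Commute (f a) (g b)) (hfh : ∀ a b, Commute (f a) (h b))
    (hgh : ∀ a b, Commute (g a) (h b)) : CT3 A →ₐ[K] Y :=
  AlgHom.ofLinearMap (CT3.lift ((LinearMap.mul K Y).compl₁₂ f.toLinearMap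
      (TensorProduct.lift ((LinearMap.mul K Y).compl₁₂ g.toLinearMap h.toLinearMap))))
    (by simp [CT3.one_def, CT3.lift_tm])
    (CT3.map_mul_of_pure _ fun a b c a' b' c' => by
      simp only [CT3.lift_tm, LinearMap.compl₁₂_apply, LinearMap.mul_apply',
        AlgHom.toLinearMap_apply, map_mul, TensorProduct.lift.tmul]
      have h₁ := (hfg a' b).eq
      have h₂ := (hfh a' c).eq
      have h₃ := (hgh b' c).eq
      simp only [mul_assoc]
      rw [← mul_assoc (g b') (h c), h₃, mul_assoc, ← mul_assoc (f a') (g b), h₁, mul_assoc,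
        ← mul_assoc (f a') (h c), h₂, mul_assoc])

@[simp] theorem CT3.liftAlg_tm [IsAdicComplete tIdeal Y] (f g h : A →ₐ[K] Y)
    (hfg : ∀ a b, Commute (f a) (g b)) (hfh : ∀ a b, Commute (f a) (h b))
    (hgh : ∀ a b, Commute (g a) (h b)) (a b c : A) :
    CT3.liftAlg f g h hfg hfh hgh (tm3 a b c) = f a * (g b * h c) := by
  change CT3.lift _ _ = _
  rw [CT3.lift_tm]
  simp

end CT3

end QStar
namespace QStar

/-! ### Legs in the completed tensor cube -/

section Legs

variable {A : Type*} [Ring A] [Algebra K A]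

theorem tm3_add_left (a a' b c : A) : tm3 (a + a') b c = tm3 a b c + tm3 a' b c := by
  simp [tm3, TensorProduct.add_tmul]

theorem tm3_smul_left (r : K) (a b c : A) : tm3 (r • a) b c = r • tm3 a b c := by
  rw [tm3, ← TensorProduct.smul_tmul', map_smul, tm3]

theorem tm3_add_mid (a b b' c : A) : tm3 a (b + b') c = tm3 a b c + tm3 a b' c := by
  simp [tm3, TensorProduct.tmul_add, TensorProduct.add_tmul]

theorem tm3_smul_mid (r : K) (a b c : A) : tm3 a (r • b) c = r • tm3 a b c := by
  simp [tm3, ← TensorProduct.smul_tmul']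

theorem tm3_add_right (a b c c' : A) : tm3 a b (c + c') = tm3 a b c + tm3 a b c' := by
  simp [tm3, TensorProduct.tmul_add]

theorem tm3_smul_right (r : K) (a b c : A) : tm3 a b (r • c) = r • tm3 a b c := by
  simp [tm3]

/-- The first leg. -/
def e1 : A →ₐ[K] CT3 A :=
  AlgHom.ofLinearMap
    { toFun := fun a => tm3 a 1 1
      map_add' := fun a b => tm3_add_left a b 1 1
      map_smul' := fun r a => tm3_smul_left r a 1 1 } rfl fun a b => by simp

/-- The second leg. -/
def e2 : A →ₐ[K] CT3 A :=
  AlgHom.ofLinearMap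
    { toFun := fun a => tm3 1 a 1
      map_add' := fun a b => tm3_add_mid 1 a b 1
      map_smul' := fun r a => tm3_smul_mid r 1 a 1 } rfl fun a b => by simp

/-- The third leg. -/
def e3 : A →ₐ[K] CT3 A :=
  AlgHom.ofLinearMap
    { toFun := fun a => tm3 1 1 a
      map_add' := fun a b => tm3_add_right 1 1 a b
      map_smul' := fun r a => tm3_smul_right r 1 1 a } rfl fun a b => by simp

theorem e1_apply (a : A) : e1 a = tm3 a 1 1 := rfl

theorem e2_apply (a : A) : e2 a = tm3 1 a 1 := rfl

theorem e3_apply (a : A) : e3 a = tm3 1 1 a := rfl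

theorem e1_e2 (a b : A) : Commute (e1 a) (e2 b) := by
  simp [Commute, SemiconjBy, e1_apply, e2_apply]

theorem e1_e3 (a b : A) : Commute (e1 a) (e3 b) := by
  simp [Commute, SemiconjBy, e1_apply, e3_apply]

theorem e2_e3 (a b : A) : Commute (e2 a) (e3 b) := by
  simp [Commute, SemiconjBy, e2_apply, e3_apply]

/-- `x ⊗ y ↦ x ⊗ y ⊗ 1`. -/
def l12 : CT A A →ₐ[K] CT3 A := CT.liftAlg e1 e2 e1_e2

/-- `x ⊗ y ↦ x ⊗ 1 ⊗ y`. -/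
def l13 : CT A A →ₐ[K] CT3 A := CT.liftAlg e1 e3 e1_e3

/-- `x ⊗ y ↦ 1 ⊗ x ⊗ y`. -/
def l23 : CT A A →ₐ[K] CT3 A := CT.liftAlg e2 e3 e2_e3

@[simp] theorem l12_tm (a b : A) : l12 (a ⊠ b) = tm3 a b 1 :=
  (CT.liftAlg_tm e1 e2 e1_e2 a b).trans (by simp [e1_apply, e2_apply])

@[simp] theorem l13_tm (a b : A) : l13 (a ⊠ b) = tm3 a 1 b :=
  (CT.liftAlg_tm e1 e3 e1_e3 a b).trans (by simp [e1_apply, e3_apply])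

@[simp] theorem l23_tm (a b : A) : l23 (a ⊠ b) = tm3 1 a b :=
  (CT.liftAlg_tm e2 e3 e2_e3 a b).trans (by simp [e2_apply, e3_apply])

/-- The two tensor factors generate a dense subalgebra, and commuting with `y` is a closed condition
stable under products. -/
theorem commute_of_pure {Y : Type*} [Ring Y] [Algebra K Y] [IsHausdorff tIdeal Y]
    {B C : Type*} [Ring B] [Algebra K B] [Ring C] [Algebra K C] (f : CT B C →ₐ[K] Y) {y : Y}
    (h₁ : ∀ b, Commute (f (CT.inl b)) y) (h₂ : ∀ c, Commute (f (CT.inr c)) y) (x : CT B C) :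
    Commute (f x) y := by
  have : (LinearMap.mulRight K y).comp f.toLinearMap = (LinearMap.mulLeft K y).comp f.toLinearMap := by
    ext b c
    have : (b ⊠ c : CT B C) = CT.inl b * CT.inr c := by simp [CT.inl_apply, CT.inr_apply]
    simp only [LinearMap.compr₂_apply, LinearMap.comp_apply, LinearMap.mulRight_apply,
      LinearMap.mulLeft_apply, AlgHom.toLinearMap_apply, this, map_mul]
    exact ((h₁ b).mul_left (h₂ c)).eq
  exact LinearMap.congr_fun this x

@[simp] theorem l12_inl (a : A) : l12 (CT.inl a) = e1 a := by simp [CT.inl_apply, e1_apply]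
@[simp] theorem l12_inr (a : A) : l12 (CT.inr a) = e2 a := by simp [CT.inr_apply, e2_apply]
@[simp] theorem l23_inl (a : A) : l23 (CT.inl a) = e2 a := by simp [CT.inl_apply, e2_apply]
@[simp] theorem l23_inr (a : A) : l23 (CT.inr a) = e3 a := by simp [CT.inr_apply, e3_apply]

theorem e1_l23 (a : A) (y : CT A A) : Commute (e1 a) (l23 y) :=
  (commute_of_pure l23 (fun b => by simpa using (e1_e2 a b).symm)
    (fun b => by simpa using (e1_e3 a b).symm) y).symm

theorem l12_e3 (y : CT A A) (a : A) : Commute (l12 y) (e3 a) :=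
  commute_of_pure l12 (fun b => by simpa using e1_e3 b a) (fun b => by simpa using e2_e3 b a) y

end Legs

/-! ### Hopf algebras -/

section Comul

variable {A : Type*} [Ring A] [Algebra K A] (Δ : A →ₐ[K] CT A A)

/-- `Δ ⊗ id`. -/
def comulL : CT A A →ₐ[K] CT3 A := CT.liftAlg (l12.comp Δ) e3 fun a b => l12_e3 (Δ a) b

/-- `id ⊗ Δ`. -/
def comulR : CT A A →ₐ[K] CT3 A := CT.liftAlg e1 (l23.comp Δ) fun a b => e1_l23 a (Δ b)

@[simp] theorem comulL_tm (a b : A) : comulL Δ (a ⊠ b) = l12 (Δ a) * e3 b :=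
  CT.liftAlg_tm _ _ _ a b

@[simp] theorem comulR_tm (a b : A) : comulR Δ (a ⊠ b) = e1 a * l23 (Δ b) :=
  CT.liftAlg_tm _ _ _ a b

end Comul

/-- A complete Hopf algebra over `ℂ[[t]]` with invertible antipode. -/
structure Hopf (A : Type*) [Ring A] [Algebra K A] [IsAdicComplete tIdeal A] where
  Δ : A →ₐ[K] CT A A
  ε : A →ₐ[K] K
  S : A →ₗ[K] A
  coassoc : ∀ x, comulL Δ (Δ x) = comulR Δ (Δ x)
  counit_left : ∀ x, CT.sliceL ε.toLinearMap (Δ x) = x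
  counit_right : ∀ x, CT.sliceR ε.toLinearMap (Δ x) = x
  antipode_left : ∀ x, CT.lift ((LinearMap.mul K A).compl₁₂ S LinearMap.id) (Δ x) = algebraMap K A (ε x)
  antipode_right : ∀ x, CT.lift ((LinearMap.mul K A).compl₁₂ LinearMap.id S) (Δ x) = algebraMap K A (ε x)
  S_bijective : Function.Bijective S

namespace Hopf

variable {A : Type*} [Ring A] [Algebra K A] [IsAdicComplete tIdeal A]

/-- The underlying operations. -/
def toData (h : Hopf A) : HopfData A where
  comul := h.Δ.toLinearMap
  counit := h.ε.toLinearMap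
  antipode := h.S

end Hopf

/-! ### Comparison with the unbundled definitions -/

section Compare

variable {A : Type*} [Ring A] [Algebra K A]

theorem flip_eq (x : CT A A) : flip x = CT.swap x := by
  have : (flip : CT A A →ₗ[K] CT A A) = CT.swap.toLinearMap := by
    ext a b
    change flip (of _ (a ⊗ₜ[K] b)) = CT.swap (a ⊠ b)
    rw [CT.swap_tm, flip, cmap_of, LinearEquiv.coe_coe, TensorProduct.comm_tmul]
    rfl
  exact LinearMap.congr_fun this x

theorem leg12_eq (x : CT A A) : leg12 x = l12 x := by
  have : (leg12 : CT A A →ₗ[K] CT3 A) = l12.toLinearMap := by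
    ext a b
    change leg12 (of _ (a ⊗ₜ[K] b)) = l12 (a ⊠ b)
    rw [l12_tm, leg12, cmap_of, TensorProduct.map_tmul, LinearMap.id_apply, LinearMap.flip_apply,
      TensorProduct.mk_apply]
    rfl
  exact LinearMap.congr_fun this x

theorem leg13_eq (x : CT A A) : leg13 x = l13 x := by
  have : (leg13 : CT A A →ₗ[K] CT3 A) = l13.toLinearMap := by
    ext a b
    change leg13 (of _ (a ⊗ₜ[K] b)) = l13 (a ⊠ b)
    rw [l13_tm, leg13, cmap_of, TensorProduct.map_tmul, LinearMap.id_apply, TensorProduct.mk_apply]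
    rfl
  exact LinearMap.congr_fun this x

theorem leg23_eq (x : CT A A) : leg23 x = l23 x := by
  have : (leg23 : CT A A →ₗ[K] CT3 A) = l23.toLinearMap := by
    ext a b
    change leg23 (of _ (a ⊗ₜ[K] b)) = l23 (a ⊠ b)
    rw [l23_tm, leg23, cmap_of, TensorProduct.mk_apply]
    rfl
  exact LinearMap.congr_fun this x

/-- Rewrites the external tensor product as a product of legs, so that `id ⊗ Δ` becomes an algebra
map built from commuting legs. -/
theorem tens_of_left (a : A) (y : CT A A) :
    (tens (N := A ⊗[K] A) (of A a) y : CT3 A) = e1 a * l23 y := by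
  have : (tens (N := A ⊗[K] A) (of A a) : CT A A →ₗ[K] CT3 A) =
      (LinearMap.mulLeft K (e1 a)).comp l23.toLinearMap := by
    ext b c
    change tens (of A a) (of _ (b ⊗ₜ[K] c)) = e1 a * l23 (b ⊠ c)
    rw [l23_tm, tens_of_of, e1_apply, tm3_mul_tm3, mul_one, one_mul, one_mul]
    rfl
  exact LinearMap.congr_fun this y

theorem assoc_tens_of_right (y : CT A A) (c : A) :
    (cmap (TensorProduct.assoc K A A A).toLinearMap (tens (M := A ⊗[K] A) y (of A c)) : CT3 A) =
      l12 y * e3 c := by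
  have : ((cmap (TensorProduct.assoc K A A A).toLinearMap).comp
      ((tens (M := A ⊗[K] A) (N := A)).flip (of A c)) : CT A A →ₗ[K] CT3 A) =
      (LinearMap.mulRight K (e3 c)).comp l12.toLinearMap := by
    ext a b
    change cmap (TensorProduct.assoc K A A A).toLinearMap (tens (of _ (a ⊗ₜ[K] b)) (of A c)) =
      l12 (a ⊠ b) * e3 c
    rw [l12_tm, tens_of_of, e3_apply, tm3_mul_tm3, mul_one, one_mul, mul_one, cmap_of,
      LinearEquiv.coe_coe, TensorProduct.assoc_tmul]
    rfl
  exact LinearMap.congr_fun this y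

theorem comulRight_eq (D : HopfData A) (Δ : A →ₐ[K] CT A A) (hΔ : ∀ x, D.comul x = Δ x)
    (y : CT A A) :
    D.comulRight y = comulR Δ y := by
  have : (D.comulRight : CT A A →ₗ[K] CT3 A) =
      (comulR Δ).toLinearMap := by
    ext a b
    change D.comulRight (of _ (a ⊗ₜ[K] b)) = comulR Δ (a ⊠ b)
    rw [comulR_tm, HopfData.comulRight, cext_of, TensorProduct.lift.tmul,
      LinearMap.compl₁₂_apply, hΔ]
    exact tens_of_left a (Δ b)
  exact LinearMap.congr_fun this y

theorem comulLeft_eq (D : HopfData A) (Δ : A →ₐ[K] CT A A) (hΔ : ∀ x, D.comul x = Δ x)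
    (y : CT A A) :
    D.comulLeft y = comulL Δ y := by
  have : (D.comulLeft : CT A A →ₗ[K] CT3 A) =
      (comulL Δ).toLinearMap := by
    ext a b
    change D.comulLeft (of _ (a ⊗ₜ[K] b)) = comulL Δ (a ⊠ b)
    rw [comulL_tm, HopfData.comulLeft, LinearMap.comp_apply, cext_of, TensorProduct.lift.tmul,
      LinearMap.compl₁₂_apply, hΔ]
    exact assoc_tens_of_right (Δ a) b
  exact LinearMap.congr_fun this y

theorem evalT_eq {B : Type*} [Ring B] [Algebra K B] (φ : A →ₗ[K] K) (ψ : B →ₗ[K] K) (x : CT A B) :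
    evalT φ ψ x = CT.eval φ ψ x := by
  have : (evalT φ ψ : CT A B →ₗ[K] K) = CT.eval φ ψ := by
    refine CT.linear_ext (LinearMap.ext₂ fun a b => ?_)
    change evalT φ ψ (of _ (a ⊗ₜ[K] b)) = CT.eval φ ψ (a ⊠ b)
    rw [CT.eval_tm, evalT_of]
  exact LinearMap.congr_fun this x

variable [IsAdicComplete tIdeal A]

theorem sliceLeft_eq (φ : A →ₗ[K] K) (x : CT A A) : sliceLeft φ x = CT.sliceL φ x := by
  have : (sliceLeft φ : CT A A →ₗ[K] A) = CT.sliceL φ := by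
    ext a b
    change sliceLeft φ (of _ (a ⊗ₜ[K] b)) = CT.sliceL φ (a ⊠ b)
    rw [CT.sliceL_tm, sliceLeft, LinearMap.comp_apply, cmap_of, uncpl_of, LinearMap.comp_apply,
      TensorProduct.map_tmul, LinearEquiv.coe_coe, TensorProduct.lid_tmul, LinearMap.id_apply]
  exact LinearMap.congr_fun this x

theorem sliceRight_eq (φ : A →ₗ[K] K) (x : CT A A) : sliceRight φ x = CT.sliceR φ x := by
  have : (sliceRight φ : CT A A →ₗ[K] A) = CT.sliceR φ := by
    ext a b
    change sliceRight φ (of _ (a ⊗ₜ[K] b)) = CT.sliceR φ (a ⊠ b)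
    rw [CT.sliceR_tm, sliceRight, LinearMap.comp_apply, cmap_of, uncpl_of, LinearMap.comp_apply,
      TensorProduct.map_tmul, LinearEquiv.coe_coe, TensorProduct.rid_tmul, LinearMap.id_apply]
  exact LinearMap.congr_fun this x

theorem counitLeft_eq (φ : A →ₗ[K] K) (x : CT A A) :
    cmap ((TensorProduct.lid K A).toLinearMap.comp (TensorProduct.map φ LinearMap.id)) x =
      of A (CT.sliceL φ x) :=
  (of_uncpl _).symm.trans (congrArg (of A) (sliceLeft_eq φ x))

theorem counitRight_eq (φ : A →ₗ[K] K) (x : CT A A) :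
    cmap ((TensorProduct.rid K A).toLinearMap.comp (TensorProduct.map LinearMap.id φ)) x =
      of A (CT.sliceR φ x) :=
  (of_uncpl _).symm.trans (congrArg (of A) (sliceRight_eq φ x))

theorem cmul_map_eq (f g : A →ₗ[K] A) (x : CT A A) :
    cmul (cmap (TensorProduct.map f g) x) =
      of A (CT.lift ((LinearMap.mul K A).compl₁₂ f g) x) := by
  have : (cmul.comp (cmap (TensorProduct.map f g)) : CT A A →ₗ[K] Cpl A) =
      (of A).comp (CT.lift ((LinearMap.mul K A).compl₁₂ f g)) := by
    ext a b
    change cmul (cmap (TensorProduct.map f g) (of _ (a ⊗ₜ[K] b))) = of A (CT.lift _ (a ⊠ b))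
    rw [CT.lift_tm, cmap_of, TensorProduct.map_tmul, cmul, cmap_of, LinearMap.mul'_apply,
      LinearMap.compl₁₂_apply, LinearMap.mul_apply']
  exact LinearMap.congr_fun this x

theorem Hopf.isHopf (h : Hopf A) : h.toData.IsHopf where
  comul_one := map_one h.Δ
  comul_mul := map_mul h.Δ
  counit_one := map_one h.ε
  counit_mul := map_mul h.ε
  coassoc x := by
    have h₁ := comulLeft_eq h.toData h.Δ (fun _ => rfl) (h.Δ x)
    have h₂ := comulRight_eq h.toData h.Δ (fun _ => rfl) (h.Δ x)
    exact h₁.trans ((h.coassoc x).trans h₂.symm)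
  counit_left x := (counitLeft_eq _ (h.Δ x)).trans (congrArg _ (h.counit_left x))
  counit_right x := (counitRight_eq _ (h.Δ x)).trans (congrArg _ (h.counit_right x))
  antipode_left x := (cmul_map_eq h.S LinearMap.id (h.Δ x)).trans (congrArg _ (h.antipode_left x))
  antipode_right x := (cmul_map_eq LinearMap.id h.S (h.Δ x)).trans (congrArg _ (h.antipode_right x))
  antipode_bijective := h.S_bijective

/-- The Hopf algebra with given operations. -/
def Hopf.ofData (D : HopfData A) (hD : D.IsHopf) : Hopf A where
  Δ := AlgHom.ofLinearMap (B := CT A A) D.comul hD.comul_one hD.comul_mul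
  ε := AlgHom.ofLinearMap D.counit hD.counit_one hD.counit_mul
  S := D.antipode
  coassoc x := by
    have h₁ := comulLeft_eq D (AlgHom.ofLinearMap (B := CT A A) D.comul hD.comul_one hD.comul_mul)
      (fun _ => rfl) (D.comul x)
    have h₂ := comulRight_eq D (AlgHom.ofLinearMap (B := CT A A) D.comul hD.comul_one hD.comul_mul)
      (fun _ => rfl) (D.comul x)
    exact h₁.symm.trans ((hD.coassoc x).trans h₂)
  counit_left x := of_injective ((counitLeft_eq D.counit (D.comul x)).symm.trans (hD.counit_left x))
  counit_right x := of_injective ((counitRight_eq D.counit (D.comul x)).symm.trans (hD.counit_right x))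
  antipode_left x :=
    of_injective ((cmul_map_eq D.antipode LinearMap.id (D.comul x)).symm.trans (hD.antipode_left x))
  antipode_right x :=
    of_injective ((cmul_map_eq LinearMap.id D.antipode (D.comul x)).symm.trans (hD.antipode_right x))
  S_bijective := hD.antipode_bijective

end Compare

section StarT

variable {A : Type*} [Ring A] [Algebra K A]

/-- `* ⊗ *` on the completed tensor square. -/
def CT.star (st : A →ₛₗ[conjK] A) : CT A A →ₛₗ[conjK] CT A A := starT st

@[simp] theorem CT.star_tm (st : A →ₛₗ[conjK] A) (a b : A) : CT.star st (a ⊠ b) = st a ⊠ st b := by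
  change starT st (QStar.of _ (a ⊗ₜ[K] b)) = _
  rw [starT, cmapConj_of, TensorProduct.map_tmul]
  rfl

/-- The bilinear criterion is not available for conjugate-linear maps. Instead one factor is frozen
at a time: both sides are then conjugate-linear in the other factor. -/
theorem CT.star_mul (st : A →ₛₗ[conjK] A) (hst : ∀ x y, st (x * y) = st y * st x) (x y : CT A A) :
    CT.star st (x * y) = CT.star st y * CT.star st x := by
  have h₁ : ∀ a b y, CT.star st (a ⊠ b * y) = CT.star st y * CT.star st (a ⊠ b) := fun a b y => by
    have : (CT.star st).comp (LinearMap.mulLeft K (a ⊠ b : CT A A)) =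
        (LinearMap.mulRight K (CT.star st (a ⊠ b))).comp (CT.star st) :=
      CT.conj_ext fun a' b' => by simp [hst]
    exact LinearMap.congr_fun this y
  have : (CT.star st).comp (LinearMap.mulRight K y) =
      (LinearMap.mulLeft K (CT.star st y)).comp (CT.star st) :=
    CT.conj_ext fun a b => by simpa using h₁ a b y
  exact LinearMap.congr_fun this x

theorem CT.star_one (st : A →ₛₗ[conjK] A) (hst : st 1 = 1) : CT.star st 1 = 1 := by
  rw [CT.one_def, CT.star_tm, hst]

end StarT

end QStar
namespace QStar

/-! ### Slices and convolution -/

section Slices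

variable {A Z : Type*} [Ring A] [Algebra K A] [Ring Z] [Algebra K Z] [IsAdicComplete tIdeal Z]

/-- The linear map on the completed tensor cube defined by a trilinear map. -/
def CT3.lift₃ {Z : Type*} [AddCommGroup Z] [Module K Z] [IsAdicComplete tIdeal Z]
    (φ : A →ₗ[K] A →ₗ[K] A →ₗ[K] Z) : CT3 A →ₗ[K] Z :=
  CT3.lift ((TensorProduct.uncurry (RingHom.id K) A A Z).comp φ)

@[simp] theorem CT3.lift₃_tm {Z : Type*} [AddCommGroup Z] [Module K Z] [IsAdicComplete tIdeal Z]
    (φ : A →ₗ[K] A →ₗ[K] A →ₗ[K] Z) (a b c : A) : CT3.lift₃ φ (tm3 a b c) = φ a b c := by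
  rw [CT3.lift₃, CT3.lift_tm]
  rfl

/-- `f ⊗ id ⊗ id`. -/
def slice1 (f : A →ₗ[K] K) : CT3 A →ₗ[K] CT A A := CT3.lift₃ (f.smulRight tmL)

/-- `id ⊗ f ⊗ id`. -/
def slice2 (f : A →ₗ[K] K) : CT3 A →ₗ[K] CT A A := CT3.lift₃ ((LinearMap.smulRightₗ f).comp tmL)

/-- `id ⊗ id ⊗ f`. -/
def slice3 (f : A →ₗ[K] K) : CT3 A →ₗ[K] CT A A := CT3.lift₃ (tmL.compr₂ (LinearMap.smulRightₗ f))

@[simp] theorem slice1_tm (f : A →ₗ[K] K) (a b c : A) : slice1 f (tm3 a b c) = f a • b ⊠ c := by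
  simp [slice1]

@[simp] theorem slice2_tm (f : A →ₗ[K] K) (a b c : A) : slice2 f (tm3 a b c) = f b • a ⊠ c := by
  simp [slice2]

@[simp] theorem slice3_tm (f : A →ₗ[K] K) (a b c : A) : slice3 f (tm3 a b c) = f c • a ⊠ b := by
  simp [slice3]

theorem slice1_e1_l23 (f : A →ₗ[K] K) (a : A) (z : CT A A) : slice1 f (e1 a * l23 z) = f a • z := by
  have : (slice1 f).comp ((LinearMap.mulLeft K (e1 a)).comp l23.toLinearMap) =
      f a • LinearMap.id := by
    ext b c
    simp [e1_apply]
  exact LinearMap.congr_fun this z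

theorem slice3_l12_e3 (f : A →ₗ[K] K) (z : CT A A) (c : A) : slice3 f (l12 z * e3 c) = f c • z := by
  have : (slice3 f).comp ((LinearMap.mulRight K (e3 c)).comp l12.toLinearMap) =
      f c • LinearMap.id := by
    ext a b
    simp [e3_apply]
  exact LinearMap.congr_fun this z

variable [IsAdicComplete tIdeal A]

theorem slice2_e1_l23 (f : A →ₗ[K] K) (a : A) (z : CT A A) :
    slice2 f (e1 a * l23 z) = a ⊠ CT.sliceL f z := by
  have : (slice2 f).comp ((LinearMap.mulLeft K (e1 a)).comp l23.toLinearMap) =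
      (tmL a).comp (CT.sliceL f) := by
    ext b c
    simp [e1_apply]
  exact LinearMap.congr_fun this z

theorem slice3_e1_l23 (f : A →ₗ[K] K) (a : A) (z : CT A A) :
    slice3 f (e1 a * l23 z) = a ⊠ CT.sliceR f z := by
  have : (slice3 f).comp ((LinearMap.mulLeft K (e1 a)).comp l23.toLinearMap) =
      (tmL a).comp (CT.sliceR f) := by
    ext b c
    simp [e1_apply]
  exact LinearMap.congr_fun this z

theorem slice1_l12_e3 (f : A →ₗ[K] K) (z : CT A A) (c : A) :
    slice1 f (l12 z * e3 c) = CT.sliceL f z ⊠ c := by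
  have : (slice1 f).comp ((LinearMap.mulRight K (e3 c)).comp l12.toLinearMap) =
      (tmL.flip c).comp (CT.sliceL f) := by
    ext a b
    simp [e3_apply]
  exact LinearMap.congr_fun this z

theorem slice2_l12_e3 (f : A →ₗ[K] K) (z : CT A A) (c : A) :
    slice2 f (l12 z * e3 c) = CT.sliceR f z ⊠ c := by
  have : (slice2 f).comp ((LinearMap.mulRight K (e3 c)).comp l12.toLinearMap) =
      (tmL.flip c).comp (CT.sliceR f) := by
    ext a b
    simp [e3_apply]
  exact LinearMap.congr_fun this z

end Slices

namespace Hopf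

variable {A Z : Type*} [Ring A] [Algebra K A] [IsAdicComplete tIdeal A] [Ring Z] [Algebra K Z]
  [IsAdicComplete tIdeal Z] (h : Hopf A)

/-- `x ↦ f(x₍₁₎) x₍₂₎`. -/
def hitL (f : A →ₗ[K] K) : A →ₗ[K] A := (CT.sliceL f).comp h.Δ.toLinearMap

/-- `x ↦ f(x₍₂₎) x₍₁₎`. -/
def hitR (f : A →ₗ[K] K) : A →ₗ[K] A := (CT.sliceR f).comp h.Δ.toLinearMap

theorem hitL_apply (f : A →ₗ[K] K) (x : A) : h.hitL f x = CT.sliceL f (h.Δ x) := rfl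

theorem hitR_apply (f : A →ₗ[K] K) (x : A) : h.hitR f x = CT.sliceR f (h.Δ x) := rfl

theorem slice1_comulR (f : A →ₗ[K] K) (y : CT A A) :
    slice1 f (comulR h.Δ y) = h.Δ (CT.sliceL f y) := by
  have : (slice1 f).comp (comulR h.Δ).toLinearMap = h.Δ.toLinearMap.comp (CT.sliceL f) := by
    ext a b
    simp [slice1_e1_l23]
  exact LinearMap.congr_fun this y

theorem slice2_comulR (f : A →ₗ[K] K) (y : CT A A) :
    slice2 f (comulR h.Δ y) = CT.lmap LinearMap.id (h.hitL f) y := by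
  have : (slice2 f).comp (comulR h.Δ).toLinearMap = CT.lmap LinearMap.id (h.hitL f) := by
    ext a b
    simp [slice2_e1_l23, hitL_apply]
  exact LinearMap.congr_fun this y

theorem slice3_comulR (f : A →ₗ[K] K) (y : CT A A) :
    slice3 f (comulR h.Δ y) = CT.lmap LinearMap.id (h.hitR f) y := by
  have : (slice3 f).comp (comulR h.Δ).toLinearMap = CT.lmap LinearMap.id (h.hitR f) := by
    ext a b
    simp [slice3_e1_l23, hitR_apply]
  exact LinearMap.congr_fun this y

theorem slice1_comulL (f : A →ₗ[K] K) (y : CT A A) :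
    slice1 f (comulL h.Δ y) = CT.lmap (h.hitL f) LinearMap.id y := by
  have : (slice1 f).comp (comulL h.Δ).toLinearMap = CT.lmap (h.hitL f) LinearMap.id := by
    ext a b
    simp [slice1_l12_e3, hitL_apply]
  exact LinearMap.congr_fun this y

theorem slice2_comulL (f : A →ₗ[K] K) (y : CT A A) :
    slice2 f (comulL h.Δ y) = CT.lmap (h.hitR f) LinearMap.id y := by
  have : (slice2 f).comp (comulL h.Δ).toLinearMap = CT.lmap (h.hitR f) LinearMap.id := by
    ext a b
    simp [slice2_l12_e3, hitR_apply]
  exact LinearMap.congr_fun this y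

theorem slice3_comulL (f : A →ₗ[K] K) (y : CT A A) :
    slice3 f (comulL h.Δ y) = h.Δ (CT.sliceR f y) := by
  have : (slice3 f).comp (comulL h.Δ).toLinearMap = h.Δ.toLinearMap.comp (CT.sliceR f) := by
    ext a b
    simp [slice3_l12_e3]
  exact LinearMap.congr_fun this y

/-- Coassociativity contracted with `f` in the first leg. Contraction in the third leg is `Δ_hitR`,
and in the middle leg `lmap_hitR_Δ`. -/
theorem Δ_hitL (f : A →ₗ[K] K) (x : A) :
    h.Δ (h.hitL f x) = CT.lmap (h.hitL f) LinearMap.id (h.Δ x) := by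
  rw [← slice1_comulL, h.coassoc, slice1_comulR, hitL_apply]

theorem Δ_hitR (f : A →ₗ[K] K) (x : A) :
    h.Δ (h.hitR f x) = CT.lmap LinearMap.id (h.hitR f) (h.Δ x) := by
  rw [← slice3_comulR, ← h.coassoc, slice3_comulL, hitR_apply]

theorem lmap_hitR_Δ (f : A →ₗ[K] K) (x : A) :
    CT.lmap (h.hitR f) LinearMap.id (h.Δ x) = CT.lmap LinearMap.id (h.hitL f) (h.Δ x) := by
  rw [← slice2_comulL, h.coassoc, slice2_comulR]

end Hopf

section SliceNat

variable {A B : Type*} [Ring A] [Algebra K A] [IsAdicComplete tIdeal A] [Ring B] [Algebra K B]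
  [IsAdicComplete tIdeal B]

theorem sliceL_lmap (f : B →ₗ[K] K) (u : A →ₗ[K] B) (v : A →ₗ[K] B) (y : CT A A) :
    CT.sliceL f (CT.lmap u v y) = v (CT.sliceL (f.comp u) y) := by
  have : (CT.sliceL f).comp (CT.lmap u v) = v.comp (CT.sliceL (f.comp u)) := by
    ext a b
    simp
  exact LinearMap.congr_fun this y

theorem sliceR_lmap (f : B →ₗ[K] K) (u : A →ₗ[K] B) (v : A →ₗ[K] B) (y : CT A A) :
    CT.sliceR f (CT.lmap u v y) = u (CT.sliceR (f.comp v) y) := by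
  have : (CT.sliceR f).comp (CT.lmap u v) = u.comp (CT.sliceR (f.comp v)) := by
    ext a b
    simp
  exact LinearMap.congr_fun this y

theorem apply_sliceL (f g : A →ₗ[K] K) (y : CT A A) : g (CT.sliceL f y) = CT.eval f g y := by
  have : g.comp (CT.sliceL f) = CT.eval f g :=
    CT.linear_ext (LinearMap.ext₂ fun a b => by simp)
  exact LinearMap.congr_fun this y

theorem apply_sliceR (f g : A →ₗ[K] K) (y : CT A A) : f (CT.sliceR g y) = CT.eval f g y := by
  have : f.comp (CT.sliceR g) = CT.eval f g :=
    CT.linear_ext (LinearMap.ext₂ fun a b => by simp [mul_comm])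
  exact LinearMap.congr_fun this y

end SliceNat

namespace Hopf

variable {A Z : Type*} [Ring A] [Algebra K A] [IsAdicComplete tIdeal A] [Ring Z] [Algebra K Z]
  [IsAdicComplete tIdeal Z] (h : Hopf A)

/-- The convolution product of functionals. -/
def dconv (f g : A →ₗ[K] K) : A →ₗ[K] K := (CT.eval f g).comp h.Δ.toLinearMap

theorem dconv_apply (f g : A →ₗ[K] K) (x : A) : h.dconv f g x = CT.eval f g (h.Δ x) := rfl

theorem hitR_hitR (f g : A →ₗ[K] K) (x : A) : h.hitR f (h.hitR g x) = h.hitR (h.dconv f g) x := by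
  rw [hitR_apply, Δ_hitR, sliceR_lmap, hitR_apply, LinearMap.id_apply]
  congr 2
  ext1 y
  rw [LinearMap.comp_apply, hitR_apply, apply_sliceR, dconv_apply]

theorem hitR_hitL (f g : A →ₗ[K] K) (x : A) : h.hitR g (h.hitL f x) = h.hitL f (h.hitR g x) := by
  rw [hitR_apply, Δ_hitL, sliceR_lmap, LinearMap.comp_id, hitR_apply]

theorem hitL_ε (x : A) : h.hitL h.ε.toLinearMap x = x := h.counit_left x

theorem hitR_ε (x : A) : h.hitR h.ε.toLinearMap x = x := h.counit_right x

/-! Convolution of algebra-valued maps. -/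

/-- The convolution product of linear maps to an algebra. -/
def conv (f g : A →ₗ[K] Z) : A →ₗ[K] Z :=
  (CT.lift ((LinearMap.mul K Z).compl₁₂ f g)).comp h.Δ.toLinearMap

/-- The unit of the convolution product. -/
def convOne : A →ₗ[K] Z := (Algebra.linearMap K Z).comp h.ε.toLinearMap

theorem conv_apply (f g : A →ₗ[K] Z) (x : A) :
    h.conv f g x = CT.lift ((LinearMap.mul K Z).compl₁₂ f g) (h.Δ x) := rfl

theorem conv_assoc (f g k : A →ₗ[K] Z) : h.conv (h.conv f g) k = h.conv f (h.conv g k) := by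
  -- The triple product `a ⊗ b ⊗ c ↦ f a * g b * k c`: the two bracketings are its composites with
  -- `Δ ⊗ id` and `id ⊗ Δ`.
  let m3 : CT3 A →ₗ[K] Z :=
    CT3.lift₃ (((LinearMap.mul K Z).compl₁₂ f g).compr₂ ((LinearMap.mul K Z).compl₂ k))
  have hm : ∀ a b c, m3 (tm3 a b c) = f a * g b * k c := fun a b c => by simp [m3]
  have h₁ : ∀ y, m3 (comulL h.Δ y) = CT.lift ((LinearMap.mul K Z).compl₁₂ (h.conv f g) k) y := by
    have h₁ : ∀ z c, m3 (l12 z * e3 c) = CT.lift ((LinearMap.mul K Z).compl₁₂ f g) z * k c := by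
      intro z c
      have : m3.comp ((LinearMap.mulRight K (e3 c)).comp l12.toLinearMap) =
          (LinearMap.mulRight K (k c)).comp (CT.lift ((LinearMap.mul K Z).compl₁₂ f g)) := by
        ext a b
        simp [hm, e3_apply]
      exact LinearMap.congr_fun this z
    intro y
    have : m3.comp (comulL h.Δ).toLinearMap =
        CT.lift ((LinearMap.mul K Z).compl₁₂ (h.conv f g) k) := by
      ext a b
      simp [h₁, conv_apply]
    exact LinearMap.congr_fun this y
  have h₂ : ∀ y, m3 (comulR h.Δ y) = CT.lift ((LinearMap.mul K Z).compl₁₂ f (h.conv g k)) y := by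
    have h₁ : ∀ a z, m3 (e1 a * l23 z) = f a * CT.lift ((LinearMap.mul K Z).compl₁₂ g k) z := by
      intro a z
      have : m3.comp ((LinearMap.mulLeft K (e1 a)).comp l23.toLinearMap) =
          (LinearMap.mulLeft K (f a)).comp (CT.lift ((LinearMap.mul K Z).compl₁₂ g k)) := by
        ext b c
        simp [hm, mul_assoc, e1_apply]
      exact LinearMap.congr_fun this z
    intro y
    have : m3.comp (comulR h.Δ).toLinearMap =
        CT.lift ((LinearMap.mul K Z).compl₁₂ f (h.conv g k)) := by
      ext a b
      simp [h₁, conv_apply]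
    exact LinearMap.congr_fun this y
  ext x
  rw [conv_apply, ← h₁, h.coassoc, h₂, conv_apply]

theorem conv_one (f : A →ₗ[K] Z) : h.conv f h.convOne = f := by
  have : CT.lift ((LinearMap.mul K Z).compl₁₂ f h.convOne) = f.comp (CT.sliceR h.ε.toLinearMap) := by
    ext a b
    simp [convOne, ← Algebra.commutes, ← Algebra.smul_def]
  ext x
  rw [conv_apply, this, LinearMap.comp_apply, h.counit_right]

theorem one_conv (f : A →ₗ[K] Z) : h.conv h.convOne f = f := by
  have : CT.lift ((LinearMap.mul K Z).compl₁₂ h.convOne f) = f.comp (CT.sliceL h.ε.toLinearMap) := by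
    ext a b
    simp [convOne, ← Algebra.smul_def]
  ext x
  rw [conv_apply, this, LinearMap.comp_apply, h.counit_left]

theorem conv_S_id : h.conv h.S LinearMap.id = h.convOne := LinearMap.ext h.antipode_left

theorem conv_id_S : h.conv LinearMap.id h.S = h.convOne := LinearMap.ext h.antipode_right

end Hopf
end QStar
namespace QStar

/-! ### The antipode -/

namespace Hopf

variable {A Z Y : Type*} [Ring A] [Algebra K A] [IsAdicComplete tIdeal A] [Ring Z] [Algebra K Z]
  [IsAdicComplete tIdeal Z] [Ring Y] [Algebra K Y] [IsAdicComplete tIdeal Y] (h : Hopf A)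

theorem conv_comp_algHom (φ : Z →ₐ[K] Y) (f g : A →ₗ[K] Z) :
    h.conv (φ.toLinearMap.comp f) (φ.toLinearMap.comp g) = φ.toLinearMap.comp (h.conv f g) := by
  have : CT.lift ((LinearMap.mul K Y).compl₁₂ (φ.toLinearMap.comp f) (φ.toLinearMap.comp g)) =
      φ.toLinearMap.comp (CT.lift ((LinearMap.mul K Z).compl₁₂ f g)) := by
    ext a b
    simp
  ext x
  exact LinearMap.congr_fun this (h.Δ x)

theorem comp_convOne {Z Y : Type*} [Ring Z] [Algebra K Z] [Ring Y] [Algebra K Y] (φ : Z →ₐ[K] Y) :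
    φ.toLinearMap.comp (h.convOne (Z := Z)) = h.convOne := by
  ext x
  simp [convOne]

theorem conv_smul_one (f : A →ₗ[K] Z) (z : Z) :
    h.conv ((LinearMap.mulLeft K z).comp h.convOne) f = (LinearMap.mulLeft K z).comp f := by
  have : CT.lift ((LinearMap.mul K Z).compl₁₂ ((LinearMap.mulLeft K z).comp h.convOne) f) =
      (LinearMap.mulLeft K z).comp (CT.lift ((LinearMap.mul K Z).compl₁₂ h.convOne f)) := by
    ext a b
    simp [mul_assoc]
  have h₂ := h.one_conv f
  ext x
  rw [conv_apply, this, LinearMap.comp_apply, ← conv_apply, h₂, LinearMap.comp_apply]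

/-- Since `S` is the convolution inverse of the identity, convolving `f * id = z ε` with `S` on the
right solves for `f`. -/
theorem eq_of_conv_id (f : A →ₗ[K] A) (z : A)
    (hf : h.conv f LinearMap.id = (LinearMap.mulLeft K z).comp h.convOne) :
    f = (LinearMap.mulLeft K z).comp h.S := by
  rw [← h.conv_one f, ← h.conv_id_S, ← conv_assoc, hf, conv_smul_one]

theorem S_one : h.S 1 = 1 := by
  have := h.antipode_left 1
  rw [map_one, CT.one_def, CT.lift_tm] at this
  simpa using this

/-- Uniqueness of convolution inverses is used twice. For fixed `x`, convolving `y ↦ S(x₁ y) x₂`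
with the identity gives `ε(x) ε(y)`, so this map is `ε(x) S`. For fixed `y`, convolving `x ↦ S(x y)`
with the identity then gives `ε(x) S(y)`, so this map is `S(y) S(·)`. -/
theorem S_mul (x y : A) : h.S (x * y) = h.S y * h.S x := by
  -- On pure tensors `Φ (a ⊗ b) y = S(a y) b`; it is needed as a linear function of a general `z` in
  -- order to be evaluated at `Δ x`.
  let Φ : CT A A →ₗ[K] A →ₗ[K] A := LinearMap.flip
    (LinearMap.mk₂ K (fun y z => CT.lift ((LinearMap.mul K A).compl₁₂
      (h.S.comp (LinearMap.mulRight K y)) LinearMap.id) z)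
      (fun y y' z => by
        rw [← LinearMap.add_apply]
        congr 1
        ext a b
        simp [mul_add])
      (fun r y z => by
        rw [← LinearMap.smul_apply]
        congr 1
        ext a b
        simp)
      (fun y z z' => by simp) (fun r y z => by simp))
  have hΦ : ∀ z y, Φ z y = CT.lift ((LinearMap.mul K A).compl₁₂
      (h.S.comp (LinearMap.mulRight K y)) LinearMap.id) z := fun _ _ => rfl
  have h₁ : ∀ w y, Φ w y = CT.lift ((LinearMap.mul K A).compl₁₂ h.S LinearMap.id)
      (w * y ⊠ 1) := by
    intro w y
    rw [hΦ]
    have : CT.lift ((LinearMap.mul K A).compl₁₂ (h.S.comp (LinearMap.mulRight K y)) LinearMap.id) =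
        (CT.lift ((LinearMap.mul K A).compl₁₂ h.S LinearMap.id)).comp
          (LinearMap.mulRight K (y ⊠ 1 : CT A A)) := by
      ext a b
      simp
    exact LinearMap.congr_fun this w
  have h₂ : ∀ z w, CT.lift ((LinearMap.mul K A).compl₁₂ (Φ z) LinearMap.id) w =
      CT.lift ((LinearMap.mul K A).compl₁₂ h.S LinearMap.id) (z * w) := by
    intro z w
    have : ∀ a b, CT.lift ((LinearMap.mul K A).compl₁₂ (Φ (a ⊠ b)) LinearMap.id) =
      (CT.lift ((LinearMap.mul K A).compl₁₂ h.S LinearMap.id)).comp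
        (LinearMap.mulLeft K (a ⊠ b : CT A A)) := by
      intro a b
      ext c d
      simp [hΦ, mul_assoc]
    have h₃ : ∀ c d, ((LinearMap.mulRight K d).comp ((LinearMap.flip Φ) c)) =
      (CT.lift ((LinearMap.mul K A).compl₁₂ h.S LinearMap.id)).comp
        (LinearMap.mulRight K (c ⊠ d : CT A A)) := by
      intro c d
      ext a b
      simp [hΦ, mul_assoc]
    have h₄ : CT.lift ((LinearMap.mul K A).compl₁₂ (Φ z) LinearMap.id) =
      (CT.lift ((LinearMap.mul K A).compl₁₂ h.S LinearMap.id)).comp (LinearMap.mulLeft K z) := by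
      ext c d
      simpa using LinearMap.congr_fun (h₃ c d) z
    exact LinearMap.congr_fun h₄ w
  -- By the previous identity the convolution at `y` is `m(S ⊗ id)` applied to `Δ x * Δ y = Δ(x y)`.
  have h₃ : ∀ x, Φ (h.Δ x) = (LinearMap.mulLeft K (algebraMap K A (h.ε x))).comp h.S := by
    intro x
    apply h.eq_of_conv_id
    ext y
    rw [conv_apply, h₂, ← map_mul, h.antipode_left]
    simp [convOne]
  have h₄ : h.S.comp (LinearMap.mulRight K y) = (LinearMap.mulLeft K (h.S y)).comp h.S := by
    apply h.eq_of_conv_id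
    ext x
    rw [conv_apply, ← hΦ, h₃]
    simp [convOne, Algebra.commutes]
  exact LinearMap.congr_fun h₄ x

theorem conv_inl_inr : h.conv CT.inl.toLinearMap CT.inr.toLinearMap = h.Δ.toLinearMap := by
  have : CT.lift ((LinearMap.mul K (CT A A)).compl₁₂ CT.inl.toLinearMap CT.inr.toLinearMap) =
      LinearMap.id := by
    ext a b
    simp [CT.inl_apply, CT.inr_apply]
  ext x
  rw [conv_apply, this]
  rfl

theorem conv_inr_inl : h.conv (CT.inr.toLinearMap.comp h.S) (CT.inl.toLinearMap.comp h.S) =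
    CT.swap.toLinearMap.comp ((CT.lmap h.S h.S).comp h.Δ.toLinearMap) := by
  have : CT.lift ((LinearMap.mul K (CT A A)).compl₁₂ (CT.inr.toLinearMap.comp h.S)
      (CT.inl.toLinearMap.comp h.S)) = CT.swap.toLinearMap.comp (CT.lmap h.S h.S) := by
    ext a b
    simp [CT.inl_apply, CT.inr_apply]
  ext x
  rw [conv_apply, this]
  rfl

/-- Both sides are convolution inverses of `Δ`: the left one because `Δ` is an algebra map, the
right one because `Δ` is the convolution product of the two inclusions `a ↦ a ⊗ 1` and `a ↦ 1 ⊗ a`.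
-/
theorem Δ_S (x : A) : h.Δ (h.S x) = CT.swap (CT.lmap h.S h.S (h.Δ x)) := by
  have h₁ : h.conv (h.Δ.toLinearMap.comp h.S) h.Δ.toLinearMap = h.convOne := by
    have := h.conv_comp_algHom h.Δ h.S LinearMap.id
    rwa [LinearMap.comp_id, h.conv_S_id, comp_convOne] at this
  have hinl := h.conv_comp_algHom (CT.inl : A →ₐ[K] CT A A) LinearMap.id h.S
  have hinr := h.conv_comp_algHom (CT.inr : A →ₐ[K] CT A A) LinearMap.id h.S
  rw [LinearMap.comp_id, conv_id_S, comp_convOne] at hinl hinr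
  have h₂ : h.conv h.Δ.toLinearMap
      (CT.swap.toLinearMap.comp ((CT.lmap h.S h.S).comp h.Δ.toLinearMap)) = h.convOne := by
    rw [← conv_inr_inl, ← conv_inl_inr, conv_assoc, ← conv_assoc h CT.inr.toLinearMap, hinr,
      one_conv, hinl]
  have h₃ : h.Δ.toLinearMap.comp h.S =
      CT.swap.toLinearMap.comp ((CT.lmap h.S h.S).comp h.Δ.toLinearMap) := by
    rw [← h.conv_one (h.Δ.toLinearMap.comp h.S), ← h₂, ← conv_assoc, h₁, one_conv]
  exact LinearMap.congr_fun h₃ x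

theorem ε_S (x : A) : h.ε (h.S x) = h.ε x := by
  have h₁ : h.conv (h.ε.toLinearMap.comp h.S) h.ε.toLinearMap = h.convOne := by
    have := h.conv_comp_algHom h.ε h.S LinearMap.id
    rwa [LinearMap.comp_id, h.conv_S_id, comp_convOne] at this
  have h₂ : h.ε.toLinearMap = h.convOne := by
    ext1 x
    simp [convOne]
  have h₃ : h.ε.toLinearMap.comp h.S = h.convOne := by
    rw [← h.conv_one (h.ε.toLinearMap.comp h.S), ← h₂, h₁, h₂]
  have := LinearMap.congr_fun h₃ x
  simpa [convOne] using this

theorem sliceL_swap (f : A →ₗ[K] K) (y : CT A A) : CT.sliceL f (CT.swap y) = CT.sliceR f y := by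
  have : (CT.sliceL f).comp (CT.swap (A := A) (B := A)).toLinearMap = CT.sliceR f := by
    ext a b
    simp
  exact LinearMap.congr_fun this y

theorem sliceR_swap (f : A →ₗ[K] K) (y : CT A A) : CT.sliceR f (CT.swap y) = CT.sliceL f y := by
  have : (CT.sliceR f).comp (CT.swap (A := A) (B := A)).toLinearMap = CT.sliceL f := by
    ext a b
    simp
  exact LinearMap.congr_fun this y

theorem hitL_S (f : A →ₗ[K] K) (x : A) : h.hitL f (h.S x) = h.S (h.hitR (f.comp h.S) x) := by
  rw [hitL_apply, Δ_S, sliceL_swap, sliceR_lmap, hitR_apply]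

theorem hitR_S (f : A →ₗ[K] K) (x : A) : h.hitR f (h.S x) = h.S (h.hitL (f.comp h.S) x) := by
  rw [hitR_apply, Δ_S, sliceR_swap, sliceL_lmap, hitL_apply]

theorem hitR_zero (x : A) : h.hitR 0 x = 0 := by
  have : CT.sliceR (A := A) (B := A) 0 = 0 := by
    ext a b
    simp
  rw [hitR_apply, this, LinearMap.zero_apply]

/-- The inverse of the antipode. -/
def Sinv : A →ₗ[K] A := (LinearEquiv.ofBijective h.S h.S_bijective).symm.toLinearMap

@[simp] theorem S_Sinv (x : A) : h.S (h.Sinv x) = x :=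
  (LinearEquiv.ofBijective h.S h.S_bijective).apply_symm_apply x

@[simp] theorem Sinv_S (x : A) : h.Sinv (h.S x) = x :=
  (LinearEquiv.ofBijective h.S h.S_bijective).symm_apply_apply x

theorem Sinv_mul (x y : A) : h.Sinv (x * y) = h.Sinv y * h.Sinv x :=
  h.S_bijective.1 (by rw [S_mul, S_Sinv, S_Sinv, S_Sinv])

theorem Sinv_one : h.Sinv 1 = 1 := h.S_bijective.1 (by rw [S_Sinv, S_one])

theorem hitL_Sinv (f : A →ₗ[K] K) (x : A) :
    h.hitL f (h.Sinv x) = h.Sinv (h.hitR (f.comp h.Sinv) x) := by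
  apply h.S_bijective.1
  rw [S_Sinv]
  conv_rhs => rw [← h.S_Sinv x, hitR_S]
  have : (f.comp h.Sinv).comp h.S = f := LinearMap.ext fun y => by simp
  rw [this]

/-- Apply the injective, antimultiplicative map `S`: the expression `S⁻¹(x₂) x₁` becomes `S(x₁) x₂`.
-/
theorem skew_antipode (x : A) :
    CT.lift (((LinearMap.mul K A).flip).compl₁₂ LinearMap.id h.Sinv) (h.Δ x) =
      algebraMap K A (h.ε x) := by
  apply h.S_bijective.1
  have : h.S.comp (CT.lift (((LinearMap.mul K A).flip).compl₁₂ LinearMap.id h.Sinv)) =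
      CT.lift ((LinearMap.mul K A).compl₁₂ h.S LinearMap.id) := by
    ext a b
    simp [S_mul]
  have h₂ := LinearMap.congr_fun this (h.Δ x)
  rw [LinearMap.comp_apply] at h₂
  rw [h₂, h.antipode_left, Algebra.algebraMap_eq_smul_one, map_smul, S_one]

end Hopf

/-! ### Matrix representations -/

/-- `x ▷ p i = ∑ a, ρ i a x • p a` is an action. -/
structure IsRep {X ι : Type*} [Ring X] [Algebra K X] [Fintype ι] [DecidableEq ι]
    (ρ : ι → ι → X →ₗ[K] K) : Prop where
  one : ∀ i j, ρ i j 1 = if i = j then 1 else 0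
  mul : ∀ i j x y, ρ i j (x * y) = ∑ a, ρ i a y * ρ a j x

section Rep

variable {X ι : Type*} [Ring X] [Algebra K X] [Fintype ι] [DecidableEq ι]
  {ρ : ι → ι → X →ₗ[K] K}

theorem IsRep.algebraMap (hρ : IsRep ρ) (i j : ι) (r : K) : ρ i j (algebraMap K X r) = if i = j then r else 0 := by
  rw [Algebra.algebraMap_eq_smul_one, map_smul, hρ.one]
  simp

variable [IsAdicComplete tIdeal X] (h : Hopf X)

/-- Because the matrix `ρ` reverses products, the sum is the matrix entry of `S(x₁) x₂`. -/
theorem IsRep.sum_dconv_S (hρ : IsRep ρ) (a c : ι) (x : X) :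
    ∑ b, h.dconv ((ρ b c).comp h.S) (ρ a b) x = if a = c then h.ε x else 0 := by
  have : ∑ b, CT.eval ((ρ b c).comp h.S) (ρ a b) =
      (ρ a c).comp (CT.lift ((LinearMap.mul K X).compl₁₂ h.S LinearMap.id)) :=
    CT.linear_ext (LinearMap.ext₂ fun x y => by simp [hρ.mul, mul_comm])
  have h₂ := LinearMap.congr_fun this (h.Δ x)
  rw [LinearMap.sum_apply, LinearMap.comp_apply, h.antipode_left, hρ.algebraMap] at h₂
  exact h₂

theorem IsRep.sum_dconv_Sinv (hρ : IsRep ρ) (a c : ι) (x : X) :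
    ∑ b, h.dconv (ρ a b) ((ρ b c).comp h.Sinv) x = if a = c then h.ε x else 0 := by
  have : ∑ b, CT.eval (ρ a b) ((ρ b c).comp h.Sinv) =
      (ρ a c).comp (CT.lift (((LinearMap.mul K X).flip).compl₁₂ LinearMap.id h.Sinv)) :=
    CT.linear_ext (LinearMap.ext₂ fun x y => by simp [hρ.mul])
  have h₂ := LinearMap.congr_fun this (h.Δ x)
  rw [LinearMap.sum_apply, LinearMap.comp_apply, h.skew_antipode, hρ.algebraMap] at h₂
  exact h₂

theorem sum_hitR {ι : Type*} [Fintype ι] (f : ι → X →ₗ[K] K) (x : X) : ∑ b, h.hitR (f b) x = h.hitR (∑ b, f b) x := by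
  have : ∑ b, CT.sliceR (A := X) (f b) = CT.sliceR (∑ b, f b) := by
    ext x y
    simp [Finset.sum_smul]
  have h₂ := LinearMap.congr_fun this (h.Δ x)
  rw [LinearMap.sum_apply] at h₂
  exact h₂

/-- The matrices of `x ↦ ρ(S x)` and `ρ` are convolution inverse to each other. This lets a momentum
generator be moved from the left of `S x` to its right. -/
theorem IsRep.sum_hitL_S_hitR (hρ : IsRep ρ) (a c : ι) (x : X) :
    ∑ b, h.hitL (ρ b c) (h.S (h.hitR (ρ a b) x)) = if a = c then h.S x else 0 := by
  simp only [h.hitL_S, h.hitR_hitR]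
  rw [← map_sum, sum_hitR]
  have : ∑ b, h.dconv ((ρ b c).comp h.S) (ρ a b) = if a = c then h.ε.toLinearMap else 0 := by
    ext1 y
    rw [LinearMap.sum_apply, hρ.sum_dconv_S]
    split_ifs <;> rfl
  rw [this]
  split_ifs
  · rw [h.hitR_ε]
  · rw [h.hitR_zero, map_zero]

theorem IsRep.sliceL_mul (hρ : IsRep ρ) (i j : ι) (y z : CT X X) :
    CT.sliceL (ρ i j) (y * z) = ∑ a, CT.sliceL (ρ a j) y * CT.sliceL (ρ i a) z := by
  have : (LinearMap.mul K (CT X X)).compr₂ (CT.sliceL (ρ i j)) =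
      ∑ a, (LinearMap.mul K X).compl₁₂ (CT.sliceL (ρ a j)) (CT.sliceL (ρ i a)) := by
    ext a b c d
    simp [hρ.mul, Finset.sum_smul, smul_smul]
  simpa [LinearMap.sum_apply] using LinearMap.congr_fun₂ this y z

theorem IsRep.sliceR_mul (hρ : IsRep ρ) (i j : ι) (y z : CT X X) :
    CT.sliceR (ρ i j) (y * z) = ∑ a, CT.sliceR (ρ a j) y * CT.sliceR (ρ i a) z := by
  have : (LinearMap.mul K (CT X X)).compr₂ (CT.sliceR (ρ i j)) =
      ∑ a, (LinearMap.mul K X).compl₁₂ (CT.sliceR (ρ a j)) (CT.sliceR (ρ i a)) := by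
    ext a b c d
    simp [hρ.mul, Finset.sum_smul, smul_smul]
  simpa [LinearMap.sum_apply] using LinearMap.congr_fun₂ this y z

end Rep

/-! ### Quasitriangular structures -/

/-- A quasitriangular structure on a complete Hopf algebra. -/
structure QT {X : Type*} [Ring X] [Algebra K X] [IsAdicComplete tIdeal X] (h : Hopf X) where
  R : CT X X
  Rinv : CT X X
  mul_inv : R * Rinv = 1
  inv_mul : Rinv * R = 1
  comulR_R : comulR h.Δ R = l13 R * l12 R
  comulL_R : comulL h.Δ R = l13 R * l23 R
  swap_Δ : ∀ x, CT.swap (h.Δ x) * R = R * h.Δ x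

/-! ### Evaluating multilinear maps on products of legs -/

section Pairing

variable {X : Type*} [Ring X] [Algebra K X]

/-- For `y = z = 𝓡` this evaluates the right-hand side of a hexagon identity once the value on pure
tensors is known. -/
theorem trilinear_l13_l23 {Z : Type*} [AddCommGroup Z] [Module K Z] [IsHausdorff tIdeal Z]
    {F : CT3 X →ₗ[K] Z} {G : CT X X →ₗ[K] CT X X →ₗ[K] Z}
    (hF : ∀ a c a' c', F (tm3 a a' (c * c')) = G (a ⊠ c) (a' ⊠ c')) (y z : CT X X) :
    F (l13 y * l23 z) = G y z := by
  have : ((LinearMap.mul K (CT3 X)).compl₁₂ l13.toLinearMap l23.toLinearMap).compr₂ F = G := by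
    ext a b c d
    simpa using hF a b c d
  exact LinearMap.congr_fun₂ this y z

theorem trilinear_l13_l12 {Z : Type*} [AddCommGroup Z] [Module K Z] [IsHausdorff tIdeal Z]
    {F : CT3 X →ₗ[K] Z} {G : CT X X →ₗ[K] CT X X →ₗ[K] Z}
    (hF : ∀ a c a' b', F (tm3 (a * a') b' c) = G (a ⊠ c) (a' ⊠ b')) (y z : CT X X) :
    F (l13 y * l12 z) = G y z := by
  have : ((LinearMap.mul K (CT3 X)).compl₁₂ l13.toLinearMap l12.toLinearMap).compr₂ F = G := by
    ext a b c d
    simpa using hF a b c d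
  exact LinearMap.congr_fun₂ this y z

theorem trilinear_l12_l13 {Z : Type*} [AddCommGroup Z] [Module K Z] [IsHausdorff tIdeal Z]
    {F : CT3 X →ₗ[K] Z} {G : CT X X →ₗ[K] CT X X →ₗ[K] Z}
    (hF : ∀ a b a' c', F (tm3 (a * a') b c') = G (a ⊠ b) (a' ⊠ c')) (y z : CT X X) :
    F (l12 y * l13 z) = G y z := by
  have : ((LinearMap.mul K (CT3 X)).compl₁₂ l12.toLinearMap l13.toLinearMap).compr₂ F = G := by
    ext a b c d
    simpa using hF a b c d
  exact LinearMap.congr_fun₂ this y z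

end Pairing

namespace QT

variable {X : Type*} [Ring X] [Algebra K X] [IsAdicComplete tIdeal X] {h : Hopf X} (q : QT h)

/-- Apply `ε ⊗ id ⊗ id` to `(Δ ⊗ id)𝓡 = 𝓡₁₃𝓡₂₃` to get `𝓡 = (1 ⊗ (ε ⊗ id)𝓡) 𝓡`, then cancel the
invertible `𝓡`. -/
theorem inr_sliceL_ε : (CT.inr (CT.sliceL h.ε.toLinearMap q.R) : CT X X) = 1 := by
  have h₁ : ∀ y z : CT X X, slice1 h.ε.toLinearMap (l13 y * l23 z) =
      CT.inr (CT.sliceL h.ε.toLinearMap y) * z := fun y z =>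
    trilinear_l13_l23 (G := (LinearMap.mul K (CT X X)).comp
      (CT.inr.toLinearMap.comp (CT.sliceL h.ε.toLinearMap)))
      (fun a c a' c' => by simp [CT.inr_apply]) y z
  have h₂ := h₁ q.R q.R
  have h₃ : CT.lmap (h.hitL h.ε.toLinearMap) LinearMap.id q.R = q.R := by
    have : CT.lmap (h.hitL h.ε.toLinearMap) LinearMap.id = (LinearMap.id : CT X X →ₗ[K] CT X X) := by
      ext a b
      simp [h.hitL_ε]
    rw [this, LinearMap.id_apply]
  rw [← q.comulL_R, h.slice1_comulL, h₃] at h₂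
  have := congrArg (· * q.Rinv) h₂
  simp only [mul_assoc, q.mul_inv, mul_one] at this
  exact this.symm

theorem inl_sliceR_ε : (CT.inl (CT.sliceR h.ε.toLinearMap q.R) : CT X X) = 1 := by
  have h₁ : ∀ y z : CT X X, slice3 h.ε.toLinearMap (l13 y * l12 z) =
      CT.inl (CT.sliceR h.ε.toLinearMap y) * z := fun y z =>
    trilinear_l13_l12 (G := (LinearMap.mul K (CT X X)).comp
      (CT.inl.toLinearMap.comp (CT.sliceR h.ε.toLinearMap)))
      (fun a c a' c' => by simp [CT.inl_apply]) y z
  have h₂ := h₁ q.R q.R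
  have h₃ : CT.lmap LinearMap.id (h.hitR h.ε.toLinearMap) q.R = q.R := by
    have : CT.lmap LinearMap.id (h.hitR h.ε.toLinearMap) = (LinearMap.id : CT X X →ₗ[K] CT X X) := by
      ext a b
      simp [h.hitR_ε]
    rw [this, LinearMap.id_apply]
  rw [← q.comulR_R, h.slice3_comulR, h₃] at h₂
  have := congrArg (· * q.Rinv) h₂
  simp only [mul_assoc, q.mul_inv, mul_one] at this
  exact this.symm

theorem sliceR_ε : CT.sliceR h.ε.toLinearMap q.R = 1 := by
  have := congrArg (CT.sliceR h.ε.toLinearMap) q.inl_sliceR_ε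
  simpa [CT.inl_apply, CT.one_def] using this

theorem sliceL_ε : CT.sliceL h.ε.toLinearMap q.R = 1 := by
  have := congrArg (CT.sliceL h.ε.toLinearMap) q.inr_sliceL_ε
  simpa [CT.inr_apply, CT.one_def] using this

theorem sliceR_ε_inv : CT.sliceR h.ε.toLinearMap q.Rinv = 1 := by
  have h₁ : ∀ y z : CT X X, CT.sliceR h.ε.toLinearMap (y * z) =
      CT.sliceR h.ε.toLinearMap y * CT.sliceR h.ε.toLinearMap z :=
    CT.map_mul_of_pure _ fun a b a' b' => by simp [smul_smul, mul_comm]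
  have h₂ := h₁ q.R q.Rinv
  rw [q.mul_inv, q.sliceR_ε, one_mul] at h₂
  rw [← h₂]
  simp [CT.one_def]

/-- Apply `a ⊗ b ⊗ c ↦ S(a) b ⊗ c` to `(Δ ⊗ id)𝓡 = 𝓡₁₃𝓡₂₃`. The antipode axiom collapses the left
side to `1`, and the right side is `(S ⊗ id)𝓡 · 𝓡`. -/
theorem lmap_S_id : CT.lmap h.S LinearMap.id q.R = q.Rinv := by
  let W : CT3 X →ₗ[K] CT X X := CT3.lift₃ (((LinearMap.mul K X).comp h.S).compr₂ tmL)
  have hW : ∀ a b c, W (tm3 a b c) = (h.S a * b) ⊠ c := fun a b c => by simp [W]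
  have h₁ : W (l13 q.R * l23 q.R) = CT.lmap h.S LinearMap.id q.R * q.R :=
    trilinear_l13_l23 (G := (LinearMap.mul K (CT X X)).comp (CT.lmap h.S LinearMap.id))
      (fun a c a' c' => by simp [hW]) _ _
  have h₂ : ∀ y c, W (l12 y * e3 c) =
      CT.lift ((LinearMap.mul K X).compl₁₂ h.S LinearMap.id) y ⊠ c := fun y c => by
    have : W.comp ((LinearMap.mulRight K (e3 c)).comp l12.toLinearMap) =
      (tmL.flip c).comp (CT.lift ((LinearMap.mul K X).compl₁₂ h.S LinearMap.id)) := by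
      ext a b
      simp [hW, e3_apply]
    exact LinearMap.congr_fun this y
  have h₃ : ∀ y, W (comulL h.Δ y) = CT.inr (CT.sliceL h.ε.toLinearMap y) := fun y => by
    have : W.comp (comulL h.Δ).toLinearMap = CT.inr.toLinearMap.comp (CT.sliceL h.ε.toLinearMap) := by
      ext a b
      simp [h₂, h.antipode_left, CT.inr_apply, Algebra.algebraMap_eq_smul_one]
    exact LinearMap.congr_fun this y
  rw [← q.comulL_R, h₃, q.inr_sliceL_ε] at h₁
  have := congrArg (· * q.Rinv) h₁
  simp only [mul_assoc, q.mul_inv, mul_one, one_mul] at this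
  exact this.symm

theorem comulR_Rinv : comulR h.Δ q.Rinv = l12 q.Rinv * l13 q.Rinv := by
  have h₁ : comulR h.Δ q.Rinv * comulR h.Δ q.R = 1 := by rw [← map_mul, q.inv_mul, map_one]
  have h₂ : comulR h.Δ q.R * (l12 q.Rinv * l13 q.Rinv) = 1 := by
    rw [q.comulR_R, mul_assoc, ← mul_assoc (l12 _), ← map_mul, q.mul_inv, map_one, one_mul, ← map_mul,
      q.mul_inv, map_one]
  exact left_inv_eq_right_inv h₁ h₂

/-- The same argument in the last two legs, with the inverted hexagon `comulR_Rinv` and the map `a ⊗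
b ⊗ c ↦ a ⊗ b S(c)`. -/
theorem lmap_id_S_inv : CT.lmap LinearMap.id h.S q.Rinv = q.R := by
  let W : CT3 X →ₗ[K] CT X X := CT3.lift₃
    (tmL.compr₂ ((LinearMap.mul K (CT X X)).compl₂ (CT.inr.toLinearMap.comp h.S)))
  have hW : ∀ a b c, W (tm3 a b c) = a ⊠ (b * h.S c) := fun a b c => by simp [W, CT.inr_apply]
  have h₁ : W (l12 q.Rinv * l13 q.Rinv) = q.Rinv * CT.lmap LinearMap.id h.S q.Rinv :=
    trilinear_l12_l13 (G := (LinearMap.mul K (CT X X)).compl₂ (CT.lmap LinearMap.id h.S))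
      (fun a c a' c' => by simp [hW]) _ _
  have h₂ : ∀ a y, W (e1 a * l23 y) =
      a ⊠ CT.lift ((LinearMap.mul K X).compl₁₂ LinearMap.id h.S) y := fun a y => by
    have : W.comp ((LinearMap.mulLeft K (e1 a)).comp l23.toLinearMap) =
      (tmL a).comp (CT.lift ((LinearMap.mul K X).compl₁₂ LinearMap.id h.S)) := by
      ext b c
      simp [hW, e1_apply]
    exact LinearMap.congr_fun this y
  have h₃ : ∀ y, W (comulR h.Δ y) = CT.inl (CT.sliceR h.ε.toLinearMap y) := fun y => by
    have : W.comp (comulR h.Δ).toLinearMap = CT.inl.toLinearMap.comp (CT.sliceR h.ε.toLinearMap) := by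
      ext a b
      simp [h₂, h.antipode_right, CT.inl_apply, Algebra.algebraMap_eq_smul_one]
    exact LinearMap.congr_fun this y
  rw [← q.comulR_Rinv, h₃, q.sliceR_ε_inv, map_one] at h₁
  have := congrArg (q.R * ·) h₁
  simp only [← mul_assoc, q.mul_inv, mul_one, one_mul] at this
  exact this.symm

theorem lmap_S_S : CT.lmap h.S h.S q.R = q.R := by
  have : CT.lmap h.S h.S = (CT.lmap LinearMap.id h.S).comp (CT.lmap h.S LinearMap.id) := by
    ext a b
    simp
  rw [this, LinearMap.comp_apply, q.lmap_S_id, q.lmap_id_S_inv]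

/-- The slice `f(R⁽¹⁾) R⁽²⁾`. -/
def sl (f : X →ₗ[K] K) : X := CT.sliceL f q.R

theorem sl_apply (f : X →ₗ[K] K) : q.sl f = CT.sliceL f q.R := rfl

/-- The hexagon `(Δ ⊗ id)𝓡 = 𝓡₁₃𝓡₂₃` read with functionals in the first two legs: slicing turns
convolution into multiplication. -/
theorem sl_mul_sl (f g : X →ₗ[K] K) : q.sl f * q.sl g = q.sl (h.dconv f g) := by
  let F : CT3 X →ₗ[K] X := (CT.sliceL g).comp (slice1 f)
  have h₁ : F (l13 q.R * l23 q.R) = q.sl f * q.sl g :=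
    trilinear_l13_l23 (G := (LinearMap.mul K X).compl₁₂ (CT.sliceL f) (CT.sliceL g))
      (fun a c a' c' => by simp [F, smul_smul, mul_comm]) _ _
  rw [← h₁, ← q.comulL_R, LinearMap.comp_apply, h.slice1_comulL, sliceL_lmap, sl_apply]
  have : g ∘ₗ h.hitL f = h.dconv f g := by
    ext1 y
    rw [LinearMap.comp_apply, h.hitL_apply, apply_sliceL, h.dconv_apply]
  rw [this]
  rfl

variable {ι : Type*} [Fintype ι] [DecidableEq ι] {ρ : ι → ι → X →ₗ[K] K}

/-- The hexagon `(id ⊗ Δ)𝓡 = 𝓡₁₃𝓡₁₂` with a matrix coefficient in the first leg. The reversed order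
`𝓡₁₃𝓡₁₂` matches the reversed products in `IsRep`. -/
theorem Δ_sl (hρ : IsRep ρ) (i j : ι) : h.Δ (q.sl (ρ i j)) = ∑ a, q.sl (ρ i a) ⊠ q.sl (ρ a j) := by
  rw [sl_apply, ← h.slice1_comulR, q.comulR_R]
  have := trilinear_l13_l12 (X := X) (F := slice1 (ρ i j))
    (G := ∑ a, (tmL (A := X) (B := X)).flip.compl₁₂ (CT.sliceL (ρ a j)) (CT.sliceL (ρ i a)))
    (fun a c a' b' => by simp [hρ.mul, Finset.sum_smul, smul_smul]) q.R q.R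
  rw [this]
  simp [LinearMap.sum_apply, sl_apply]

theorem ε_sl (hρ : IsRep ρ) (i j : ι) : h.ε (q.sl (ρ i j)) = if i = j then 1 else 0 := by
  have := apply_sliceL (ρ i j) h.ε.toLinearMap q.R
  rw [← apply_sliceR, q.sliceR_ε, hρ.one] at this
  exact this

/-- Slice `Δᵒᵖ(x) 𝓡 = 𝓡 Δ(x)` with a matrix coefficient in the first leg. -/
theorem sum_hitR_mul_sl (hρ : IsRep ρ) (i b : ι) (x : X) :
    ∑ a, h.hitR (ρ a b) x * q.sl (ρ i a) = ∑ a, q.sl (ρ a b) * h.hitL (ρ i a) x := by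
  have := congrArg (CT.sliceL (ρ i b)) (q.swap_Δ x)
  rw [hρ.sliceL_mul, hρ.sliceL_mul] at this
  simpa only [Hopf.sliceL_swap, Hopf.hitR_apply, Hopf.hitL_apply, sl_apply] using this

end QT

end QStar
namespace QStar

/-! ### Exponentials in complete algebras -/

section Exp

variable {Z Y : Type*} [Ring Z] [Algebra K Z] [Ring Y] [Algebra K Y]

/-- The coefficients `ℓ ^ k / k!` of the exponential. -/
def expCoeff (ℓ : tIdeal) (k : ℕ) : K := PowerSeries.C ((k.factorial : ℂ)⁻¹) * (ℓ : K) ^ k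

/-- The partial sums of the exponential. -/
def expSum (ℓ : tIdeal) (x : Z) (n : ℕ) : Z := ∑ k ∈ Finset.range n, expCoeff ℓ k • x ^ k

theorem expCoeff_mem (ℓ : tIdeal) (k : ℕ) : expCoeff ℓ k ∈ tIdeal ^ k :=
  Ideal.mul_mem_left _ _ (Ideal.pow_mem_pow ℓ.2 k)

theorem conjK_expCoeff (ℓ : tIdeal) (hℓ : conjK (ℓ : K) = ℓ) (k : ℕ) :
    conjK (expCoeff ℓ k) = expCoeff ℓ k := by
  rw [expCoeff, map_mul, map_pow, hℓ, conjK, PowerSeries.map_C]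
  simp

theorem mul_mem_left_pow (a : Z) {n : ℕ} {x : Z} (hx : x ∈ (tIdeal ^ n • ⊤ : Submodule K Z)) :
    a * x ∈ (tIdeal ^ n • ⊤ : Submodule K Z) :=
  map_mem_pow_smul (fun _ h => h) (LinearMap.mulLeft K a) hx

theorem mul_mem_right_pow (a : Z) {n : ℕ} {x : Z} (hx : x ∈ (tIdeal ^ n • ⊤ : Submodule K Z)) :
    x * a ∈ (tIdeal ^ n • ⊤ : Submodule K Z) :=
  map_mem_pow_smul (fun _ h => h) (LinearMap.mulRight K a) hx

/-- In the product of the two partial sums, the terms of total degree below `n` add up to the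
binomial expansion, and all other terms have coefficients in `(t ^ n)`. -/
theorem expSum_add_sub_mem (ℓ : tIdeal) {x y : Z} (hxy : Commute x y) (n : ℕ) :
    expSum ℓ x n * expSum ℓ y n - expSum ℓ (x + y) n ∈ (tIdeal ^ n • ⊤ : Submodule K Z) := by
  let f : ℕ × ℕ → Z := fun p => (expCoeff ℓ p.1 * expCoeff ℓ p.2) • (x ^ p.1 * y ^ p.2)
  have h₁ : expSum ℓ x n * expSum ℓ y n = ∑ p ∈ Finset.range n ×ˢ Finset.range n, f p := by
    rw [expSum, expSum, Finset.sum_mul_sum, Finset.sum_product]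
    simp [f, smul_smul, mul_comm]
  have h₂ : expSum ℓ (x + y) n =
      ∑ p ∈ (Finset.range n ×ˢ Finset.range n).filter (fun p => p.1 + p.2 < n), f p := by
    rw [← Finset.sum_fiberwise_of_maps_to (t := Finset.range n) (g := fun p => p.1 + p.2)
      (fun p hp => by simpa using (Finset.mem_filter.1 hp).2), expSum]
    refine Finset.sum_congr rfl fun m hm => ?_
    -- As `m < n`, restricting to the square of side `n` loses no pair of the antidiagonal.
    have h₃ : ((Finset.range n ×ˢ Finset.range n).filter (fun p => p.1 + p.2 < n)).filter
        (fun p => p.1 + p.2 = m) = Finset.HasAntidiagonal.antidiagonal m := by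
      ext ⟨i, j⟩
      have := Finset.mem_range.1 hm
      simp only [Finset.mem_filter, Finset.mem_product, Finset.mem_range, Finset.HasAntidiagonal.mem_antidiagonal]
      omega
    rw [h₃, hxy.add_pow', Finset.smul_sum]
    refine Finset.sum_congr rfl fun p hp => ?_
    obtain rfl := Finset.HasAntidiagonal.mem_antidiagonal.1 hp
    rw [← Nat.cast_smul_eq_nsmul K, smul_smul]
    congr 1
    have h₄ : (((p.1 + p.2).factorial : ℂ)⁻¹) * ((p.1 + p.2).choose p.1 : ℂ) =
        (p.1.factorial : ℂ)⁻¹ * (p.2.factorial : ℂ)⁻¹ := by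
      rw [Nat.choose_symm_add, Nat.add_choose, Nat.cast_div (Nat.factorial_mul_factorial_dvd_factorial_add _ _)
        (by exact_mod_cast Nat.mul_ne_zero (Nat.factorial_ne_zero _) (Nat.factorial_ne_zero _))]
      have := Nat.cast_ne_zero (R := ℂ).2 (Nat.factorial_ne_zero (p.1 + p.2))
      push_cast
      field_simp
    have h₅ : (((p.1 + p.2).choose p.1 : ℕ) : K) = PowerSeries.C (((p.1 + p.2).choose p.1 : ℕ) : ℂ) := by
      simp
    rw [expCoeff, expCoeff, expCoeff, h₅, mul_right_comm, ← map_mul, h₄, map_mul, pow_add]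
    ring
  rw [h₁, h₂, ← Finset.sum_filter_add_sum_filter_not (Finset.range n ×ˢ Finset.range n)
    (fun p => p.1 + p.2 < n), add_sub_cancel_left]
  refine Submodule.sum_mem _ fun p hp => ?_
  have hp' : n ≤ p.1 + p.2 := by simpa using (Finset.mem_filter.1 hp).2
  refine Submodule.smul_mem_smul (Ideal.pow_le_pow_right hp' ?_) trivial
  rw [pow_add]
  exact Ideal.mul_mem_mul (expCoeff_mem ℓ p.1) (expCoeff_mem ℓ p.2)

theorem texp_sub_mem (ℓ : tIdeal) (x : Z) (n : ℕ) :
    texp ℓ x - of Z (expSum ℓ x n) ∈ (tIdeal ^ n • ⊤ : Submodule K (Cpl Z)) := by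
  have h := AdicCompletion.pow_smul_top_eq_ker_eval (I := tIdeal) (M := Z) (n := n) tIdeal_fg
  have h' : texp ℓ x - of Z (expSum ℓ x n) ∈ LinearMap.ker (red Z n) := by
    rw [LinearMap.mem_ker, map_sub, red_of, sub_eq_zero]
    rfl
  exact h.ge h'

variable [IsAdicComplete tIdeal Z] [IsAdicComplete tIdeal Y]

/-- The exponential `exp (ℓ x)` in a complete algebra. -/
def cexp (ℓ : tIdeal) (x : Z) : Z := uncpl Z (texp ℓ x)

theorem cexp_sub_mem (ℓ : tIdeal) (x : Z) (n : ℕ) :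
    cexp ℓ x - expSum ℓ x n ∈ (tIdeal ^ n • ⊤ : Submodule K Z) := by
  have := map_mem_pow_smul (fun _ h => h) (uncpl Z) (texp_sub_mem ℓ x n)
  rwa [map_sub, uncpl_of] at this

theorem eq_cexp {ℓ : tIdeal} {x z : Z}
    (hz : ∀ n, z - expSum ℓ x n ∈ (tIdeal ^ n • ⊤ : Submodule K Z)) : z = cexp ℓ x :=
  eq_of_forall_sub_mem fun n => by
    have := sub_mem (hz n) (cexp_sub_mem ℓ x n)
    rwa [sub_sub_sub_cancel_right] at this

/-- The hypothesis on partial sums covers algebra maps, the passage to the opposite algebra and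
conjugate-linear antimultiplicative maps alike. -/
theorem map_cexp_of {σ : K →+* K} (hσ : ∀ a ∈ tIdeal, σ a ∈ tIdeal) (F : Z →ₛₗ[σ] Y)
    {ℓ ℓ' : tIdeal} {x : Z} {y : Y} (h : ∀ n, F (expSum ℓ x n) = expSum ℓ' y n) :
    F (cexp ℓ x) = cexp ℓ' y :=
  eq_cexp fun n => by
    rw [← h, ← map_sub]
    exact map_mem_pow_smul hσ F (cexp_sub_mem ℓ x n)

theorem map_cexp (φ : Z →ₐ[K] Y) (ℓ : tIdeal) (x : Z) : φ (cexp ℓ x) = cexp ℓ (φ x) :=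
  map_cexp_of (σ := RingHom.id K) (fun _ h => h) φ.toLinearMap fun n => by simp [expSum]

/-- An intertwining relation passes to powers, to partial sums and to the limit. All commutation
rules between `λ^ξ` or `λ^{-ξ⊗ξ}` and the generators are instances of it. -/
theorem semiconj_cexp (ℓ : tIdeal) {a x y : Z} (h : a * x = y * a) :
    a * cexp ℓ x = cexp ℓ y * a := by
  have h' : SemiconjBy a x y := h
  have hs : ∀ n, a * expSum ℓ x n = expSum ℓ y n * a := fun n => by
    simp [expSum, Finset.mul_sum, Finset.sum_mul, (h'.pow_right _).eq]
  refine eq_of_forall_sub_mem fun n => ?_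
  have h₁ := mul_mem_left_pow a (cexp_sub_mem ℓ x n)
  have h₂ := mul_mem_right_pow a (cexp_sub_mem ℓ y n)
  have := sub_mem h₁ h₂
  rwa [mul_sub, sub_mul, hs, sub_sub_sub_cancel_right] at this

theorem cexp_add (ℓ : tIdeal) {x y : Z} (h : Commute x y) :
    cexp ℓ (x + y) = cexp ℓ x * cexp ℓ y := by
  symm
  refine eq_cexp fun n => ?_
  have h₁ := mul_mem_right_pow (cexp ℓ y) (cexp_sub_mem ℓ x n)
  have h₂ := mul_mem_left_pow (expSum ℓ x n) (cexp_sub_mem ℓ y n)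
  have := add_mem (add_mem h₁ h₂) (expSum_add_sub_mem ℓ h n)
  rw [sub_mul, mul_sub] at this
  convert this using 1
  abel

theorem cexp_zero (ℓ : tIdeal) : cexp ℓ (0 : Z) = 1 := by
  refine (eq_cexp fun n => ?_).symm
  cases n with
  | zero => simp
  | succ n => simp [expSum, Finset.sum_range_succ', expCoeff]

theorem cexp_neg_mul (ℓ : tIdeal) (x : Z) : cexp ℓ (-x) * cexp ℓ x = 1 := by
  rw [← cexp_add ℓ (Commute.refl x).neg_left, neg_add_cancel, cexp_zero]

theorem cexp_mul_neg (ℓ : tIdeal) (x : Z) : cexp ℓ x * cexp ℓ (-x) = 1 := by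
  rw [← cexp_add ℓ (Commute.refl x).neg_right, add_neg_cancel, cexp_zero]

theorem cexp_neg_left (ℓ : tIdeal) (x : Z) : cexp (-ℓ) x = cexp ℓ (-x) := by
  refine eq_cexp fun n => ?_
  have := cexp_sub_mem (-ℓ) x n
  convert this using 2
  refine Finset.sum_congr rfl fun k _ => ?_
  have h₁ : -x = (-1 : K) • x := by rw [neg_one_smul]
  have h₂ : ((-ℓ : tIdeal) : K) = -1 * ℓ := by push_cast; ring
  rw [h₁, smul_pow, smul_smul, expCoeff, expCoeff, h₂, mul_pow]
  congr 1
  ring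

theorem cexp_add_left (ℓ : tIdeal) (x : Z) : cexp (ℓ + ℓ) x = cexp ℓ (x + x) := by
  refine eq_cexp fun n => ?_
  have := cexp_sub_mem (ℓ + ℓ) x n
  convert this using 2
  refine Finset.sum_congr rfl fun k _ => ?_
  have h₁ : x + x = (2 : K) • x := by rw [two_smul]
  have h₂ : ((ℓ + ℓ : tIdeal) : K) = 2 * ℓ := by push_cast; ring
  rw [h₁, smul_pow, smul_smul, expCoeff, expCoeff, h₂, mul_pow]
  congr 1
  ring

theorem cexp_algebraMap (ℓ : tIdeal) (r : K) :
    cexp ℓ (algebraMap K Z r) = algebraMap K Z (cexp ℓ r) := (map_cexp (Algebra.ofId K Z) ℓ r).symm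

/-- One exponential is formed in the uncompleted tensor product and lands in its completion, the
other is formed inside the complete algebra; they are limits of the same partial sums. -/
theorem texp_eq_cexp {A B : Type*} [Ring A] [Algebra K A] [Ring B] [Algebra K B] (ℓ : tIdeal) (a : A)
    (b : B) : @Eq (CT A B) (texp ℓ (a ⊗ₜ[K] b)) (cexp ℓ (a ⊠ b)) := by
  refine eq_cexp fun n => ?_
  have := texp_sub_mem ℓ (a ⊗ₜ[K] b) n
  have h : (expSum ℓ (a ⊠ b) n : CT A B) = of _ (expSum ℓ (a ⊗ₜ[K] b) n) := by
    rw [expSum, expSum, map_sum]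
    refine Finset.sum_congr rfl fun k _ => ?_
    rw [map_smul]
    congr 1
    clear * -
    induction k with
    | zero => rfl
    | succ k ih => rw [pow_succ, pow_succ, ih]; rfl
  rw [h]
  exact this

end Exp

/-! ### Opposite algebras -/

section Op

/-- Cauchy sequences are pulled back along `e'` and their limits pushed forward along `e`. Allowing
a semilinear `e` covers algebras whose scalars act through conjugation. -/
theorem isAdicComplete_of_semilinear {M N : Type*} [AddCommGroup M] [Module K M] [AddCommGroup N]
    [Module K N] {σ : K →+* K} (hσ : ∀ a ∈ tIdeal, σ a ∈ tIdeal) (e : M →ₛₗ[σ] N) (e' : N →ₛₗ[σ] M)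
    (h : ∀ x, e (e' x) = x) [IsAdicComplete tIdeal M] :
    IsAdicComplete tIdeal N where
  haus' x hx := by
    have : e' x = 0 := IsHausdorff.haus (I := tIdeal) inferInstance _ fun n => by
      have := hx n
      rw [SModEq.sub_mem, sub_zero] at this ⊢
      exact map_mem_pow_smul hσ e' this
    rw [← h x, this, map_zero]
  prec' f hf := by
    obtain ⟨L, hL⟩ := IsPrecomplete.prec (I := tIdeal) (M := M) inferInstance (f := fun n => e' (f n))
      (fun {m n} hmn => by
        have := hf hmn
        rw [SModEq.sub_mem] at this ⊢
        rw [← map_sub]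
        exact map_mem_pow_smul hσ e' this)
    refine ⟨e L, fun n => ?_⟩
    have := hL n
    rw [SModEq.sub_mem] at this ⊢
    have := map_mem_pow_smul hσ e this
    rwa [map_sub, h] at this

variable {Z : Type*} [Ring Z] [Algebra K Z]

instance [IsAdicComplete tIdeal Z] : IsAdicComplete tIdeal Zᵐᵒᵖ :=
  isAdicComplete_of_semilinear (σ := RingHom.id K) (fun _ h => h)
    (MulOpposite.opLinearEquiv K : Z ≃ₗ[K] Zᵐᵒᵖ).toLinearMap
    (MulOpposite.opLinearEquiv K : Z ≃ₗ[K] Zᵐᵒᵖ).symm.toLinearMap fun _ => rfl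

/-- The opposite algebra, with the complex conjugate scalar multiplication. -/
def ConjOp (Z : Type*) : Type _ := Zᵐᵒᵖ

instance : Ring (ConjOp Z) := inferInstanceAs (Ring Zᵐᵒᵖ)

instance : Algebra K (ConjOp Z) :=
  RingHom.toAlgebra' (((algebraMap K Zᵐᵒᵖ).comp conjK : K →+* Zᵐᵒᵖ)) fun r x =>
    Algebra.commutes (A := Zᵐᵒᵖ) (conjK r) x

/-- The identity map to the conjugate opposite algebra. -/
def toConjOp : Z →ₛₗ[conjK] ConjOp Z where
  toFun x := MulOpposite.op x
  map_add' _ _ := rfl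
  map_smul' r x := by
    change MulOpposite.op (r • x) =
      (MulOpposite.op (algebraMap K Z (conjK (conjK r))) * MulOpposite.op x : Zᵐᵒᵖ)
    rw [conjK_conjK, Algebra.smul_def, Algebra.commutes, MulOpposite.op_mul]

/-- The identity map from the conjugate opposite algebra. -/
def ofConjOp : ConjOp Z →ₛₗ[conjK] Z where
  toFun x := MulOpposite.unop x
  map_add' _ _ := rfl
  map_smul' r x := by
    change MulOpposite.unop x * algebraMap K Z (conjK r) = conjK r • MulOpposite.unop x
    rw [Algebra.smul_def, Algebra.commutes]

theorem toConjOp_mul (x y : Z) : toConjOp (x * y) = toConjOp y * toConjOp x := rfl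

theorem ofConjOp_mul (x y : ConjOp Z) : ofConjOp (x * y) = ofConjOp y * ofConjOp x := rfl

instance [IsAdicComplete tIdeal Z] : IsAdicComplete tIdeal (ConjOp Z) :=
  isAdicComplete_of_semilinear (fun _ h => conjK_mem h) toConjOp ofConjOp fun _ => rfl

end Op

/-! ### Algebra maps out of a completion -/

section LiftAlg

variable {A Z : Type*} [Ring A] [Algebra K A] [Ring Z] [Algebra K Z] [IsAdicComplete tIdeal Z]

theorem cplLift_mul (φ : A →ₐ[K] Z) (x y : Cpl A) :
    cplLift φ.toLinearMap (x * y) = cplLift φ.toLinearMap x * cplLift φ.toLinearMap y := by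
  have h : (mulB (A := A)).compr₂ (cplLift φ.toLinearMap) =
      (LinearMap.mul K Z).compl₁₂ (cplLift φ.toLinearMap) (cplLift φ.toLinearMap) := by
    refine Cpl.linear_ext (LinearMap.ext fun a => Cpl.linear_ext (LinearMap.ext fun b => ?_))
    change cplLift φ.toLinearMap (of A (a * b)) =
      cplLift φ.toLinearMap (of A a) * cplLift φ.toLinearMap (of A b)
    rw [cplLift_of, cplLift_of, cplLift_of, AlgHom.toLinearMap_apply, map_mul]
    rfl
  exact LinearMap.congr_fun₂ h x y

end LiftAlg

end QStar
namespace QStar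

/-! ### The universal property of the inhomogeneous quantum group -/

/-- The relations `rel` are the quadratic relations with coefficients `c`. -/
structure IsQuadratic {ι κ : Type*} [Fintype ι]
    (rel : FreeAlgebra K ι → FreeAlgebra K ι → Prop) (c : κ → ι → ι → K) : Prop where
  of_rel : ∀ a b, rel a b → ∃ k, a - b =
    ∑ i, ∑ j, c k i j • (FreeAlgebra.ι K i * FreeAlgebra.ι K j)
  to_rel : ∀ k, ∃ a b, rel a b ∧ a - b =
    ∑ i, ∑ j, c k i j • (FreeAlgebra.ι K i * FreeAlgebra.ι K j)

/-- A realisation of the generators and relations of the inhomogeneous quantum group in `Z`. -/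
structure BosData {X ι κ : Type*} [Ring X] [Algebra K X] [IsAdicComplete tIdeal X] [Fintype ι]
    (h : Hopf X) (ρ : ι → ι → X →ₗ[K] K) (c : κ → ι → ι → K) (Z : Type*) [Ring Z] [Algebra K Z] where
  f : X →ₐ[K] Z
  P : ι → Z
  Ξ : Z
  mom : ∀ k, ∑ i, ∑ j, c k i j • (P i * P j) = 0
  dil_bg : ∀ x, Ξ * f x = f x * Ξ
  dil_mom : ∀ i, Ξ * P i = P i * Ξ - P i
  cross : ∀ x i, f x * P i = ∑ a, P a * f (h.hitL (ρ i a) x)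

/-- The inhomogeneous quantum group. -/
def BB {X ι : Type*} [Ring X] [Algebra K X] [IsAdicComplete tIdeal X] [Fintype ι]
    (h : Hopf X) (ρ : ι → ι → X →ₗ[K] K) (rel : FreeAlgebra K ι → FreeAlgebra K ι → Prop) : Type _ :=
  Cpl (RingQuot (BosRel h.toData ρ rel))

section BB

variable {X ι κ : Type*} [Ring X] [Algebra K X] [IsAdicComplete tIdeal X] [Fintype ι]
  {h : Hopf X} {ρ : ι → ι → X →ₗ[K] K} {rel : FreeAlgebra K ι → FreeAlgebra K ι → Prop}
  {c : κ → ι → ι → K}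

instance : Ring (BB h ρ rel) := inferInstanceAs (Ring (Cpl (RingQuot (BosRel h.toData ρ rel))))

instance : Algebra K (BB h ρ rel) :=
  inferInstanceAs (Algebra K (Cpl (RingQuot (BosRel h.toData ρ rel))))

instance : IsAdicComplete tIdeal (BB h ρ rel) :=
  inferInstanceAs (IsAdicComplete tIdeal (Cpl (RingQuot (BosRel h.toData ρ rel))))

variable (h ρ rel) in
/-- The canonical map from the free algebra. -/
def BB.π : FreeAlgebra K (BosGen X ι) →ₐ[K] BB h ρ rel :=
  AlgHom.ofLinearMap ((of (RingQuot (BosRel h.toData ρ rel))).comp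
    (RingQuot.mkAlgHom K (BosRel h.toData ρ rel)).toLinearMap)
    (congrArg (of _) (map_one (RingQuot.mkAlgHom K (BosRel h.toData ρ rel))))
    fun x y => congrArg (of _) (map_mul (RingQuot.mkAlgHom K (BosRel h.toData ρ rel)) x y)

theorem BB.π_rel {x y : FreeAlgebra K (BosGen X ι)} (hxy : BosRel h.toData ρ rel x y) :
    BB.π h ρ rel x = BB.π h ρ rel y :=
  congrArg (of _) (RingQuot.mkAlgHom_rel K hxy)

/-- The background quantum group in the inhomogeneous quantum group. -/
def BB.bg : X →ₐ[K] BB h ρ rel :=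
  AlgHom.ofLinearMap (bgMap h.toData ρ rel : X →ₗ[K] Bos h.toData ρ rel)
    ((by
      have := BB.π_rel (BosRel.bg_scalar (D := h.toData) (ρ := ρ) (rel := rel) 1)
      rw [map_one, map_one, map_one] at this
      exact this) : BB.π h ρ rel (FreeAlgebra.ι K (.bg 1)) = 1)
    fun x y => (by
      have := BB.π_rel (BosRel.bg_mul (D := h.toData) (ρ := ρ) (rel := rel) x y)
      rw [map_mul] at this
      exact this)

theorem BB.bg_eq (x : X) : (BB.bg x : BB h ρ rel) = BB.π h ρ rel (FreeAlgebra.ι K (.bg x)) := rfl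

variable (h ρ rel) in
/-- The tautological realisation. -/
def BB.gen (hc : IsQuadratic rel c) : BosData h ρ c (BB h ρ rel) where
  f := BB.bg
  P i := BB.π h ρ rel (FreeAlgebra.ι K (.mom i))
  Ξ := BB.π h ρ rel (FreeAlgebra.ι K .dil)
  mom k := by
    obtain ⟨a, b, hab, e⟩ := hc.to_rel k
    have h₁ := BB.π_rel (BosRel.mom (D := h.toData) (ρ := ρ) (rel := rel) a b hab)
    rw [← sub_eq_zero, ← map_sub, ← map_sub, e] at h₁
    simpa using h₁
  dil_bg x := by
    have h₁ := BB.π_rel (BosRel.dil_bg (D := h.toData) (ρ := ρ) (rel := rel) x)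
    rw [map_mul, map_mul] at h₁
    exact h₁
  dil_mom i := by
    have h₁ := BB.π_rel (BosRel.dil_mom (D := h.toData) (ρ := ρ) (rel := rel) i)
    rw [map_mul, map_sub, map_mul] at h₁
    exact h₁
  cross x i := by
    have h₁ := BB.π_rel (BosRel.cross (D := h.toData) (ρ := ρ) (rel := rel) x i)
    rw [map_mul, map_sum] at h₁
    refine h₁.trans (Finset.sum_congr rfl fun a _ => ?_)
    rw [map_mul, Hopf.hitL_apply, BB.bg_eq]
    congr 4
    exact sliceLeft_eq (ρ i a) (h.Δ x)

variable {Z : Type*} [Ring Z] [Algebra K Z]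

/-- The map from the free algebra defined by a realisation. -/
def BosData.freeLift (d : BosData h ρ c Z) : FreeAlgebra K (BosGen X ι) →ₐ[K] Z :=
  FreeAlgebra.lift K fun g => match g with
    | .bg x => d.f x
    | .mom i => d.P i
    | .dil => d.Ξ

@[simp] theorem BosData.freeLift_bg (d : BosData h ρ c Z) (x : X) :
    d.freeLift (FreeAlgebra.ι K (.bg x)) = d.f x := by simp [freeLift]

@[simp] theorem BosData.freeLift_mom (d : BosData h ρ c Z) (i : ι) :
    d.freeLift (FreeAlgebra.ι K (.mom i)) = d.P i := by simp [freeLift]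

@[simp] theorem BosData.freeLift_dil (d : BosData h ρ c Z) :
    d.freeLift (FreeAlgebra.ι K .dil) = d.Ξ := by simp [freeLift]

theorem BosData.freeLift_rel (hc : IsQuadratic rel c) (d : BosData h ρ c Z)
    ⦃x y : FreeAlgebra K (BosGen X ι)⦄ (hxy : BosRel h.toData ρ rel x y) :
    d.freeLift x = d.freeLift y := by
  cases hxy with
  | bg_add x y => simp
  | bg_mul x y => simp
  | bg_scalar a => simp
  | mom a b hab =>
    obtain ⟨k, hk⟩ := hc.of_rel a b hab
    rw [← sub_eq_zero, ← map_sub, ← map_sub, hk]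
    simpa using d.mom k
  | dil_bg x => simpa using d.dil_bg x
  | dil_mom i => simpa using d.dil_mom i
  | cross x i =>
    simp only [map_mul, map_sum, freeLift_bg, freeLift_mom, d.cross]
    refine Finset.sum_congr rfl fun a _ => ?_
    rw [Hopf.hitL_apply]
    congr 2
    exact (sliceLeft_eq (ρ i a) (h.Δ x)).symm

/-- The map from the uncompleted inhomogeneous quantum group defined by a realisation. -/
def BosData.quotLift (hc : IsQuadratic rel c) (d : BosData h ρ c Z) :
    RingQuot (BosRel h.toData ρ rel) →ₐ[K] Z :=
  RingQuot.liftAlgHom K ⟨d.freeLift, d.freeLift_rel hc⟩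

variable [IsAdicComplete tIdeal Z]

/-- The map from the inhomogeneous quantum group defined by a realisation. -/
def BosData.lift (hc : IsQuadratic rel c) (d : BosData h ρ c Z) : BB h ρ rel →ₐ[K] Z :=
  AlgHom.ofLinearMap (cplLift (d.quotLift hc).toLinearMap)
    ((cplLift_of _ (1 : RingQuot (BosRel h.toData ρ rel))).trans (map_one (d.quotLift hc)))
    (cplLift_mul _)

theorem BosData.lift_π (hc : IsQuadratic rel c) (d : BosData h ρ c Z)
    (x : FreeAlgebra K (BosGen X ι)) : d.lift hc (BB.π h ρ rel x) = d.freeLift x :=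
  (cplLift_of _ (RingQuot.mkAlgHom K (BosRel h.toData ρ rel) x)).trans
    (RingQuot.liftAlgHom_mkAlgHom_apply K d.freeLift (d.freeLift_rel hc) x)

@[simp] theorem BosData.lift_bg (hc : IsQuadratic rel c) (d : BosData h ρ c Z) (x : X) :
    d.lift hc ((BB.gen h ρ rel hc).f x) = d.f x := (d.lift_π hc _).trans (d.freeLift_bg x)

@[simp] theorem BosData.lift_mom (hc : IsQuadratic rel c) (d : BosData h ρ c Z) (i : ι) :
    d.lift hc ((BB.gen h ρ rel hc).P i) = d.P i := (d.lift_π hc _).trans (d.freeLift_mom i)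

@[simp] theorem BosData.lift_dil (hc : IsQuadratic rel c) (d : BosData h ρ c Z) :
    d.lift hc (BB.gen h ρ rel hc).Ξ = d.Ξ := (d.lift_π hc _).trans d.freeLift_dil

theorem BB.linear_ext_of_π {Z : Type*} [AddCommGroup Z] [Module K Z] [IsHausdorff tIdeal Z]
    {F G : BB h ρ rel →ₗ[K] Z} (hFG : ∀ x, F (BB.π h ρ rel x) = G (BB.π h ρ rel x)) : F = G := by
  refine Cpl.linear_ext (M := RingQuot (BosRel h.toData ρ rel)) (LinearMap.ext fun x => ?_)
  obtain ⟨y, rfl⟩ := RingQuot.mkAlgHom_surjective K (BosRel h.toData ρ rel) x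
  exact hFG y

/-- Stability under products is a hypothesis and not a consequence of multiplicativity. The
criterion therefore also applies to `m(S ⊗ id)Δ`, to composites of two antimultiplicative maps and
to `* ∘ *`. -/
theorem BB.linear_ext (hc : IsQuadratic rel c) {Z : Type*} [AddCommGroup Z] [Module K Z]
    [IsHausdorff tIdeal Z] {F G : BB h ρ rel →ₗ[K] Z} (one : F 1 = G 1)
    (mul : ∀ x y, F x = G x → F y = G y → F (x * y) = G (x * y))
    (bg : ∀ x, F ((BB.gen h ρ rel hc).f x) = G ((BB.gen h ρ rel hc).f x))
    (mom : ∀ i, F ((BB.gen h ρ rel hc).P i) = G ((BB.gen h ρ rel hc).P i))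
    (dil : F (BB.gen h ρ rel hc).Ξ = G (BB.gen h ρ rel hc).Ξ) : F = G := by
  refine BB.linear_ext_of_π fun x => ?_
  induction x using FreeAlgebra.induction with
  | grade0 r => rw [AlgHom.commutes, Algebra.algebraMap_eq_smul_one, map_smul, map_smul, one]
  | grade1 g =>
    cases g with
    | bg x => exact bg x
    | mom i => exact mom i
    | dil => exact dil
  | mul a b ha hb => rw [map_mul]; exact mul _ _ ha hb
  | add a b ha hb => rw [map_add, map_add, map_add, ha, hb]

theorem BB.algHom_ext (hc : IsQuadratic rel c) {Z : Type*} [Ring Z] [Algebra K Z]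
    [IsHausdorff tIdeal Z] {F G : BB h ρ rel →ₐ[K] Z}
    (bg : ∀ x, F ((BB.gen h ρ rel hc).f x) = G ((BB.gen h ρ rel hc).f x))
    (mom : ∀ i, F ((BB.gen h ρ rel hc).P i) = G ((BB.gen h ρ rel hc).P i))
    (dil : F (BB.gen h ρ rel hc).Ξ = G (BB.gen h ρ rel hc).Ξ) : F = G := by
  have : F.toLinearMap = G.toLinearMap :=
    BB.linear_ext hc (by simp) (fun x y hx hy => by
      simp only [AlgHom.toLinearMap_apply] at hx hy
      simp [hx, hy]) bg mom dil
  exact AlgHom.ext fun x => LinearMap.congr_fun this x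

end BB

end QStar
namespace QStar

/-! ### Operations on realisations -/

section QuadSum

variable {ι β M N : Type*} [Fintype ι] [Fintype β] [AddCommGroup M] [Module K M] [AddCommGroup N]
  [Module K N] (c : ι → ι → K)

/-- `∑ c i j F i j`. -/
def quadSum (F : ι → ι → M) : M := ∑ i, ∑ j, c i j • F i j

theorem quadSum_sum (F : ι → ι → β → M) :
    quadSum c (fun i j => ∑ b, F i j b) = ∑ b, quadSum c fun i j => F i j b := by
  simp only [quadSum, Finset.smul_sum]
  rw [Finset.sum_comm]
  refine (Finset.sum_congr rfl fun i _ => Finset.sum_congr rfl fun j _ => rfl).trans ?_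
  rw [Finset.sum_comm]
  calc _ = ∑ i, ∑ b, ∑ j, c i j • F i j b := Finset.sum_congr rfl fun i _ => Finset.sum_comm
    _ = _ := Finset.sum_comm

theorem map_quadSum (φ : M →ₗ[K] N) (F : ι → ι → M) :
    φ (quadSum c F) = quadSum c fun i j => φ (F i j) := by
  simp [quadSum]

theorem quadSum_add (F G : ι → ι → M) :
    quadSum c (fun i j => F i j + G i j) = quadSum c F + quadSum c G := by
  simp [quadSum, Finset.sum_add_distrib]

theorem quadSum_smul (F : ι → ι → K) (z : M) :
    quadSum c (fun i j => F i j • z) = quadSum c F • z := by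
  simp [quadSum, Finset.sum_smul, smul_smul]

end QuadSum

/-- The compatibility conditions between the quasitriangular structure, the action on the momentum
generators, their relations and the dilaton normalisation. -/
structure IsCompatible {X ι κ : Type*} [Ring X] [Algebra K X] [IsAdicComplete tIdeal X] [Fintype ι]
    [DecidableEq ι] [Fintype κ] {h : Hopf X} (q : QT h) (ρ : ι → ι → X →ₗ[K] K) (c : κ → ι → ι → K)
    (ℓ : tIdeal) : Prop where
  rep : IsRep ρ
  covariant : ∀ k, ∃ s : κ → X, ∀ a b,
    quadSum (c k) (fun i j => q.sl (ρ i a) * q.sl (ρ j b)) = ∑ l, c l a b • s l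
  braided : ∀ k a b,
    quadSum (c k) (fun i j => cexp ℓ (-1 : K) * ρ j a (q.sl (ρ i b))) = -c k a b

namespace BosData

variable {X ι κ : Type*} [Ring X] [Algebra K X] [IsAdicComplete tIdeal X] [Fintype ι]
  [DecidableEq ι] [Fintype κ] {h : Hopf X} {q : QT h} {ρ : ι → ι → X →ₗ[K] K} {c : κ → ι → ι → K}
  {ℓ : tIdeal} {Z : Type*} [Ring Z] [Algebra K Z] [IsAdicComplete tIdeal Z] (d : BosData h ρ c Z)

theorem cexp_bg (ℓ : tIdeal) (x : X) : cexp ℓ d.Ξ * d.f x = d.f x * cexp ℓ d.Ξ :=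
  (semiconj_cexp ℓ (d.dil_bg x).symm).symm

theorem cexp_neg_bg (ℓ : tIdeal) (x : X) : cexp ℓ (-d.Ξ) * d.f x = d.f x * cexp ℓ (-d.Ξ) :=
  (semiconj_cexp ℓ (by rw [mul_neg, neg_mul, d.dil_bg x])).symm

/-- From `ξ p = p (ξ - 1)`, exponentiation yields the scalar `λ⁻¹`. -/
theorem cexp_mom (ℓ : tIdeal) (i : ι) :
    cexp ℓ d.Ξ * d.P i = cexp ℓ (-1 : K) • (d.P i * cexp ℓ d.Ξ) := by
  have h₁ : d.P i * (d.Ξ + algebraMap K Z (-1)) = d.Ξ * d.P i := by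
    rw [d.dil_mom]
    simp [mul_add, sub_eq_add_neg]
  rw [← semiconj_cexp ℓ h₁, cexp_add ℓ (Algebra.commutes _ _).symm, cexp_algebraMap,
    ← Algebra.commutes, ← Algebra.smul_def, mul_smul_comm]

theorem mom_cexp_neg (ℓ : tIdeal) (i : ι) :
    d.P i * cexp ℓ (-d.Ξ) = cexp ℓ (-1 : K) • (cexp ℓ (-d.Ξ) * d.P i) := by
  have h₁ := congrArg (fun z => cexp ℓ (-d.Ξ) * z * cexp ℓ (-d.Ξ)) (d.cexp_mom ℓ i)
  simp only [mul_smul_comm, smul_mul_assoc] at h₁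
  rwa [← mul_assoc, cexp_neg_mul, one_mul, mul_assoc, mul_assoc, cexp_mul_neg, mul_one] at h₁

variable (q ℓ) in
/-- The elements `λ ^ ξ 𝓡⁽²⁾ ρ(𝓡⁽¹⁾)`. -/
def g (i a : ι) : Z := cexp ℓ d.Ξ * d.f (q.sl (ρ i a))

theorem hitL_sl (hρ : IsRep ρ) (i a j b : ι) :
    h.hitL (ρ j b) (q.sl (ρ i a)) = ∑ e, ρ j b (q.sl (ρ i e)) • q.sl (ρ e a) := by
  rw [Hopf.hitL_apply, q.Δ_sl hρ]
  simp

theorem hitR_sl (hρ : IsRep ρ) (f : X →ₗ[K] K) (i a : ι) :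
    h.hitR f (q.sl (ρ i a)) = ∑ e, f (q.sl (ρ e a)) • q.sl (ρ i e) := by
  rw [Hopf.hitR_apply, q.Δ_sl hρ]
  simp

/-- Moving `g` past a momentum produces the normalised braiding matrix: `λ⁻¹` comes from `λ^ξ`, and
the matrix of `𝓡` in `ρ ⊗ ρ` from the cross relations and the coproduct of the slices. -/
theorem g_mul_mom (hρ : IsRep ρ) (i a j : ι) :
    d.g q ℓ i a * d.P j =
      ∑ b, ∑ e, (cexp ℓ (-1 : K) * ρ j b (q.sl (ρ i e))) • (d.P b * d.g q ℓ e a) := by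
  rw [g, mul_assoc, d.cross, Finset.mul_sum]
  refine Finset.sum_congr rfl fun b _ => ?_
  rw [← mul_assoc, d.cexp_mom, hitL_sl hρ, map_sum, Finset.mul_sum]
  refine Finset.sum_congr rfl fun e _ => ?_
  rw [map_smul, mul_smul_comm, smul_mul_assoc, smul_smul, mul_comm, g, mul_assoc]

theorem quadSum_mom (k : κ) : quadSum (c k) (fun i j => d.P i * d.P j) = 0 := d.mom k

/-- The normalised braiding is `-1` on relation tensors, so the two kinds of mixed terms in `Δ(p p)`
are opposite to each other. -/
theorem quadSum_g_mul_mom (H : IsCompatible q ρ c ℓ) (k : κ) (b : ι) :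
    quadSum (c k) (fun i j => d.g q ℓ i b * d.P j) =
      -quadSum (c k) (fun i j => d.P i * d.g q ℓ j b) := by
  simp only [d.g_mul_mom H.rep, quadSum_sum, quadSum_smul, H.braided]
  simp [quadSum]

theorem g_mul_g (i a j b : ι) : d.g q ℓ i a * d.g q ℓ j b =
    cexp ℓ d.Ξ * cexp ℓ d.Ξ * d.f (q.sl (ρ i a) * q.sl (ρ j b)) := by
  rw [g, g, map_mul, mul_assoc, ← mul_assoc (d.f _), ← d.cexp_bg]
  simp only [mul_assoc]

theorem quadSum_g_mul_g (H : IsCompatible q ρ c ℓ) (k : κ) : ∃ s : κ → X, ∀ a b,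
    quadSum (c k) (fun i j => d.g q ℓ i a * d.g q ℓ j b) =
      ∑ l, c l a b • (cexp ℓ d.Ξ * cexp ℓ d.Ξ * d.f (s l)) := by
  obtain ⟨s, hs⟩ := H.covariant k
  refine ⟨s, fun a b => ?_⟩
  have := congrArg ((LinearMap.mulLeft K (cexp ℓ d.Ξ * cexp ℓ d.Ξ)).comp d.f.toLinearMap) (hs a b)
  rw [map_quadSum] at this
  simpa [g_mul_g, mul_assoc] using this

/-- Covariance moves the coefficients `c` from the outer indices of `g g` to the inner ones, where
they contract with `p p` and give zero. -/
theorem quadSum_g_tm (H : IsCompatible q ρ c ℓ) (k : κ) :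
    quadSum (c k) (fun i j => ∑ a, ∑ b, (d.g q ℓ i a * d.g q ℓ j b) ⊠ (d.P a * d.P b) :
      ι → ι → CT Z Z) = 0 := by
  obtain ⟨s, hs⟩ := d.quadSum_g_mul_g H k
  have h₁ : ∀ a b, quadSum (c k)
      (fun i j => (d.g q ℓ i a * d.g q ℓ j b) ⊠ (d.P a * d.P b) : ι → ι → CT Z Z) =
      ∑ l, c l a b • (cexp ℓ d.Ξ * cexp ℓ d.Ξ * d.f (s l)) ⊠ (d.P a * d.P b) := fun a b => by
    have := congrArg (tmL.flip (d.P a * d.P b) : Z →ₗ[K] CT Z Z) (hs a b)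
    rw [map_quadSum] at this
    simpa using this
  simp only [quadSum_sum, h₁]
  have h₂ : ∀ l, ∑ a, ∑ b, c l a b • (cexp ℓ d.Ξ * cexp ℓ d.Ξ * d.f (s l)) ⊠ (d.P a * d.P b) =
      (0 : CT Z Z) := fun l => by
    have := congrArg (tmL (cexp ℓ d.Ξ * cexp ℓ d.Ξ * d.f (s l)) : Z →ₗ[K] CT Z Z) (d.mom l)
    simpa using this
  calc _ = ∑ a, ∑ l, ∑ b, c l a b • (cexp ℓ d.Ξ * cexp ℓ d.Ξ * d.f (s l)) ⊠ (d.P a * d.P b) :=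
        Finset.sum_congr rfl fun a _ => Finset.sum_comm
    _ = ∑ l, ∑ a, ∑ b, c l a b • (cexp ℓ d.Ξ * cexp ℓ d.Ξ * d.f (s l)) ⊠ (d.P a * d.P b) :=
        Finset.sum_comm
    _ = 0 := by simp [h₂]

theorem map_mul_mom_tm (i : ι) (y : CT X X) : CT.map d.f d.f y * d.P i ⊠ 1 =
    ∑ a, (d.P a ⊠ 1 : CT Z Z) * CT.map d.f d.f (CT.lmap (h.hitL (ρ i a)) LinearMap.id y) := by
  have : (LinearMap.mulRight K (d.P i ⊠ 1 : CT Z Z)).comp (CT.map d.f d.f).toLinearMap =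
      ∑ a, (LinearMap.mulLeft K (d.P a ⊠ 1 : CT Z Z)).comp ((CT.map d.f d.f).toLinearMap.comp
        (CT.lmap (h.hitL (ρ i a)) LinearMap.id)) := by
    ext x y
    simp [d.cross, LinearMap.sum_apply]
  simpa [LinearMap.sum_apply] using LinearMap.congr_fun this y

theorem map_mul_g_tm (i b : ι) (y : CT X X) : CT.map d.f d.f y * d.g q ℓ i b ⊠ d.P b =
    ∑ e, (1 ⊠ d.P e : CT Z Z) * CT.map d.f d.f (CT.lmap LinearMap.id (h.hitL (ρ b e)) y) *
      d.g q ℓ i b ⊠ 1 := by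
  have : (LinearMap.mulRight K (d.g q ℓ i b ⊠ d.P b : CT Z Z)).comp (CT.map d.f d.f).toLinearMap =
      ∑ e, (LinearMap.mulLeft K (1 ⊠ d.P e : CT Z Z)).comp
        ((LinearMap.mulRight K (d.g q ℓ i b ⊠ 1 : CT Z Z)).comp ((CT.map d.f d.f).toLinearMap.comp
        (CT.lmap LinearMap.id (h.hitL (ρ b e))))) := by
    ext x y
    simp [d.cross, LinearMap.sum_apply]
  simpa [LinearMap.sum_apply, mul_assoc] using LinearMap.congr_fun this y

/-- This is `QT.sum_hitR_mul_sl` multiplied by `λ^ξ`, which commutes with the background. -/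
theorem sum_hitR_mul_g (hρ : IsRep ρ) (i e : ι) (x : X) :
    ∑ b, d.f (h.hitR (ρ b e) x) * d.g q ℓ i b = ∑ b, d.g q ℓ b e * d.f (h.hitL (ρ i b) x) := by
  have := congrArg (fun z => cexp ℓ d.Ξ * d.f z) (q.sum_hitR_mul_sl hρ i e x)
  simp only [map_sum, map_mul, Finset.mul_sum] at this
  simp only [g, ← mul_assoc, ← d.cexp_bg]
  simpa only [mul_assoc] using this

theorem map_hitR_mul_g_tm (hρ : IsRep ρ) (i e : ι) (y : CT X X) :
    ∑ b, CT.map d.f d.f (CT.lmap (h.hitR (ρ b e)) LinearMap.id y) * (d.g q ℓ i b ⊠ 1 : CT Z Z) =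
    ∑ b, (d.g q ℓ b e ⊠ 1 : CT Z Z) * CT.map d.f d.f (CT.lmap (h.hitL (ρ i b)) LinearMap.id y) := by
  have : ∑ b, (LinearMap.mulRight K (d.g q ℓ i b ⊠ 1 : CT Z Z)).comp
        ((CT.map d.f d.f).toLinearMap.comp (CT.lmap (h.hitR (ρ b e)) LinearMap.id)) =
      ∑ b, (LinearMap.mulLeft K (d.g q ℓ b e ⊠ 1 : CT Z Z)).comp
        ((CT.map d.f d.f).toLinearMap.comp (CT.lmap (h.hitL (ρ i b)) LinearMap.id)) := by
    ext x y
    have := congrArg (tmL.flip (d.f y) : Z →ₗ[K] CT Z Z) (d.sum_hitR_mul_g (q := q) (ℓ := ℓ) hρ i e x)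
    simpa [LinearMap.sum_apply] using this
  simpa [LinearMap.sum_apply] using LinearMap.congr_fun this y

theorem dil_g (i a : ι) : d.Ξ * d.g q ℓ i a = d.g q ℓ i a * d.Ξ := by
  rw [g, mul_assoc, ← d.dil_bg, ← mul_assoc, ← mul_assoc, semiconj_cexp ℓ (rfl : d.Ξ * d.Ξ = _)]

/-- The coproduct. -/
def comul (H : IsCompatible q ρ c ℓ) : BosData h ρ c (CT Z Z) where
  f := (CT.map d.f d.f).comp h.Δ
  P i := d.P i ⊠ 1 + ∑ a, d.g q ℓ i a ⊠ d.P a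
  Ξ := d.Ξ ⊠ 1 + 1 ⊠ d.Ξ
  mom k := by
    have h₁ : quadSum (c k) (fun i j => (d.P i * d.P j) ⊠ 1 : ι → ι → CT Z Z) = 0 := by
      have := congrArg (tmL.flip 1 : Z →ₗ[K] CT Z Z) (d.quadSum_mom k)
      rw [map_quadSum] at this
      simpa using this
    have h₂ : quadSum (c k) (fun i j => ∑ b, (d.P i * d.g q ℓ j b) ⊠ d.P b : ι → ι → CT Z Z) +
        quadSum (c k) (fun i j => ∑ b, (d.g q ℓ i b * d.P j) ⊠ d.P b : ι → ι → CT Z Z) = 0 := by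
      rw [quadSum_sum, quadSum_sum, ← Finset.sum_add_distrib]
      refine Finset.sum_eq_zero fun b _ => ?_
      have := congrArg (tmL.flip (d.P b) : Z →ₗ[K] CT Z Z) (d.quadSum_g_mul_mom H k b)
      rw [map_neg, map_quadSum, map_quadSum] at this
      rw [add_eq_zero_iff_neg_eq]
      simpa using this.symm
    have h₅ := d.quadSum_g_tm H k
    -- Sorted by type: the `p p ⊗ 1` terms vanish by the relations, the mixed terms by the braiding
    -- condition, the `g g ⊗ p p` terms by covariance.
    have h₆ : ∀ i j, (d.P i ⊠ 1 + ∑ a, d.g q ℓ i a ⊠ d.P a : CT Z Z) *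
        (d.P j ⊠ 1 + ∑ a, d.g q ℓ j a ⊠ d.P a) =
        ((d.P i * d.P j) ⊠ 1 + (∑ b, (d.P i * d.g q ℓ j b) ⊠ d.P b +
          ∑ b, (d.g q ℓ i b * d.P j) ⊠ d.P b)) +
          ∑ a, ∑ b, (d.g q ℓ i a * d.g q ℓ j b) ⊠ (d.P a * d.P b) := fun i j => by
      simp only [add_mul, mul_add, Finset.sum_mul, Finset.mul_sum, tm_mul_tm, mul_one, one_mul,
        Finset.sum_add_distrib]
      rw [Finset.sum_comm]
      abel
    change quadSum (c k) _ = 0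
    simp only [h₆]
    rw [quadSum_add, quadSum_add, quadSum_add, h₁, h₂, h₅, add_zero, add_zero]
  dil_bg x := by
    refine (commute_of_pure (CT.map d.f d.f) (fun a => ?_) (fun a => ?_) (h.Δ x)).symm.eq
    · simp [Commute, SemiconjBy, CT.inl_apply, mul_add, add_mul, d.dil_bg]
    · simp [Commute, SemiconjBy, CT.inr_apply, mul_add, add_mul, d.dil_bg]
  dil_mom i := by
    simp only [add_mul, mul_add, Finset.mul_sum, Finset.sum_mul, tm_mul_tm, mul_one, one_mul, d.dil_mom,
      dil_g, map_sub, LinearMap.sub_apply, Finset.sum_add_distrib, Finset.sum_sub_distrib]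
    abel
  cross x i := by
    simp only [AlgHom.comp_apply, mul_add, add_mul, Finset.sum_add_distrib]
    congr 1
    · rw [d.map_mul_mom_tm]
      simp only [h.Δ_hitL]
    -- After `p` is pulled out of the second factor, coassociativity turns the action through `h₍₂₎`
    -- into `hitR` on the first factor; there the intertwining property of `𝓡` exchanges it with
    -- `g`.
    · simp only [Finset.mul_sum, Finset.sum_mul, d.map_mul_g_tm]
      rw [Finset.sum_comm]
      conv_rhs => rw [Finset.sum_comm]
      refine Finset.sum_congr rfl fun e _ => ?_
      have := congrArg (fun z => (1 ⊠ d.P e : CT Z Z) * z)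
        (d.map_hitR_mul_g_tm (q := q) (ℓ := ℓ) H.rep i e (h.Δ x))
      simp only [h.lmap_hitR_Δ, ← h.Δ_hitL, Finset.mul_sum, ← mul_assoc, tm_mul_tm, one_mul,
        mul_one] at this
      exact this

end BosData

end QStar
namespace QStar

/-! ### Counit, antipode and inverse antipode as realisations -/

namespace BosData

variable {X ι κ : Type*} [Ring X] [Algebra K X] [IsAdicComplete tIdeal X] [Fintype ι]
  [DecidableEq ι] [Fintype κ] {h : Hopf X} {q : QT h} {ρ : ι → ι → X →ₗ[K] K} {c : κ → ι → ι → K}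
  {ℓ : tIdeal} {Z : Type*} [Ring Z] [Algebra K Z] [IsAdicComplete tIdeal Z] (d : BosData h ρ c Z)

variable (h ρ c) in
/-- The counit. -/
def counit : BosData h ρ c K where
  f := h.ε
  P _ := 0
  Ξ := 0
  mom k := by simp
  dil_bg x := by simp
  dil_mom i := by simp
  cross x i := by simp

theorem cexp_neg_mom (ℓ : tIdeal) (i : ι) :
    cexp ℓ (-d.Ξ) * d.P i = cexp ℓ (1 : K) • (d.P i * cexp ℓ (-d.Ξ)) := by
  rw [d.mom_cexp_neg, smul_smul, cexp_mul_neg, one_smul]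

/-! #### The antipode -/

variable (q ℓ) in
/-- The antipode of `g`. -/
def sg (i a : ι) : Z := cexp ℓ (-d.Ξ) * d.f (h.S (q.sl (ρ i a)))

/-- The cross relation solved for the other order: expanding the right-hand side by the cross
relation, the two matrices of `ρ` cancel by `IsRep.sum_hitL_S_hitR`. -/
theorem mom_mul_bg_S (hρ : IsRep ρ) (a : ι) (x : X) :
    d.P a * d.f (h.S x) = ∑ b, d.f (h.S (h.hitR (ρ a b) x)) * d.P b := by
  have h₁ : ∀ e, ∑ b, d.P e * d.f (h.hitL (ρ b e) (h.S (h.hitR (ρ a b) x))) =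
      d.P e * d.f (if a = e then h.S x else 0) := fun e => by
    rw [← hρ.sum_hitL_S_hitR h, map_sum, Finset.mul_sum]
  simp only [d.cross]
  rw [Finset.sum_comm]
  simp only [h₁]
  rw [Finset.sum_eq_single a (fun e _ he => by rw [if_neg (Ne.symm he), map_zero, mul_zero]) (by simp),
    if_pos rfl]

theorem mom_mul_sg (hρ : IsRep ρ) (b i a : ι) :
    d.P b * d.sg q ℓ i a =
      ∑ e', ∑ e, (cexp ℓ (-1 : K) * ρ b e' (q.sl (ρ e a))) • (d.sg q ℓ i e * d.P e') := by
  rw [sg, ← mul_assoc, d.mom_cexp_neg, smul_mul_assoc, mul_assoc, d.mom_mul_bg_S hρ, Finset.mul_sum,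
    Finset.smul_sum]
  refine Finset.sum_congr rfl fun e' _ => ?_
  rw [hitR_sl hρ]
  simp only [map_sum, map_smul, Finset.sum_mul, Finset.mul_sum, Finset.smul_sum, smul_mul_assoc,
    mul_smul_comm, smul_smul, sg, mul_assoc]

theorem sg_mul_sg (i a j b : ι) : d.sg q ℓ j b * d.sg q ℓ i a =
    cexp ℓ (-d.Ξ) * cexp ℓ (-d.Ξ) * d.f (h.S (q.sl (ρ i a) * q.sl (ρ j b))) := by
  rw [sg, sg, h.S_mul, map_mul, mul_assoc, ← mul_assoc (d.f _), ← d.cexp_neg_bg]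
  simp only [mul_assoc]

theorem quadSum_sg (H : IsCompatible q ρ c ℓ) (k : κ) : ∃ W : κ → Z, ∀ a b,
    quadSum (c k) (fun i j => d.sg q ℓ j b * d.sg q ℓ i a) = ∑ l, c l a b • W l := by
  obtain ⟨s, hs⟩ := H.covariant k
  refine ⟨fun l => cexp ℓ (-d.Ξ) * cexp ℓ (-d.Ξ) * d.f (h.S (s l)), fun a b => ?_⟩
  have := congrArg ((LinearMap.mulLeft K (cexp ℓ (-d.Ξ) * cexp ℓ (-d.Ξ))).comp
    (d.f.toLinearMap.comp h.S)) (hs a b)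
  rw [map_quadSum] at this
  simpa [sg_mul_sg, mul_assoc] using this

/-- Antimultiplicativity puts the factor of index `j` first. Moving `p` past `S(g)` creates one
braiding matrix; covariance carries `c` to its input indices, the braiding condition replaces it by
`-c` on the output indices, and these contract with `p p`. -/
theorem quadSum_antipode (H : IsCompatible q ρ c ℓ) (k : κ) :
    quadSum (c k) (fun i j => (∑ b, d.sg q ℓ j b * d.P b) * ∑ a, d.sg q ℓ i a * d.P a) = 0 := by
  obtain ⟨W, hW⟩ := d.quadSum_sg H k
  have h₁ : ∀ i j, (∑ b, d.sg q ℓ j b * d.P b) * (∑ a, d.sg q ℓ i a * d.P a) =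
      ∑ a, ∑ b, ∑ e', ∑ e, (cexp ℓ (-1 : K) * ρ b e' (q.sl (ρ e a))) •
        (d.sg q ℓ j b * d.sg q ℓ i e * (d.P e' * d.P a)) := fun i j => by
    rw [Finset.mul_sum]
    refine Finset.sum_congr rfl fun a _ => ?_
    rw [Finset.sum_mul]
    refine Finset.sum_congr rfl fun b _ => ?_
    rw [mul_assoc, ← mul_assoc (d.P b), d.mom_mul_sg H.rep]
    simp only [Finset.sum_mul, Finset.mul_sum, smul_mul_assoc, mul_smul_comm, mul_assoc]
  have h₂ : ∀ a b e' e, quadSum (c k) (fun i j => (cexp ℓ (-1 : K) * ρ b e' (q.sl (ρ e a))) •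
        (d.sg q ℓ j b * d.sg q ℓ i e * (d.P e' * d.P a))) =
      ∑ l, (c l e b • (cexp ℓ (-1 : K) * ρ b e' (q.sl (ρ e a)))) • (W l * (d.P e' * d.P a)) := by
    intro a b e' e
    have := congrArg ((cexp ℓ (-1 : K) * ρ b e' (q.sl (ρ e a))) •
      LinearMap.mulRight K (d.P e' * d.P a)) (hW e b)
    rw [map_quadSum] at this
    simpa [-LinearMap.mulRight_mul, Finset.sum_mul, Finset.smul_sum, smul_smul, mul_comm] using this
  simp only [h₁, quadSum_sum, h₂]
  have h₃ : ∀ a e', ∑ b, ∑ e, ∑ l, (c l e b • (cexp ℓ (-1 : K) * ρ b e' (q.sl (ρ e a)))) •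
      (W l * (d.P e' * d.P a)) = -∑ l, c l e' a • (W l * (d.P e' * d.P a)) := fun a e' => by
    rw [Finset.sum_comm, ← Finset.sum_neg_distrib]
    simp only [← neg_smul, ← H.braided, quadSum, Finset.sum_smul]
    rw [Finset.sum_comm]
    calc _ = ∑ b, ∑ l, ∑ e, (c l e b • (cexp ℓ (-1 : K) * ρ b e' (q.sl (ρ e a)))) •
          (W l * (d.P e' * d.P a)) := Finset.sum_congr rfl fun _ _ => Finset.sum_comm
      _ = ∑ l, ∑ b, ∑ e, (c l e b • (cexp ℓ (-1 : K) * ρ b e' (q.sl (ρ e a)))) •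
          (W l * (d.P e' * d.P a)) := Finset.sum_comm
      _ = _ := Finset.sum_congr rfl fun _ _ => Finset.sum_comm
  have h₄ : ∀ l, ∑ e', ∑ a, c l e' a • (W l * (d.P e' * d.P a)) = 0 := fun l => by
    have := congrArg (LinearMap.mulLeft K (W l)) (d.mom l)
    simpa using this
  calc _ = ∑ a, ∑ e', ∑ b, ∑ e, ∑ l, (c l e b • (cexp ℓ (-1 : K) * ρ b e' (q.sl (ρ e a)))) •
      (W l * (d.P e' * d.P a)) := Finset.sum_congr rfl fun _ _ => Finset.sum_comm
    _ = -∑ a, ∑ e', ∑ l, c l e' a • (W l * (d.P e' * d.P a)) := by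
        simp only [h₃, Finset.sum_neg_distrib]
    _ = -∑ e', ∑ a, ∑ l, c l e' a • (W l * (d.P e' * d.P a)) := by rw [Finset.sum_comm]
    _ = -∑ e', ∑ l, ∑ a, c l e' a • (W l * (d.P e' * d.P a)) := by
        congr 1
        exact Finset.sum_congr rfl fun _ _ => Finset.sum_comm
    _ = -∑ l, ∑ e', ∑ a, c l e' a • (W l * (d.P e' * d.P a)) := by rw [Finset.sum_comm]
    _ = 0 := by simp [h₄]

/-- Apply the antimultiplicative `S` to the sliced intertwining relation of `𝓡`, and use
`mom_mul_bg_S` to pass the momentum across `S x`. -/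
theorem antipode_cross (hρ : IsRep ρ) (x : X) (i : ι) :
    (∑ b, d.sg q ℓ i b * d.P b) * d.f (h.S x) =
      ∑ a, d.f (h.S (h.hitL (ρ i a) x)) * ∑ b, d.sg q ℓ a b * d.P b := by
  have h₁ : ∀ e, ∑ b, d.sg q ℓ i b * d.f (h.S (h.hitR (ρ b e) x)) =
      ∑ a, d.f (h.S (h.hitL (ρ i a) x)) * d.sg q ℓ a e := fun e => by
    have := congrArg (fun z => cexp ℓ (-d.Ξ) * d.f (h.S z)) (q.sum_hitR_mul_sl hρ i e x)
    simp only [map_sum, h.S_mul, map_mul, Finset.mul_sum] at this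
    simp only [sg, ← mul_assoc, ← d.cexp_neg_bg]
    simpa only [mul_assoc] using this
  simp only [Finset.sum_mul, Finset.mul_sum, mul_assoc, d.mom_mul_bg_S hρ]
  rw [Finset.sum_comm]
  conv_rhs => rw [Finset.sum_comm]
  refine Finset.sum_congr rfl fun e _ => ?_
  have := congrArg (· * d.P e) (h₁ e)
  simpa only [Finset.sum_mul, mul_assoc] using this

/-- An antimultiplicative linear map as an algebra map. -/
def antiHom (d : BosData h ρ c Z) (S : X →ₗ[K] X) (one : S 1 = 1)
    (mul : ∀ x y, S (x * y) = S y * S x) : X →ₐ[K] Zᵐᵒᵖ :=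
  AlgHom.ofLinearMap ((MulOpposite.opLinearEquiv K : Z ≃ₗ[K] Zᵐᵒᵖ).toLinearMap.comp
    (d.f.toLinearMap.comp S)) (by simp [one]) fun x y => by simp [mul]

/-- The antipode. -/
def antipode (H : IsCompatible q ρ c ℓ) : BosData h ρ c Zᵐᵒᵖ where
  f := d.antiHom h.S h.S_one h.S_mul
  P i := MulOpposite.op (-∑ a, d.sg q ℓ i a * d.P a)
  Ξ := MulOpposite.op (-d.Ξ)
  mom k := by
    have := congrArg (MulOpposite.opLinearEquiv K : Z ≃ₗ[K] Zᵐᵒᵖ).toLinearMap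
      (d.quadSum_antipode H k)
    rw [map_quadSum] at this
    change quadSum (c k) (fun i j => MulOpposite.op (-_) * MulOpposite.op (-_)) = 0
    simp only [← MulOpposite.op_mul, neg_mul_neg]
    exact this
  dil_bg x := by
    change MulOpposite.op (-d.Ξ) * MulOpposite.op (d.f (h.S x)) = MulOpposite.op (d.f (h.S x)) * MulOpposite.op (-d.Ξ)
    rw [← MulOpposite.op_mul, ← MulOpposite.op_mul, neg_mul, mul_neg, d.dil_bg]
  dil_mom i := by
    rw [← MulOpposite.op_mul, ← MulOpposite.op_mul, ← MulOpposite.op_sub]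
    congr 1
    have : d.Ξ * (∑ a, d.sg q ℓ i a * d.P a) = (∑ a, d.sg q ℓ i a * d.P a) * d.Ξ -
        ∑ a, d.sg q ℓ i a * d.P a := by
      rw [Finset.mul_sum, Finset.sum_mul, ← Finset.sum_sub_distrib]
      refine Finset.sum_congr rfl fun a _ => ?_
      have h₁ : d.Ξ * d.sg q ℓ i a = d.sg q ℓ i a * d.Ξ := by
        rw [sg, mul_assoc, ← d.dil_bg, ← mul_assoc, ← mul_assoc,
          semiconj_cexp ℓ (by rw [mul_neg, neg_mul] : d.Ξ * -d.Ξ = -d.Ξ * d.Ξ)]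
      rw [← mul_assoc, h₁, mul_assoc, d.dil_mom, mul_sub, mul_assoc]
    simp only [neg_mul_neg, this]
    abel
  cross x i := by
    change MulOpposite.op (d.f (h.S x)) * MulOpposite.op _ = ∑ a, MulOpposite.op _ * MulOpposite.op (d.f (h.S (h.hitL (ρ i a) x)))
    simp only [← MulOpposite.op_mul, neg_mul, mul_neg, d.antipode_cross H.rep]
    simp

/-! #### The inverse antipode -/

variable (q ℓ) in
/-- The inverse antipode of `g`. -/
def ig (i a : ι) : Z := d.f (h.Sinv (q.sl (ρ i a))) * cexp ℓ (-d.Ξ)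

theorem ig_mul_mom (hρ : IsRep ρ) (j b a : ι) :
    d.ig q ℓ j b * d.P a =
      ∑ e', ∑ e, (cexp ℓ (1 : K) * ρ a e' (h.Sinv (q.sl (ρ e b)))) • (d.P e' * d.ig q ℓ j e) := by
  rw [ig, mul_assoc, d.cexp_neg_mom, mul_smul_comm, ← mul_assoc, d.cross, Finset.sum_mul,
    Finset.smul_sum]
  refine Finset.sum_congr rfl fun e' _ => ?_
  rw [h.hitL_Sinv, hitR_sl hρ]
  simp only [map_sum, map_smul, Finset.sum_mul, Finset.mul_sum, Finset.smul_sum, smul_mul_assoc,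
    mul_smul_comm, smul_smul, ig, mul_assoc, LinearMap.comp_apply]

theorem ig_mul_ig (i a j b : ι) : d.ig q ℓ j b * d.ig q ℓ i a =
    d.f (h.Sinv (q.sl (ρ i a) * q.sl (ρ j b))) * (cexp ℓ (-d.Ξ) * cexp ℓ (-d.Ξ)) := by
  rw [ig, ig, h.Sinv_mul, map_mul, mul_assoc, ← mul_assoc (cexp ℓ _), d.cexp_neg_bg]
  simp only [mul_assoc]

theorem quadSum_ig (H : IsCompatible q ρ c ℓ) (k : κ) : ∃ W : κ → Z, ∀ a b,
    quadSum (c k) (fun i j => d.ig q ℓ j b * d.ig q ℓ i a) = ∑ l, c l a b • W l := by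
  obtain ⟨s, hs⟩ := H.covariant k
  refine ⟨fun l => d.f (h.Sinv (s l)) * (cexp ℓ (-d.Ξ) * cexp ℓ (-d.Ξ)), fun a b => ?_⟩
  have := congrArg ((LinearMap.mulRight K (cexp ℓ (-d.Ξ) * cexp ℓ (-d.Ξ))).comp
    (d.f.toLinearMap.comp h.Sinv)) (hs a b)
  rw [map_quadSum] at this
  simpa [ig_mul_ig, mul_assoc, Finset.sum_mul] using this

theorem sum_Sinv_sl_mul_sl (hρ : IsRep ρ) (i b : ι) :
    ∑ e, h.Sinv (q.sl (ρ e b)) * q.sl (ρ i e) = if i = b then 1 else 0 := by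
  have := h.skew_antipode (q.sl (ρ i b))
  rw [q.Δ_sl hρ, q.ε_sl hρ] at this
  rw [map_sum] at this
  simp only [CT.lift_tm, LinearMap.compl₁₂_apply, LinearMap.flip_apply, LinearMap.mul_apply',
    LinearMap.id_apply] at this
  rw [this]
  split_ifs <;> simp

/-- A row vector on which an invertible matrix acts as `-1` has the same property for the inverse
matrix; the inverse of the braiding is written with `S⁻¹` and `λ`. -/
theorem braided_inv (H : IsCompatible q ρ c ℓ) (k : κ) (b b' : ι) :
    quadSum (c k) (fun a e => cexp ℓ (1 : K) * ρ a b' (h.Sinv (q.sl (ρ e b)))) = -c k b b' := by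
  have h₁ : ∀ a e, c k a e = -quadSum (c k) (fun i j => cexp ℓ (-1 : K) * ρ j a (q.sl (ρ i e))) :=
    fun a e => by rw [H.braided, neg_neg]
  -- The braiding times its candidate inverse: the representation property collects the product into
  -- `S⁻¹(𝓡-slice) · 𝓡-slice`, and the scalars `λ⁻¹` and `λ` cancel.
  have h₂ : ∀ i j, ∑ a, ∑ e, cexp ℓ (-1 : K) * ρ j a (q.sl (ρ i e)) *
      (cexp ℓ (1 : K) * ρ a b' (h.Sinv (q.sl (ρ e b)))) =
      if i = b then (if j = b' then 1 else 0) else 0 := fun i j => by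
    have h₃ := congrArg (ρ j b') (sum_Sinv_sl_mul_sl (q := q) H.rep i b)
    rw [map_sum] at h₃
    simp only [H.rep.mul] at h₃
    rw [Finset.sum_comm]
    have h₄ := cexp_neg_mul ℓ (1 : K)
    calc _ = ∑ e, ∑ a, ρ j a (q.sl (ρ i e)) * ρ a b' (h.Sinv (q.sl (ρ e b))) :=
          Finset.sum_congr rfl fun e _ => Finset.sum_congr rfl fun a _ => by
            linear_combination (ρ j a (q.sl (ρ i e)) * ρ a b' (h.Sinv (q.sl (ρ e b)))) * h₄
      _ = _ := by
        rw [h₃]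
        split_ifs <;> simp_all [H.rep.one]
  have h₅ : quadSum (c k) (fun a e => cexp ℓ (1 : K) * ρ a b' (h.Sinv (q.sl (ρ e b)))) =
      -quadSum (c k) (fun i j => ∑ a, ∑ e, cexp ℓ (-1 : K) * ρ j a (q.sl (ρ i e)) *
      (cexp ℓ (1 : K) * ρ a b' (h.Sinv (q.sl (ρ e b))))) := by
    simp only [quadSum_sum]
    conv_lhs => rw [quadSum]
    simp only [h₁, neg_smul, Finset.sum_neg_distrib]
    congr 1
    refine Finset.sum_congr rfl fun a _ => Finset.sum_congr rfl fun e _ => ?_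
    rw [← quadSum_smul]
    rfl
  rw [h₅]
  simp only [h₂, quadSum]
  simp

/-- Mirror image of `quadSum_antipode`: momenta are collected on the left, and `braided_inv` plays
the role of the braiding condition. -/
theorem quadSum_antipode_inv (H : IsCompatible q ρ c ℓ) (k : κ) :
    quadSum (c k) (fun i j => (∑ b, d.P b * d.ig q ℓ j b) * ∑ a, d.P a * d.ig q ℓ i a) = 0 := by
  obtain ⟨W, hW⟩ := d.quadSum_ig H k
  have h₁ : ∀ i j, (∑ b, d.P b * d.ig q ℓ j b) * (∑ a, d.P a * d.ig q ℓ i a) =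
      ∑ b, ∑ a, ∑ e', ∑ e, (cexp ℓ (1 : K) * ρ a e' (h.Sinv (q.sl (ρ e b)))) •
        (d.P b * d.P e' * (d.ig q ℓ j e * d.ig q ℓ i a)) := fun i j => by
    rw [Finset.sum_mul]
    refine Finset.sum_congr rfl fun b _ => ?_
    rw [Finset.mul_sum]
    refine Finset.sum_congr rfl fun a _ => ?_
    rw [mul_assoc, ← mul_assoc (d.ig _ _ _ _), d.ig_mul_mom H.rep]
    simp only [Finset.sum_mul, Finset.mul_sum, smul_mul_assoc, mul_smul_comm, mul_assoc]
  have h₂ : ∀ b a e' e, quadSum (c k) (fun i j => (cexp ℓ (1 : K) * ρ a e' (h.Sinv (q.sl (ρ e b)))) •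
        (d.P b * d.P e' * (d.ig q ℓ j e * d.ig q ℓ i a))) =
      ∑ l, (c l a e • (cexp ℓ (1 : K) * ρ a e' (h.Sinv (q.sl (ρ e b))))) • (d.P b * d.P e' * W l) := by
    intro b a e' e
    have := congrArg ((cexp ℓ (1 : K) * ρ a e' (h.Sinv (q.sl (ρ e b)))) •
      LinearMap.mulLeft K (d.P b * d.P e')) (hW a e)
    rw [map_quadSum] at this
    simpa [-LinearMap.mulLeft_mul, Finset.mul_sum, Finset.smul_sum, smul_smul, mul_comm] using this
  simp only [h₁, quadSum_sum, h₂]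
  have h₃ : ∀ b e', ∑ a, ∑ e, ∑ l, (c l a e • (cexp ℓ (1 : K) * ρ a e' (h.Sinv (q.sl (ρ e b))))) •
      (d.P b * d.P e' * W l) = -∑ l, c l b e' • (d.P b * d.P e' * W l) := fun b e' => by
    rw [← Finset.sum_neg_distrib]
    simp only [← neg_smul, ← braided_inv H, quadSum, Finset.sum_smul]
    calc _ = ∑ a, ∑ l, ∑ e, (c l a e • (cexp ℓ (1 : K) * ρ a e' (h.Sinv (q.sl (ρ e b))))) •
          (d.P b * d.P e' * W l) := Finset.sum_congr rfl fun _ _ => Finset.sum_comm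
      _ = _ := Finset.sum_comm
  have h₄ : ∀ l, ∑ b, ∑ e', c l b e' • (d.P b * d.P e' * W l) = 0 := fun l => by
    have := congrArg (LinearMap.mulRight K (W l)) (d.mom l)
    simpa using this
  calc _ = ∑ b, ∑ e', ∑ a, ∑ e, ∑ l,
      (c l a e • (cexp ℓ (1 : K) * ρ a e' (h.Sinv (q.sl (ρ e b))))) • (d.P b * d.P e' * W l) :=
        Finset.sum_congr rfl fun _ _ => Finset.sum_comm
    _ = -∑ b, ∑ e', ∑ l, c l b e' • (d.P b * d.P e' * W l) := by
        simp only [h₃, Finset.sum_neg_distrib]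
    _ = -∑ b, ∑ l, ∑ e', c l b e' • (d.P b * d.P e' * W l) := by
        congr 1
        exact Finset.sum_congr rfl fun _ _ => Finset.sum_comm
    _ = -∑ l, ∑ b, ∑ e', c l b e' • (d.P b * d.P e' * W l) := by rw [Finset.sum_comm]
    _ = 0 := by simp [h₄]

/-- With all `S⁻¹` outside, the intertwining property of `𝓡` moves the slice to the right of `x`;
the two contractions of `x` are then both on the right leg and cancel by `IsRep.sum_dconv_Sinv`. -/
theorem sum_hitL_Sinv_hitL (hρ : IsRep ρ) (i e : ι) (x : X) :
    ∑ a, ∑ b, h.hitL (ρ b e) (h.Sinv (h.hitL (ρ i a) x)) * h.Sinv (q.sl (ρ a b)) =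
      h.Sinv (x * q.sl (ρ i e)) := by
  simp only [h.hitL_Sinv, ← h.Sinv_mul, h.hitR_hitL, ← map_sum]
  congr 1
  rw [Finset.sum_comm]
  simp only [← q.sum_hitR_mul_sl hρ, h.hitR_hitR]
  rw [Finset.sum_comm]
  simp only [← Finset.sum_mul, sum_hitR]
  have : ∀ a, ∑ b, h.dconv (ρ a b) ((ρ b e).comp h.Sinv) = if a = e then h.ε.toLinearMap else 0 := by
    intro a
    ext1 y
    rw [LinearMap.sum_apply, hρ.sum_dconv_Sinv]
    split_ifs <;> rfl
  simp only [this]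
  rw [Finset.sum_eq_single e]
  · rw [if_pos rfl, h.hitR_ε]
  · intro a _ ha
    rw [if_neg ha, h.hitR_zero, zero_mul]
  · simp

theorem antipode_inv_cross (hρ : IsRep ρ) (x : X) (i : ι) :
    (∑ b, d.P b * d.ig q ℓ i b) * d.f (h.Sinv x) =
      ∑ a, d.f (h.Sinv (h.hitL (ρ i a) x)) * ∑ b, d.P b * d.ig q ℓ a b := by
  simp only [Finset.sum_mul, Finset.mul_sum, ← mul_assoc, d.cross]
  have h₁ : ∀ e, d.ig q ℓ i e * d.f (h.Sinv x) =
      ∑ a, ∑ b, d.f (h.hitL (ρ b e) (h.Sinv (h.hitL (ρ i a) x))) * d.ig q ℓ a b := fun e => by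
    have := congrArg (fun z => d.f z * cexp ℓ (-d.Ξ)) (sum_hitL_Sinv_hitL (q := q) hρ i e x)
    simp only [h.Sinv_mul, map_mul, map_sum, Finset.sum_mul, mul_assoc] at this
    simp only [ig, mul_assoc, d.cexp_neg_bg]
    exact this.symm
  simp only [mul_assoc, h₁, Finset.mul_sum]
  rw [Finset.sum_comm]
  exact Finset.sum_congr rfl fun _ _ => Finset.sum_comm

/-- The inverse antipode. -/
def antipodeInv (H : IsCompatible q ρ c ℓ) : BosData h ρ c Zᵐᵒᵖ where
  f := d.antiHom h.Sinv h.Sinv_one h.Sinv_mul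
  P i := MulOpposite.op (-∑ a, d.P a * d.ig q ℓ i a)
  Ξ := MulOpposite.op (-d.Ξ)
  mom k := by
    have := congrArg (MulOpposite.opLinearEquiv K : Z ≃ₗ[K] Zᵐᵒᵖ).toLinearMap
      (d.quadSum_antipode_inv H k)
    rw [map_quadSum] at this
    change quadSum (c k) (fun i j => MulOpposite.op (-_) * MulOpposite.op (-_)) = 0
    simp only [← MulOpposite.op_mul, neg_mul_neg]
    exact this
  dil_bg x := by
    change MulOpposite.op (-d.Ξ) * MulOpposite.op (d.f (h.Sinv x)) =
      MulOpposite.op (d.f (h.Sinv x)) * MulOpposite.op (-d.Ξ)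
    rw [← MulOpposite.op_mul, ← MulOpposite.op_mul, neg_mul, mul_neg, d.dil_bg]
  dil_mom i := by
    rw [← MulOpposite.op_mul, ← MulOpposite.op_mul, ← MulOpposite.op_sub]
    congr 1
    have : d.Ξ * (∑ a, d.P a * d.ig q ℓ i a) = (∑ a, d.P a * d.ig q ℓ i a) * d.Ξ -
        ∑ a, d.P a * d.ig q ℓ i a := by
      rw [Finset.mul_sum, Finset.sum_mul, ← Finset.sum_sub_distrib]
      refine Finset.sum_congr rfl fun a _ => ?_
      have h₁ : d.Ξ * d.ig q ℓ i a = d.ig q ℓ i a * d.Ξ := by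
        rw [ig, ← mul_assoc, d.dil_bg, mul_assoc, mul_assoc,
          semiconj_cexp ℓ (by rw [mul_neg, neg_mul] : d.Ξ * -d.Ξ = -d.Ξ * d.Ξ)]
      rw [← mul_assoc, d.dil_mom, sub_mul, mul_assoc, h₁, mul_assoc]
    simp only [neg_mul_neg, this]
    abel
  cross x i := by
    change MulOpposite.op (d.f (h.Sinv x)) * MulOpposite.op _ =
      ∑ a, MulOpposite.op _ * MulOpposite.op (d.f (h.Sinv (h.hitL (ρ i a) x)))
    simp only [← MulOpposite.op_mul, neg_mul, mul_neg, d.antipode_inv_cross H.rep]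
    simp

end BosData

end QStar
namespace QStar

/-! ### Star structures -/

/-- A real quasitriangular Hopf `*`-algebra structure. -/
structure RealStar {X : Type*} [Ring X] [Algebra K X] [IsAdicComplete tIdeal X] {h : Hopf X}
    (q : QT h) where
  st : X →ₛₗ[conjK] X
  st_st : ∀ x, st (st x) = x
  st_mul : ∀ x y, st (x * y) = st y * st x
  st_Δ : ∀ x, CT.star st (h.Δ x) = h.Δ (st x)
  st_ε : ∀ x, conjK (h.ε x) = h.ε (st x)
  real : CT.star st q.R = CT.swap q.R

/-- The matrix `m` defines a `*`-operation on the momentum generators, compatible with the action. -/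
structure IsStarAction {X ι : Type*} [Ring X] [Algebra K X] [IsAdicComplete tIdeal X] [Fintype ι]
    [DecidableEq ι] {h : Hopf X} {q : QT h} (s : RealStar q) (ρ : ι → ι → X →ₗ[K] K)
    (m : ι → ι → K) : Prop where
  conj_rep : ∀ i b x, ∑ a, conjK (ρ i a x) * m a b = ∑ a, m i a * ρ a b (s.st (h.S x))
  invol : ∀ i b, ∑ a, conjK (m i a) * m a b = if i = b then 1 else 0

theorem star_one_of {A : Type*} [Ring A] [Algebra K A] {st : A →ₛₗ[conjK] A}
    (h₁ : ∀ x, st (st x) = x) (h₂ : ∀ x y, st (x * y) = st y * st x) : st 1 = 1 := by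
  have := h₂ (st 1) 1
  rwa [mul_one, h₁, mul_one, eq_comm] at this

theorem conj_smul_apply {M N : Type*} [AddCommGroup M] [Module K M] [AddCommGroup N] [Module K N]
    (f : M →ₛₗ[conjK] N) (r : K) (x : M) : f (r • x) = conjK r • f x := f.map_smulₛₗ r x

/-- Lets the composite of two conjugate-linear maps be typed as a linear map, so that involutivity
can be tested with the linear extension principles. -/
instance : RingHomCompTriple conjK conjK (RingHom.id K) := ⟨RingHom.ext conjK_conjK⟩

namespace RealStar

variable {X ι κ : Type*} [Ring X] [Algebra K X] [IsAdicComplete tIdeal X] [Fintype ι]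
  [DecidableEq ι] [Fintype κ] {h : Hopf X} {q : QT h} (s : RealStar q) {ρ : ι → ι → X →ₗ[K] K}
  {m : ι → ι → K} {c : κ → ι → ι → K}

theorem st_one : s.st 1 = 1 := star_one_of s.st_st s.st_mul

theorem star_Rinv : CT.star s.st q.Rinv = CT.swap q.Rinv := by
  have h₁ : CT.star s.st q.Rinv * CT.star s.st q.R = 1 := by
    rw [← CT.star_mul s.st s.st_mul, q.mul_inv, CT.star_one s.st s.st_one]
  have h₂ : CT.star s.st q.R * CT.swap q.Rinv = 1 := by
    rw [s.real, ← map_mul, q.mul_inv, map_one]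
  exact left_inv_eq_right_inv h₁ h₂

/-- The condition `conj_rep` replaces the conjugate of `ρ(u₁)` by `ρ((S u₁)^*)`; the product with
`ρ(u₂^*)` is then the matrix of `(S(u₁) u₂)^* = conj ε(u)`. -/
theorem sum_rep_st_hitL (hρ : IsRep ρ) (hm : IsStarAction s ρ m) (i e : ι) (u : X) :
    ∑ a, ∑ b, m a b * ρ b e (s.st (h.hitL (ρ i a) u)) = m i e * conjK (h.ε u) := by
  have key : ∑ a, ∑ b, m a b • ((ρ b e).comp (s.st.comp (CT.sliceL (ρ i a)))) =
      ∑ a', m i a' • ((ρ a' e).comp (s.st.comp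
        (CT.lift ((LinearMap.mul K X).compl₁₂ h.S LinearMap.id)))) := by
    refine CT.conj_ext fun y z => ?_
    simp only [LinearMap.sum_apply, LinearMap.smul_apply, LinearMap.comp_apply, CT.sliceL_tm,
      conj_smul_apply, map_smul, CT.lift_tm, LinearMap.compl₁₂_apply, LinearMap.mul_apply',
      LinearMap.id_apply, s.st_mul, hρ.mul, smul_eq_mul, Finset.mul_sum]
    rw [Finset.sum_comm]
    conv_rhs => rw [Finset.sum_comm]
    refine Finset.sum_congr rfl fun b _ => ?_
    have := congrArg (· * ρ b e (s.st z)) (hm.conj_rep i b y)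
    simp only [Finset.sum_mul] at this
    simpa only [mul_assoc, mul_left_comm] using this
  have := LinearMap.congr_fun key (h.Δ u)
  simp only [LinearMap.sum_apply, LinearMap.smul_apply, LinearMap.comp_apply, h.antipode_left,
    smul_eq_mul] at this
  simp only [Hopf.hitL_apply]
  rw [this]
  simp only [Algebra.algebraMap_eq_smul_one, conj_smul_apply, s.st_one, map_smul, hρ.one]
  simp

/-- As `*` is compatible with `Δ`, only the first leg of `Δ x` is affected, and `sum_rep_st_hitL`
reduces that leg to the counit. -/
theorem sum_hitL_st_hitL (hρ : IsRep ρ) (hm : IsStarAction s ρ m) (i e : ι) (x : X) :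
    ∑ a, ∑ b, m a b • h.hitL (ρ b e) (s.st (h.hitL (ρ i a) x)) = m i e • s.st x := by
  have key : ∑ a, ∑ b, m a b • ((CT.sliceL (ρ b e)).comp ((CT.star s.st).comp
      (CT.lmap (h.hitL (ρ i a)) LinearMap.id))) =
      m i e • (s.st.comp (CT.sliceL h.ε.toLinearMap)) := by
    refine CT.conj_ext fun y z => ?_
    simp only [LinearMap.sum_apply, LinearMap.smul_apply, LinearMap.comp_apply, CT.sliceL_tm,
      conj_smul_apply, CT.lmap_tm, CT.star_tm, LinearMap.id_apply, smul_smul, ← Finset.sum_smul,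
      s.sum_rep_st_hitL hρ hm, AlgHom.toLinearMap_apply]
  have := LinearMap.congr_fun key (h.Δ x)
  simp only [LinearMap.sum_apply, LinearMap.smul_apply, LinearMap.comp_apply, h.counit_left,
    ← h.Δ_hitL, s.st_Δ] at this
  exact this

/-- In the basis of adjoints, conjugating `ρ` amounts to `x ↦ ρ((S x)^*)`. So the sum is a slice of
`(* ⊗ *)(S ⊗ id)𝓡 = (* ⊗ *)𝓡⁻¹`, which by reality is the transposed `𝓡⁻¹`. -/
theorem sum_st_sl (hm : IsStarAction s ρ m) (i e : ι) :
    ∑ a, ∑ b, (conjK (m i a) * m b e) • s.st (q.sl (ρ a b)) = CT.sliceR (ρ i e) q.Rinv := by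
  have key : ∑ a, ∑ b, (conjK (m i a) * m b e) • (s.st.comp (CT.sliceL (ρ a b))) =
      (CT.sliceL (ρ i e)).comp ((CT.star s.st).comp (CT.lmap h.S LinearMap.id)) := by
    refine CT.conj_ext fun y z => ?_
    have h₁ : ∑ a, ∑ b, conjK (m i a) * m b e * conjK (ρ a b y) = ρ i e (s.st (h.S y)) := by
      calc _ = ∑ a, conjK (m i a) * ∑ b, conjK (ρ a b y) * m b e := by
            simp only [Finset.mul_sum]
            exact Finset.sum_congr rfl fun a _ => Finset.sum_congr rfl fun b _ => by ring
        _ = ∑ b, (∑ a, conjK (m i a) * m a b) * ρ b e (s.st (h.S y)) := by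
            simp only [hm.conj_rep, Finset.mul_sum, Finset.sum_mul]
            rw [Finset.sum_comm]
            simp only [mul_assoc]
        _ = _ := by simp [hm.invol]
    simp only [LinearMap.sum_apply, LinearMap.smul_apply, LinearMap.comp_apply, CT.sliceL_tm,
      conj_smul_apply, CT.lmap_tm, CT.star_tm, LinearMap.id_apply, smul_smul, ← Finset.sum_smul, h₁]
  have := LinearMap.congr_fun key q.R
  simp only [LinearMap.sum_apply, LinearMap.smul_apply, LinearMap.comp_apply, q.lmap_S_id,
    s.star_Rinv, Hopf.sliceL_swap] at this
  exact this

end RealStar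

/-! ### The `*`-operation as a realisation in the conjugate opposite algebra -/

namespace BosData

variable {X ι κ : Type*} [Ring X] [Algebra K X] [IsAdicComplete tIdeal X] [Fintype ι]
  [DecidableEq ι] [Fintype κ] {h : Hopf X} {q : QT h} {ρ : ι → ι → X →ₗ[K] K} {c : κ → ι → ι → K}
  {Z : Type*} [Ring Z] [Algebra K Z] (d : BosData h ρ c Z) {m : ι → ι → K}

variable (m) in
/-- The adjoint of a momentum generator. -/
def starP (i : ι) : Z := ∑ a, m i a • d.P a

theorem dil_starP (i : ι) : d.Ξ * d.starP m i = d.starP m i * d.Ξ - d.starP m i := by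
  simp only [starP, Finset.mul_sum, Finset.sum_mul, mul_smul_comm, smul_mul_assoc, d.dil_mom, smul_sub,
    Finset.sum_sub_distrib]

/-- The adjoint of the cross relation, with the adjoint momenta expanded by the original relation;
`RealStar.sum_hitL_st_hitL` is precisely the identity needed. -/
theorem star_cross (s : RealStar q) (hρ : IsRep ρ) (hm : IsStarAction s ρ m) (x : X) (i : ι) :
    d.starP m i * d.f (s.st x) = ∑ a, d.f (s.st (h.hitL (ρ i a) x)) * d.starP m a := by
  simp only [starP, Finset.mul_sum, Finset.sum_mul, mul_smul_comm, smul_mul_assoc, d.cross,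
    Finset.smul_sum]
  have h₁ : ∀ e, ∑ a, ∑ b, m a b • (d.P e * d.f (h.hitL (ρ b e) (s.st (h.hitL (ρ i a) x)))) =
      m i e • (d.P e * d.f (s.st x)) := fun e => by
    have := congrArg (fun z => d.P e * d.f z) (s.sum_hitL_st_hitL hρ hm i e x)
    simpa only [map_sum, map_smul, Finset.mul_sum, mul_smul_comm] using this
  simp only [← h₁]
  rw [Finset.sum_comm]
  exact Finset.sum_congr rfl fun _ _ => Finset.sum_comm

/-- The `*`-structure. -/
def star (s : RealStar q) (hρ : IsRep ρ) (hm : IsStarAction s ρ m)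
    (mom : ∀ k, quadSum (fun i j => conjK (c k i j)) (fun i j => d.starP m j * d.starP m i) = 0) :
    BosData h ρ c (ConjOp Z) where
  f := AlgHom.ofLinearMap (toConjOp.comp (d.f.toLinearMap.comp s.st))
    (by
      change toConjOp (d.f (s.st 1)) = 1
      rw [s.st_one, map_one]
      rfl)
    fun x y => by
      change toConjOp (d.f (s.st (x * y))) = toConjOp (d.f (s.st x)) * toConjOp (d.f (s.st y))
      rw [s.st_mul, map_mul, toConjOp_mul]
  P i := toConjOp (d.starP m i)
  Ξ := toConjOp (-d.Ξ)
  mom k := by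
    have := congrArg toConjOp (mom k)
    rw [map_zero, quadSum] at this
    simpa only [map_sum, conj_smul_apply, conjK_conjK, toConjOp_mul] using this
  dil_bg x := by
    change toConjOp (-d.Ξ) * toConjOp (d.f (s.st x)) = toConjOp (d.f (s.st x)) * toConjOp (-d.Ξ)
    rw [← toConjOp_mul, ← toConjOp_mul, mul_neg, neg_mul, d.dil_bg]
  dil_mom i := by
    rw [← toConjOp_mul, ← toConjOp_mul, ← map_sub, mul_neg, neg_mul, d.dil_starP]
    congr 1
    abel
  cross x i := by
    change toConjOp (d.f (s.st x)) * toConjOp (d.starP m i) =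
      ∑ a, toConjOp (d.starP m a) * toConjOp (d.f (s.st (h.hitL (ρ i a) x)))
    simp only [← toConjOp_mul, ← map_sum, d.star_cross s hρ hm]

end BosData

end QStar
namespace QStar

/-! ### The Hopf algebra structure of the inhomogeneous quantum group -/

section Aux

variable {X Z : Type*} [Ring X] [Algebra K X] [Ring Z] [Algebra K Z]

/-- The completed tensor cube of an algebra map. -/
def CT3.map (f : X →ₐ[K] Z) : CT3 X →ₐ[K] CT3 Z :=
  CT3.liftAlg (e1.comp f) (e2.comp f) (e3.comp f) (fun a b => e1_e2 (f a) (f b))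
    (fun a b => e1_e3 (f a) (f b)) fun a b => e2_e3 (f a) (f b)

@[simp] theorem CT3.map_tm (f : X →ₐ[K] Z) (a b c : X) :
    CT3.map f (tm3 a b c) = tm3 (f a) (f b) (f c) :=
  (CT3.liftAlg_tm _ _ _ _ _ _ a b c).trans (by simp [e1_apply, e2_apply, e3_apply])

theorem CT3.map_l12 (f : X →ₐ[K] Z) (y : CT X X) : CT3.map f (l12 y) = l12 (CT.map f f y) := by
  have : (CT3.map f).toLinearMap.comp l12.toLinearMap =
      l12.toLinearMap.comp (CT.map f f).toLinearMap := by
    ext a b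
    simp
  exact LinearMap.congr_fun this y

theorem CT3.map_l13 (f : X →ₐ[K] Z) (y : CT X X) : CT3.map f (l13 y) = l13 (CT.map f f y) := by
  have : (CT3.map f).toLinearMap.comp l13.toLinearMap =
      l13.toLinearMap.comp (CT.map f f).toLinearMap := by
    ext a b
    simp
  exact LinearMap.congr_fun this y

theorem CT3.map_l23 (f : X →ₐ[K] Z) (y : CT X X) : CT3.map f (l23 y) = l23 (CT.map f f y) := by
  have : (CT3.map f).toLinearMap.comp l23.toLinearMap =
      l23.toLinearMap.comp (CT.map f f).toLinearMap := by
    ext a b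
    simp
  exact LinearMap.congr_fun this y

theorem comulL_map {Δ : X →ₐ[K] CT X X} {Δ' : Z →ₐ[K] CT Z Z} (f : X →ₐ[K] Z)
    (hf : ∀ x, Δ' (f x) = CT.map f f (Δ x)) (y : CT X X) :
    comulL Δ' (CT.map f f y) = CT3.map f (comulL Δ y) := by
  have : (comulL Δ').toLinearMap.comp (CT.map f f).toLinearMap =
      (CT3.map f).toLinearMap.comp (comulL Δ).toLinearMap := by
    ext a b
    simp [hf, CT3.map_l12, e3_apply]
  exact LinearMap.congr_fun this y

theorem comulR_map {Δ : X →ₐ[K] CT X X} {Δ' : Z →ₐ[K] CT Z Z} (f : X →ₐ[K] Z)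
    (hf : ∀ x, Δ' (f x) = CT.map f f (Δ x)) (y : CT X X) :
    comulR Δ' (CT.map f f y) = CT3.map f (comulR Δ y) := by
  have : (comulR Δ').toLinearMap.comp (CT.map f f).toLinearMap =
      (CT3.map f).toLinearMap.comp (comulR Δ).toLinearMap := by
    ext a b
    simp [hf, CT3.map_l23, e1_apply]
  exact LinearMap.congr_fun this y

variable [IsAdicComplete tIdeal Z]

theorem sliceL_algHom_mul (ε : Z →ₐ[K] K) (y z : CT Z Z) :
    CT.sliceL ε.toLinearMap (y * z) = CT.sliceL ε.toLinearMap y * CT.sliceL ε.toLinearMap z :=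
  CT.map_mul_of_pure _ (fun a b a' b' => by simp [smul_smul, mul_comm]) y z

theorem sliceR_algHom_mul (ε : Z →ₐ[K] K) (y z : CT Z Z) :
    CT.sliceR ε.toLinearMap (y * z) = CT.sliceR ε.toLinearMap y * CT.sliceR ε.toLinearMap z :=
  CT.map_mul_of_pure _ (fun a b a' b' => by simp [smul_smul, mul_comm]) y z

/-- With `S` reversing products, `S(z₁w₁) z₂w₂ = S(w₁) (S(z₁) z₂) w₂`, and the bracket is a scalar.
Hence the antipode axiom passes from generators to products. -/
theorem lift_antipode_left_mul {S : Z →ₗ[K] Z} (hS : ∀ x y, S (x * y) = S y * S x) {z : CT Z Z} {r : K}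
    (hz : CT.lift ((LinearMap.mul K Z).compl₁₂ S LinearMap.id) z = algebraMap K Z r) (w : CT Z Z) :
    CT.lift ((LinearMap.mul K Z).compl₁₂ S LinearMap.id) (z * w) =
      r • CT.lift ((LinearMap.mul K Z).compl₁₂ S LinearMap.id) w := by
  have h₁ : ∀ c d, CT.lift ((LinearMap.mul K Z).compl₁₂ S LinearMap.id) (z * c ⊠ d) =
      S c * CT.lift ((LinearMap.mul K Z).compl₁₂ S LinearMap.id) z * d := fun c d => by
    have : (CT.lift ((LinearMap.mul K Z).compl₁₂ S LinearMap.id)).comp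
        (LinearMap.mulRight K (c ⊠ d : CT Z Z)) =
        (LinearMap.mulRight K d).comp ((LinearMap.mulLeft K (S c)).comp
          (CT.lift ((LinearMap.mul K Z).compl₁₂ S LinearMap.id))) := by
      ext a b
      simp [hS, mul_assoc]
    exact LinearMap.congr_fun this z
  have h₂ : (CT.lift ((LinearMap.mul K Z).compl₁₂ S LinearMap.id)).comp (LinearMap.mulLeft K z) =
      r • CT.lift ((LinearMap.mul K Z).compl₁₂ S LinearMap.id) := by
    ext c d
    simp only [LinearMap.compr₂_apply, LinearMap.comp_apply, LinearMap.mulLeft_apply, h₁, hz]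
    simp [Algebra.algebraMap_eq_smul_one]
  exact LinearMap.congr_fun h₂ w

theorem lift_antipode_right_mul {S : Z →ₗ[K] Z} (hS : ∀ x y, S (x * y) = S y * S x) {w : CT Z Z} {r : K}
    (hw : CT.lift ((LinearMap.mul K Z).compl₁₂ LinearMap.id S) w = algebraMap K Z r) (z : CT Z Z) :
    CT.lift ((LinearMap.mul K Z).compl₁₂ LinearMap.id S) (z * w) =
      r • CT.lift ((LinearMap.mul K Z).compl₁₂ LinearMap.id S) z := by
  have h₁ : ∀ c d, CT.lift ((LinearMap.mul K Z).compl₁₂ LinearMap.id S) (c ⊠ d * w) =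
      c * CT.lift ((LinearMap.mul K Z).compl₁₂ LinearMap.id S) w * S d := fun c d => by
    have : (CT.lift ((LinearMap.mul K Z).compl₁₂ LinearMap.id S)).comp
        (LinearMap.mulLeft K (c ⊠ d : CT Z Z)) =
        (LinearMap.mulRight K (S d)).comp ((LinearMap.mulLeft K c).comp
          (CT.lift ((LinearMap.mul K Z).compl₁₂ LinearMap.id S))) := by
      ext a b
      simp [hS, mul_assoc]
    exact LinearMap.congr_fun this w
  have h₂ : (CT.lift ((LinearMap.mul K Z).compl₁₂ LinearMap.id S)).comp (LinearMap.mulRight K w) =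
      r • CT.lift ((LinearMap.mul K Z).compl₁₂ LinearMap.id S) := by
    ext c d
    simp only [LinearMap.compr₂_apply, LinearMap.comp_apply, LinearMap.mulRight_apply, h₁, hw]
    simp [Algebra.algebraMap_eq_smul_one]
  exact LinearMap.congr_fun h₂ z

theorem cexp_op (ℓ : tIdeal) (x : Z) : cexp ℓ (MulOpposite.op x) = MulOpposite.op (cexp ℓ x) :=
  (map_cexp_of (σ := RingHom.id K) (fun _ h => h)
    (MulOpposite.opLinearEquiv K : Z ≃ₗ[K] Zᵐᵒᵖ).toLinearMap fun n => by simp [expSum]).symm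

/-- The two summands commute, so the exponential of a primitive element is group-like. -/
theorem cexp_tm (ℓ : tIdeal) (x y : Z) :
    cexp ℓ (x ⊠ 1 + 1 ⊠ y : CT Z Z) = cexp ℓ x ⊠ cexp ℓ y := by
  rw [← CT.inl_apply, ← CT.inr_apply, cexp_add ℓ (CT.commute x y), ← map_cexp, ← map_cexp,
    CT.inl_apply, CT.inr_apply]
  simp

end Aux

namespace BosData

variable {X ι κ : Type*} [Ring X] [Algebra K X] [IsAdicComplete tIdeal X] [Fintype ι]
  [DecidableEq ι] [Fintype κ] {h : Hopf X} {q : QT h} {ρ : ι → ι → X →ₗ[K] K} {c : κ → ι → ι → K}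
  {ℓ : tIdeal} {Z : Type*} [Ring Z] [Algebra K Z] [IsAdicComplete tIdeal Z] (d : BosData h ρ c Z)

theorem sum_sl_mul_S_sl (hρ : IsRep ρ) (i b : ι) :
    ∑ e, q.sl (ρ i e) * h.S (q.sl (ρ e b)) = if i = b then 1 else 0 := by
  have := h.antipode_right (q.sl (ρ i b))
  rw [q.Δ_sl hρ, q.ε_sl hρ] at this
  rw [map_sum] at this
  simp only [CT.lift_tm, LinearMap.compl₁₂_apply, LinearMap.mul_apply', LinearMap.id_apply] at this
  rw [this]
  split_ifs <;> simp

theorem sum_g_mul_sg (hρ : IsRep ρ) (i b : ι) :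
    ∑ e, d.g q ℓ i e * d.sg q ℓ e b = if i = b then 1 else 0 := by
  have := congrArg d.f (sum_sl_mul_S_sl (q := q) hρ i b)
  rw [map_sum] at this
  have h₁ : ∀ e, d.g q ℓ i e * d.sg q ℓ e b = d.f (q.sl (ρ i e) * h.S (q.sl (ρ e b))) := fun e => by
    rw [g, sg, d.cexp_bg, map_mul, mul_assoc, ← mul_assoc (cexp ℓ _), cexp_mul_neg, one_mul]
  simp only [h₁, this]
  split_ifs <;> simp

theorem sum_ig_mul_g (hρ : IsRep ρ) (i b : ι) :
    ∑ e, d.ig q ℓ e b * d.g q ℓ i e = if i = b then 1 else 0 := by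
  have := congrArg d.f (sum_Sinv_sl_mul_sl (q := q) hρ i b)
  rw [map_sum] at this
  have h₁ : ∀ e, d.ig q ℓ e b * d.g q ℓ i e = d.f (h.Sinv (q.sl (ρ e b)) * q.sl (ρ i e)) := fun e => by
    rw [g, ig, map_mul, mul_assoc, ← mul_assoc (cexp ℓ _), cexp_neg_mul, one_mul]
  simp only [h₁, this]
  split_ifs <;> simp

end BosData

namespace BB

variable {X ι κ : Type*} [Ring X] [Algebra K X] [IsAdicComplete tIdeal X] [Fintype ι]
  [DecidableEq ι] [Fintype κ] {h : Hopf X} {q : QT h} {ρ : ι → ι → X →ₗ[K] K}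
  {rel : FreeAlgebra K ι → FreeAlgebra K ι → Prop} {c : κ → ι → ι → K} {ℓ : tIdeal}
  (hc : IsQuadratic rel c) (H : IsCompatible q ρ c ℓ)

/-- The coproduct. -/
def Δ : BB h ρ rel →ₐ[K] CT (BB h ρ rel) (BB h ρ rel) := ((BB.gen h ρ rel hc).comul H).lift hc

/-- The counit. -/
def ε : BB h ρ rel →ₐ[K] K := (BosData.counit h ρ c).lift hc

/-- The antipode. -/
def S : BB h ρ rel →ₗ[K] BB h ρ rel :=
  (MulOpposite.opLinearEquiv K).symm.toLinearMap.comp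
    (((BB.gen h ρ rel hc).antipode H).lift hc).toLinearMap

/-- The inverse antipode. -/
def T : BB h ρ rel →ₗ[K] BB h ρ rel :=
  (MulOpposite.opLinearEquiv K).symm.toLinearMap.comp
    (((BB.gen h ρ rel hc).antipodeInv H).lift hc).toLinearMap

theorem Δ_bg (x : X) : Δ hc H ((BB.gen h ρ rel hc).f x) =
    CT.map (BB.gen h ρ rel hc).f (BB.gen h ρ rel hc).f (h.Δ x) := BosData.lift_bg hc _ x

theorem Δ_mom (i : ι) : Δ hc H ((BB.gen h ρ rel hc).P i) = (BB.gen h ρ rel hc).P i ⊠ 1 +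
    ∑ a, (BB.gen h ρ rel hc).g q ℓ i a ⊠ (BB.gen h ρ rel hc).P a := BosData.lift_mom hc _ i

theorem Δ_dil : Δ hc H (BB.gen h ρ rel hc).Ξ = (BB.gen h ρ rel hc).Ξ ⊠ 1 + 1 ⊠ (BB.gen h ρ rel hc).Ξ :=
  BosData.lift_dil hc _

theorem ε_bg (x : X) : ε (h := h) (ρ := ρ) hc ((BB.gen h ρ rel hc).f x) = h.ε x := BosData.lift_bg hc _ x

theorem ε_mom (i : ι) : ε (h := h) (ρ := ρ) hc ((BB.gen h ρ rel hc).P i) = 0 := BosData.lift_mom hc _ i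

theorem ε_dil : ε (h := h) (ρ := ρ) hc (BB.gen h ρ rel hc).Ξ = 0 := BosData.lift_dil hc _

theorem S_bg (x : X) : S hc H ((BB.gen h ρ rel hc).f x) = (BB.gen h ρ rel hc).f (h.S x) :=
  congrArg MulOpposite.unop (BosData.lift_bg hc ((BB.gen h ρ rel hc).antipode H) x)

theorem S_mom (i : ι) : S hc H ((BB.gen h ρ rel hc).P i) =
    -∑ a, (BB.gen h ρ rel hc).sg q ℓ i a * (BB.gen h ρ rel hc).P a :=
  congrArg MulOpposite.unop (BosData.lift_mom hc ((BB.gen h ρ rel hc).antipode H) i)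

theorem S_dil : S hc H (BB.gen h ρ rel hc).Ξ = -(BB.gen h ρ rel hc).Ξ :=
  congrArg MulOpposite.unop (BosData.lift_dil hc ((BB.gen h ρ rel hc).antipode H))

theorem S_mul (x y : BB h ρ rel) : S hc H (x * y) = S hc H y * S hc H x :=
  congrArg MulOpposite.unop (map_mul (((BB.gen h ρ rel hc).antipode H).lift hc) x y)

theorem S_one : S hc H 1 = 1 :=
  congrArg MulOpposite.unop (map_one (((BB.gen h ρ rel hc).antipode H).lift hc))

theorem S_cexp (x : BB h ρ rel) : S hc H (cexp ℓ x) = cexp ℓ (S hc H x) := by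
  have := map_cexp (((BB.gen h ρ rel hc).antipode H).lift hc) ℓ x
  refine congrArg MulOpposite.unop (this.trans ?_)
  exact cexp_op ℓ (S hc H x)

theorem T_bg (x : X) : T hc H ((BB.gen h ρ rel hc).f x) = (BB.gen h ρ rel hc).f (h.Sinv x) :=
  congrArg MulOpposite.unop (BosData.lift_bg hc ((BB.gen h ρ rel hc).antipodeInv H) x)

theorem T_mom (i : ι) : T hc H ((BB.gen h ρ rel hc).P i) =
    -∑ a, (BB.gen h ρ rel hc).P a * (BB.gen h ρ rel hc).ig q ℓ i a :=
  congrArg MulOpposite.unop (BosData.lift_mom hc ((BB.gen h ρ rel hc).antipodeInv H) i)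

theorem T_dil : T hc H (BB.gen h ρ rel hc).Ξ = -(BB.gen h ρ rel hc).Ξ :=
  congrArg MulOpposite.unop (BosData.lift_dil hc ((BB.gen h ρ rel hc).antipodeInv H))

theorem T_mul (x y : BB h ρ rel) : T hc H (x * y) = T hc H y * T hc H x :=
  congrArg MulOpposite.unop (map_mul (((BB.gen h ρ rel hc).antipodeInv H).lift hc) x y)

theorem T_one : T hc H 1 = 1 :=
  congrArg MulOpposite.unop (map_one (((BB.gen h ρ rel hc).antipodeInv H).lift hc))

theorem T_cexp (x : BB h ρ rel) : T hc H (cexp ℓ x) = cexp ℓ (T hc H x) := by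
  have := map_cexp (((BB.gen h ρ rel hc).antipodeInv H).lift hc) ℓ x
  refine congrArg MulOpposite.unop (this.trans ?_)
  exact cexp_op ℓ (T hc H x)

theorem S_g (i a : ι) : S hc H ((BB.gen h ρ rel hc).g q ℓ i a) = (BB.gen h ρ rel hc).sg q ℓ i a := by
  rw [BosData.g, S_mul, S_bg, S_cexp, S_dil, BosData.sg, BosData.cexp_neg_bg]

theorem S_ig (i a : ι) : S hc H ((BB.gen h ρ rel hc).ig q ℓ i a) = (BB.gen h ρ rel hc).g q ℓ i a := by
  rw [BosData.ig, S_mul, S_bg, S_cexp, map_neg, S_dil, h.S_Sinv, BosData.g, neg_neg]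

theorem T_sg (i a : ι) : T hc H ((BB.gen h ρ rel hc).sg q ℓ i a) = (BB.gen h ρ rel hc).g q ℓ i a := by
  rw [BosData.sg, T_mul, T_bg, T_cexp, map_neg, T_dil, h.Sinv_S, BosData.g, neg_neg,
    BosData.cexp_bg]

/-- The group-like factor `λ^ξ` does not disturb the matrix coproduct of the slices; this is what
makes the coproduct of `p` coassociative. -/
theorem Δ_g (i a : ι) : Δ hc H ((BB.gen h ρ rel hc).g q ℓ i a) =
    ∑ e, (BB.gen h ρ rel hc).g q ℓ i e ⊠ (BB.gen h ρ rel hc).g q ℓ e a := by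
  rw [BosData.g, map_mul, map_cexp, Δ_dil, cexp_tm, Δ_bg, q.Δ_sl H.rep]
  simp [Finset.mul_sum, BosData.g]

theorem ε_g (hρ : IsRep ρ) (i a : ι) : ε (h := h) (ρ := ρ) hc ((BB.gen h ρ rel hc).g q ℓ i a) = if i = a then 1 else 0 := by
  rw [BosData.g, map_mul, map_cexp, ε_dil, cexp_zero, ε_bg, q.ε_sl hρ, one_mul]

theorem coassoc (x : BB h ρ rel) : comulL (Δ hc H) (Δ hc H x) = comulR (Δ hc H) (Δ hc H x) := by
  have : (comulL (Δ hc H)).comp (Δ hc H) = (comulR (Δ hc H)).comp (Δ hc H) := by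
    refine BB.algHom_ext hc (fun x => ?_) (fun i => ?_) ?_
    · simp only [AlgHom.comp_apply]
      rw [Δ_bg, comulL_map _ (Δ_bg hc H), comulR_map _ (Δ_bg hc H), h.coassoc]
    · simp only [AlgHom.comp_apply]
      simp only [Δ_mom, map_add, map_sum, comulL_tm, comulR_tm, Δ_g, map_one, e1_apply, e3_apply, l12_tm,
        l23_tm, mul_one, Finset.sum_mul, Finset.mul_sum, mul_add, tm3_mul_tm3, one_mul,
        Finset.sum_add_distrib]
      rw [add_assoc]
      congr 2
      exact Finset.sum_comm
    · simp only [AlgHom.comp_apply]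
      simp only [Δ_dil, map_add, comulL_tm, comulR_tm, map_one, e1_apply, e3_apply, l12_tm, l23_tm,
        mul_one, one_mul, mul_add]
      rw [add_assoc]
  exact AlgHom.congr_fun this x

theorem counit_left (x : BB h ρ rel) : CT.sliceL (ε (h := h) (ρ := ρ) hc).toLinearMap (Δ hc H x) = x := by
  have : (CT.sliceL (ε (h := h) (ρ := ρ) hc).toLinearMap).comp (Δ hc H).toLinearMap = LinearMap.id := by
    refine BB.linear_ext hc ?_ (fun x y hx hy => ?_) (fun x => ?_) (fun i => ?_) ?_
    · simp [CT.one_def]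
    · simp only [LinearMap.comp_apply, AlgHom.toLinearMap_apply, LinearMap.id_apply] at hx hy ⊢
      rw [map_mul, sliceL_algHom_mul, hx, hy]
    · simp only [LinearMap.comp_apply, AlgHom.toLinearMap_apply, LinearMap.id_apply]
      rw [Δ_bg]
      have : (CT.sliceL (ε (h := h) (ρ := ρ) hc).toLinearMap).comp
          (CT.map (BB.gen h ρ rel hc).f (BB.gen h ρ rel hc).f).toLinearMap =
          (BB.gen h ρ rel hc).f.toLinearMap.comp (CT.sliceL h.ε.toLinearMap) := by
        ext a b
        simp [ε_bg]
      exact (LinearMap.congr_fun this (h.Δ x)).trans (congrArg (BB.gen h ρ rel hc).f (h.counit_left x))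
    · simp only [LinearMap.comp_apply, AlgHom.toLinearMap_apply, LinearMap.id_apply]
      rw [Δ_mom]
      simp [ε_mom, ε_g hc H.rep]
    · simp only [LinearMap.comp_apply, AlgHom.toLinearMap_apply, LinearMap.id_apply]
      rw [Δ_dil]
      simp [ε_dil]
  exact LinearMap.congr_fun this x

theorem counit_right (x : BB h ρ rel) : CT.sliceR (ε (h := h) (ρ := ρ) hc).toLinearMap (Δ hc H x) = x := by
  have : (CT.sliceR (ε (h := h) (ρ := ρ) hc).toLinearMap).comp (Δ hc H).toLinearMap = LinearMap.id := by
    refine BB.linear_ext hc ?_ (fun x y hx hy => ?_) (fun x => ?_) (fun i => ?_) ?_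
    · simp [CT.one_def]
    · simp only [LinearMap.comp_apply, AlgHom.toLinearMap_apply, LinearMap.id_apply] at hx hy ⊢
      rw [map_mul, sliceR_algHom_mul, hx, hy]
    · simp only [LinearMap.comp_apply, AlgHom.toLinearMap_apply, LinearMap.id_apply]
      rw [Δ_bg]
      have : (CT.sliceR (ε (h := h) (ρ := ρ) hc).toLinearMap).comp
          (CT.map (BB.gen h ρ rel hc).f (BB.gen h ρ rel hc).f).toLinearMap =
          (BB.gen h ρ rel hc).f.toLinearMap.comp (CT.sliceR h.ε.toLinearMap) := by
        ext a b
        simp [ε_bg]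
      exact (LinearMap.congr_fun this (h.Δ x)).trans (congrArg (BB.gen h ρ rel hc).f (h.counit_right x))
    · simp only [LinearMap.comp_apply, AlgHom.toLinearMap_apply, LinearMap.id_apply]
      rw [Δ_mom]
      simp [ε_mom]
    · simp only [LinearMap.comp_apply, AlgHom.toLinearMap_apply, LinearMap.id_apply]
      rw [Δ_dil]
      simp [ε_dil]
  exact LinearMap.congr_fun this x

theorem antipode_left (x : BB h ρ rel) :
    CT.lift ((LinearMap.mul K (BB h ρ rel)).compl₁₂ (S hc H) LinearMap.id) (Δ hc H x) =
      algebraMap K (BB h ρ rel) (ε hc x) := by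
  have : (CT.lift ((LinearMap.mul K (BB h ρ rel)).compl₁₂ (S hc H) LinearMap.id)).comp
      (Δ hc H).toLinearMap = (Algebra.linearMap K (BB h ρ rel)).comp (ε hc).toLinearMap := by
    refine BB.linear_ext hc ?_ (fun x y hx hy => ?_) (fun x => ?_) (fun i => ?_) ?_ <;>
      simp only [LinearMap.comp_apply, AlgHom.toLinearMap_apply, Algebra.linearMap_apply] at *
    · simp [CT.one_def, S_one]
    · rw [map_mul, lift_antipode_left_mul (S_mul hc H) hx, hy, map_mul, map_mul, Algebra.smul_def]
    · rw [Δ_bg, ε_bg]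
      have : (CT.lift ((LinearMap.mul K (BB h ρ rel)).compl₁₂ (S hc H) LinearMap.id)).comp
          (CT.map (BB.gen h ρ rel hc).f (BB.gen h ρ rel hc).f).toLinearMap =
          (BB.gen h ρ rel hc).f.toLinearMap.comp
            (CT.lift ((LinearMap.mul K X).compl₁₂ h.S LinearMap.id)) := by
        ext a b
        simp [S_bg]
      refine (LinearMap.congr_fun this (h.Δ x)).trans ?_
      rw [LinearMap.comp_apply, h.antipode_left]
      simp
    · rw [Δ_mom, ε_mom]
      simp [S_mom, S_g]
    · rw [Δ_dil, ε_dil]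
      simp [S_dil, S_one]
  exact LinearMap.congr_fun this x

theorem antipode_right (x : BB h ρ rel) :
    CT.lift ((LinearMap.mul K (BB h ρ rel)).compl₁₂ LinearMap.id (S hc H)) (Δ hc H x) =
      algebraMap K (BB h ρ rel) (ε hc x) := by
  have : (CT.lift ((LinearMap.mul K (BB h ρ rel)).compl₁₂ LinearMap.id (S hc H))).comp
      (Δ hc H).toLinearMap = (Algebra.linearMap K (BB h ρ rel)).comp (ε hc).toLinearMap := by
    refine BB.linear_ext hc ?_ (fun x y hx hy => ?_) (fun x => ?_) (fun i => ?_) ?_ <;>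
      simp only [LinearMap.comp_apply, AlgHom.toLinearMap_apply, Algebra.linearMap_apply] at *
    · simp [CT.one_def, S_one]
    · rw [map_mul, lift_antipode_right_mul (S_mul hc H) hy, hx, map_mul, Algebra.smul_def, ← map_mul,
        mul_comm]
    · rw [Δ_bg, ε_bg]
      have : (CT.lift ((LinearMap.mul K (BB h ρ rel)).compl₁₂ LinearMap.id (S hc H))).comp
          (CT.map (BB.gen h ρ rel hc).f (BB.gen h ρ rel hc).f).toLinearMap =
          (BB.gen h ρ rel hc).f.toLinearMap.comp
            (CT.lift ((LinearMap.mul K X).compl₁₂ LinearMap.id h.S)) := by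
        ext a b
        simp [S_bg]
      refine (LinearMap.congr_fun this (h.Δ x)).trans ?_
      rw [LinearMap.comp_apply, h.antipode_right]
      simp
    · rw [Δ_mom, ε_mom]
      have : ∑ a, (BB.gen h ρ rel hc).g q ℓ i a * ∑ b, (BB.gen h ρ rel hc).sg q ℓ a b * (BB.gen h ρ rel hc).P b =
          (BB.gen h ρ rel hc).P i := by
        simp only [Finset.mul_sum, ← mul_assoc]
        rw [Finset.sum_comm]
        simp only [← Finset.sum_mul, BosData.sum_g_mul_sg _ H.rep]
        simp
      simp [S_mom, S_one, this]
    · rw [Δ_dil, ε_dil]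
      simp [S_dil, S_one]
  exact LinearMap.congr_fun this x

/-- Bijectivity of the antipode is obtained from an explicit inverse. The composite is
multiplicative, and on momenta it reduces to `g` being inverse to its antipode. -/
theorem S_T (x : BB h ρ rel) : S hc H (T hc H x) = x := by
  have : (S hc H).comp (T hc H) = LinearMap.id := by
    refine BB.linear_ext hc ?_ (fun x y hx hy => ?_) (fun x => ?_) (fun i => ?_) ?_ <;>
      simp only [LinearMap.comp_apply, LinearMap.id_apply] at *
    · rw [T_one, S_one]
    · rw [T_mul, S_mul, hx, hy]
    · rw [T_bg, S_bg, h.S_Sinv]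
    · rw [T_mom, map_neg, map_sum]
      simp only [S_mul, S_ig, S_mom, mul_neg, Finset.sum_neg_distrib, neg_neg, Finset.mul_sum,
        ← mul_assoc]
      rw [Finset.sum_comm]
      simp only [← Finset.sum_mul, BosData.sum_g_mul_sg _ H.rep]
      simp
    · rw [T_dil, map_neg, S_dil, neg_neg]
  exact LinearMap.congr_fun this x

theorem T_S (x : BB h ρ rel) : T hc H (S hc H x) = x := by
  have : (T hc H).comp (S hc H) = LinearMap.id := by
    refine BB.linear_ext hc ?_ (fun x y hx hy => ?_) (fun x => ?_) (fun i => ?_) ?_ <;>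
      simp only [LinearMap.comp_apply, LinearMap.id_apply] at *
    · rw [S_one, T_one]
    · rw [S_mul, T_mul, hx, hy]
    · rw [S_bg, T_bg, h.Sinv_S]
    · rw [S_mom, map_neg, map_sum]
      simp only [T_mul, T_sg, T_mom, neg_mul, Finset.sum_neg_distrib, neg_neg, Finset.sum_mul,
        mul_assoc]
      rw [Finset.sum_comm]
      simp only [← Finset.mul_sum, BosData.sum_ig_mul_g _ H.rep]
      simp
    · rw [S_dil, map_neg, T_dil, neg_neg]
  exact LinearMap.congr_fun this x

/-- The Hopf algebra structure of the inhomogeneous quantum group. -/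
def hopf : Hopf (BB h ρ rel) where
  Δ := Δ hc H
  ε := ε hc
  S := S hc H
  coassoc := coassoc hc H
  counit_left := counit_left hc H
  counit_right := counit_right hc H
  antipode_left := antipode_left hc H
  antipode_right := antipode_right hc H
  S_bijective := ⟨Function.LeftInverse.injective (T_S hc H), Function.RightInverse.surjective (S_T hc H)⟩

end BB

end QStar
namespace QStar

/-! ### The quasi-`*` structure of the inhomogeneous quantum group -/

namespace QT

variable {X : Type*} [Ring X] [Algebra K X] [IsAdicComplete tIdeal X] {h : Hopf X} (q : QT h)

/-- Contract the first leg of `(Δ ⊗ id)𝓡 = 𝓡₁₃𝓡₂₃` with `f`. -/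
theorem lmap_hitL_id (f : X →ₗ[K] K) :
    CT.lmap (h.hitL f) LinearMap.id q.R = (1 ⊠ q.sl f : CT X X) * q.R := by
  rw [← h.slice1_comulL, q.comulL_R]
  exact trilinear_l13_l23
    (G := (LinearMap.mul K (CT X X)).compl₁₂ (CT.inr.toLinearMap.comp (CT.sliceL f)) LinearMap.id)
    (fun a c a' c' => by simp [CT.inr_apply]) q.R q.R

theorem lmap_id_hitL (f : X →ₗ[K] K) :
    CT.lmap LinearMap.id (h.hitL f) q.R = q.R * (CT.sliceR f q.R ⊠ 1 : CT X X) := by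
  rw [← h.slice2_comulR, q.comulR_R]
  exact trilinear_l13_l12
    (G := (LinearMap.mul K (CT X X)).compl₁₂ LinearMap.id (CT.inl.toLinearMap.comp (CT.sliceR f)))
    (fun a c a' c' => by simp [CT.inl_apply]) q.R q.R

end QT

namespace BosData

variable {X ι κ : Type*} [Ring X] [Algebra K X] [IsAdicComplete tIdeal X] [Fintype ι]
  [DecidableEq ι] [Fintype κ] {h : Hopf X} {q : QT h} {ρ : ι → ι → X →ₗ[K] K} {c : κ → ι → ι → K}
  {ℓ : tIdeal} {Z : Type*} [Ring Z] [Algebra K Z] [IsAdicComplete tIdeal Z] (d : BosData h ρ c Z)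

variable (q ℓ) in
/-- The quasitriangular structure of the extended background quantum group. -/
def dilR : CT Z Z := CT.map d.f d.f q.R * cexp (-ℓ) (d.Ξ ⊠ d.Ξ)

variable (q ℓ) in
/-- The inverse of `dilR`. -/
def dilRinv : CT Z Z := cexp ℓ (d.Ξ ⊠ d.Ξ) * CT.map d.f d.f q.Rinv

theorem dilR_mul_inv : d.dilR q ℓ * d.dilRinv q ℓ = 1 := by
  rw [dilR, dilRinv, mul_assoc, ← mul_assoc (cexp (-ℓ) _), cexp_neg_left, cexp_neg_mul, one_mul,
    ← map_mul, q.mul_inv, map_one]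

theorem dilRinv_mul : d.dilRinv q ℓ * d.dilR q ℓ = 1 := by
  rw [dilR, dilRinv, mul_assoc, ← mul_assoc (CT.map _ _ _), ← map_mul, q.inv_mul, map_one, one_mul,
    cexp_neg_left, cexp_mul_neg]

theorem map_comm_of {w : CT Z Z} (h₁ : ∀ x, w * d.f x ⊠ 1 = d.f x ⊠ 1 * w)
    (h₂ : ∀ x, w * 1 ⊠ d.f x = 1 ⊠ d.f x * w) (y : CT X X) :
    CT.map d.f d.f y * w = w * CT.map d.f d.f y :=
  commute_of_pure (CT.map d.f d.f) (y := w)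
    (fun b => by simpa [CT.inl_apply, Commute, SemiconjBy] using (h₁ b).symm)
    (fun b => by simpa [CT.inr_apply, Commute, SemiconjBy] using (h₂ b).symm) y

theorem map_mul_exp (ℓ : tIdeal) (y : CT X X) :
    CT.map d.f d.f y * cexp ℓ (d.Ξ ⊠ d.Ξ) = cexp ℓ (d.Ξ ⊠ d.Ξ) * CT.map d.f d.f y :=
  semiconj_cexp ℓ (d.map_comm_of (by simp [d.dil_bg]) (by simp [d.dil_bg]) y)

/-- Since `(ξ ⊗ ξ)(p ⊗ 1) = (p ⊗ 1)(ξ ⊗ ξ - 1 ⊗ ξ)`, exponentiating with `-ℓ` leaves a factor `λ^ξ`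
in the second tensorand: exactly the one in `g`. -/
theorem exp_mom_left (i : ι) : cexp (-ℓ) (d.Ξ ⊠ d.Ξ) * (d.P i ⊠ 1 : CT Z Z) =
    d.P i ⊠ 1 * cexp (-ℓ) (d.Ξ ⊠ d.Ξ) * 1 ⊠ cexp ℓ d.Ξ := by
  have h₁ : (d.P i ⊠ 1 : CT Z Z) * (d.Ξ ⊠ d.Ξ + -(1 ⊠ d.Ξ)) = d.Ξ ⊠ d.Ξ * d.P i ⊠ 1 := by
    simp [mul_add, d.dil_mom, sub_eq_add_neg]
  have h₂ : Commute (d.Ξ ⊠ d.Ξ : CT Z Z) (-(1 ⊠ d.Ξ)) := by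
    simp [Commute, SemiconjBy]
  rw [← semiconj_cexp (-ℓ) h₁, cexp_add _ h₂, mul_assoc, cexp_neg_left ℓ (-_), neg_neg,
    ← CT.inr_apply, ← CT.inr_apply, map_cexp]

theorem exp_mom_right (i : ι) : cexp (-ℓ) (d.Ξ ⊠ d.Ξ) * (1 ⊠ d.P i : CT Z Z) =
    1 ⊠ d.P i * cexp (-ℓ) (d.Ξ ⊠ d.Ξ) * cexp ℓ d.Ξ ⊠ 1 := by
  have h₁ : (1 ⊠ d.P i : CT Z Z) * (d.Ξ ⊠ d.Ξ + -(d.Ξ ⊠ 1)) = d.Ξ ⊠ d.Ξ * 1 ⊠ d.P i := by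
    simp [mul_add, d.dil_mom, sub_eq_add_neg]
  have h₂ : Commute (d.Ξ ⊠ d.Ξ : CT Z Z) (-(d.Ξ ⊠ 1)) := by
    simp [Commute, SemiconjBy]
  rw [← semiconj_cexp (-ℓ) h₁, cexp_add _ h₂, mul_assoc, cexp_neg_left ℓ (-_), neg_neg,
    ← CT.inl_apply, ← CT.inl_apply, map_cexp]

theorem dilR_comm_right : d.dilR q ℓ * (1 ⊠ cexp ℓ d.Ξ : CT Z Z) = 1 ⊠ cexp ℓ d.Ξ * d.dilR q ℓ := by
  have h₁ : (1 ⊠ cexp ℓ d.Ξ : CT Z Z) * cexp (-ℓ) (d.Ξ ⊠ d.Ξ) =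
      cexp (-ℓ) (d.Ξ ⊠ d.Ξ) * 1 ⊠ cexp ℓ d.Ξ := by
    refine semiconj_cexp _ ?_
    have : d.Ξ * cexp ℓ d.Ξ = cexp ℓ d.Ξ * d.Ξ := semiconj_cexp ℓ rfl
    simp [this]
  rw [dilR, mul_assoc, ← h₁, ← mul_assoc, d.map_comm_of, mul_assoc] <;> simp [d.cexp_bg]

theorem map_mul_mom_tm_right (i : ι) (y : CT X X) : CT.map d.f d.f y * 1 ⊠ d.P i =
    ∑ a, (1 ⊠ d.P a : CT Z Z) * CT.map d.f d.f (CT.lmap LinearMap.id (h.hitL (ρ i a)) y) := by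
  have : (LinearMap.mulRight K (1 ⊠ d.P i : CT Z Z)).comp (CT.map d.f d.f).toLinearMap =
      ∑ a, (LinearMap.mulLeft K (1 ⊠ d.P a : CT Z Z)).comp ((CT.map d.f d.f).toLinearMap.comp
        (CT.lmap LinearMap.id (h.hitL (ρ i a)))) := by
    ext x z
    simp [d.cross]
  simpa using LinearMap.congr_fun this y

/-- The exponential supplies the `λ^ξ` and the hexagon for `Δ ⊗ id` supplies the slice of `𝓡`;
together they form `g` in the second factor. -/
theorem dilR_mul_mom_left (i : ι) :
    d.dilR q ℓ * (d.P i ⊠ 1 : CT Z Z) = ∑ a, d.P a ⊠ d.g q ℓ i a * d.dilR q ℓ := by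
  have h₁ : ∀ a, (d.P a ⊠ d.g q ℓ i a : CT Z Z) = d.P a ⊠ 1 * 1 ⊠ d.f (q.sl (ρ i a)) * 1 ⊠ cexp ℓ d.Ξ :=
    fun a => by simp [g, d.cexp_bg]
  conv_lhs => rw [dilR, mul_assoc, d.exp_mom_left, mul_assoc (_ ⊠ _), ← mul_assoc, d.map_mul_mom_tm,
    Finset.sum_mul]
  refine Finset.sum_congr rfl fun a _ => ?_
  rw [h₁, mul_assoc _ _ (d.dilR q ℓ), ← d.dilR_comm_right, q.lmap_hitL_id, map_mul, CT.map_tm, dilR,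
    map_one d.f]
  simp only [mul_assoc]

/-- Here the hexagon for `id ⊗ Δ` leaves the slice to the right of `𝓡`, where it can meet its
inverse in `dilR_mul_star_mom`. -/
theorem dilR_mul_mom_right (i : ι) : d.dilR q ℓ * (1 ⊠ d.P i : CT Z Z) =
    ∑ a, 1 ⊠ d.P a * d.dilR q ℓ * (d.f (CT.sliceR (ρ i a) q.R) * cexp ℓ d.Ξ) ⊠ 1 := by
  have h₁ : ∀ a, ((d.f (CT.sliceR (ρ i a) q.R) * cexp ℓ d.Ξ) ⊠ 1 : CT Z Z) =
      d.f (CT.sliceR (ρ i a) q.R) ⊠ 1 * cexp ℓ d.Ξ ⊠ 1 := fun a => by simp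
  have h₂ : ∀ x, (d.f x ⊠ 1 : CT Z Z) * cexp (-ℓ) (d.Ξ ⊠ d.Ξ) = cexp (-ℓ) (d.Ξ ⊠ d.Ξ) * d.f x ⊠ 1 :=
    fun x => semiconj_cexp _ (by simp [d.dil_bg])
  conv_lhs => rw [dilR, mul_assoc, d.exp_mom_right, mul_assoc (_ ⊠ _), ← mul_assoc,
    d.map_mul_mom_tm_right, Finset.sum_mul]
  refine Finset.sum_congr rfl fun a _ => ?_
  rw [h₁, q.lmap_id_hitL, map_mul, CT.map_tm, dilR, map_one d.f]
  simp only [mul_assoc]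
  rw [← mul_assoc (_ ⊠ _) (cexp (-ℓ) _), h₂]
  simp only [mul_assoc]

theorem sum_sliceR_mul_inv (hρ : IsRep ρ) (i e : ι) :
    ∑ c, CT.sliceR (ρ c e) q.R * CT.sliceR (ρ i c) q.Rinv = if i = e then 1 else 0 := by
  rw [← hρ.sliceR_mul, q.mul_inv, CT.one_def, CT.sliceR_tm, hρ.one]
  split_ifs <;> simp

/-- The term `p ⊗ 1` turns into the flipped `g ⊗ p`. In the other terms the slice of `𝓡` left over
on the right cancels the slice of `𝓡⁻¹`, and `λ^ξ` cancels `λ^{-ξ}`, so `1 ⊗ p` remains. -/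
theorem dilR_mul_star_mom (hρ : IsRep ρ) (i : ι) :
    d.dilR q ℓ * (d.P i ⊠ 1 + ∑ a, (d.f (CT.sliceR (ρ i a) q.Rinv) * cexp ℓ (-d.Ξ)) ⊠ d.P a : CT Z Z) =
      (1 ⊠ d.P i + ∑ a, d.P a ⊠ d.g q ℓ i a) * d.dilR q ℓ := by
  have h₁ : ∀ a, ((d.f (CT.sliceR (ρ i a) q.Rinv) * cexp ℓ (-d.Ξ)) ⊠ d.P a : CT Z Z) =
      1 ⊠ d.P a * (d.f (CT.sliceR (ρ i a) q.Rinv) * cexp ℓ (-d.Ξ)) ⊠ 1 := fun a => by simp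
  have h₂ : ∀ a e, (d.f (CT.sliceR (ρ a e) q.R) * cexp ℓ d.Ξ) *
      (d.f (CT.sliceR (ρ i a) q.Rinv) * cexp ℓ (-d.Ξ)) =
      d.f (CT.sliceR (ρ a e) q.R * CT.sliceR (ρ i a) q.Rinv) := fun a e => by
    rw [← d.cexp_neg_bg, map_mul, mul_assoc, ← mul_assoc (cexp ℓ _), cexp_mul_neg, one_mul]
  have h₃ : ∑ a, d.dilR q ℓ * ((d.f (CT.sliceR (ρ i a) q.Rinv) * cexp ℓ (-d.Ξ)) ⊠ d.P a : CT Z Z) =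
      1 ⊠ d.P i * d.dilR q ℓ := by
    simp only [h₁, ← mul_assoc (d.dilR q ℓ), d.dilR_mul_mom_right, Finset.sum_mul]
    rw [Finset.sum_comm]
    simp only [mul_assoc (_ * d.dilR q ℓ), tm_mul_tm, h₂, mul_one, ← Finset.mul_sum]
    have h₄ : ∀ e, ∑ a, (d.f (CT.sliceR (ρ a e) q.R * CT.sliceR (ρ i a) q.Rinv) ⊠ 1 : CT Z Z) =
        if i = e then 1 else 0 := fun e => by
      have := congrArg (fun x => (d.f x ⊠ 1 : CT Z Z)) (sum_sliceR_mul_inv (q := q) hρ i e)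
      simp only [map_sum, LinearMap.sum_apply] at this
      rw [this]
      split_ifs <;> simp [CT.one_def]
    simp only [h₄]
    simp
  rw [mul_add, Finset.mul_sum, h₃, d.dilR_mul_mom_left, add_mul, Finset.sum_mul, add_comm]

/-- As `ξ` is primitive, `(id ⊗ Δ)(ξ ⊗ ξ)` is the sum of two commuting terms, so its exponential is
a bicharacter. -/
theorem comulR_dil {Δ : Z →ₐ[K] CT Z Z} (hΔ : Δ d.Ξ = d.Ξ ⊠ 1 + 1 ⊠ d.Ξ) (ℓ : tIdeal) :
    comulR Δ (cexp ℓ (d.Ξ ⊠ d.Ξ)) = l13 (cexp ℓ (d.Ξ ⊠ d.Ξ)) * l12 (cexp ℓ (d.Ξ ⊠ d.Ξ)) := by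
  rw [map_cexp, map_cexp, map_cexp, ← cexp_add]
  · simp [hΔ, e1_apply, mul_add, add_comm]
  · simp [Commute, SemiconjBy]

theorem comulL_dil {Δ : Z →ₐ[K] CT Z Z} (hΔ : Δ d.Ξ = d.Ξ ⊠ 1 + 1 ⊠ d.Ξ) (ℓ : tIdeal) :
    comulL Δ (cexp ℓ (d.Ξ ⊠ d.Ξ)) = l13 (cexp ℓ (d.Ξ ⊠ d.Ξ)) * l23 (cexp ℓ (d.Ξ ⊠ d.Ξ)) := by
  rw [map_cexp, map_cexp, map_cexp, ← cexp_add]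
  · simp [hΔ, e3_apply, add_mul]
  · simp [Commute, SemiconjBy]

theorem l13_dil_l12 (ℓ : tIdeal) (y : CT X X) : l12 (CT.map d.f d.f y) * l13 (cexp ℓ (d.Ξ ⊠ d.Ξ)) =
    l13 (cexp ℓ (d.Ξ ⊠ d.Ξ)) * l12 (CT.map d.f d.f y) := by
  rw [map_cexp]
  refine semiconj_cexp _ ?_
  exact commute_of_pure (l12.comp (CT.map d.f d.f)) (y := l13 (d.Ξ ⊠ d.Ξ))
    (fun b => by simp [CT.inl_apply, Commute, SemiconjBy, d.dil_bg])
    (fun b => by simp [CT.inr_apply, Commute, SemiconjBy]) y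

theorem l13_dil_l23 (ℓ : tIdeal) (y : CT X X) : l23 (CT.map d.f d.f y) * l13 (cexp ℓ (d.Ξ ⊠ d.Ξ)) =
    l13 (cexp ℓ (d.Ξ ⊠ d.Ξ)) * l23 (CT.map d.f d.f y) := by
  rw [map_cexp]
  refine semiconj_cexp _ ?_
  exact commute_of_pure (l23.comp (CT.map d.f d.f)) (y := l13 (d.Ξ ⊠ d.Ξ))
    (fun b => by simp [CT.inl_apply, Commute, SemiconjBy])
    (fun b => by simp [CT.inr_apply, Commute, SemiconjBy, d.dil_bg]) y

/-- The element lies in the extended background, so only the coproducts of `X` and `ξ` enter; the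
exponential in legs 1 and 3 commutes past the background `𝓡₁₂`. -/
theorem comulR_dilR {Δ : Z →ₐ[K] CT Z Z} (hΔ : Δ d.Ξ = d.Ξ ⊠ 1 + 1 ⊠ d.Ξ)
    (hf : ∀ x, Δ (d.f x) = CT.map d.f d.f (h.Δ x)) :
    comulR Δ (d.dilR q ℓ) = l13 (d.dilR q ℓ) * l12 (d.dilR q ℓ) := by
  rw [dilR, map_mul, d.comulR_dil hΔ, comulR_map _ hf, q.comulR_R, map_mul, CT3.map_l13, CT3.map_l12,
    map_mul, map_mul]
  simp only [mul_assoc]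
  rw [← mul_assoc (l12 _), d.l13_dil_l12]
  simp only [mul_assoc]

theorem comulL_dilR {Δ : Z →ₐ[K] CT Z Z} (hΔ : Δ d.Ξ = d.Ξ ⊠ 1 + 1 ⊠ d.Ξ)
    (hf : ∀ x, Δ (d.f x) = CT.map d.f d.f (h.Δ x)) :
    comulL Δ (d.dilR q ℓ) = l13 (d.dilR q ℓ) * l23 (d.dilR q ℓ) := by
  rw [dilR, map_mul, d.comulL_dil hΔ, comulL_map _ hf, q.comulL_R, map_mul, CT3.map_l13, CT3.map_l23,
    map_mul, map_mul]
  simp only [mul_assoc]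
  rw [← mul_assoc (l23 _), d.l13_dil_l23]
  simp only [mul_assoc]

end BosData

end QStar
namespace QStar

/-- Reality of `ℓ` makes the exponential coefficients invariant under conjugation, and powers of a
single element are insensitive to the reversal of products. -/
theorem conj_cexp {Z : Type*} [Ring Z] [Algebra K Z] [IsAdicComplete tIdeal Z]
    (st : Z →ₛₗ[conjK] Z) (one : st 1 = 1) (mul : ∀ x y, st (x * y) = st y * st x) {ℓ : tIdeal}
    (hℓ : conjK (ℓ : K) = ℓ) (x : Z) : st (cexp ℓ x) = cexp ℓ (st x) := by
  have hp : ∀ n, st (x ^ n) = st x ^ n := fun n => by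
    induction n with
    | zero => simp [one]
    | succ n ih => rw [pow_succ, mul, ih, ← pow_succ']
  exact map_cexp_of (fun _ h => conjK_mem h) st fun n => by
    simp [expSum, conjK_expCoeff ℓ hℓ, hp]

theorem CT.star_swap {A : Type*} [Ring A] [Algebra K A] (st : A →ₛₗ[conjK] A) (y : CT A A) :
    CT.star st (CT.swap y) = CT.swap (CT.star st y) := by
  have : (CT.star st).comp (CT.swap (A := A) (B := A)).toLinearMap =
      (CT.swap (A := A) (B := A)).toLinearMap.comp (CT.star st) :=
    CT.conj_ext fun a b => by simp
  exact LinearMap.congr_fun this y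

/-! ### The `*`-operation on the completed algebra and the quasi-`*` identity -/

namespace BB

variable {X ι κ : Type*} [Ring X] [Algebra K X] [IsAdicComplete tIdeal X] [Fintype ι]
  [DecidableEq ι] [Fintype κ] {h : Hopf X} {q : QT h} {ρ : ι → ι → X →ₗ[K] K}
  {rel : FreeAlgebra K ι → FreeAlgebra K ι → Prop} {c : κ → ι → ι → K} {ℓ : tIdeal}
  (hc : IsQuadratic rel c) (H : IsCompatible q ρ c ℓ) {m : ι → ι → K}
  (s : RealStar q) (hm : IsStarAction s ρ m)
  (mom : ∀ k, quadSum (fun i j => conjK (c k i j))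
    (fun i j => (BB.gen h ρ rel hc).starP m j * (BB.gen h ρ rel hc).starP m i) = 0)

/-- The `*`-structure. -/
def st : BB h ρ rel →ₛₗ[conjK] BB h ρ rel :=
  ofConjOp.comp ((((BB.gen h ρ rel hc).star s H.rep hm mom).lift hc).toLinearMap)

theorem st_bg (x : X) : st hc H s hm mom ((BB.gen h ρ rel hc).f x) = (BB.gen h ρ rel hc).f (s.st x) :=
  congrArg ofConjOp (BosData.lift_bg hc ((BB.gen h ρ rel hc).star s H.rep hm mom) x)

theorem st_mom (i : ι) : st hc H s hm mom ((BB.gen h ρ rel hc).P i) = (BB.gen h ρ rel hc).starP m i :=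
  congrArg ofConjOp (BosData.lift_mom hc ((BB.gen h ρ rel hc).star s H.rep hm mom) i)

theorem st_dil : st hc H s hm mom (BB.gen h ρ rel hc).Ξ = -(BB.gen h ρ rel hc).Ξ :=
  congrArg ofConjOp (BosData.lift_dil hc ((BB.gen h ρ rel hc).star s H.rep hm mom))

theorem st_mul (x y : BB h ρ rel) :
    st hc H s hm mom (x * y) = st hc H s hm mom y * st hc H s hm mom x :=
  (congrArg ofConjOp (map_mul (((BB.gen h ρ rel hc).star s H.rep hm mom).lift hc) x y)).trans
    (ofConjOp_mul _ _)

theorem st_one : st hc H s hm mom 1 = 1 :=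
  congrArg ofConjOp (map_one (((BB.gen h ρ rel hc).star s H.rep hm mom).lift hc))

theorem sum_conj_starP {Z : Type*} [Ring Z] [Algebra K Z] (hm : IsStarAction s ρ m)
    (d : BosData h ρ c Z) (i : ι) : ∑ a, conjK (m i a) • d.starP m a = d.P i := by
  simp only [BosData.starP, Finset.smul_sum, smul_smul]
  rw [Finset.sum_comm]
  simp [← Finset.sum_smul, hm.invol]

theorem st_st (x : BB h ρ rel) : st hc H s hm mom (st hc H s hm mom x) = x := by
  have : (st hc H s hm mom).comp (st hc H s hm mom) = LinearMap.id := by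
    refine BB.linear_ext hc ?_ (fun x y hx hy => ?_) (fun x => ?_) (fun i => ?_) ?_ <;>
      simp only [LinearMap.comp_apply, LinearMap.id_apply] at *
    · rw [st_one, st_one]
    · rw [st_mul, st_mul, hx, hy]
    · rw [st_bg, st_bg, s.st_st]
    · rw [st_mom, BosData.starP, map_sum]
      simp only [conj_smul_apply, st_mom]
      exact sum_conj_starP s hm _ i
    · rw [st_dil, map_neg, st_dil, neg_neg]
  exact LinearMap.congr_fun this x

theorem star_counit (x : BB h ρ rel) :
    conjK (ε (h := h) (ρ := ρ) hc x) = ε (h := h) (ρ := ρ) hc (st hc H s hm mom x) := by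
  -- The composite `conj ∘ ε ∘ *` is linear and can be compared with `ε` on generators.
  let conjL : K →ₛₗ[conjK] K := ⟨⟨conjK, map_add conjK⟩, fun a b => map_mul conjK a b⟩
  have : conjL.comp ((ε (h := h) (ρ := ρ) hc).toLinearMap.comp (st hc H s hm mom)) =
      (ε (h := h) (ρ := ρ) hc).toLinearMap := by
    refine BB.linear_ext hc ?_ (fun x y hx hy => ?_) (fun x => ?_) (fun i => ?_) ?_ <;>
      simp only [LinearMap.comp_apply, AlgHom.toLinearMap_apply] at *
    · rw [st_one, map_one]
      exact map_one conjK
    · rw [st_mul, map_mul (ε (h := h) (ρ := ρ) hc), map_mul (ε (h := h) (ρ := ρ) hc), ← hx, ← hy, mul_comm]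
      exact map_mul conjK ((ε (h := h) (ρ := ρ) hc) (st hc H s hm mom x)) _
    · rw [st_bg, ε_bg, ε_bg, ← s.st_ε]
      exact conjK_conjK _
    · rw [st_mom, BosData.starP, map_sum]
      simp [ε_mom]
    · rw [st_dil, map_neg, ε_dil]
      simp
  have := LinearMap.congr_fun this x
  rw [← AlgHom.toLinearMap_apply, ← this]
  exact conjK_conjK _

theorem star_map (y : CT X X) :
    CT.star (st hc H s hm mom) (CT.map (BB.gen h ρ rel hc).f (BB.gen h ρ rel hc).f y) =
      CT.map (BB.gen h ρ rel hc).f (BB.gen h ρ rel hc).f (CT.star s.st y) := by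
  have : (CT.star (st hc H s hm mom)).comp
      (CT.map (BB.gen h ρ rel hc).f (BB.gen h ρ rel hc).f).toLinearMap =
      (CT.map (BB.gen h ρ rel hc).f (BB.gen h ρ rel hc).f).toLinearMap.comp (CT.star s.st) :=
    CT.conj_ext fun a b => by simp [st_bg]
  exact LinearMap.congr_fun this y

theorem swap_map {Z : Type*} [Ring Z] [Algebra K Z] (f : X →ₐ[K] Z) (y : CT X X) :
    CT.swap (CT.map f f y) = CT.map f f (CT.swap y) := by
  have : (CT.swap (A := Z) (B := Z)).toLinearMap.comp (CT.map f f).toLinearMap =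
      (CT.map f f).toLinearMap.comp (CT.swap (A := X) (B := X)).toLinearMap := by
    ext a b
    simp
  exact LinearMap.congr_fun this y

/-- The two signs in `ξ^* ⊗ ξ^*` cancel, so the exponential is self-adjoint and symmetric; it
commutes with the background part, which restores the order reversed by `*`. -/
theorem star_dilR (hℓ : conjK (ℓ : K) = ℓ) :
    CT.star (st hc H s hm mom) ((BB.gen h ρ rel hc).dilR q ℓ) =
      CT.swap ((BB.gen h ρ rel hc).dilR q ℓ) := by
  have hℓ' : conjK ((-ℓ : tIdeal) : K) = (-ℓ : tIdeal) := by simp [hℓ]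
  rw [BosData.dilR, CT.star_mul _ (st_mul hc H s hm mom), star_map, s.real,
    conj_cexp _ (CT.star_one _ (st_one hc H s hm mom)) (CT.star_mul _ (st_mul hc H s hm mom)) hℓ',
    CT.star_tm, st_dil, map_mul, map_cexp, CT.swap_tm, swap_map]
  simp only [map_neg, LinearMap.neg_apply, neg_neg]
  rw [BosData.map_mul_exp]

/-- Involutivity of the adjoint matrix returns the momenta `p`, while the coefficients `g` become
`g^*` in the adjoint basis. By `RealStar.sum_st_sl` these are slices of `𝓡⁻¹`, and `(λ^ξ)^* =
λ^{-ξ}`. -/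
theorem star_Δ_star_mom (hℓ : conjK (ℓ : K) = ℓ) (i : ι) :
    CT.star (st hc H s hm mom) (Δ hc H (st hc H s hm mom ((BB.gen h ρ rel hc).P i))) =
      (BB.gen h ρ rel hc).P i ⊠ 1 + ∑ a, ((BB.gen h ρ rel hc).f (CT.sliceR (ρ i a) q.Rinv) *
        cexp ℓ (-(BB.gen h ρ rel hc).Ξ)) ⊠ (BB.gen h ρ rel hc).P a := by
  have hg : ∀ a b, st hc H s hm mom ((BB.gen h ρ rel hc).g q ℓ a b) =
      (BB.gen h ρ rel hc).f (s.st (q.sl (ρ a b))) * cexp ℓ (-(BB.gen h ρ rel hc).Ξ) := fun a b => by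
    rw [BosData.g, st_mul, st_bg, conj_cexp _ (st_one hc H s hm mom) (st_mul hc H s hm mom) hℓ, st_dil]
  rw [st_mom, BosData.starP, map_sum, map_sum]
  simp only [map_smul, conj_smul_apply, Δ_mom, map_add, map_sum, CT.star_tm, st_one, hg, st_mom,
    smul_add, Finset.sum_add_distrib]
  congr 1
  · rw [← sum_conj_starP s hm (BB.gen h ρ rel hc) i]
    simp
  · have h₁ : ∀ e, (((BB.gen h ρ rel hc).f (CT.sliceR (ρ i e) q.Rinv) *
        cexp ℓ (-(BB.gen h ρ rel hc).Ξ)) ⊠ (BB.gen h ρ rel hc).P e : CT (BB h ρ rel) (BB h ρ rel)) =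
        ∑ a, ∑ b, (conjK (m i a) * m b e) • (((BB.gen h ρ rel hc).f (s.st (q.sl (ρ a b))) *
          cexp ℓ (-(BB.gen h ρ rel hc).Ξ)) ⊠ (BB.gen h ρ rel hc).P e) := fun e => by
      rw [← s.sum_st_sl hm]
      simp [Finset.sum_mul]
    simp only [h₁, BosData.starP, map_sum, map_smul, Finset.smul_sum, smul_smul]
    rw [Finset.sum_comm]
    conv_rhs => rw [Finset.sum_comm]
    refine Eq.trans ?_ (Finset.sum_congr rfl fun a _ => Finset.sum_comm)
    rw [Finset.sum_comm]

/-- Keeping `𝓡` on the left avoids its inverse and makes the identity stable under products. On `X`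
it is quasitriangularity, on `ξ` everything commutes, and on `p` it is `BosData.dilR_mul_star_mom`.
-/
theorem dilR_mul_star_Δ_star (hℓ : conjK (ℓ : K) = ℓ) (x : BB h ρ rel) :
    (BB.gen h ρ rel hc).dilR q ℓ * CT.star (st hc H s hm mom) (Δ hc H (st hc H s hm mom x)) =
      CT.swap (Δ hc H x) * (BB.gen h ρ rel hc).dilR q ℓ := by
  have : (LinearMap.mulLeft K ((BB.gen h ρ rel hc).dilR q ℓ)).comp
      ((CT.star (st hc H s hm mom)).comp ((Δ hc H).toLinearMap.comp (st hc H s hm mom))) =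
      (LinearMap.mulRight K ((BB.gen h ρ rel hc).dilR q ℓ)).comp
        ((CT.swap (A := BB h ρ rel) (B := BB h ρ rel)).toLinearMap.comp (Δ hc H).toLinearMap) := by
    refine BB.linear_ext hc ?_ (fun x y hx hy => ?_) (fun x => ?_) (fun i => ?_) ?_ <;>
      simp only [LinearMap.comp_apply, AlgHom.toLinearMap_apply, LinearMap.mulLeft_apply,
        LinearMap.mulRight_apply] at *
    · rw [st_one, map_one (Δ hc H), CT.star_one _ (st_one hc H s hm mom), map_one, one_mul, mul_one]
    · rw [st_mul, map_mul (Δ hc H), CT.star_mul _ (st_mul hc H s hm mom), ← mul_assoc, hx, mul_assoc, hy,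
        map_mul, map_mul, mul_assoc]
    · rw [st_bg, Δ_bg, star_map, s.st_Δ, s.st_st, Δ_bg, swap_map, BosData.dilR, mul_assoc,
        ← BosData.map_mul_exp, ← mul_assoc, ← mul_assoc, ← map_mul, ← map_mul, q.swap_Δ]
    · rw [star_Δ_star_mom hc H s hm mom hℓ, BosData.dilR_mul_star_mom _ H.rep, Δ_mom]
      simp
    · rw [st_dil, map_neg, Δ_dil, map_neg, map_add, CT.star_tm, CT.star_tm, st_one, st_dil, map_add,
        CT.swap_tm, CT.swap_tm, BosData.dilR]
      have h₁ := (BB.gen h ρ rel hc).map_comm_of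
        (w := 1 ⊠ (BB.gen h ρ rel hc).Ξ + (BB.gen h ρ rel hc).Ξ ⊠ 1)
        (by simp [mul_add, add_mul, BosData.dil_bg]) (by simp [mul_add, add_mul, BosData.dil_bg]) q.R
      have h₂ : (1 ⊠ (BB.gen h ρ rel hc).Ξ + (BB.gen h ρ rel hc).Ξ ⊠ 1 : CT (BB h ρ rel) (BB h ρ rel)) *
          cexp (-ℓ) ((BB.gen h ρ rel hc).Ξ ⊠ (BB.gen h ρ rel hc).Ξ) =
          cexp (-ℓ) ((BB.gen h ρ rel hc).Ξ ⊠ (BB.gen h ρ rel hc).Ξ) *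
          (1 ⊠ (BB.gen h ρ rel hc).Ξ + (BB.gen h ρ rel hc).Ξ ⊠ 1) :=
        semiconj_cexp _ (by simp [mul_add, add_mul])
      simp only [map_neg, LinearMap.neg_apply, neg_add_rev, neg_neg]
      rw [← mul_assoc, ← h₁, mul_assoc, mul_assoc, h₂]
  exact LinearMap.congr_fun this x

theorem star_Δ_star (hℓ : conjK (ℓ : K) = ℓ) (x : BB h ρ rel) :
    CT.star (st hc H s hm mom) (Δ hc H (st hc H s hm mom x)) =
      (BB.gen h ρ rel hc).dilRinv q ℓ * CT.swap (Δ hc H x) * (BB.gen h ρ rel hc).dilR q ℓ := by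
  rw [mul_assoc, ← dilR_mul_star_Δ_star hc H s hm mom hℓ, ← mul_assoc, BosData.dilRinv_mul, one_mul]

theorem cmap_bgMap (y : CT X X) :
    (cmap (TensorProduct.map (bgMap h.toData ρ rel) (bgMap h.toData ρ rel)) y :
      CT (BB h ρ rel) (BB h ρ rel)) =
      CT.map (BB.gen h ρ rel hc).f (BB.gen h ρ rel hc).f y := by
  have : (cmap (TensorProduct.map (bgMap h.toData ρ rel) (bgMap h.toData ρ rel)) :
      CT X X →ₗ[K] CT (BB h ρ rel) (BB h ρ rel)) =
      (CT.map (BB.gen h ρ rel hc).f (BB.gen h ρ rel hc).f).toLinearMap := by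
    refine CT.linear_ext (LinearMap.ext₂ fun a b => ?_)
    exact (CT.map_tm (BB.gen h ρ rel hc).f (BB.gen h ρ rel hc).f a b).symm
  exact LinearMap.congr_fun this y

theorem isBosonisation : IsBosonisation h.toData ρ rel q.R ℓ (hopf hc H).toData where
  comul_bg x := (Δ_bg hc H x).trans (cmap_bgMap hc (h.Δ x)).symm
  comul_xi := (Δ_dil hc H).trans (map_add (CT.of (A := BB h ρ rel) (B := BB h ρ rel)) _ _).symm
  comul_mom i := by
    refine (Δ_mom hc H i).trans (Eq.symm ?_)
    refine (map_add (CT.of (A := BB h ρ rel) (B := BB h ρ rel)) _ _).trans ?_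
    refine congrArg₂ (· + ·) rfl ?_
    refine (map_sum (CT.of (A := BB h ρ rel) (B := BB h ρ rel)) _ _).trans ?_
    refine Finset.sum_congr rfl fun a _ => ?_
    rw [sliceLeft_eq]
    rfl
  counit_bg x := ε_bg hc x
  counit_xi := ε_dil hc
  counit_mom i := ε_mom hc i

theorem dilR_eq_bosR :
    @Eq (CT (BB h ρ rel) (BB h ρ rel)) ((BB.gen h ρ rel hc).dilR q ℓ) (bosR h.toData ρ rel q.R ℓ) := by
  change (BB.gen h ρ rel hc).dilR q ℓ = (_ * _ : CT (BB h ρ rel) (BB h ρ rel))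
  rw [BosData.dilR, ← cmap_bgMap hc q.R]
  exact congrArg _ (texp_eq_cexp (-ℓ) (BB.gen h ρ rel hc).Ξ (BB.gen h ρ rel hc).Ξ).symm

/-- `dilR` as a unit. -/
def dilRUnit : (CT (BB h ρ rel) (BB h ρ rel))ˣ :=
  ⟨(BB.gen h ρ rel hc).dilR q ℓ, (BB.gen h ρ rel hc).dilRinv q ℓ,
    (BB.gen h ρ rel hc).dilR_mul_inv, (BB.gen h ρ rel hc).dilRinv_mul⟩

end BB

/-- Quasi-`*` Hopf algebras in terms of bundled complete Hopf algebras. -/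
theorem Hopf.isQuasiStarHopf {Z : Type*} [Ring Z] [Algebra K Z] [IsAdicComplete tIdeal Z] (h : Hopf Z)
    (st : Z →ₛₗ[conjK] Z) (R : (CT Z Z)ˣ) (st_st : ∀ x, st (st x) = x)
    (st_mul : ∀ x y, st (x * y) = st y * st x)
    (comulR_R : comulR h.Δ R.val = l13 R.val * l12 R.val)
    (comulL_R : comulL h.Δ R.val = l13 R.val * l23 R.val)
    (st_Δ_st : ∀ x, CT.star st (h.Δ (st x)) = R⁻¹.val * CT.swap (h.Δ x) * R.val)
    (st_ε : ∀ x, conjK (h.ε x) = h.ε (st x))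
    (real : CT.star st R.val = CT.swap R.val) : IsQuasiStarHopf h.toData st R :=
  { h.isHopf with
    star_star := st_st
    star_mul := st_mul
    comulRight := by
      refine (comulRight_eq _ h.Δ (fun _ => rfl) _).trans (comulR_R.trans ?_)
      exact (congrArg₂ (fun a b : CT3 Z => a * b) (leg13_eq _) (leg12_eq _)).symm
    comulLeft := by
      refine (comulLeft_eq _ h.Δ (fun _ => rfl) _).trans (comulL_R.trans ?_)
      exact (congrArg₂ (fun a b : CT3 Z => a * b) (leg13_eq _) (leg23_eq _)).symm
    star_comul_star := fun x => (st_Δ_st x).trans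
      (congrArg (fun y : CT Z Z => R⁻¹.val * y * R.val) (flip_eq (h.Δ x))).symm
    star_counit := st_ε
    real := real.trans (flip_eq _).symm }

/-! ### Assembling the quasi-`*` bosonisation -/

namespace BB

variable {X ι κ : Type*} [Ring X] [Algebra K X] [IsAdicComplete tIdeal X] [Fintype ι]
  [DecidableEq ι] [Fintype κ] {h : Hopf X} {q : QT h} {ρ : ι → ι → X →ₗ[K] K}
  {rel : FreeAlgebra K ι → FreeAlgebra K ι → Prop} {c : κ → ι → ι → K} {ℓ : tIdeal}
  (hc : IsQuadratic rel c) (H : IsCompatible q ρ c ℓ) {m : ι → ι → K}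
  (s : RealStar q) (hm : IsStarAction s ρ m)
  (mom : ∀ k, quadSum (fun i j => conjK (c k i j))
    (fun i j => (BB.gen h ρ rel hc).starP m j * (BB.gen h ρ rel hc).starP m i) = 0)

theorem isQuasiStarHopf (hℓ : conjK (ℓ : K) = ℓ) :
    IsQuasiStarHopf (hopf hc H).toData (st hc H s hm mom) (dilRUnit (q := q) (ℓ := ℓ) hc) :=
  (hopf hc H).isQuasiStarHopf _ (dilRUnit hc) (st_st hc H s hm mom) (st_mul hc H s hm mom)
    ((BB.gen h ρ rel hc).comulR_dilR (Δ_dil hc H) (Δ_bg hc H))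
    ((BB.gen h ρ rel hc).comulL_dilR (Δ_dil hc H) (Δ_bg hc H))
    (star_Δ_star hc H s hm mom hℓ) (star_counit hc H s hm mom) (star_dilR hc H s hm mom hℓ)

theorem isQuasiStarBosonisation (hℓ : conjK (ℓ : K) = ℓ) :
    IsQuasiStarBosonisation h.toData ρ rel q.R ℓ s.st (hopf hc H).toData (st hc H s hm mom) where
  bosonisation := isBosonisation hc H
  quasiStar := ⟨dilRUnit hc, dilR_eq_bosR hc, isQuasiStarHopf hc H s hm mom hℓ⟩
  star_bg := st_bg hc H s hm mom

end BB

end QStar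
namespace QStar

/-! ### The background quantum group -/

section OfData

variable {H : Type*} [Ring H] [Algebra K H] [IsAdicComplete tIdeal H]

/-- Bundled form of a quasitriangular structure. -/
def QT.ofData {D : HopfData H} (hD : D.IsHopf) {RR : (CTensor H H)ˣ} (hR : D.IsQuasitriangular RR) :
    QT (Hopf.ofData D hD) where
  R := RR.val
  Rinv := RR⁻¹.val
  mul_inv := RR.mul_inv
  inv_mul := RR.inv_mul
  comulR_R := by
    refine (comulRight_eq D (Hopf.ofData D hD).Δ (fun _ => rfl) RR.val).symm.trans
      (hR.comulRight.trans ?_)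
    exact congrArg₂ (fun a b : CT3 H => a * b) (leg13_eq _) (leg12_eq _)
  comulL_R := by
    refine (comulLeft_eq D (Hopf.ofData D hD).Δ (fun _ => rfl) RR.val).symm.trans
      (hR.comulLeft.trans ?_)
    exact congrArg₂ (fun a b : CT3 H => a * b) (leg13_eq _) (leg23_eq _)
  swap_Δ x := by
    have h₁ : CT.swap ((Hopf.ofData D hD).Δ x) =
        (show (CT H H)ˣ from RR).val * ((Hopf.ofData D hD).Δ x) * (show (CT H H)ˣ from RR)⁻¹.val :=
      (flip_eq (D.comul x)).symm.trans (hR.comul_op x)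
    change CT.swap ((Hopf.ofData D hD).Δ x) * (show (CT H H)ˣ from RR).val =
      (show (CT H H)ˣ from RR).val * ((Hopf.ofData D hD).Δ x)
    rw [h₁, mul_assoc, Units.inv_mul, mul_one]

/-- Bundled form of a real quasitriangular Hopf `*`-algebra. -/
def RealStar.ofData {D : HopfData H} (hD : D.IsHopf) {RR : (CTensor H H)ˣ}
    (hR : D.IsQuasitriangular RR) {st : H →ₛₗ[conjK] H} (hst : D.IsHopfStar st)
    (real : starT st RR.val = flip RR.val) : RealStar (QT.ofData hD hR) where
  st := st
  st_st := hst.star_star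
  st_mul := hst.star_mul
  st_Δ := hst.star_comul
  st_ε := hst.star_counit
  real := real.trans (flip_eq _)

end OfData

/-! ### The tensor square of a quantum group -/

namespace Sq

variable {H Y Z : Type*} [Ring H] [Algebra K H] [Ring Y] [Algebra K Y] [AddCommGroup Z] [Module K Z]

/-- The first copy, as an algebra map. -/
def i1 : H →ₐ[K] Sq H := (CT.inl : H →ₐ[K] CT H H)

/-- The second copy, as an algebra map. -/
def i2 : H →ₐ[K] Sq H := (CT.inr : H →ₐ[K] CT H H)

theorem i1_commute (a b : H) : Commute (i1 a) (i2 b) := CT.commute a b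

theorem tm_eq (a b : H) : (a ⊠ b : CT H H) = (i1 a * i2 b : Sq H) := by
  refine Eq.trans ?_ (tm_mul_tm a 1 1 b).symm
  rw [one_mul, mul_one]

theorem linear_ext [IsHausdorff tIdeal Z] {F G : Sq H →ₗ[K] Z}
    (h : ∀ a b, F (i1 a * i2 b) = G (i1 a * i2 b)) : F = G :=
  CT.linear_ext (A := H) (B := H) (LinearMap.ext₂ fun a b => by
    have := h a b
    rw [← tm_eq] at this
    exact this)

theorem conj_ext [IsHausdorff tIdeal Z] {F G : Sq H →ₛₗ[conjK] Z}
    (h : ∀ a b, F (i1 a * i2 b) = G (i1 a * i2 b)) : F = G :=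
  CT.conj_ext (A := H) (B := H) fun a b => by
    have := h a b
    rw [← tm_eq] at this
    exact this

theorem alg_ext [IsHausdorff tIdeal Y] {F G : Sq H →ₐ[K] Y} (h₁ : ∀ a, F (i1 a) = G (i1 a))
    (h₂ : ∀ a, F (i2 a) = G (i2 a)) : F = G := CT.alg_ext (A := H) (B := H) h₁ h₂

/-- The algebra map defined by a pair of commuting algebra maps. -/
def lift [IsAdicComplete tIdeal Y] (f g : H →ₐ[K] Y) (h : ∀ a b, Commute (f a) (g b)) :
    Sq H →ₐ[K] Y := CT.liftAlg f g h

@[simp] theorem lift_i1 [IsAdicComplete tIdeal Y] (f g : H →ₐ[K] Y)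
    (h : ∀ a b, Commute (f a) (g b)) (a : H) : lift f g h (i1 a) = f a :=
  (CT.liftAlg_tm f g h a 1).trans (by simp)

@[simp] theorem lift_i2 [IsAdicComplete tIdeal Y] (f g : H →ₐ[K] Y)
    (h : ∀ a b, Commute (f a) (g b)) (a : H) : lift f g h (i2 a) = g a :=
  (CT.liftAlg_tm f g h 1 a).trans (by simp)

theorem map_i1_i2 {A B A' B' : Type*} [Ring A] [Algebra K A] [Ring B] [Algebra K B] [Ring A']
    [Algebra K A'] [Ring B'] [Algebra K B'] {f : A →ₐ[K] Y} {g : B →ₐ[K] Y} {f' : A' →ₐ[K] Y}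
    {g' : B' →ₐ[K] Y} (h₁ : ∀ a b, Commute (f a) (f' b)) (h₂ : ∀ a b, Commute (g a) (g' b))
    (y : CT A B) (z : CT A' B') : Commute (CT.map f g y) (CT.map f' g' z) := by
  refine commute_of_pure _ (fun a => ?_) (fun b => ?_) y
  · refine (commute_of_pure _ (fun a' => ?_) (fun b' => ?_) z).symm
    · simpa [CT.inl_apply, Commute, SemiconjBy] using congrArg (tmL · (1 : Y)) (h₁ a a').eq.symm
    · simp [CT.inl_apply, CT.inr_apply, Commute, SemiconjBy]
  · refine (commute_of_pure _ (fun a' => ?_) (fun b' => ?_) z).symm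
    · simp [CT.inl_apply, CT.inr_apply, Commute, SemiconjBy]
    · simpa [CT.inr_apply, Commute, SemiconjBy] using congrArg (tmL (1 : Y) ·) (h₂ b b').eq.symm

theorem map_comm (y z : CT H H) : Commute (CT.map i1 i1 y : CT (Sq H) (Sq H)) (CT.map i2 i2 z) :=
  map_i1_i2 i1_commute i1_commute y z

theorem cmap_inl_inl (y : CT H H) :
    (cmap (TensorProduct.map inl inl) y : CT (Sq H) (Sq H)) = CT.map i1 i1 y := by
  have : (cmap (TensorProduct.map inl inl) : CT H H →ₗ[K] CT (Sq H) (Sq H)) =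
      (CT.map i1 i1).toLinearMap :=
    CT.linear_ext (LinearMap.ext₂ fun a b => (CT.map_tm i1 i1 a b).symm)
  exact LinearMap.congr_fun this y

theorem cmap_inr_inr (y : CT H H) :
    (cmap (TensorProduct.map inr inr) y : CT (Sq H) (Sq H)) = CT.map i2 i2 y := by
  have : (cmap (TensorProduct.map inr inr) : CT H H →ₗ[K] CT (Sq H) (Sq H)) =
      (CT.map i2 i2).toLinearMap :=
    CT.linear_ext (LinearMap.ext₂ fun a b => (CT.map_tm i2 i2 a b).symm)
  exact LinearMap.congr_fun this y

theorem cmap_inr_inl (y : CT H H) :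
    (cmap (TensorProduct.map inr inl) y : CT (Sq H) (Sq H)) = CT.map i2 i1 y := by
  have : (cmap (TensorProduct.map inr inl) : CT H H →ₗ[K] CT (Sq H) (Sq H)) =
      (CT.map i2 i1).toLinearMap :=
    CT.linear_ext (LinearMap.ext₂ fun a b => (CT.map_tm i2 i1 a b).symm)
  exact LinearMap.congr_fun this y

theorem CT3_map_comm (y z : CT3 H) : Commute (CT3.map (i1 : H →ₐ[K] Sq H) y) (CT3.map i2 z) := by
  have h₁ : ∀ a b c, Commute (tm3 (i1 a) (i1 b) (i1 c) : CT3 (Sq H)) (CT3.map i2 z) := fun a b c => by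
    have : (LinearMap.mulLeft K (tm3 (i1 a) (i1 b) (i1 c) : CT3 (Sq H))).comp
        (CT3.map (i2 : H →ₐ[K] Sq H)).toLinearMap =
        (LinearMap.mulRight K (tm3 (i1 a) (i1 b) (i1 c) : CT3 (Sq H))).comp
          (CT3.map (i2 : H →ₐ[K] Sq H)).toLinearMap :=
      CT3.linear_ext fun a' b' c' => by
        simp [(i1_commute a a').eq, (i1_commute b b').eq, (i1_commute c c').eq]
    exact LinearMap.congr_fun this z
  have : (LinearMap.mulRight K (CT3.map (i2 : H →ₐ[K] Sq H) z)).comp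
        (CT3.map (i1 : H →ₐ[K] Sq H)).toLinearMap =
        (LinearMap.mulLeft K (CT3.map (i2 : H →ₐ[K] Sq H) z)).comp
          (CT3.map (i1 : H →ₐ[K] Sq H)).toLinearMap :=
    CT3.linear_ext fun a b c => by
      simpa using (h₁ a b c).eq
  exact LinearMap.congr_fun this y

end Sq

section Square

variable {H : Type*} [Ring H] [Algebra K H] [IsAdicComplete tIdeal H] (h : Hopf H)

open Sq

namespace Hopf

/-- The coproduct of the tensor square. -/
def sqΔ : Sq H →ₐ[K] CT (Sq H) (Sq H) :=
  Sq.lift ((CT.map i1 i1).comp h.Δ) ((CT.map i2 i2).comp h.Δ) fun a b => map_comm (h.Δ a) (h.Δ b)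

/-- The counit of the tensor square. -/
def sqε : Sq H →ₐ[K] K := Sq.lift h.ε h.ε fun _ _ => Commute.all _ _

/-- The antipode of the tensor square. -/
def sqS : Sq H →ₗ[K] Sq H := CT.lmap (A := H) (B := H) h.S h.S

theorem sqΔ_i1 (a : H) : h.sqΔ (i1 a) = CT.map i1 i1 (h.Δ a) := Sq.lift_i1 _ _ _ a

theorem sqΔ_i2 (a : H) : h.sqΔ (i2 a) = CT.map i2 i2 (h.Δ a) := Sq.lift_i2 _ _ _ a

theorem sqε_i1 (a : H) : h.sqε (i1 a) = h.ε a := Sq.lift_i1 _ _ _ a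

theorem sqε_i2 (a : H) : h.sqε (i2 a) = h.ε a := Sq.lift_i2 _ _ _ a

theorem sqS_tm (a b : H) : h.sqS (i1 a * i2 b) = i1 (h.S a) * i2 (h.S b) := by
  rw [← tm_eq, ← tm_eq]
  exact CT.lmap_tm _ _ a b

theorem sqS_i1 (a : H) : h.sqS (i1 a) = i1 (h.S a) := by
  simpa [h.S_one] using h.sqS_tm a 1

theorem sqS_i2 (a : H) : h.sqS (i2 a) = i2 (h.S a) := by
  simpa [h.S_one] using h.sqS_tm 1 a

theorem sqS_mul (x y : Sq H) : h.sqS (x * y) = h.sqS y * h.sqS x :=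
  CT.map_mul_rev_of_pure (A := H) (B := H) (Y := Sq H) h.sqS (fun a b a' b' => by
    refine (CT.lmap_tm _ _ _ _).trans ?_
    refine Eq.trans ?_ (congrArg₂ (fun x y : CT H H => x * y) (CT.lmap_tm h.S h.S a' b')
      (CT.lmap_tm h.S h.S a b)).symm
    rw [tm_mul_tm, h.S_mul, h.S_mul]) x y

/-- The tensor square of a complete Hopf algebra. -/
def square : Hopf (Sq H) where
  Δ := h.sqΔ
  ε := h.sqε
  S := h.sqS
  coassoc x := by
    have : (comulL h.sqΔ).comp h.sqΔ = (comulR h.sqΔ).comp h.sqΔ := by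
      refine Sq.alg_ext (fun a => ?_) fun a => ?_
      · simp only [AlgHom.comp_apply]
        rw [sqΔ_i1, comulL_map _ h.sqΔ_i1, comulR_map _ h.sqΔ_i1, h.coassoc]
      · simp only [AlgHom.comp_apply]
        rw [sqΔ_i2, comulL_map _ h.sqΔ_i2, comulR_map _ h.sqΔ_i2, h.coassoc]
    exact AlgHom.congr_fun this x
  counit_left x := by
    have h₁ : ∀ f : H →ₐ[K] Sq H, (∀ a, h.sqε (f a) = h.ε a) → ∀ y,
        CT.sliceL h.sqε.toLinearMap (CT.map f f y) = f (CT.sliceL h.ε.toLinearMap y) :=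
      fun f hf y => by
        have : (CT.sliceL h.sqε.toLinearMap).comp (CT.map f f).toLinearMap =
            f.toLinearMap.comp (CT.sliceL h.ε.toLinearMap) := by
          ext a b
          simp [hf]
        exact LinearMap.congr_fun this y
    have : (CT.sliceL h.sqε.toLinearMap).comp h.sqΔ.toLinearMap = LinearMap.id :=
      Sq.linear_ext fun a b => by
        simp only [LinearMap.comp_apply, AlgHom.toLinearMap_apply, map_mul, sliceL_algHom_mul,
          LinearMap.id_apply, sqΔ_i1, sqΔ_i2]
        rw [h₁ i1 h.sqε_i1, h₁ i2 h.sqε_i2, h.counit_left, h.counit_left]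
    exact LinearMap.congr_fun this x
  counit_right x := by
    have h₁ : ∀ f : H →ₐ[K] Sq H, (∀ a, h.sqε (f a) = h.ε a) → ∀ y,
        CT.sliceR h.sqε.toLinearMap (CT.map f f y) = f (CT.sliceR h.ε.toLinearMap y) :=
      fun f hf y => by
        have : (CT.sliceR h.sqε.toLinearMap).comp (CT.map f f).toLinearMap =
            f.toLinearMap.comp (CT.sliceR h.ε.toLinearMap) := by
          ext a b
          simp [hf]
        exact LinearMap.congr_fun this y
    have : (CT.sliceR h.sqε.toLinearMap).comp h.sqΔ.toLinearMap = LinearMap.id :=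
      Sq.linear_ext fun a b => by
        simp only [LinearMap.comp_apply, AlgHom.toLinearMap_apply, map_mul, sliceR_algHom_mul,
          LinearMap.id_apply, sqΔ_i1, sqΔ_i2]
        rw [h₁ i1 h.sqε_i1, h₁ i2 h.sqε_i2, h.counit_right, h.counit_right]
    exact LinearMap.congr_fun this x
  antipode_left x := by
    have h₁ : ∀ f : H →ₐ[K] Sq H, (∀ a, h.sqS (f a) = f (h.S a)) → ∀ a,
        CT.lift ((LinearMap.mul K (Sq H)).compl₁₂ h.sqS LinearMap.id) (CT.map f f (h.Δ a)) =
          algebraMap K (Sq H) (h.ε a) :=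
      fun f hf a => by
        have : (CT.lift ((LinearMap.mul K (Sq H)).compl₁₂ h.sqS LinearMap.id)).comp
            (CT.map f f).toLinearMap =
            f.toLinearMap.comp (CT.lift ((LinearMap.mul K H).compl₁₂ h.S LinearMap.id)) := by
          ext a b
          simp [hf]
        refine (LinearMap.congr_fun this (h.Δ a)).trans ?_
        rw [LinearMap.comp_apply, h.antipode_left]
        simp
    have : (CT.lift ((LinearMap.mul K (Sq H)).compl₁₂ h.sqS LinearMap.id)).comp h.sqΔ.toLinearMap =
        (Algebra.linearMap K (Sq H)).comp h.sqε.toLinearMap :=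
      Sq.linear_ext fun a b => by
        simp only [LinearMap.comp_apply, AlgHom.toLinearMap_apply, map_mul, Algebra.linearMap_apply,
          sqε_i1, sqε_i2]
        rw [lift_antipode_left_mul h.sqS_mul (r := h.ε a) (by rw [sqΔ_i1, h₁ i1 h.sqS_i1]), sqΔ_i2,
          h₁ i2 h.sqS_i2, Algebra.smul_def]
    exact LinearMap.congr_fun this x
  antipode_right x := by
    have h₁ : ∀ f : H →ₐ[K] Sq H, (∀ a, h.sqS (f a) = f (h.S a)) → ∀ a,
        CT.lift ((LinearMap.mul K (Sq H)).compl₁₂ LinearMap.id h.sqS) (CT.map f f (h.Δ a)) =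
          algebraMap K (Sq H) (h.ε a) :=
      fun f hf a => by
        have : (CT.lift ((LinearMap.mul K (Sq H)).compl₁₂ LinearMap.id h.sqS)).comp
            (CT.map f f).toLinearMap =
            f.toLinearMap.comp (CT.lift ((LinearMap.mul K H).compl₁₂ LinearMap.id h.S)) := by
          ext a b
          simp [hf]
        refine (LinearMap.congr_fun this (h.Δ a)).trans ?_
        rw [LinearMap.comp_apply, h.antipode_right]
        simp
    have : (CT.lift ((LinearMap.mul K (Sq H)).compl₁₂ LinearMap.id h.sqS)).comp h.sqΔ.toLinearMap =
        (Algebra.linearMap K (Sq H)).comp h.sqε.toLinearMap :=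
      Sq.linear_ext fun a b => by
        simp only [LinearMap.comp_apply, AlgHom.toLinearMap_apply, map_mul, Algebra.linearMap_apply,
          sqε_i1, sqε_i2]
        rw [lift_antipode_right_mul h.sqS_mul (r := h.ε b) (by rw [sqΔ_i2, h₁ i2 h.sqS_i2]), sqΔ_i1,
          h₁ i1 h.sqS_i1, Algebra.smul_def, Algebra.commutes]
    exact LinearMap.congr_fun this x
  S_bijective := by
    have h₁ : ∀ x, CT.lmap (A := H) (B := H) h.Sinv h.Sinv (h.sqS x) = x := fun x => by
      have : (CT.lmap (A := H) (B := H) h.Sinv h.Sinv).comp (CT.lmap (A := H) (B := H) h.S h.S) =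
          LinearMap.id := by
        ext a b
        simp
      exact LinearMap.congr_fun this x
    have h₂ : ∀ x : Sq H, h.sqS (CT.lmap (A := H) (B := H) h.Sinv h.Sinv x) = x := fun x => by
      have : (CT.lmap (A := H) (B := H) h.S h.S).comp (CT.lmap (A := H) (B := H) h.Sinv h.Sinv) =
          LinearMap.id := by
        ext a b
        simp
      exact LinearMap.congr_fun this x
    exact ⟨Function.LeftInverse.injective h₁, Function.RightInverse.surjective h₂⟩

theorem square_comul_tmul (D : HopfData H) (a b : H) :
    D.square.comul (of (H ⊗[K] H) (a ⊗ₜ[K] b)) =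
      cmap (TensorProduct.map inl inl) (D.comul a) * cmap (TensorProduct.map inr inr) (D.comul b) := by
  unfold HopfData.square
  exact cext_of _ _

theorem sqΔ_eq (x : Sq H) : @Eq (CT (Sq H) (Sq H)) (h.sqΔ x) (h.toData.square.comul x) := by
  have : h.sqΔ.toLinearMap = (h.toData.square.comul : Sq H →ₗ[K] CT (Sq H) (Sq H)) :=
    Sq.linear_ext fun a b => by
      rw [AlgHom.toLinearMap_apply, map_mul, sqΔ_i1, sqΔ_i2, ← cmap_inl_inl, ← cmap_inr_inr, ← tm_eq]
      exact (square_comul_tmul h.toData a b).symm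
  exact LinearMap.congr_fun this x

theorem sqε_eq (x : Sq H) : h.sqε x = h.toData.square.counit x := by
  have : h.sqε.toLinearMap = h.toData.square.counit :=
    Sq.linear_ext fun a b => by
      rw [AlgHom.toLinearMap_apply, map_mul, sqε_i1, sqε_i2, ← tm_eq]
      exact (evalT_of h.ε.toLinearMap h.ε.toLinearMap a b).symm
  exact LinearMap.congr_fun this x

theorem sqS_eq (x : Sq H) : h.sqS x = h.toData.square.antipode x := by
  have : h.sqS = h.toData.square.antipode :=
    Sq.linear_ext fun a b => by
      rw [sqS_tm, ← tm_eq, ← tm_eq]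
      exact (cmap_of _ _).symm
  exact LinearMap.congr_fun this x

theorem hopfData_ext {A : Type*} [Ring A] [Algebra K A] {D D' : HopfData A}
    (h₁ : ∀ x, D.comul x = D'.comul x) (h₂ : ∀ x, D.counit x = D'.counit x)
    (h₃ : ∀ x, D.antipode x = D'.antipode x) : D = D' := by
  cases D
  cases D'
  congr
  · exact LinearMap.ext h₁
  · exact LinearMap.ext h₂
  · exact LinearMap.ext h₃

theorem square_toData : h.square.toData = h.toData.square :=
  hopfData_ext h.sqΔ_eq h.sqε_eq h.sqS_eq

end Hopf

variable {h}

/-- The tensor square of a quasitriangular structure. -/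
def QT.square (q : QT h) : QT h.square where
  R := CT.map i1 i1 q.R * CT.map i2 i2 q.R
  Rinv := CT.map i1 i1 q.Rinv * CT.map i2 i2 q.Rinv
  mul_inv := by
    rw [mul_assoc, ← mul_assoc (CT.map i2 i2 q.R), ← (map_comm q.Rinv q.R).eq, mul_assoc, ← map_mul,
      q.mul_inv, map_one, mul_one, ← map_mul, q.mul_inv, map_one]
  inv_mul := by
    rw [mul_assoc, ← mul_assoc (CT.map i2 i2 q.Rinv), ← (map_comm q.R q.Rinv).eq, mul_assoc, ← map_mul,
      q.inv_mul, map_one, mul_one, ← map_mul, q.inv_mul, map_one]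
  comulR_R := by
    change comulR h.sqΔ _ = _
    -- Legs taken in different copies of `H` commute, so the two hexagons can be interleaved.
    rw [map_mul, comulR_map _ h.sqΔ_i1, comulR_map _ h.sqΔ_i2, q.comulR_R, map_mul, map_mul, map_mul,
      map_mul, ← CT3.map_l13, ← CT3.map_l13, ← CT3.map_l12, ← CT3.map_l12, mul_assoc, mul_assoc,
      ← mul_assoc (CT3.map i1 (l12 q.R)), (CT3_map_comm (l12 q.R) (l13 q.R)).eq, mul_assoc]
  comulL_R := by
    change comulL h.sqΔ _ = _
    rw [map_mul, comulL_map _ h.sqΔ_i1, comulL_map _ h.sqΔ_i2, q.comulL_R, map_mul, map_mul, map_mul,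
      map_mul, ← CT3.map_l13, ← CT3.map_l13, ← CT3.map_l23, ← CT3.map_l23, mul_assoc, mul_assoc,
      ← mul_assoc (CT3.map i1 (l23 q.R)), (CT3_map_comm (l23 q.R) (l13 q.R)).eq, mul_assoc]
  swap_Δ x := by
    change CT.swap (h.sqΔ x) * _ = _ * h.sqΔ x
    have : (LinearMap.mulRight K (CT.map i1 i1 q.R * CT.map i2 i2 q.R : CT (Sq H) (Sq H))).comp
        ((CT.swap (A := Sq H) (B := Sq H)).toLinearMap.comp h.sqΔ.toLinearMap) =
        (LinearMap.mulLeft K (CT.map i1 i1 q.R * CT.map i2 i2 q.R : CT (Sq H) (Sq H))).comp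
          h.sqΔ.toLinearMap :=
      Sq.linear_ext fun a b => by
        simp only [LinearMap.comp_apply, AlgHom.toLinearMap_apply, map_mul, LinearMap.mulRight_apply,
          LinearMap.mulLeft_apply, h.sqΔ_i1, h.sqΔ_i2, BB.swap_map]
        rw [mul_assoc, ← mul_assoc (CT.map i2 i2 (CT.swap (h.Δ b))),
          ← (map_comm q.R (CT.swap (h.Δ b))).eq, mul_assoc, ← map_mul, q.swap_Δ, ← mul_assoc,
          ← map_mul, q.swap_Δ, map_mul, map_mul, mul_assoc, mul_assoc,
          ← mul_assoc (CT.map i1 i1 (h.Δ a)), (map_comm (h.Δ a) q.R).eq, mul_assoc]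
    exact LinearMap.congr_fun this x

theorem QT.square_R (q : QT h) :
    @Eq (CT (Sq H) (Sq H)) q.square.R (squareR (H := H) q.R) :=
  (congrArg₂ (fun x y : CT (Sq H) (Sq H) => x * y) (cmap_inl_inl q.R) (cmap_inr_inr q.R)).symm

end Square

end QStar
namespace QStar

/-! ### Twisting -/

section Perm

variable {A : Type*} [Ring A] [Algebra K A]

/-- The transposition of the first two tensor factors. -/
def perm12 : CT3 A →ₐ[K] CT3 A :=
  CT3.liftAlg e2 e1 e3 (fun a b => (e1_e2 b a).symm) e2_e3 e1_e3

/-- The transposition of the last two tensor factors. -/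
def perm23 : CT3 A →ₐ[K] CT3 A :=
  CT3.liftAlg e1 e3 e2 e1_e3 e1_e2 fun a b => (e2_e3 b a).symm

/-- The cyclic permutation `a ⊗ b ⊗ c ↦ b ⊗ c ⊗ a`. -/
def perm312 : CT3 A →ₐ[K] CT3 A :=
  CT3.liftAlg e3 e1 e2 (fun a b => (e1_e3 b a).symm) (fun a b => (e2_e3 b a).symm) e1_e2

/-- The cyclic permutation `a ⊗ b ⊗ c ↦ c ⊗ a ⊗ b`. -/
def perm231 : CT3 A →ₐ[K] CT3 A :=
  CT3.liftAlg e2 e3 e1 e2_e3 (fun a b => (e1_e2 b a).symm) fun a b => (e1_e3 b a).symm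

@[simp] theorem perm12_tm (a b c : A) : perm12 (tm3 a b c) = tm3 b a c :=
  (CT3.liftAlg_tm _ _ _ _ _ _ a b c).trans (by simp [e1_apply, e2_apply, e3_apply])

@[simp] theorem perm23_tm (a b c : A) : perm23 (tm3 a b c) = tm3 a c b :=
  (CT3.liftAlg_tm _ _ _ _ _ _ a b c).trans (by simp [e1_apply, e2_apply, e3_apply])

@[simp] theorem perm312_tm (a b c : A) : perm312 (tm3 a b c) = tm3 b c a :=
  (CT3.liftAlg_tm _ _ _ _ _ _ a b c).trans (by simp [e1_apply, e2_apply, e3_apply])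

@[simp] theorem perm231_tm (a b c : A) : perm231 (tm3 a b c) = tm3 c a b :=
  (CT3.liftAlg_tm _ _ _ _ _ _ a b c).trans (by simp [e1_apply, e2_apply, e3_apply])

theorem eq_of_tm {Y : Type*} [Ring Y] [Algebra K Y] [IsHausdorff tIdeal Y] {F G : CT A A →ₐ[K] Y}
    (h : ∀ a b, F (a ⊠ b) = G (a ⊠ b)) (y : CT A A) : F y = G y :=
  LinearMap.congr_fun (CT.linear_ext (LinearMap.ext₂ h) : F.toLinearMap = G.toLinearMap) y

theorem perm12_l12 (y : CT A A) : perm12 (l12 y) = l12 (CT.swap y) :=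
  eq_of_tm (F := perm12.comp l12) (G := l12.comp CT.swap) (fun a b => by simp) y

theorem perm12_l13 (y : CT A A) : perm12 (l13 y) = l23 y :=
  eq_of_tm (F := perm12.comp l13) (fun a b => by simp) y

theorem perm12_l23 (y : CT A A) : perm12 (l23 y) = l13 y :=
  eq_of_tm (F := perm12.comp l23) (fun a b => by simp) y

theorem perm23_l12 (y : CT A A) : perm23 (l12 y) = l13 y :=
  eq_of_tm (F := perm23.comp l12) (fun a b => by simp) y

theorem perm23_l13 (y : CT A A) : perm23 (l13 y) = l12 y :=
  eq_of_tm (F := perm23.comp l13) (fun a b => by simp) y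

theorem perm23_l23 (y : CT A A) : perm23 (l23 y) = l23 (CT.swap y) :=
  eq_of_tm (F := perm23.comp l23) (G := l23.comp CT.swap) (fun a b => by simp) y

theorem perm312_l12 (y : CT A A) : perm312 (l12 y) = l13 (CT.swap y) :=
  eq_of_tm (F := perm312.comp l12) (G := l13.comp CT.swap) (fun a b => by simp) y

theorem perm312_l13 (y : CT A A) : perm312 (l13 y) = l23 (CT.swap y) :=
  eq_of_tm (F := perm312.comp l13) (G := l23.comp CT.swap) (fun a b => by simp) y

theorem perm312_l23 (y : CT A A) : perm312 (l23 y) = l12 y :=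
  eq_of_tm (F := perm312.comp l23) (fun a b => by simp) y

theorem perm231_l12 (y : CT A A) : perm231 (l12 y) = l23 y :=
  eq_of_tm (F := perm231.comp l12) (fun a b => by simp) y

theorem perm231_l13 (y : CT A A) : perm231 (l13 y) = l12 (CT.swap y) :=
  eq_of_tm (F := perm231.comp l13) (G := l12.comp CT.swap) (fun a b => by simp) y

theorem perm231_l23 (y : CT A A) : perm231 (l23 y) = l13 (CT.swap y) :=
  eq_of_tm (F := perm231.comp l23) (G := l13.comp CT.swap) (fun a b => by simp) y

theorem comulL_swap (Δ : A →ₐ[K] CT A A) (y : CT A A) :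
    comulL Δ (CT.swap y) = perm312 (comulR Δ y) :=
  eq_of_tm (F := (comulL Δ).comp CT.swap) (G := perm312.comp (comulR Δ)) (fun a b => by
    simp only [AlgHom.comp_apply, CT.swap_tm, comulL_tm, comulR_tm, map_mul, perm312_l23, e1_apply,
      perm312_tm]
    rw [← e3_apply, (l12_e3 _ _).eq]) y

theorem comulR_swap (Δ : A →ₐ[K] CT A A) (y : CT A A) :
    comulR Δ (CT.swap y) = perm231 (comulL Δ y) :=
  eq_of_tm (F := (comulR Δ).comp CT.swap) (G := perm231.comp (comulL Δ)) (fun a b => by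
    simp only [AlgHom.comp_apply, CT.swap_tm, comulL_tm, comulR_tm, map_mul, perm231_l12, e3_apply,
      perm231_tm]
    rw [← e1_apply, (e1_l23 _ _).eq]) y

end Perm

namespace QT

variable {X : Type*} [Ring X] [Algebra K X] [IsAdicComplete tIdeal X] {h : Hopf X} (q : QT h)

/-- Quasitriangularity in the first two legs. Applied to `χ`, whose coproducts are products of legs,
it gives the exchange relations between `𝓡` and `χ` that enter the twisted hexagons. -/
theorem l12_R_mul_comulL (y : CT X X) :
    l12 q.R * comulL h.Δ y = perm12 (comulL h.Δ y) * l12 q.R := by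
  have : (LinearMap.mulLeft K (l12 q.R)).comp (comulL h.Δ).toLinearMap =
      (LinearMap.mulRight K (l12 q.R)).comp ((perm12 (A := X)).toLinearMap.comp
        (comulL h.Δ).toLinearMap) := by
    refine CT.linear_ext (LinearMap.ext₂ fun a b => ?_)
    simp only [LinearMap.compr₂_apply, LinearMap.comp_apply, AlgHom.toLinearMap_apply,
      LinearMap.mulLeft_apply, LinearMap.mulRight_apply, comulL_tm, map_mul, perm12_l12]
    have : perm12 (e3 b) = e3 b := by simp [e3_apply]
    rw [this, mul_assoc, ← (l12_e3 q.R b).eq, ← mul_assoc, ← mul_assoc, ← map_mul, ← map_mul, q.swap_Δ]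
  exact LinearMap.congr_fun this y

theorem l23_R_mul_comulR (y : CT X X) :
    l23 q.R * comulR h.Δ y = perm23 (comulR h.Δ y) * l23 q.R := by
  have : (LinearMap.mulLeft K (l23 q.R)).comp (comulR h.Δ).toLinearMap =
      (LinearMap.mulRight K (l23 q.R)).comp ((perm23 (A := X)).toLinearMap.comp
        (comulR h.Δ).toLinearMap) := by
    refine CT.linear_ext (LinearMap.ext₂ fun a b => ?_)
    simp only [LinearMap.compr₂_apply, LinearMap.comp_apply, AlgHom.toLinearMap_apply,
      LinearMap.mulLeft_apply, LinearMap.mulRight_apply, comulR_tm, map_mul, perm23_l23]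
    have : perm23 (e1 a) = e1 a := by simp [e1_apply]
    rw [this, ← mul_assoc, ← (e1_l23 a q.R).eq, mul_assoc, mul_assoc, ← map_mul, ← map_mul, q.swap_Δ]
  exact LinearMap.congr_fun this y

end QT

/-- Twisting data of bicharacter type, with the elements implementing the twisted antipode. -/
structure Twist {X : Type*} [Ring X] [Algebra K X] [IsAdicComplete tIdeal X] (h : Hopf X) where
  χ : (CT X X)ˣ
  U : Xˣ
  comulL_χ : comulL h.Δ χ.val = l23 χ.val * l13 χ.val
  comulR_χ : comulR h.Δ χ.val = l12 χ.val * l13 χ.val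
  comm : Commute (l12 χ.val) (l23 χ.val)
  sliceL_ε : CT.sliceL h.ε.toLinearMap χ.val = 1
  sliceR_ε : CT.sliceR h.ε.toLinearMap χ.val = 1
  U_eq : CT.lift ((LinearMap.mul K X).compl₁₂ LinearMap.id h.S) χ.val = U.val
  Uinv_eq : CT.lift ((LinearMap.mul K X).compl₁₂ h.S LinearMap.id) χ⁻¹.val = U⁻¹.val
  left : CT.lift ((LinearMap.mul K X).compl₁₂ ((LinearMap.mulRight K U⁻¹.val).comp h.S)
    LinearMap.id) χ.val = 1
  right : CT.lift ((LinearMap.mul K X).compl₁₂ (LinearMap.mulRight K U.val) h.S) χ⁻¹.val = 1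

/-- Group theory behind the hexagon for `χ₂₁𝓡χ⁻¹`: the letters `x` are legs of `χ` and the letters
`r` legs of `𝓡`. Three hypotheses are commutations of legs of `χ`, and two say that a leg of `𝓡`
flips a product of legs of `χ`. -/
theorem twisted_hexagon_left {G : Type*} [Group G] {x12 x31 x32 r13 r23 x13 x23 : G}
    (h₁ : x12 * x31 = x31 * x12) (h₂ : r13 * (x32 * x12) = x12 * x32 * r13)
    (h₃ : x13 * x32 = x32 * x13) (h₄ : r23 * (x12 * x13) = x13 * x12 * r23)
    (h₅ : x12 * x23 = x23 * x12) :
    x12 * (x31 * x32 * (r13 * r23) * (x23 * x13)⁻¹) * x12⁻¹ =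
      x31 * r13 * x13⁻¹ * (x32 * r23 * x23⁻¹) := by
  -- The outer conjugation by `x12` is absorbed here: `r23` exchanges it with `x13`, and the
  -- remaining `x12` commutes with `x23`.
  have h₆ : x32 * x12 * r23 * (x23 * x13)⁻¹ * x12⁻¹ = x13⁻¹ * (x32 * r23 * x23⁻¹) := by
    rw [eq_inv_mul_iff_mul_eq]
    calc x13 * (x32 * x12 * r23 * (x23 * x13)⁻¹ * x12⁻¹)
        = x13 * x32 * x12 * r23 * (x23 * x13)⁻¹ * x12⁻¹ := by group
      _ = x32 * (x13 * x12 * r23) * (x23 * x13)⁻¹ * x12⁻¹ := by rw [h₃]; group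
      _ = x32 * r23 * x12 * x23⁻¹ * x12⁻¹ := by rw [← h₄]; group
      _ = x32 * r23 * (x12 * x23⁻¹ * x12⁻¹) := by group
      _ = _ := by
        have : x12 * x23⁻¹ * x12⁻¹ = x23⁻¹ := by
          rw [mul_inv_eq_iff_eq_mul, eq_inv_mul_iff_mul_eq, ← mul_assoc, ← h₅]
          group
        rw [this]
  calc x12 * (x31 * x32 * (r13 * r23) * (x23 * x13)⁻¹) * x12⁻¹
      = x12 * x31 * x32 * r13 * r23 * (x23 * x13)⁻¹ * x12⁻¹ := by group
    _ = x31 * (x12 * x32 * r13) * r23 * (x23 * x13)⁻¹ * x12⁻¹ := by rw [h₁]; group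
    _ = x31 * r13 * (x32 * x12 * r23 * (x23 * x13)⁻¹ * x12⁻¹) := by rw [← h₂]; group
    _ = _ := by rw [h₆]; group

/-- The same identity with letters renamed: `x23` takes the place of `x12`, `x21` that of `x32`, and
`r12` that of `r23`. -/
theorem twisted_hexagon_right {G : Type*} [Group G] {x23 x31 x21 r13 r12 x13 x12 : G}
    (h₁ : x23 * x31 = x31 * x23) (h₂ : r13 * (x21 * x23) = x23 * x21 * r13)
    (h₃ : x21 * x13 = x13 * x21) (h₄ : r12 * (x23 * x13) = x13 * x23 * r12)
    (h₅ : x12 * x23 = x23 * x12) :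
    x23 * (x31 * x21 * (r13 * r12) * (x12 * x13)⁻¹) * x23⁻¹ =
      x31 * r13 * x13⁻¹ * (x21 * r12 * x12⁻¹) :=
  twisted_hexagon_left h₁ h₂ h₃.symm h₄ h₅.symm

namespace Twist

variable {X : Type*} [Ring X] [Algebra K X] [IsAdicComplete tIdeal X] {h : Hopf X} (T : Twist h)

/-- The twisted coproduct. -/
def Δ : X →ₐ[K] CT X X :=
  AlgHom.ofLinearMap ((mulLR T.χ.val T.χ⁻¹.val).comp h.Δ.toLinearMap)
    (by
      change T.χ.val * h.Δ 1 * T.χ⁻¹.val = 1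
      rw [map_one, mul_one, Units.mul_inv])
    fun x y => by
      change T.χ.val * h.Δ (x * y) * T.χ⁻¹.val =
        T.χ.val * h.Δ x * T.χ⁻¹.val * (T.χ.val * h.Δ y * T.χ⁻¹.val)
      simp [mul_assoc]

theorem Δ_apply (x : X) : T.Δ x = T.χ.val * h.Δ x * T.χ⁻¹.val := rfl

/-- The twisted antipode. -/
def S : X →ₗ[K] X := (mulLR T.U.val T.U⁻¹.val).comp h.S

theorem S_apply (x : X) : T.S x = T.U.val * h.S x * T.U⁻¹.val := rfl

theorem comulL_Δ (y : CT X X) : comulL T.Δ y = l12 T.χ.val * comulL h.Δ y * l12 T.χ⁻¹.val := by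
  have : (comulL T.Δ).toLinearMap =
      (LinearMap.mulRight K (l12 T.χ⁻¹.val)).comp ((LinearMap.mulLeft K (l12 T.χ.val)).comp
        (comulL h.Δ).toLinearMap) := by
    refine CT.linear_ext (LinearMap.ext₂ fun a b => ?_)
    simp only [LinearMap.compr₂_apply, LinearMap.comp_apply, AlgHom.toLinearMap_apply,
      LinearMap.mulLeft_apply, LinearMap.mulRight_apply, comulL_tm, Δ_apply, map_mul]
    rw [mul_assoc, (l12_e3 T.χ⁻¹.val b).eq]
    simp only [mul_assoc]
  exact LinearMap.congr_fun this y

theorem comulR_Δ (y : CT X X) : comulR T.Δ y = l23 T.χ.val * comulR h.Δ y * l23 T.χ⁻¹.val := by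
  have : (comulR T.Δ).toLinearMap =
      (LinearMap.mulRight K (l23 T.χ⁻¹.val)).comp ((LinearMap.mulLeft K (l23 T.χ.val)).comp
        (comulR h.Δ).toLinearMap) := by
    refine CT.linear_ext (LinearMap.ext₂ fun a b => ?_)
    simp only [LinearMap.compr₂_apply, LinearMap.comp_apply, AlgHom.toLinearMap_apply,
      LinearMap.mulLeft_apply, LinearMap.mulRight_apply, comulR_tm, Δ_apply, map_mul]
    rw [← mul_assoc (l23 T.χ.val) (e1 a), ← (e1_l23 a T.χ.val).eq]
    simp only [mul_assoc]
  exact LinearMap.congr_fun this y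

/-- A leg map on units. -/
def unit {A B : Type*} [Ring A] [Algebra K A] [Ring B] [Algebra K B] (f : A →ₐ[K] B) (u : Aˣ) : Bˣ :=
  Units.map (f : A →* B) u

/-- By the bicharacter property both sides are `χ₁₂`, `χ₂₃`, `χ₁₃` multiplied together, with the
first two exchanged; these commute. -/
theorem cocycle : unit l12 T.χ * unit (comulL h.Δ) T.χ = unit l23 T.χ * unit (comulR h.Δ) T.χ := by
  refine Units.ext ?_
  change l12 T.χ.val * comulL h.Δ T.χ.val = l23 T.χ.val * comulR h.Δ T.χ.val
  rw [T.comulL_χ, T.comulR_χ, ← mul_assoc, ← mul_assoc, T.comm.eq]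

theorem coassoc (x : X) : comulL T.Δ (T.Δ x) = comulR T.Δ (T.Δ x) := by
  have h₁ := congrArg Units.val T.cocycle
  have h₂ := congrArg (fun u => (u⁻¹ : (CT3 X)ˣ).val) T.cocycle
  change l12 T.χ.val * comulL h.Δ T.χ.val = l23 T.χ.val * comulR h.Δ T.χ.val at h₁
  simp only [mul_inv_rev] at h₂
  change comulL h.Δ T.χ⁻¹.val * l12 T.χ⁻¹.val = comulR h.Δ T.χ⁻¹.val * l23 T.χ⁻¹.val at h₂
  rw [comulL_Δ, comulR_Δ, Δ_apply, map_mul, map_mul, map_mul, map_mul, h.coassoc]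
  simp only [mul_assoc]
  rw [h₂, ← mul_assoc, h₁]
  simp only [mul_assoc]

theorem sliceL_ε_inv : CT.sliceL h.ε.toLinearMap T.χ⁻¹.val = 1 := by
  have := congrArg (CT.sliceL h.ε.toLinearMap) T.χ.inv_mul
  rwa [sliceL_algHom_mul, T.sliceL_ε, mul_one, CT.one_def, CT.sliceL_tm, AlgHom.toLinearMap_apply,
    map_one, one_smul] at this

theorem sliceR_ε_inv : CT.sliceR h.ε.toLinearMap T.χ⁻¹.val = 1 := by
  have := congrArg (CT.sliceR h.ε.toLinearMap) T.χ.inv_mul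
  rwa [sliceR_algHom_mul, T.sliceR_ε, mul_one, CT.one_def, CT.sliceR_tm, AlgHom.toLinearMap_apply,
    map_one, one_smul] at this

/-- With `U⁻¹` inserted in the middle, the product reads `S(w₁) (S(χ⁽¹⁾) U⁻¹ χ⁽²⁾) w₂`, and the
bracket is `1`. This removes `χ` from the twisted coproduct in the antipode axiom. -/
theorem lift_χ_mul (w : CT X X) :
    CT.lift ((LinearMap.mul K X).compl₁₂ ((LinearMap.mulRight K T.U⁻¹.val).comp h.S)
      LinearMap.id) (T.χ.val * w) = CT.lift ((LinearMap.mul K X).compl₁₂ h.S LinearMap.id) w := by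
  have h₁ : ∀ c d y, CT.lift ((LinearMap.mul K X).compl₁₂ ((LinearMap.mulRight K T.U⁻¹.val).comp h.S)
      LinearMap.id) (y * c ⊠ d) = h.S c * CT.lift ((LinearMap.mul K X).compl₁₂
        ((LinearMap.mulRight K T.U⁻¹.val).comp h.S) LinearMap.id) y * d := fun c d y => by
    have : (CT.lift ((LinearMap.mul K X).compl₁₂ ((LinearMap.mulRight K T.U⁻¹.val).comp h.S)
        LinearMap.id)).comp (LinearMap.mulRight K (c ⊠ d : CT X X)) =
        (LinearMap.mulRight K d).comp ((LinearMap.mulLeft K (h.S c)).comp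
          (CT.lift ((LinearMap.mul K X).compl₁₂ ((LinearMap.mulRight K T.U⁻¹.val).comp h.S)
        LinearMap.id))) := by
      ext a b
      simp [h.S_mul, mul_assoc]
    exact LinearMap.congr_fun this y
  have : (CT.lift ((LinearMap.mul K X).compl₁₂ ((LinearMap.mulRight K T.U⁻¹.val).comp h.S)
      LinearMap.id)).comp (LinearMap.mulLeft K T.χ.val) =
      CT.lift ((LinearMap.mul K X).compl₁₂ h.S LinearMap.id) := by
    refine CT.linear_ext (LinearMap.ext₂ fun c d => ?_)
    refine (h₁ c d T.χ.val).trans ?_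
    rw [T.left]
    simp
  exact LinearMap.congr_fun this w

theorem lift_mul_χinv (w : CT X X) :
    CT.lift ((LinearMap.mul K X).compl₁₂ (LinearMap.mulRight K T.U.val) h.S) (w * T.χ⁻¹.val) =
      CT.lift ((LinearMap.mul K X).compl₁₂ LinearMap.id h.S) w := by
  have h₁ : ∀ c d y, CT.lift ((LinearMap.mul K X).compl₁₂ (LinearMap.mulRight K T.U.val) h.S)
      (c ⊠ d * y) = c * CT.lift ((LinearMap.mul K X).compl₁₂ (LinearMap.mulRight K T.U.val) h.S) y *
        h.S d := fun c d y => by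
    have : (CT.lift ((LinearMap.mul K X).compl₁₂ (LinearMap.mulRight K T.U.val) h.S)).comp
        (LinearMap.mulLeft K (c ⊠ d : CT X X)) =
        (LinearMap.mulRight K (h.S d)).comp ((LinearMap.mulLeft K c).comp
          (CT.lift ((LinearMap.mul K X).compl₁₂ (LinearMap.mulRight K T.U.val) h.S))) := by
      ext a b
      simp [h.S_mul, mul_assoc]
    exact LinearMap.congr_fun this y
  have : (CT.lift ((LinearMap.mul K X).compl₁₂ (LinearMap.mulRight K T.U.val) h.S)).comp
      (LinearMap.mulRight K T.χ⁻¹.val) = CT.lift ((LinearMap.mul K X).compl₁₂ LinearMap.id h.S) := by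
    refine CT.linear_ext (LinearMap.ext₂ fun c d => ?_)
    refine (h₁ c d T.χ⁻¹.val).trans ?_
    rw [T.right]
    simp
  exact LinearMap.congr_fun this w

/-- The twisted Hopf algebra. -/
def hopf : Hopf X where
  Δ := T.Δ
  ε := h.ε
  S := T.S
  coassoc := T.coassoc
  counit_left x := by
    rw [Δ_apply, sliceL_algHom_mul, sliceL_algHom_mul, T.sliceL_ε, T.sliceL_ε_inv, h.counit_left,
      one_mul, mul_one]
  counit_right x := by
    rw [Δ_apply, sliceR_algHom_mul, sliceR_algHom_mul, T.sliceR_ε, T.sliceR_ε_inv, h.counit_right,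
      one_mul, mul_one]
  antipode_left x := by
    have : CT.lift ((LinearMap.mul K X).compl₁₂ T.S LinearMap.id) = (LinearMap.mulLeft K T.U.val).comp
        (CT.lift ((LinearMap.mul K X).compl₁₂ ((LinearMap.mulRight K T.U⁻¹.val).comp h.S)
          LinearMap.id)) := by
      ext a b
      simp [S_apply, mul_assoc]
    rw [this, LinearMap.comp_apply, Δ_apply, mul_assoc, lift_χ_mul,
      lift_antipode_left_mul h.S_mul (h.antipode_left x), T.Uinv_eq, map_smul,
      LinearMap.mulLeft_apply, Units.mul_inv, Algebra.algebraMap_eq_smul_one]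
  antipode_right x := by
    have : CT.lift ((LinearMap.mul K X).compl₁₂ LinearMap.id T.S) =
        (LinearMap.mulRight K T.U⁻¹.val).comp
        (CT.lift ((LinearMap.mul K X).compl₁₂ (LinearMap.mulRight K T.U.val) h.S)) := by
      ext a b
      simp [S_apply, mul_assoc]
    rw [this, LinearMap.comp_apply, Δ_apply, lift_mul_χinv,
      lift_antipode_right_mul h.S_mul (h.antipode_right x), T.U_eq, map_smul,
      LinearMap.mulRight_apply, Units.mul_inv, Algebra.algebraMap_eq_smul_one]
  S_bijective := by
    refine ⟨Function.LeftInverse.injective (g := fun x => h.Sinv (T.U⁻¹.val * x * T.U.val)) fun x => ?_,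
      Function.RightInverse.surjective (g := fun x => h.Sinv (T.U⁻¹.val * x * T.U.val)) fun x => ?_⟩
    · simp [S_apply, mul_assoc]
    · simp [S_apply, mul_assoc]

theorem toData_hopf : T.hopf.toData = h.toData.twist T.χ.val T.χ⁻¹.val := by
  have h₁ : h.toData.twistU T.χ.val = T.U.val := by
    rw [← T.U_eq]
    exact (congrArg (uncpl X) (cmul_map_eq LinearMap.id h.S T.χ.val)).trans (uncpl_of _)
  have h₂ : h.toData.twistUinv T.χ⁻¹.val = T.U⁻¹.val := by
    rw [← T.Uinv_eq]
    exact (congrArg (uncpl X) (cmul_map_eq h.S LinearMap.id T.χ⁻¹.val)).trans (uncpl_of _)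
  refine Hopf.hopfData_ext (fun x => rfl) (fun x => rfl) fun x => ?_
  change T.U.val * h.S x * T.U⁻¹.val =
    h.toData.twistU T.χ.val * h.S x * h.toData.twistUinv T.χ⁻¹.val
  rw [h₁, h₂]

/-- The twisted quasitriangular structure. -/
def qt (q : QT h) : QT T.hopf where
  R := CT.swap T.χ.val * q.R * T.χ⁻¹.val
  Rinv := T.χ.val * q.Rinv * CT.swap T.χ⁻¹.val
  mul_inv := by
    calc _ = CT.swap T.χ.val * (q.R * (T.χ⁻¹.val * T.χ.val) * q.Rinv) * CT.swap T.χ⁻¹.val := by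
          simp only [mul_assoc]
      _ = 1 := by rw [Units.inv_mul, mul_one, q.mul_inv, mul_one, ← map_mul, Units.mul_inv, map_one]
  inv_mul := by
    calc _ = T.χ.val * (q.Rinv * (CT.swap T.χ⁻¹.val * CT.swap T.χ.val) * q.R) * T.χ⁻¹.val := by
          simp only [mul_assoc]
      _ = 1 := by rw [← map_mul, Units.inv_mul, map_one, mul_one, q.inv_mul, mul_one, Units.mul_inv]
  comulR_R := by
    let r : (CT X X)ˣ := ⟨q.R, q.Rinv, q.mul_inv, q.inv_mul⟩
    -- The inputs of the group identity are permutations of the legs in `T.comm` and in the exchange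
    -- relations of `𝓡` with the coproducts of `χ`.
    have h₁ : unit l23 T.χ * unit (l13.comp CT.swap) T.χ = unit (l13.comp CT.swap) T.χ * unit l23 T.χ :=
      Units.ext (by
        have := congrArg perm231 T.comm.eq
        simp only [map_mul, perm231_l12, perm231_l23] at this
        exact this)
    have h₂ : unit l13 r * (unit (l12.comp CT.swap) T.χ * unit l23 T.χ) =
        unit l23 T.χ * unit (l12.comp CT.swap) T.χ * unit l13 r :=
      Units.ext (by
        have := congrArg perm12 (q.l23_R_mul_comulR T.χ.val)
        simp only [T.comulR_χ, map_mul, perm23_l12, perm23_l13, perm12_l12, perm12_l13,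
          perm12_l23] at this
        exact this)
    have h₃ : unit (l12.comp CT.swap) T.χ * unit l13 T.χ = unit l13 T.χ * unit (l12.comp CT.swap) T.χ :=
      Units.ext (by
        have := congrArg perm12 T.comm.eq
        simp only [map_mul, perm12_l12, perm12_l23] at this
        exact this)
    have h₄ : unit l12 r * (unit l23 T.χ * unit l13 T.χ) = unit l13 T.χ * unit l23 T.χ * unit l12 r :=
      Units.ext (by
        have := q.l12_R_mul_comulL T.χ.val
        simp only [T.comulL_χ, map_mul, perm12_l13, perm12_l23] at this
        exact this)
    have h₅ : unit l12 T.χ * unit l23 T.χ = unit l23 T.χ * unit l12 T.χ := Units.ext T.comm.eq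
    have h₆ := congrArg Units.val (twisted_hexagon_right h₁ h₂ h₃ h₄ h₅)
    have h₇ : unit (comulR h.Δ) T.χ = unit l12 T.χ * unit l13 T.χ := Units.ext T.comulR_χ
    rw [← h₇] at h₆
    change comulR T.Δ _ = _
    rw [comulR_Δ, map_mul, map_mul, comulR_swap, T.comulL_χ, q.comulR_R]
    simp only [map_mul, perm231_l23, perm231_l13]
    exact h₆
  comulL_R := by
    let r : (CT X X)ˣ := ⟨q.R, q.Rinv, q.mul_inv, q.inv_mul⟩
    -- The same five inputs for the other hexagon, with the roles of the two exchange relations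
    -- interchanged.
    have h₁ : unit l12 T.χ * unit (l13.comp CT.swap) T.χ = unit (l13.comp CT.swap) T.χ * unit l12 T.χ :=
      Units.ext (by
        have := congrArg perm312 T.comm.eq.symm
        simp only [map_mul, perm312_l12, perm312_l23] at this
        exact this)
    have h₂ : unit l13 r * (unit (l23.comp CT.swap) T.χ * unit l12 T.χ) =
        unit l12 T.χ * unit (l23.comp CT.swap) T.χ * unit l13 r :=
      Units.ext (by
        have := congrArg perm23 (q.l12_R_mul_comulL T.χ.val)
        simp only [T.comulL_χ, map_mul, perm12_l13, perm12_l23, perm23_l12, perm23_l13,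
          perm23_l23] at this
        exact this)
    have h₃ : unit l13 T.χ * unit (l23.comp CT.swap) T.χ = unit (l23.comp CT.swap) T.χ * unit l13 T.χ :=
      Units.ext (by
        have := congrArg perm23 T.comm.eq
        simp only [map_mul, perm23_l12, perm23_l23] at this
        exact this)
    have h₄ : unit l23 r * (unit l12 T.χ * unit l13 T.χ) = unit l13 T.χ * unit l12 T.χ * unit l23 r :=
      Units.ext (by
        have := q.l23_R_mul_comulR T.χ.val
        simp only [T.comulR_χ, map_mul, perm23_l13, perm23_l12] at this
        exact this)
    have h₅ : unit l12 T.χ * unit l23 T.χ = unit l23 T.χ * unit l12 T.χ := Units.ext T.comm.eq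
    have h₆ := congrArg Units.val (twisted_hexagon_left h₁ h₂ h₃ h₄ h₅)
    have h₇ : unit (comulL h.Δ) T.χ = unit l23 T.χ * unit l13 T.χ := Units.ext T.comulL_χ
    rw [← h₇] at h₆
    change comulL T.Δ _ = _
    rw [comulL_Δ, map_mul, map_mul, comulL_swap, T.comulR_χ, q.comulL_R]
    simp only [map_mul, perm312_l12, perm312_l13]
    exact h₆
  swap_Δ x := by
    change CT.swap (T.Δ x) * _ = _ * T.Δ x
    rw [Δ_apply, map_mul, map_mul]
    calc _ = CT.swap T.χ.val * CT.swap (h.Δ x) * (CT.swap T.χ⁻¹.val * CT.swap T.χ.val) * q.R *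
          T.χ⁻¹.val := by simp only [mul_assoc]
      _ = CT.swap T.χ.val * (CT.swap (h.Δ x) * q.R) * T.χ⁻¹.val := by
          rw [← map_mul CT.swap T.χ⁻¹.val, Units.inv_mul, map_one, mul_one]
          simp only [mul_assoc]
      _ = CT.swap T.χ.val * q.R * (T.χ⁻¹.val * T.χ.val) * h.Δ x * T.χ⁻¹.val := by
          rw [q.swap_Δ, Units.inv_mul, mul_one]
          simp only [mul_assoc]
      _ = _ := by simp only [mul_assoc]

variable {q : QT h} (s : RealStar q)

theorem star_conj (y : CT X X) :
    CT.star ((mulLR T.U.val T.U⁻¹.val).comp s.st) y =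
      (T.U.val ⊠ T.U.val) * CT.star s.st y * (T.U⁻¹.val ⊠ T.U⁻¹.val) := by
  have : CT.star ((mulLR T.U.val T.U⁻¹.val).comp s.st) =
      (mulLR (T.U.val ⊠ T.U.val : CT X X) (T.U⁻¹.val ⊠ T.U⁻¹.val)).comp (CT.star s.st) :=
    CT.conj_ext fun a b => by
      change _ = (T.U.val ⊠ T.U.val : CT X X) * CT.star s.st (a ⊠ b) * (T.U⁻¹.val ⊠ T.U⁻¹.val)
      rw [CT.star_tm, CT.star_tm, tm_mul_tm, tm_mul_tm]
      rfl
  exact LinearMap.congr_fun this y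

theorem Δ_Uinv (Δ_U : h.Δ T.U.val = T.χ⁻¹.val * (T.U.val ⊠ T.U.val) * CT.swap T.χ⁻¹.val) :
    h.Δ T.U⁻¹.val = CT.swap T.χ.val * (T.U⁻¹.val ⊠ T.U⁻¹.val) * T.χ.val := by
  have h₁ : h.Δ T.U⁻¹.val * h.Δ T.U.val = 1 := by rw [← map_mul, Units.inv_mul, map_one]
  refine left_inv_eq_right_inv h₁ ?_
  rw [Δ_U]
  calc _ = T.χ⁻¹.val * ((T.U.val ⊠ T.U.val) * (CT.swap T.χ⁻¹.val * CT.swap T.χ.val) *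
        (T.U⁻¹.val ⊠ T.U⁻¹.val)) * T.χ.val := by simp only [mul_assoc]
    _ = 1 := by
      rw [← map_mul, Units.inv_mul, map_one, mul_one, tm_mul_tm, Units.mul_inv, ← CT.one_def, mul_one,
        Units.inv_mul]

theorem star_χinv (star_χ : CT.star s.st T.χ.val = CT.swap T.χ.val) :
    CT.star s.st T.χ⁻¹.val = CT.swap T.χ⁻¹.val := by
  have h₁ : CT.star s.st T.χ⁻¹.val * CT.star s.st T.χ.val = 1 := by
    rw [← CT.star_mul s.st s.st_mul, Units.mul_inv, CT.star_one s.st s.st_one]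
  have h₂ : CT.star s.st T.χ.val * CT.swap T.χ⁻¹.val = 1 := by
    rw [star_χ, ← map_mul, Units.mul_inv, map_one]
  exact left_inv_eq_right_inv h₁ h₂

theorem swap_swap {A B : Type*} [Ring A] [Algebra K A] [Ring B] [Algebra K B] (y : CT A B) :
    CT.swap (CT.swap y) = y := by
  have : (CT.swap (A := B) (B := A)).toLinearMap.comp (CT.swap (A := A) (B := B)).toLinearMap =
      LinearMap.id := by
    ext a b
    simp
  exact LinearMap.congr_fun this y

/-- The twisted `*`-structure. -/
def realStar (star_χ : CT.star s.st T.χ.val = CT.swap T.χ.val) (st_U : s.st T.U.val = T.U.val)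
    (Δ_U : h.Δ T.U.val = T.χ⁻¹.val * (T.U.val ⊠ T.U.val) * CT.swap T.χ⁻¹.val) :
    RealStar (T.qt q) where
  st := (mulLR T.U.val T.U⁻¹.val).comp s.st
  st_st x := by
    change T.U.val * s.st (T.U.val * s.st x * T.U⁻¹.val) * T.U⁻¹.val = x
    have h₁ : s.st T.U⁻¹.val * T.U.val = 1 := by
      rw [← st_U, ← s.st_mul, Units.mul_inv, s.st_one]
    have h₂ : T.U.val * s.st T.U⁻¹.val = 1 := by
      rw [← st_U, ← s.st_mul, Units.inv_mul, s.st_one]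
    rw [s.st_mul, s.st_mul, s.st_st, st_U, ← mul_assoc, ← mul_assoc, h₂, one_mul, mul_assoc,
      Units.mul_inv, mul_one]
  st_mul x y := by
    change T.U.val * s.st (x * y) * T.U⁻¹.val =
      T.U.val * s.st y * T.U⁻¹.val * (T.U.val * s.st x * T.U⁻¹.val)
    rw [s.st_mul]
    simp [mul_assoc]
  st_Δ x := by
    change _ = T.χ.val * h.Δ (T.U.val * s.st x * T.U⁻¹.val) * T.χ⁻¹.val
    rw [star_conj]
    change (T.U.val ⊠ T.U.val) * CT.star s.st (T.χ.val * h.Δ x * T.χ⁻¹.val) *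
      (T.U⁻¹.val ⊠ T.U⁻¹.val) = _
    rw [CT.star_mul _ s.st_mul, CT.star_mul _ s.st_mul, star_χ, T.star_χinv s star_χ, s.st_Δ, map_mul,
      map_mul, Δ_U, T.Δ_Uinv Δ_U]
    simp [mul_assoc]
  st_ε x := by
    change _ = h.ε (T.U.val * s.st x * T.U⁻¹.val)
    rw [map_mul, map_mul, mul_comm, ← mul_assoc, ← map_mul, Units.inv_mul, map_one, one_mul]
    exact s.st_ε x
  real := by
    rw [star_conj]
    change (T.U.val ⊠ T.U.val) * CT.star s.st (CT.swap T.χ.val * q.R * T.χ⁻¹.val) *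
      (T.U⁻¹.val ⊠ T.U⁻¹.val) = CT.swap (CT.swap T.χ.val * q.R * T.χ⁻¹.val)
    -- The hypothesis on `Δ U` trades `U ⊗ U` for `χ Δ(U)` on one side and `Δᵒᵖ(U⁻¹)` on the other;
    -- `𝓡₂₁` intertwines the two, and they cancel.
    have h₁ : (T.U.val ⊠ T.U.val : CT X X) * CT.swap T.χ⁻¹.val = T.χ.val * h.Δ T.U.val := by
      rw [Δ_U]
      simp [mul_assoc]
    have h₂ : T.χ.val * (T.U⁻¹.val ⊠ T.U⁻¹.val) = CT.swap (h.Δ T.U⁻¹.val) * CT.swap T.χ⁻¹.val := by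
      rw [T.Δ_Uinv Δ_U, ← map_mul]
      simp [mul_assoc, swap_swap]
    have h₃ : h.Δ T.U.val * CT.swap q.R = CT.swap q.R * CT.swap (h.Δ T.U.val) := by
      have := congrArg CT.swap (q.swap_Δ T.U.val)
      rwa [map_mul, map_mul, swap_swap] at this
    rw [CT.star_mul _ s.st_mul, CT.star_mul _ s.st_mul, CT.star_swap, star_χ, T.star_χinv s star_χ,
      s.real, swap_swap, map_mul, map_mul, swap_swap]
    calc _ = (T.U.val ⊠ T.U.val) * CT.swap T.χ⁻¹.val * CT.swap q.R *
          (T.χ.val * (T.U⁻¹.val ⊠ T.U⁻¹.val)) := by simp only [mul_assoc]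
      _ = T.χ.val * (h.Δ T.U.val * CT.swap q.R) * CT.swap (h.Δ T.U⁻¹.val) * CT.swap T.χ⁻¹.val := by
          rw [h₁, h₂]
          simp only [mul_assoc]
      _ = T.χ.val * CT.swap q.R * (CT.swap (h.Δ T.U.val) * CT.swap (h.Δ T.U⁻¹.val)) *
          CT.swap T.χ⁻¹.val := by
          rw [h₃]
          simp only [mul_assoc]
      _ = _ := by rw [← map_mul, ← map_mul, Units.mul_inv, map_one, map_one, mul_one]

end Twist

end QStar
namespace QStar

/-! ### `*`-structures on the tensor square -/

section SquareStar

open Sq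

variable {H : Type*} [Ring H] [Algebra K H] [IsAdicComplete tIdeal H] {h : Hopf H} {q : QT h}

theorem Sq.conj_mul_rev (T : Sq H →ₛₗ[conjK] Sq H) {f g : H → Sq H}
    (hfg : ∀ a b, f a * g b = g b * f a) (hf : ∀ a b, f (a * b) = f b * f a)
    (hg : ∀ a b, g (a * b) = g b * g a) (hT : ∀ a b, T (i1 a * i2 b) = f a * g b) (x y : Sq H) :
    T (x * y) = T y * T x := by
  have h₀ : ∀ a b a' b' : H, (i1 a * i2 b) * (i1 a' * i2 b') = i1 (a * a') * i2 (b * b') :=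
    fun a b a' b' => by
      rw [map_mul, map_mul, mul_assoc, ← mul_assoc (i2 b), ← (i1_commute a' b).eq]
      simp only [mul_assoc]
  have h₁ : ∀ a b y, T (i1 a * i2 b * y) = T y * T (i1 a * i2 b) := fun a b y => by
    have : T.comp (LinearMap.mulLeft K (i1 a * i2 b)) =
        (LinearMap.mulRight K (T (i1 a * i2 b))).comp T :=
      Sq.conj_ext fun a' b' => by
        simp only [LinearMap.comp_apply, LinearMap.mulLeft_apply, LinearMap.mulRight_apply, h₀, hT, hf,
          hg]
        rw [mul_assoc, ← mul_assoc (f a), hfg a b', mul_assoc, mul_assoc, hfg a b]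
    exact LinearMap.congr_fun this y
  have : T.comp (LinearMap.mulRight K y) = (LinearMap.mulLeft K (T y)).comp T :=
    Sq.conj_ext fun a b => by simpa using h₁ a b y
  exact LinearMap.congr_fun this x

/-- A `*`-structure on the tensor square preserving or exchanging the two factors. -/
def RealStar.ofSquare (s₁ s₂ : RealStar q) {j₁ j₂ : H →ₐ[K] Sq H}
    (hj : ∀ a b, Commute (j₁ a) (j₂ b))
    (hΔ₁ : ∀ a, h.sqΔ (j₁ a) = CT.map j₁ j₁ (h.Δ a)) (hΔ₂ : ∀ a, h.sqΔ (j₂ a) = CT.map j₂ j₂ (h.Δ a))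
    (hε₁ : ∀ a, h.sqε (j₁ a) = h.ε a) (hε₂ : ∀ a, h.sqε (j₂ a) = h.ε a)
    (hR : ∀ y, CT.map j₂ j₂ y * CT.map j₁ j₁ y = (CT.map i1 i1 y * CT.map i2 i2 y : CT (Sq H) (Sq H)))
    (T : Sq H →ₛₗ[conjK] Sq H) (hT : ∀ a b, T (i1 a * i2 b) = j₁ (s₁.st a) * j₂ (s₂.st b))
    (inv₁ : ∀ a, T (j₁ (s₁.st a)) = i1 a) (inv₂ : ∀ a, T (j₂ (s₂.st a)) = i2 a) :
    RealStar q.square :=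
  have st_mul : ∀ x y, T (x * y) = T y * T x :=
    Sq.conj_mul_rev T (f := fun a => j₁ (s₁.st a)) (g := fun a => j₂ (s₂.st a)) (fun a b => (hj _ _).eq)
      (fun a b => by rw [s₁.st_mul, map_mul]) (fun a b => by rw [s₂.st_mul, map_mul]) hT
  have T₁ : ∀ a, T (i1 a) = j₁ (s₁.st a) := fun a => by simpa [s₂.st_one] using hT a 1
  have T₂ : ∀ a, T (i2 a) = j₂ (s₂.st a) := fun a => by simpa [s₁.st_one] using hT 1 a
  have star₁ : ∀ y, CT.star T (CT.map i1 i1 y) = CT.map j₁ j₁ (CT.star s₁.st y) := fun y => by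
    have : (CT.star T).comp (CT.map i1 i1).toLinearMap =
        (CT.map j₁ j₁).toLinearMap.comp (CT.star s₁.st) := CT.conj_ext fun a b => by simp [T₁]
    exact LinearMap.congr_fun this y
  have star₂ : ∀ y, CT.star T (CT.map i2 i2 y) = CT.map j₂ j₂ (CT.star s₂.st y) := fun y => by
    have : (CT.star T).comp (CT.map i2 i2).toLinearMap =
        (CT.map j₂ j₂).toLinearMap.comp (CT.star s₂.st) := CT.conj_ext fun a b => by simp [T₂]
    exact LinearMap.congr_fun this y
  { st := T
    st_mul := st_mul
    st_st := fun x => by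
      have : T.comp T = LinearMap.id := Sq.linear_ext fun a b => by
        simp only [LinearMap.comp_apply, LinearMap.id_apply]
        rw [hT, st_mul, inv₁, inv₂, (i1_commute a b).eq]
      exact LinearMap.congr_fun this x
    st_Δ := fun x => by
      have : (CT.star T).comp h.sqΔ.toLinearMap = h.sqΔ.toLinearMap.comp T :=
        Sq.conj_ext fun a b => by
          simp only [LinearMap.comp_apply, AlgHom.toLinearMap_apply]
          rw [map_mul h.sqΔ, CT.star_mul _ st_mul, h.sqΔ_i1, h.sqΔ_i2, star₁, star₂, s₁.st_Δ, s₂.st_Δ,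
            st_mul, T₁, T₂, map_mul, hΔ₁, hΔ₂]
      exact LinearMap.congr_fun this x
    st_ε := fun x => by
      let conjL : K →ₛₗ[conjK] K := ⟨⟨conjK, map_add conjK⟩, fun a b => map_mul conjK a b⟩
      have : conjL.comp h.sqε.toLinearMap = h.sqε.toLinearMap.comp T := Sq.conj_ext fun a b => by
        simp only [LinearMap.comp_apply, AlgHom.toLinearMap_apply]
        rw [hT, map_mul h.sqε, map_mul h.sqε, hε₁, hε₂, h.sqε_i1, h.sqε_i2, ← s₁.st_ε, ← s₂.st_ε]
        exact map_mul conjK _ _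
      exact LinearMap.congr_fun this x
    real := by
      change CT.star T (CT.map i1 i1 q.R * CT.map i2 i2 q.R) =
        CT.swap (CT.map i1 i1 q.R * CT.map i2 i2 q.R)
      rw [CT.star_mul _ st_mul, star₁, star₂, s₁.real, s₂.real, hR, map_mul, BB.swap_map, BB.swap_map] }

/-- The conjugate-linear map `a ⊗ b ↦ f a ⊗ g b` on the tensor square. -/
def Sq.tensorConj (f g : H →ₛₗ[conjK] H) : Sq H →ₛₗ[conjK] Sq H := cmapConj (TensorProduct.map f g)

theorem Sq.tensorConj_of (f g : H →ₛₗ[conjK] H) (a b : H) :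
    @Eq (CT H H) (Sq.tensorConj f g (a ⊠ b : CT H H)) (f a ⊠ g b : CT H H) :=
  cmapConj_of (TensorProduct.map f g) (a ⊗ₜ[K] b)

theorem Sq.tensorConj_tm (f g : H →ₛₗ[conjK] H) (a b : H) :
    Sq.tensorConj f g (i1 a * i2 b) = i1 (f a) * i2 (g b) := by
  rw [← tm_eq, ← tm_eq]
  exact Sq.tensorConj_of f g a b

/-- The conjugate-linear map `a ⊗ b ↦ f b ⊗ f a` on the tensor square. -/
def Sq.exchangeConj (f : H →ₛₗ[conjK] H) : Sq H →ₛₗ[conjK] Sq H := flip.comp (starT f)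

theorem Sq.exchangeConj_eq (f : H →ₛₗ[conjK] H) (y : CT H H) :
    @Eq (CT H H) (Sq.exchangeConj f y) (CT.swap (CT.star f y)) := flip_eq _

theorem Sq.exchangeConj_tm (f : H →ₛₗ[conjK] H) (a b : H) :
    Sq.exchangeConj f (i1 a * i2 b) = i2 (f a) * i1 (f b) := by
  rw [← tm_eq, ← (i1_commute _ _).eq, ← tm_eq]
  exact (Sq.exchangeConj_eq f (a ⊠ b)).trans (by rw [CT.star_tm, CT.swap_tm])

/-- The tensor product of two `*`-structures. -/
def RealStar.tensor (s₁ s₂ : RealStar q) : RealStar q.square :=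
  RealStar.ofSquare s₁ s₂ i1_commute h.sqΔ_i1 h.sqΔ_i2 h.sqε_i1 h.sqε_i2
    (fun y => (map_comm y y).eq.symm) (Sq.tensorConj s₁.st s₂.st) (Sq.tensorConj_tm s₁.st s₂.st)
    (fun a => by simpa [s₁.st_st, s₂.st_one] using Sq.tensorConj_tm s₁.st s₂.st (s₁.st a) 1)
    (fun a => by simpa [s₂.st_st, s₁.st_one] using Sq.tensorConj_tm s₁.st s₂.st 1 (s₂.st a))

/-- The `*`-structure `(a ⊗ b)^* = b^* ⊗ a^*`. -/
def RealStar.exchange (s : RealStar q) : RealStar q.square :=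
  RealStar.ofSquare s s (fun a b => (i1_commute b a).symm) h.sqΔ_i2 h.sqΔ_i1 h.sqε_i2 h.sqε_i1
    (fun _ => rfl) (Sq.exchangeConj s.st) (Sq.exchangeConj_tm s.st)
    (fun a => by simpa [s.st_st, s.st_one] using Sq.exchangeConj_tm s.st 1 (s.st a))
    (fun a => by simpa [s.st_st, s.st_one] using Sq.exchangeConj_tm s.st (s.st a) 1)

theorem RealStar.exchange_st (s : RealStar q) : s.exchange.st = Sq.exchangeConj s.st := rfl

theorem RealStar.exchange_i1 (s : RealStar q) (a : H) : s.exchange.st (i1 a) = i2 (s.st a) := by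
  rw [s.exchange_st]
  simpa [s.st_one] using Sq.exchangeConj_tm s.st a 1

theorem RealStar.exchange_i2 (s : RealStar q) (a : H) : s.exchange.st (i2 a) = i1 (s.st a) := by
  rw [s.exchange_st]
  simpa [s.st_one] using Sq.exchangeConj_tm s.st 1 a

/-- The `*`-structure `x ↦ (S² x)^*`. -/
def RealStar.sqAntipode (s : RealStar q) (hS : ∀ x, h.S (s.st (h.S (s.st x))) = x) : RealStar q where
  st := s.st.comp (h.S.comp h.S)
  st_st x := by
    have h₁ : ∀ x, s.st (h.S (s.st (h.S x))) = x := fun x => by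
      have := congrArg s.st (hS (s.st x))
      rwa [s.st_st] at this
    change s.st (h.S (h.S (s.st (h.S (h.S x))))) = x
    -- From `* ∘ S ∘ * ∘ S = id`: a composite `S ∘ * ∘ S` reduces to `*`, so the two squares of the
    -- antipode cancel.
    have h₂ : h.S (s.st (h.S (h.S x))) = s.st (h.S x) := by
      rw [← s.st_st (h.S (s.st (h.S (h.S x)))), h₁]
    rw [h₂, h₁]
  st_mul x y := by
    change s.st (h.S (h.S (x * y))) = s.st (h.S (h.S y)) * s.st (h.S (h.S x))
    rw [h.S_mul, h.S_mul, s.st_mul]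
  st_Δ x := by
    have h₁ : ∀ y : CT H H, CT.star (s.st.comp (h.S.comp h.S)) y =
        CT.star s.st (CT.swap (CT.lmap h.S h.S (CT.swap (CT.lmap h.S h.S y)))) := fun y => by
      have : CT.star (s.st.comp (h.S.comp h.S)) = (CT.star s.st).comp
          ((CT.swap (A := H) (B := H)).toLinearMap.comp ((CT.lmap h.S h.S).comp
            ((CT.swap (A := H) (B := H)).toLinearMap.comp (CT.lmap h.S h.S)))) :=
        CT.conj_ext fun a b => by simp
      exact LinearMap.congr_fun this y
    rw [h₁, ← h.Δ_S, ← h.Δ_S, s.st_Δ]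
    rfl
  st_ε x := by
    change conjK (h.ε x) = h.ε (s.st (h.S (h.S x)))
    rw [← s.st_ε, h.ε_S, h.ε_S]
  real := by
    have h₁ : ∀ y : CT H H, CT.star (s.st.comp (h.S.comp h.S)) y =
        CT.star s.st (CT.lmap h.S h.S (CT.lmap h.S h.S y)) := fun y => by
      have : CT.star (s.st.comp (h.S.comp h.S)) = (CT.star s.st).comp
          ((CT.lmap h.S h.S).comp (CT.lmap h.S h.S)) := CT.conj_ext fun a b => by simp
      exact LinearMap.congr_fun this y
    rw [h₁, q.lmap_S_S, q.lmap_S_S, s.real]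

end SquareStar

/-! ### The twisted square -/

section Bowtie

open Sq

variable {H : Type*} [Ring H] [Algebra K H] [IsAdicComplete tIdeal H] {h : Hopf H}

namespace QT

variable (q : QT h)

theorem comulL_Rinv : comulL h.Δ q.Rinv = l23 q.Rinv * l13 q.Rinv := by
  have h₁ : comulL h.Δ q.Rinv * comulL h.Δ q.R = 1 := by rw [← map_mul, q.inv_mul, map_one]
  refine left_inv_eq_right_inv h₁ ?_
  rw [q.comulL_R]
  calc _ = l13 q.R * (l23 q.R * l23 q.Rinv) * l13 q.Rinv := by simp only [mul_assoc]
    _ = 1 := by rw [← map_mul, q.mul_inv, map_one, mul_one, ← map_mul, q.mul_inv, map_one]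

theorem sliceL_ε_inv : CT.sliceL h.ε.toLinearMap q.Rinv = 1 := by
  have := congrArg (CT.sliceL h.ε.toLinearMap) q.inv_mul
  rwa [sliceL_algHom_mul, q.sliceL_ε, mul_one, CT.one_def, CT.sliceL_tm, AlgHom.toLinearMap_apply,
    map_one, one_smul] at this

end QT

/-- The completed tensor cube of three algebra maps. -/
def CT3.map₃ {X Z : Type*} [Ring X] [Algebra K X] [Ring Z] [Algebra K Z] (f g k : X →ₐ[K] Z) :
    CT3 X →ₐ[K] CT3 Z :=
  CT3.liftAlg (e1.comp f) (e2.comp g) (e3.comp k) (fun a b => e1_e2 (f a) (g b))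
    (fun a b => e1_e3 (f a) (k b)) fun a b => e2_e3 (g a) (k b)

@[simp] theorem CT3.map₃_tm {X Z : Type*} [Ring X] [Algebra K X] [Ring Z] [Algebra K Z]
    (f g k : X →ₐ[K] Z) (a b c : X) : CT3.map₃ f g k (tm3 a b c) = tm3 (f a) (g b) (k c) :=
  (CT3.liftAlg_tm _ _ _ _ _ _ a b c).trans (by simp [e1_apply, e2_apply, e3_apply])

theorem CT3.map₃_l12 {X Z : Type*} [Ring X] [Algebra K X] [Ring Z] [Algebra K Z]
    (f g k : X →ₐ[K] Z) (y : CT X X) : CT3.map₃ f g k (l12 y) = l12 (CT.map f g y) :=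
  eq_of_tm (F := (CT3.map₃ f g k).comp l12) (G := l12.comp (CT.map f g)) (fun a b => by simp) y

theorem CT3.map₃_l13 {X Z : Type*} [Ring X] [Algebra K X] [Ring Z] [Algebra K Z]
    (f g k : X →ₐ[K] Z) (y : CT X X) : CT3.map₃ f g k (l13 y) = l13 (CT.map f k y) :=
  eq_of_tm (F := (CT3.map₃ f g k).comp l13) (G := l13.comp (CT.map f k)) (fun a b => by simp) y

theorem CT3.map₃_l23 {X Z : Type*} [Ring X] [Algebra K X] [Ring Z] [Algebra K Z]
    (f g k : X →ₐ[K] Z) (y : CT X X) : CT3.map₃ f g k (l23 y) = l23 (CT.map g k y) :=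
  eq_of_tm (F := (CT3.map₃ f g k).comp l23) (G := l23.comp (CT.map g k)) (fun a b => by simp) y

theorem comulL_map₂ {X Z : Type*} [Ring X] [Algebra K X] [Ring Z] [Algebra K Z]
    {Δ : X →ₐ[K] CT X X} {Δ' : Z →ₐ[K] CT Z Z} (f g : X →ₐ[K] Z)
    (hf : ∀ x, Δ' (f x) = CT.map f f (Δ x)) (y : CT X X) :
    comulL Δ' (CT.map f g y) = CT3.map₃ f f g (comulL Δ y) :=
  eq_of_tm (F := (comulL Δ').comp (CT.map f g)) (G := (CT3.map₃ f f g).comp (comulL Δ))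
    (fun a b => by simp [hf, CT3.map₃_l12, e3_apply]) y

theorem comulR_map₂ {X Z : Type*} [Ring X] [Algebra K X] [Ring Z] [Algebra K Z]
    {Δ : X →ₐ[K] CT X X} {Δ' : Z →ₐ[K] CT Z Z} (f g : X →ₐ[K] Z)
    (hg : ∀ x, Δ' (g x) = CT.map g g (Δ x)) (y : CT X X) :
    comulR Δ' (CT.map f g y) = CT3.map₃ f g g (comulR Δ y) :=
  eq_of_tm (F := (comulR Δ').comp (CT.map f g)) (G := (CT3.map₃ f g g).comp (comulR Δ))
    (fun a b => by simp [hg, CT3.map₃_l23, e1_apply]) y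

namespace QT

variable (q : QT h)

/-- As `S` reverses products, multiplying `(S ⊗ id) w` by `S(a)` on the left and by `b` on the right
amounts to multiplying `w` by `a ⊗ b` on the right. -/
theorem lmap_S_Rinv_mul (z : CT H H) (w : CT H H) :
    CT.lift ((LinearMap.mul K (CT H H)).compl₁₂
      ((LinearMap.mulRight K (CT.lmap h.S LinearMap.id w)).comp (CT.inl.toLinearMap.comp h.S))
      CT.inr.toLinearMap) z = CT.lmap h.S LinearMap.id (w * z) := by
  have h₁ : ∀ a b, (h.S a ⊠ 1 : CT H H) * CT.lmap h.S LinearMap.id w * (1 ⊠ b) =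
      CT.lmap h.S LinearMap.id (w * a ⊠ b) := fun a b => by
    have : (LinearMap.mulRight K (1 ⊠ b : CT H H)).comp ((LinearMap.mulLeft K (h.S a ⊠ 1 : CT H H)).comp
        (CT.lmap h.S LinearMap.id)) = (CT.lmap h.S LinearMap.id).comp
          (LinearMap.mulRight K (a ⊠ b : CT H H)) := by
      ext c d
      simp [h.S_mul]
    exact LinearMap.congr_fun this w
  have : CT.lift ((LinearMap.mul K (CT H H)).compl₁₂
      ((LinearMap.mulRight K (CT.lmap h.S LinearMap.id w)).comp (CT.inl.toLinearMap.comp h.S))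
      CT.inr.toLinearMap) = (CT.lmap h.S LinearMap.id).comp (LinearMap.mulLeft K w) := by
    refine CT.linear_ext (LinearMap.ext₂ fun a b => ?_)
    refine (CT.lift_tm _ a b).trans (h₁ a b)
  exact LinearMap.congr_fun this z

theorem lmap_S_mul_R (z : CT H H) (w : CT H H) :
    CT.lift ((LinearMap.mul K (CT H H)).compl₁₂
      ((LinearMap.mulRight K (CT.lmap LinearMap.id h.S w)).comp CT.inl.toLinearMap)
      (CT.inr.toLinearMap.comp h.S)) z = CT.lmap LinearMap.id h.S (z * w) := by
  have h₁ : ∀ a b, (a ⊠ 1 : CT H H) * CT.lmap LinearMap.id h.S w * (1 ⊠ h.S b) =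
      CT.lmap LinearMap.id h.S (a ⊠ b * w) := fun a b => by
    have : (LinearMap.mulRight K (1 ⊠ h.S b : CT H H)).comp ((LinearMap.mulLeft K (a ⊠ 1 : CT H H)).comp
        (CT.lmap LinearMap.id h.S)) = (CT.lmap LinearMap.id h.S).comp
          (LinearMap.mulLeft K (a ⊠ b : CT H H)) := by
      ext c d
      simp [h.S_mul]
    exact LinearMap.congr_fun this w
  have : CT.lift ((LinearMap.mul K (CT H H)).compl₁₂
      ((LinearMap.mulRight K (CT.lmap LinearMap.id h.S w)).comp CT.inl.toLinearMap)
      (CT.inr.toLinearMap.comp h.S)) = (CT.lmap LinearMap.id h.S).comp (LinearMap.mulRight K w) := by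
    refine CT.linear_ext (LinearMap.ext₂ fun a b => ?_)
    refine (CT.lift_tm _ a b).trans (h₁ a b)
  exact LinearMap.congr_fun this z

/-- The transposition, with values in the tensor square. -/
def swapSq : CT H H →ₐ[K] Sq H := (CT.swap : CT H H →ₐ[K] CT H H)

theorem swapSq_tm (a b : H) : swapSq (a ⊠ b) = i2 a * i1 b := by
  rw [← (i1_commute b a).eq, ← tm_eq]
  exact CT.swap_tm a b

theorem swapSq_inl (a : H) : swapSq (CT.inl a) = i2 a := by
  rw [CT.inl_apply, swapSq_tm, map_one, mul_one]

theorem swapSq_inr (a : H) : swapSq (CT.inr a) = i1 a := by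
  rw [CT.inr_apply, swapSq_tm, map_one, one_mul]

/-- The image of the hexagon `(Δ ⊗ id)𝓡 = 𝓡₁₃𝓡₂₃` under an algebra map built from three mutually
commuting ones. -/
theorem liftAlg_comul_left {Y : Type*} [Ring Y] [Algebra K Y] [IsAdicComplete tIdeal Y]
    {f₁ f₂ g : H →ₐ[K] Y} (c₁₂ : ∀ a b, Commute (f₁ a) (f₂ b)) (c₁ : ∀ a b, Commute (f₁ a) (g b))
    (c₂ : ∀ a b, Commute (f₂ a) (g b))
    (c : ∀ a b, Commute (((CT.liftAlg f₁ f₂ c₁₂).comp h.Δ) a) (g b)) :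
    CT.liftAlg ((CT.liftAlg f₁ f₂ c₁₂).comp h.Δ) g c q.R =
      CT.liftAlg f₁ g c₁ q.R * CT.liftAlg f₂ g c₂ q.R := by
  let F : CT3 H →ₐ[K] Y := CT3.liftAlg f₁ f₂ g c₁₂ c₁ c₂
  have F_tm : ∀ a b d, F (tm3 a b d) = f₁ a * (f₂ b * g d) := CT3.liftAlg_tm f₁ f₂ g c₁₂ c₁ c₂
  have F12 : ∀ y, F (l12 y) = CT.liftAlg f₁ f₂ c₁₂ y :=
    eq_of_tm (F := F.comp l12) fun a b => by simp [F_tm]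
  have F13 : ∀ y, F (l13 y) = CT.liftAlg f₁ g c₁ y :=
    eq_of_tm (F := F.comp l13) fun a b => by simp [F_tm]
  have F23 : ∀ y, F (l23 y) = CT.liftAlg f₂ g c₂ y :=
    eq_of_tm (F := F.comp l23) fun a b => by simp [F_tm]
  have FL : ∀ y, F (comulL h.Δ y) = CT.liftAlg ((CT.liftAlg f₁ f₂ c₁₂).comp h.Δ) g c y :=
    eq_of_tm (F := F.comp (comulL h.Δ)) fun a b => by simp [F_tm, F12, e3_apply]
  rw [← FL, q.comulL_R, map_mul, F13, F23]

theorem liftAlg_comul_right {Y : Type*} [Ring Y] [Algebra K Y] [IsAdicComplete tIdeal Y]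
    {f g₁ g₂ : H →ₐ[K] Y} (c₁₂ : ∀ a b, Commute (g₁ a) (g₂ b)) (c₁ : ∀ a b, Commute (f a) (g₁ b))
    (c₂ : ∀ a b, Commute (f a) (g₂ b))
    (c : ∀ a b, Commute (f a) (((CT.liftAlg g₁ g₂ c₁₂).comp h.Δ) b)) :
    CT.liftAlg f ((CT.liftAlg g₁ g₂ c₁₂).comp h.Δ) c q.R =
      CT.liftAlg f g₂ c₂ q.R * CT.liftAlg f g₁ c₁ q.R := by
  let F : CT3 H →ₐ[K] Y := CT3.liftAlg f g₁ g₂ c₁ c₂ c₁₂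
  have F_tm : ∀ a b d, F (tm3 a b d) = f a * (g₁ b * g₂ d) := CT3.liftAlg_tm f g₁ g₂ c₁ c₂ c₁₂
  have F12 : ∀ y, F (l12 y) = CT.liftAlg f g₁ c₁ y :=
    eq_of_tm (F := F.comp l12) fun a b => by simp [F_tm]
  have F13 : ∀ y, F (l13 y) = CT.liftAlg f g₂ c₂ y :=
    eq_of_tm (F := F.comp l13) fun a b => by simp [F_tm]
  have F23 : ∀ y, F (l23 y) = CT.liftAlg g₁ g₂ c₁₂ y :=
    eq_of_tm (F := F.comp l23) fun a b => by simp [F_tm]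
  have FR : ∀ y, F (comulR h.Δ y) = CT.liftAlg f ((CT.liftAlg g₁ g₂ c₁₂).comp h.Δ) c y :=
    eq_of_tm (F := F.comp (comulR h.Δ)) fun a b => by simp [F_tm, F23, e1_apply]
  rw [← FR, q.comulR_R, map_mul, F13, F12]

theorem commute_liftAlg_comul {Y : Type*} [Ring Y] [Algebra K Y] [IsAdicComplete tIdeal Y]
    {f g₁ g₂ : H →ₐ[K] Y} (c₁₂ : ∀ a b, Commute (g₁ a) (g₂ b)) (c₁ : ∀ a b, Commute (f a) (g₁ b))
    (c₂ : ∀ a b, Commute (f a) (g₂ b)) (a b : H) :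
    Commute (f a) (((CT.liftAlg g₁ g₂ c₁₂).comp h.Δ) b) :=
  (commute_of_pure (CT.liftAlg g₁ g₂ c₁₂) (fun d => by simpa [CT.inl_apply] using (c₁ a d).symm)
    (fun d => by simpa [CT.inr_apply] using (c₂ a d).symm) (h.Δ b)).symm

/-- Both hexagons together write `(Δ ⊗ Δ)𝓡` as a product of four copies of `𝓡`. -/
theorem liftAlg_comul_comul {Y : Type*} [Ring Y] [Algebra K Y] [IsAdicComplete tIdeal Y]
    {f₁ f₂ g₁ g₂ : H →ₐ[K] Y} (cf : ∀ a b, Commute (f₁ a) (f₂ b))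
    (cg : ∀ a b, Commute (g₁ a) (g₂ b)) (c₁₁ : ∀ a b, Commute (f₁ a) (g₁ b))
    (c₁₂ : ∀ a b, Commute (f₁ a) (g₂ b)) (c₂₁ : ∀ a b, Commute (f₂ a) (g₁ b))
    (c₂₂ : ∀ a b, Commute (f₂ a) (g₂ b))
    (c : ∀ a b, Commute (((CT.liftAlg f₁ f₂ cf).comp h.Δ) a) (((CT.liftAlg g₁ g₂ cg).comp h.Δ) b)) :
    CT.liftAlg ((CT.liftAlg f₁ f₂ cf).comp h.Δ) ((CT.liftAlg g₁ g₂ cg).comp h.Δ) c q.R =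
      CT.liftAlg f₁ g₂ c₁₂ q.R * CT.liftAlg f₁ g₁ c₁₁ q.R *
        (CT.liftAlg f₂ g₂ c₂₂ q.R * CT.liftAlg f₂ g₁ c₂₁ q.R) := by
  rw [liftAlg_comul_left q cf (commute_liftAlg_comul cg c₁₁ c₁₂) (commute_liftAlg_comul cg c₂₁ c₂₂),
    liftAlg_comul_right q cg c₁₁ c₁₂, liftAlg_comul_right q cg c₂₁ c₂₂]

theorem map_comm' (a b : H) : Commute (((CT.map (i2 : H →ₐ[K] Sq H) i2).comp h.Δ) a)
    (((CT.map i1 i1).comp h.Δ) b) := (map_comm (h.Δ b) (h.Δ a)).symm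

theorem sqΔ_swapSq (y : CT H H) : h.sqΔ (swapSq y) =
    CT.liftAlg ((CT.map (i2 : H →ₐ[K] Sq H) i2).comp h.Δ) ((CT.map i1 i1).comp h.Δ) map_comm' y :=
  eq_of_tm (F := h.sqΔ.comp swapSq) (fun a b => by
    rw [AlgHom.comp_apply, swapSq_tm, map_mul, h.sqΔ_i1, h.sqΔ_i2]
    exact (CT.liftAlg_tm _ _ map_comm' a b).symm) y

theorem commute_i2_i1 {Y : Type*} [Ring Y] [Algebra K Y] (f : Sq H →ₐ[K] Y) (a b : H) :
    Commute ((f.comp i2) a) ((f.comp i1) b) := ((i1_commute b a).map f).symm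

theorem algHom_swapSq {Y : Type*} [Ring Y] [Algebra K Y] [IsAdicComplete tIdeal Y] (f : Sq H →ₐ[K] Y)
    (y : CT H H) : f (swapSq y) = CT.liftAlg (f.comp i2) (f.comp i1) (commute_i2_i1 f) y :=
  eq_of_tm (F := f.comp swapSq) (fun a b => by
    rw [AlgHom.comp_apply, swapSq_tm, map_mul]
    exact (CT.liftAlg_tm _ _ (commute_i2_i1 f) a b).symm) y

theorem commute_inl_inr {X Z : Type*} [Ring X] [Algebra K X] [Ring Z] [Algebra K Z]
    (f g : X →ₐ[K] Z) (a b : X) :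
    Commute (((CT.inl : Z →ₐ[K] CT Z Z).comp f) a) ((CT.inr.comp g) b) := CT.commute (f a) (g b)

theorem commute_inr_inl {X Z : Type*} [Ring X] [Algebra K X] [Ring Z] [Algebra K Z]
    (f g : X →ₐ[K] Z) (a b : X) :
    Commute (((CT.inr : Z →ₐ[K] CT Z Z).comp f) a) ((CT.inl.comp g) b) := (CT.commute (g b) (f a)).symm

theorem swap_map_eq_liftAlg {X Z : Type*} [Ring X] [Algebra K X] [Ring Z] [Algebra K Z]
    (f g : X →ₐ[K] Z) (y : CT X X) : CT.swap (CT.map f g y) =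
      CT.liftAlg (CT.inr.comp f) (CT.inl.comp g) (commute_inr_inl f g) y :=
  eq_of_tm (F := CT.swap.comp (CT.map f g)) (fun a b => by
    refine Eq.trans ?_ (CT.liftAlg_tm _ _ (commute_inr_inl f g) a b).symm
    simp [CT.inl_apply, CT.inr_apply]) y

theorem tm_self_eq {X : Type*} [Ring X] [Algebra K X] (a : X) :
    (a ⊠ a : CT X X) = CT.inl a * CT.inr a := by simp [CT.inl_apply, CT.inr_apply]

/-- Of the four copies of `𝓡` in `(Δ ⊗ Δ)𝓡`, the outer two join different tensorands and are `χ⁻¹`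
and its flip; the inner two are `U ⊗ 1` and `1 ⊗ U`. This is the condition under which conjugation
by `U` makes the twisted `*` compatible with the twisted coproduct. -/
theorem sqΔ_swapSq_R : h.sqΔ (swapSq q.R) =
    CT.map i2 i1 q.R * (swapSq q.R ⊠ swapSq q.R) * CT.swap (CT.map i2 i1 q.R) := by
  rw [sqΔ_swapSq, tm_self_eq, algHom_swapSq, algHom_swapSq, swap_map_eq_liftAlg]
  have := liftAlg_comul_comul q (commute_inl_inr (i2 : H →ₐ[K] Sq H) i2) (commute_inl_inr i1 i1)
    (commute_i2_i1 CT.inl) (commute_inl_inr i2 i1) (commute_inr_inl i2 i1) (commute_i2_i1 CT.inr)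
    map_comm'
  simp only [mul_assoc] at this ⊢
  exact this

end QT

end Bowtie

end QStar
namespace QStar

/-! ### The cocycle of `H ⋈ H` and its real structure -/

section Bowtie

open Sq

theorem sliceL_map {X Z : Type*} [Ring X] [Algebra K X] [IsAdicComplete tIdeal X] [Ring Z] [Algebra K Z]
    [IsAdicComplete tIdeal Z] (f g : X →ₐ[K] Z) (φ : Z →ₗ[K] K) {ψ : X →ₗ[K] K}
    (hψ : ∀ x, φ (f x) = ψ x) (y : CT X X) :
    CT.sliceL φ (CT.map f g y) = g (CT.sliceL ψ y) := by
  have : (CT.sliceL φ).comp (CT.map f g).toLinearMap = g.toLinearMap.comp (CT.sliceL ψ) := by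
    refine CT.linear_ext (LinearMap.ext₂ fun a b => ?_)
    simp [hψ]
  exact LinearMap.congr_fun this y

theorem sliceR_map {X Z : Type*} [Ring X] [Algebra K X] [IsAdicComplete tIdeal X] [Ring Z] [Algebra K Z]
    [IsAdicComplete tIdeal Z] (f g : X →ₐ[K] Z) (φ : Z →ₗ[K] K) {ψ : X →ₗ[K] K}
    (hψ : ∀ x, φ (g x) = ψ x) (y : CT X X) :
    CT.sliceR φ (CT.map f g y) = f (CT.sliceR ψ y) := by
  have : (CT.sliceR φ).comp (CT.map f g).toLinearMap = f.toLinearMap.comp (CT.sliceR ψ) := by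
    refine CT.linear_ext (LinearMap.ext₂ fun a b => ?_)
    simp [hψ]
  exact LinearMap.congr_fun this y

theorem lift_comp_map {X Z : Type*} [Ring X] [Algebra K X] [Ring Z] [Algebra K Z]
    [IsAdicComplete tIdeal Z] (f g : X →ₐ[K] Z) (φ ψ : Z →ₗ[K] Z) (F : CT X X →ₗ[K] Z)
    (hF : ∀ a b, φ (f a) * ψ (g b) = F (a ⊠ b)) (y : CT X X) :
    CT.lift ((LinearMap.mul K Z).compl₁₂ φ ψ) (CT.map f g y) = F y := by
  have : (CT.lift ((LinearMap.mul K Z).compl₁₂ φ ψ)).comp (CT.map f g).toLinearMap = F := by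
    refine CT.linear_ext (LinearMap.ext₂ fun a b => ?_)
    simpa using hF a b
  exact LinearMap.congr_fun this y

/-- Only the middle leg is shared. For `χ = (𝓡⁻¹)₂₃` the two middle entries lie in different copies
of `H`, so the cocycle condition holds without any Yang–Baxter argument. -/
theorem commute_l12_l23 {X Z : Type*} [Ring X] [Algebra K X] [Ring Z] [Algebra K Z]
    {f g f' g' : X →ₐ[K] Z} (h : ∀ a b, Commute (g a) (f' b)) (y z : CT X X) :
    Commute (l12 (CT.map f g y)) (l23 (CT.map f' g' z)) := by
  refine commute_of_pure (l12.comp (CT.map f g)) (fun a => ?_) (fun a => ?_) y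
  · simp only [AlgHom.comp_apply, CT.inl_apply, CT.map_tm, map_one, l12_tm]
    exact e1_l23 (f a) _
  · refine (commute_of_pure (l23.comp (CT.map f' g')) (fun b => ?_) (fun b => ?_) z).symm
    · simp only [AlgHom.comp_apply, CT.inl_apply, CT.inr_apply, CT.map_tm, map_one, l12_tm, l23_tm]
      exact ((h a b).map e2).symm
    · simp only [AlgHom.comp_apply, CT.inr_apply, CT.map_tm, map_one, l12_tm, l23_tm]
      exact (e2_e3 (g a) (g' b)).symm

namespace QT

variable {H : Type*} [Ring H] [Algebra K H] [IsAdicComplete tIdeal H] {h : Hopf H} (q : QT h)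

/-- The 2-cocycle of the double cross product. -/
def bowtieχ : (CT (Sq H) (Sq H))ˣ where
  val := CT.map i2 i1 q.Rinv
  inv := CT.map i2 i1 q.R
  val_inv := by rw [← map_mul, q.inv_mul, map_one]
  inv_val := by rw [← map_mul, q.mul_inv, map_one]

/-- The element implementing the antipode of the double cross product. -/
def bowtieU : (Sq H)ˣ where
  val := swapSq q.R
  inv := swapSq q.Rinv
  val_inv := by rw [← map_mul, q.mul_inv, map_one]
  inv_val := by rw [← map_mul, q.inv_mul, map_one]

theorem bowtie_comulL : comulL h.sqΔ (CT.map i2 i1 q.Rinv) =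
    l23 (CT.map i2 i1 q.Rinv) * l13 (CT.map i2 i1 q.Rinv) := by
  rw [comulL_map₂ i2 i1 h.sqΔ_i2, q.comulL_Rinv, map_mul, CT3.map₃_l23, CT3.map₃_l13]

theorem bowtie_comulR : comulR h.sqΔ (CT.map i2 i1 q.Rinv) =
    l12 (CT.map i2 i1 q.Rinv) * l13 (CT.map i2 i1 q.Rinv) := by
  rw [comulR_map₂ i2 i1 h.sqΔ_i1, q.comulR_Rinv, map_mul, CT3.map₃_l12, CT3.map₃_l13]

/-- The first entry of `χ` lies in the second copy and conversely, and `(id ⊗ S)𝓡⁻¹ = 𝓡`; hence `U`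
is the transposed `𝓡`. -/
theorem bowtie_U : CT.lift ((LinearMap.mul K (Sq H)).compl₁₂ LinearMap.id h.sqS)
    (CT.map i2 i1 q.Rinv) = swapSq q.R := by
  refine (lift_comp_map i2 i1 _ _ (swapSq.toLinearMap.comp (CT.lmap LinearMap.id h.S))
    (fun a b => ?_) q.Rinv).trans ?_
  · rw [h.sqS_i1, LinearMap.comp_apply, CT.lmap_tm]
    exact (swapSq_tm _ _).symm
  · rw [LinearMap.comp_apply, q.lmap_id_S_inv]
    rfl

theorem bowtie_Uinv : CT.lift ((LinearMap.mul K (Sq H)).compl₁₂ h.sqS LinearMap.id)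
    (CT.map i2 i1 q.R) = swapSq q.Rinv := by
  refine (lift_comp_map i2 i1 _ _ (swapSq.toLinearMap.comp (CT.lmap h.S LinearMap.id))
    (fun a b => ?_) q.R).trans ?_
  · rw [h.sqS_i2, LinearMap.comp_apply, CT.lmap_tm]
    exact (swapSq_tm _ _).symm
  · rw [LinearMap.comp_apply, q.lmap_S_id]
    rfl

/-- Writing `𝓡⁻¹` inside `U⁻¹` as `(S ⊗ id)𝓡` turns the expression into `(S ⊗ id)(𝓡𝓡⁻¹)`, transposed
into the square. -/
theorem bowtie_left : CT.lift ((LinearMap.mul K (Sq H)).compl₁₂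
    ((LinearMap.mulRight K (swapSq q.Rinv)).comp h.sqS) LinearMap.id) (CT.map i2 i1 q.Rinv) = 1 := by
  refine (lift_comp_map i2 i1 _ _ (swapSq.toLinearMap.comp
    (CT.lift ((LinearMap.mul K (CT H H)).compl₁₂
      ((LinearMap.mulRight K (CT.lmap h.S LinearMap.id q.R)).comp (CT.inl.toLinearMap.comp h.S))
      CT.inr.toLinearMap))) (fun a b => ?_) q.Rinv).trans ?_
  · rw [LinearMap.comp_apply, h.sqS_i2, LinearMap.comp_apply, CT.lift_tm, q.lmap_S_id]
    simp only [LinearMap.mulRight_apply, LinearMap.id_apply, LinearMap.compl₁₂_apply,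
      LinearMap.comp_apply, AlgHom.toLinearMap_apply, LinearMap.mul_apply', map_mul]
    rw [swapSq_inl, swapSq_inr]
  · rw [LinearMap.comp_apply, lmap_S_Rinv_mul, q.mul_inv, CT.one_def, CT.lmap_tm, h.S_one]
    exact map_one swapSq

theorem bowtie_right : CT.lift ((LinearMap.mul K (Sq H)).compl₁₂
    (LinearMap.mulRight K (swapSq q.R)) h.sqS) (CT.map i2 i1 q.R) = 1 := by
  refine (lift_comp_map i2 i1 _ _ (swapSq.toLinearMap.comp
    (CT.lift ((LinearMap.mul K (CT H H)).compl₁₂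
      ((LinearMap.mulRight K (CT.lmap LinearMap.id h.S q.Rinv)).comp CT.inl.toLinearMap)
      (CT.inr.toLinearMap.comp h.S)))) (fun a b => ?_) q.R).trans ?_
  · rw [h.sqS_i1, LinearMap.comp_apply, CT.lift_tm, q.lmap_id_S_inv]
    simp only [LinearMap.mulRight_apply, LinearMap.compl₁₂_apply,
      LinearMap.comp_apply, AlgHom.toLinearMap_apply, LinearMap.mul_apply', map_mul]
    rw [swapSq_inl, swapSq_inr]
  · rw [LinearMap.comp_apply, lmap_S_mul_R, q.mul_inv, CT.one_def, CT.lmap_tm, h.S_one]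
    exact map_one swapSq

/-- The twist defining the double cross product. -/
def bowtie : Twist h.square where
  χ := q.bowtieχ
  U := q.bowtieU
  comulL_χ := q.bowtie_comulL
  comulR_χ := q.bowtie_comulR
  comm := commute_l12_l23 i1_commute _ _
  sliceL_ε := (sliceL_map i2 i1 _ (ψ := h.ε.toLinearMap) h.sqε_i2 _).trans
    (by rw [q.sliceL_ε_inv, map_one])
  sliceR_ε := (sliceR_map i2 i1 _ (ψ := h.ε.toLinearMap) h.sqε_i1 _).trans
    (by rw [q.sliceR_ε_inv, map_one])
  U_eq := q.bowtie_U
  Uinv_eq := q.bowtie_Uinv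
  left := q.bowtie_left
  right := q.bowtie_right

theorem bowtie_toData_aux {D D' : HopfData (Sq H)} (hD : D = D') {χ χ' y y' : CTensor (Sq H) (Sq H)}
    (hχ : χ = χ') (hy : y = y') : D.twist χ y = D'.twist χ' y' := by rw [hD, hχ, hy]

theorem leg23Square_eq (y : CT H H) :
    @Eq (CT (Sq H) (Sq H)) (leg23Square (H := H) y) (CT.map i2 i1 y) := cmap_inr_inl y

variable {q} (s : RealStar q)

theorem star_exchange (y : CT H H) :
    CT.star s.exchange.st (CT.map i2 i1 y) = CT.map i1 i2 (CT.star s.st y) := by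
  have : (CT.star s.exchange.st).comp (CT.map i2 i1).toLinearMap =
      (CT.map i1 i2).toLinearMap.comp (CT.star s.st) := CT.conj_ext fun a b => by
    simp [s.exchange_i1, s.exchange_i2]
  exact LinearMap.congr_fun this y

theorem map_i1_i2_swap (y : CT H H) :
    (CT.map i1 i2 (CT.swap y) : CT (Sq H) (Sq H)) = CT.swap (CT.map i2 i1 y) :=
  eq_of_tm (F := (CT.map i1 i2).comp CT.swap) (G := CT.swap.comp (CT.map i2 i1))
    (fun a b => by simp) y

theorem exchange_swapSq (y : CT H H) : s.exchange.st (swapSq y) = swapSq (CT.swap (CT.star s.st y)) := by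
  have : s.exchange.st.comp swapSq.toLinearMap =
      (swapSq.comp CT.swap).toLinearMap.comp (CT.star s.st) := CT.conj_ext fun a b => by
    rw [LinearMap.comp_apply, LinearMap.comp_apply, CT.star_tm, AlgHom.toLinearMap_apply, swapSq_tm,
      s.exchange.st_mul, s.exchange_i1, s.exchange_i2, AlgHom.toLinearMap_apply, AlgHom.comp_apply,
      CT.swap_tm, swapSq_tm]
  exact LinearMap.congr_fun this y

/-- The `*`-structure of the double cross product. -/
def bowtieRealStar : RealStar (q.bowtie.qt q.square) :=
  Twist.realStar q.bowtie s.exchange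
    ((star_exchange s q.Rinv).trans (by rw [s.star_Rinv, map_i1_i2_swap]; rfl))
    ((exchange_swapSq s q.R).trans (by rw [s.real, Twist.swap_swap]; rfl))
    q.sqΔ_swapSq_R

end QT

end Bowtie

end QStar
namespace QStar

/-! ### Criteria for the inhomogeneous quantum group -/

section Criteria

variable {X ι κ : Type*} [Ring X] [Algebra K X] [IsAdicComplete tIdeal X] [Fintype ι]
  [DecidableEq ι] [Fintype κ] {h : Hopf X} {q : QT h} {ρ : ι → ι → X →ₗ[K] K}
  {rel : FreeAlgebra K ι → FreeAlgebra K ι → Prop} {c : κ → ι → ι → K} {ℓ : tIdeal}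

/-- The bundled data are linked to the unbundled ones by equations that are substituted away, so the
dependent types need no transport. The antipode on the background is exposed because the values
`l^*` are expressed through it. -/
theorem exists_quasiStar (hc : IsQuadratic rel c) (H : IsCompatible q ρ c ℓ) {m : ι → ι → K}
    (s : RealStar q) (hm : IsStarAction s ρ m)
    (mom : ∀ k, quadSum (fun i j => conjK (c k i j))
      (fun i j => (BB.gen h ρ rel hc).starP m j * (BB.gen h ρ rel hc).starP m i) = 0)
    (hℓ : conjK (ℓ : K) = ℓ) {D : HopfData X} (hD : h.toData = D) {R' : CTensor X X} (hR : q.R = R')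
    {st' : X →ₛₗ[conjK] X} (hst : s.st = st') :
    ∃ (E : HopfData (Bos D ρ rel)) (s' : Bos D ρ rel →ₛₗ[conjK] Bos D ρ rel),
      IsQuasiStarBosonisation D ρ rel R' ℓ st' E s' ∧
      (∀ x, E.antipode (bgMap D ρ rel x) = bgMap D ρ rel (D.antipode x)) ∧
      (∀ i, s' (bosP D ρ rel i) = ∑ a, m i a • bosP D ρ rel a) ∧
      s' (bosXi D ρ rel) = -bosXi D ρ rel := by
  subst hD hR hst
  exact ⟨(BB.hopf hc H).toData, BB.st hc H s hm mom, BB.isQuasiStarBosonisation hc H s hm mom hℓ,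
    BB.S_bg hc H, BB.st_mom hc H s hm mom, BB.st_dil hc H s hm mom⟩

variable (h ρ c) in
/-- Covariance of quadratic relations. -/
def IsCovariant : Prop := ∃ σ : κ → κ → X →ₗ[K] K, ∀ k a b x,
  quadSum (c k) (fun i j => h.dconv (ρ i a) (ρ j b) x) = ∑ l, c l a b * σ k l x

variable (ρ) in
/-- The value of a tensor in the square of a representation. -/
def evalRep (y : CT X X) : Matrix (ι × ι) (ι × ι) K := fun x a => CT.eval (ρ x.1 a.1) (ρ x.2 a.2) y

/-- Slicing `𝓡` is linear and turns convolution into products, so covariance of the matrix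
coefficients descends to the slices. The braiding condition becomes a matrix identity for the value
of `𝓡` in `ρ ⊗ ρ`. -/
theorem IsCompatible.of (hρ : IsRep ρ) (hcov : IsCovariant h ρ c)
    (braided : ∀ k a b, quadSum (c k) (fun i j => evalRep ρ q.R (i, j) (b, a)) =
      -(cexp ℓ (1 : K) * c k a b)) : IsCompatible q ρ c ℓ where
  rep := hρ
  covariant k := by
    obtain ⟨σ, hσ⟩ := hcov
    refine ⟨fun l => q.sl (σ k l), fun a b => ?_⟩
    have h₁ : quadSum (c k) (fun i j => h.dconv (ρ i a) (ρ j b)) = ∑ l, c l a b • σ k l := by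
      refine LinearMap.ext fun x => ?_
      have := hσ k a b x
      simpa [quadSum] using this
    have h₃ : ∀ (r : K) (φ : X →ₗ[K] K), q.sl (r • φ) = r • q.sl φ := fun r φ => by
      have : CT.sliceL (B := X) (r • φ) = r • CT.sliceL φ := by
        refine CT.linear_ext (LinearMap.ext₂ fun a b => ?_)
        simp [smul_smul]
      exact LinearMap.congr_fun this q.R
    have h₄ : ∀ φ ψ : X →ₗ[K] K, q.sl (φ + ψ) = q.sl φ + q.sl ψ := fun φ ψ => by
      have : CT.sliceL (B := X) (φ + ψ) = CT.sliceL φ + CT.sliceL ψ := by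
        refine CT.linear_ext (LinearMap.ext₂ fun a b => ?_)
        simp [add_smul]
      exact LinearMap.congr_fun this q.R
    let L : (X →ₗ[K] K) →ₗ[K] X := ⟨⟨q.sl, h₄⟩, h₃⟩
    have := congrArg L h₁
    rw [map_quadSum] at this
    simpa [q.sl_mul_sl, L] using this
  braided k a b := by
    have h₁ : ∀ i j, ρ j a (q.sl (ρ i b)) = evalRep ρ q.R (i, j) (b, a) := fun i j => apply_sliceL _ _ _
    simp only [h₁]
    have h₂ : cexp ℓ (-1 : K) * cexp ℓ (1 : K) = 1 := cexp_neg_mul ℓ 1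
    have : quadSum (c k) (fun i j => cexp ℓ (-1 : K) * evalRep ρ q.R (i, j) (b, a)) =
        cexp ℓ (-1 : K) * quadSum (c k) (fun i j => evalRep ρ q.R (i, j) (b, a)) :=
      (map_quadSum (c k) (LinearMap.mulLeft K (cexp ℓ (-1 : K))) _).symm
    rw [this, braided, mul_neg, ← mul_assoc, h₂, one_mul]

/-- The matrix `τ` expresses each adjoint relation, with factors reversed, as a combination of the
original relations. -/
theorem star_mom_of {Z : Type*} [Ring Z] [Algebra K Z] (d : BosData h ρ c Z) {m : ι → ι → K}
    (τ : κ → κ → K) (hτ : ∀ k a b, quadSum (fun i j => conjK (c k i j)) (fun i j => m j a * m i b) =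
      ∑ l, τ k l * c l a b) (k : κ) :
    quadSum (fun i j => conjK (c k i j)) (fun i j => d.starP m j * d.starP m i) = 0 := by
  have h₁ : ∀ i j, d.starP m j * d.starP m i = ∑ a, ∑ b, (m j a * m i b) • (d.P a * d.P b) :=
    fun i j => by
      simp only [BosData.starP, Finset.sum_mul_sum, smul_mul_smul_comm]
  simp only [h₁, quadSum_sum, quadSum_smul, hτ, Finset.sum_smul]
  have h₂ : ∀ l, ∑ a, ∑ b, (τ k l * c l a b) • (d.P a * d.P b) = 0 := fun l => by
    have := congrArg (fun z => τ k l • z) (d.mom l)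
    simpa [Finset.smul_sum, smul_smul] using this
  calc _ = ∑ a, ∑ l, ∑ b, (τ k l * c l a b) • (d.P a * d.P b) :=
        Finset.sum_congr rfl fun a _ => Finset.sum_comm
    _ = ∑ l, ∑ a, ∑ b, (τ k l * c l a b) • (d.P a * d.P b) := Finset.sum_comm
    _ = 0 := Finset.sum_eq_zero fun l _ => h₂ l

/-- The order is reversed because it is already reversed in each tensor factor by `IsRep`. -/
theorem evalRep_mul (hρ : IsRep ρ) (y z : CT X X) : evalRep ρ (y * z) = evalRep ρ z * evalRep ρ y := by
  refine Matrix.ext fun x a => ?_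
  let F : CT X X →ₗ[K] CT X X →ₗ[K] K := (LinearMap.mul K (CT X X)).compr₂ (CT.eval (ρ x.1 a.1) (ρ x.2 a.2))
  let G : CT X X →ₗ[K] CT X X →ₗ[K] K := ∑ w : ι × ι, (LinearMap.mul K K).flip.compl₁₂
    (CT.eval (ρ w.1 a.1) (ρ w.2 a.2)) (CT.eval (ρ x.1 w.1) (ρ x.2 w.2))
  have : F = G := by
    refine CT.linear_ext (LinearMap.ext₂ fun u v => CT.linear_ext (LinearMap.ext₂ fun u' v' => ?_))
    simp only [F, G, LinearMap.compr₂_apply, LinearMap.mul_apply', tm_mul_tm, CT.eval_tm, hρ.mul,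
      LinearMap.sum_apply, LinearMap.compl₁₂_apply, LinearMap.flip_apply, Finset.sum_mul_sum,
      Fintype.sum_prod_type]
    exact Finset.sum_congr rfl fun i _ => Finset.sum_congr rfl fun j _ => by ring
  have h₁ := LinearMap.congr_fun₂ this y z
  simpa [F, G, evalRep, Matrix.mul_apply, mul_comm] using h₁

theorem evalRep_one (hρ : IsRep ρ) : evalRep ρ (1 : CT X X) = 1 := by
  ext x a
  rw [evalRep, CT.one_def, CT.eval_tm, hρ.one, hρ.one, Matrix.one_apply]
  simp only [Prod.ext_iff]
  split_ifs <;> simp_all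

theorem evalRep_swap (y : CT X X) (x a : ι × ι) :
    evalRep ρ (CT.swap y) x a = evalRep ρ y x.swap a.swap := by
  have : (CT.eval (ρ x.1 a.1) (ρ x.2 a.2)).comp (CT.swap (A := X) (B := X)).toLinearMap =
      CT.eval (ρ x.2 a.2) (ρ x.1 a.1) := by
    refine CT.linear_ext (LinearMap.ext₂ fun u v => ?_)
    simp [mul_comm]
  exact LinearMap.congr_fun this y

/-- Relation coefficients as a matrix. -/
def coeffMat (c : κ → ι → ι → K) : Matrix κ (ι × ι) K := fun k x => c k x.1 x.2

theorem quadSum_eq_mul (k : κ) (M : Matrix (ι × ι) (ι × ι) K) (a b : ι) :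
    quadSum (c k) (fun i j => M (i, j) (a, b)) = (coeffMat c * M) k (a, b) := by
  simp [quadSum, coeffMat, Matrix.mul_apply, Fintype.sum_prod_type]

theorem smul_mul_cancel {α : Type*} [Fintype α] [DecidableEq α] (r : K) (C : Matrix κ α K)
    {E E' : Matrix α α K} (hE : E * E' = 1) (M N : Matrix α α K) :
    r • (C * E) * (E' * (M * N)) = r • (C * M * N) := by
  rw [Matrix.smul_mul, Matrix.mul_assoc C, ← Matrix.mul_assoc E, hE, Matrix.one_mul, Matrix.mul_assoc]

/-- Covariance and the braiding condition are preserved under twisting. -/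
theorem IsCompatible.twist (T : Twist h) (hρ : IsRep ρ) (hcov : IsCovariant h ρ c)
    (braided : ∀ k a b, quadSum (c k) (fun i j => evalRep ρ q.R (i, j) (b, a)) =
      -(cexp ℓ (1 : K) * c k a b)) {c' : κ → ι → ι → K} {r : K}
    (hc' : coeffMat c' = r • (coeffMat c * evalRep ρ T.χ.val)) : IsCompatible (T.qt q) ρ c' ℓ := by
  have hχ : evalRep ρ T.χ.val * evalRep ρ T.χ⁻¹.val = 1 := by
    rw [← evalRep_mul hρ, Units.inv_mul, evalRep_one hρ]
  refine IsCompatible.of hρ ?_ fun k a b => ?_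
  · obtain ⟨σ, hσ⟩ := hcov
    refine ⟨σ, fun k a b x => ?_⟩
    have h₁ : coeffMat c * evalRep ρ (h.Δ x) = (Matrix.of fun k l => σ k l x) * coeffMat c := by
      refine Matrix.ext fun k ab => ?_
      rw [← quadSum_eq_mul]
      refine (hσ k ab.1 ab.2 x).trans ?_
      simp [Matrix.mul_apply, coeffMat, mul_comm]
    -- In matrices, right multiplication by `χ` turns a coefficient row for `Δ` into one for
    -- `χΔχ⁻¹`, with the same `σ`: the inner `χ` and `χ⁻¹` cancel.
    have h₂ : coeffMat c' * evalRep ρ (T.Δ x) = (Matrix.of fun k l => σ k l x) * coeffMat c' := by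
      rw [hc', T.Δ_apply, evalRep_mul hρ, evalRep_mul hρ, smul_mul_cancel r _ hχ, Matrix.mul_smul,
        ← Matrix.mul_assoc _ (coeffMat c), ← h₁]
    have := congrFun (congrFun h₂ k) (a, b)
    rw [← quadSum_eq_mul] at this
    refine Eq.trans ?_ (this.trans ?_)
    · rfl
    · simp [Matrix.mul_apply, coeffMat, mul_comm]
  · have h₁ : coeffMat c' * evalRep ρ (T.qt q).R =
        r • (coeffMat c * evalRep ρ q.R * evalRep ρ (CT.swap T.χ.val)) := by
      change coeffMat c' * evalRep ρ (CT.swap T.χ.val * q.R * T.χ⁻¹.val) = _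
      rw [hc', evalRep_mul hρ, evalRep_mul hρ, smul_mul_cancel r _ hχ]
    have h₂ : ∀ w : ι × ι, (coeffMat c * evalRep ρ q.R) k w = -(cexp ℓ (1 : K) * c k w.2 w.1) :=
      fun w => by rw [← braided, ← quadSum_eq_mul]
    have h₃ : c' k a b = r * ∑ w : ι × ι, c k w.1 w.2 * evalRep ρ T.χ.val w (a, b) := by
      have := congrFun (congrFun hc' k) (a, b)
      simpa [coeffMat, Matrix.mul_apply] using this
    rw [quadSum_eq_mul, h₁, Matrix.smul_apply, Matrix.mul_apply, h₃, smul_eq_mul]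
    simp only [h₂, evalRep_swap, Prod.swap_prod_mk]
    -- The braiding condition has its two output indices exchanged, and so does `χ₂₁` relative to
    -- `χ`; relabelling the summation pair matches them.
    rw [← Equiv.sum_comp (Equiv.prodComm ι ι)]
    simp only [Equiv.prodComm_apply, Prod.swap_swap, Prod.fst_swap, Prod.snd_swap, neg_mul,
      Finset.sum_neg_distrib, mul_neg, mul_assoc, ← Finset.mul_sum]
    ring

end Criteria

end QStar
namespace QStar

/-! ### Matrix corepresentations of compact type -/

/-- A real matrix representation on which the quasitriangular structure takes the value `ν R`. -/
structure FRT {H : Type*} [Ring H] [Algebra K H] [IsAdicComplete tIdeal H] {h : Hopf H} {q : QT h}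
    (s : RealStar q) {n : ℕ} (R : Mat2 n) (ν : K) (f : Fin n → Fin n → H →ₗ[K] K) : Prop where
  one : ∀ i j, f i j 1 = if i = j then 1 else 0
  mul : ∀ i j x y, f i j (x * y) = ∑ a, f i a x * f a j y
  eval : ∀ i j k l, CT.eval (f i j) (f k l) q.R = ν * R (i, k) (j, l)
  conj : ∀ i j x, conjK (f i j x) = f j i (s.st x)
  S_st_S : ∀ x, h.S (s.st (h.S x)) = s.st x

/-- The relations `R 𝐭₁ 𝐭₂ = 𝐭₂ 𝐭₁ R`. -/
def IsIntertwiner {H : Type*} [Ring H] [Algebra K H] [IsAdicComplete tIdeal H] (h : Hopf H) {n : ℕ}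
    (R : Mat2 n) (f : Fin n → Fin n → H →ₗ[K] K) : Prop :=
  ∀ i j k l x, ∑ a, ∑ b, R (i, k) (a, b) * h.dconv (f a j) (f b l) x =
    ∑ a, ∑ b, h.dconv (f k b) (f i a) x * R (a, b) (j, l)

namespace FRT

variable {H : Type*} [Ring H] [Algebra K H] [IsAdicComplete tIdeal H] {h : Hopf H} {q : QT h}
  {s : RealStar q} {n : ℕ} {R : Mat2 n} {ν : K} {f : Fin n → Fin n → H →ₗ[K] K}

theorem dconv_S (u v : H →ₗ[K] K) (x : H) :
    h.dconv (u.comp h.S) (v.comp h.S) x = h.dconv v u (h.S x) := by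
  rw [h.dconv_apply, h.dconv_apply, h.Δ_S]
  have : CT.eval (u.comp h.S) (v.comp h.S) =
      (CT.eval v u).comp ((CT.swap (A := H) (B := H)).toLinearMap.comp (CT.lmap h.S h.S)) := by
    refine CT.linear_ext (LinearMap.ext₂ fun a b => ?_)
    simp [mul_comm]
  exact LinearMap.congr_fun this _

theorem intertwiner_S {R : Mat2 n} (hR : IsIntertwiner h R f) (i j k l : Fin n) (x : H) :
    ∑ a, ∑ b, R (i, k) (a, b) * h.dconv ((f b l).comp h.S) ((f a j).comp h.S) x =
      ∑ a, ∑ b, h.dconv ((f i a).comp h.S) ((f k b).comp h.S) x * R (a, b) (j, l) := by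
  simp only [dconv_S]
  exact hR i j k l (h.S x)

theorem eval_lmap (φ ψ : H →ₗ[K] K) (u v : H →ₗ[K] H) (y : CT H H) :
    CT.eval φ ψ (CT.lmap u v y) = CT.eval (φ.comp u) (ψ.comp v) y := by
  have : (CT.eval φ ψ).comp (CT.lmap u v) = CT.eval (φ.comp u) (ψ.comp v) := by
    refine CT.linear_ext (LinearMap.ext₂ fun a b => ?_)
    simp
  exact LinearMap.congr_fun this y

theorem eval_S_S (F : FRT s R ν f) (i j k l : Fin n) :
    CT.eval ((f i j).comp h.S) ((f k l).comp h.S) q.R = ν * R (i, k) (j, l) := by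
  rw [← eval_lmap, q.lmap_S_S, F.eval]

/-- Since `(id ⊗ S)𝓡⁻¹ = 𝓡`, this is the value of `𝓡⁻¹` when one leg acts through `t` and the other
through `S t`, as in the cocycle `χ` on matrix momenta. -/
theorem eval_id_S (F : FRT s R ν f) (i j k l : Fin n) :
    CT.eval (f i j) ((f k l).comp h.S) q.Rinv = ν * R (i, k) (j, l) := by
  have := eval_lmap (f i j) (f k l) LinearMap.id h.S q.Rinv
  rw [q.lmap_id_S_inv, F.eval] at this
  exact this.symm

theorem st_sliceR (F : FRT s R ν f) (i j : Fin n) (y : CT H H) :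
    s.st (CT.sliceR (f i j) y) = CT.sliceR (f j i) (CT.star s.st y) := by
  have : s.st.comp (CT.sliceR (f i j)) = (CT.sliceR (f j i)).comp (CT.star s.st) :=
    CT.conj_ext fun a b => by simp [F.conj]
  exact LinearMap.congr_fun this y

theorem st_sliceL (F : FRT s R ν f) (i j : Fin n) (y : CT H H) :
    s.st (CT.sliceL (f i j) y) = CT.sliceL (f j i) (CT.star s.st y) := by
  have : s.st.comp (CT.sliceL (f i j)) = (CT.sliceL (f j i)).comp (CT.star s.st) :=
    CT.conj_ext fun a b => by simp [F.conj]
  exact LinearMap.congr_fun this y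

theorem sliceL_swap (φ : H →ₗ[K] K) (y : CT H H) : CT.sliceL φ (CT.swap y) = CT.sliceR φ y := by
  have : (CT.sliceL φ).comp (CT.swap (A := H) (B := H)).toLinearMap = CT.sliceR φ := by
    refine CT.linear_ext (LinearMap.ext₂ fun a b => ?_)
    simp
  exact LinearMap.congr_fun this y

theorem sliceR_swap (φ : H →ₗ[K] K) (y : CT H H) : CT.sliceR φ (CT.swap y) = CT.sliceL φ y := by
  rw [← sliceL_swap, Twist.swap_swap]

/-- Reality of `𝓡` turns the adjoint of a right slice into a left slice of `𝓡`; then `𝓡 = (id ⊗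
S)𝓡⁻¹` brings in `l⁻`. -/
theorem st_lPlus (F : FRT s R ν f) (i j : Fin n) :
    s.st (CT.sliceR (f i j) q.R) = h.S (CT.sliceL (f j i) q.Rinv) := by
  have := sliceL_lmap (f j i) LinearMap.id h.S q.Rinv
  rw [q.lmap_id_S_inv] at this
  rw [F.st_sliceR, s.real, sliceR_swap, this]
  rfl

theorem st_lMinus (F : FRT s R ν f) (i j : Fin n) :
    s.st (CT.sliceL (f i j) q.Rinv) = h.S (CT.sliceR (f j i) q.R) := by
  have := sliceR_lmap (f j i) h.S LinearMap.id q.R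
  rw [q.lmap_S_id] at this
  rw [F.st_sliceL, s.star_Rinv, sliceL_swap, this]
  rfl

end FRT

/-! ### Matrix identities -/

section Matrices

variable {n : ℕ}

theorem permP_mul (M : Mat2 n) (x y : Fin n × Fin n) : (permP n * M) x y = M x.swap y := by
  have : ∀ z : Fin n × Fin n, (x = z.swap) ↔ (z = x.swap) := fun z =>
    ⟨fun e => by rw [e, Prod.swap_swap], fun e => by rw [e, Prod.swap_swap]⟩
  simp [Matrix.mul_apply, permP, this]

/-- Multiplication by `P` swaps the row indices, after which the real type I condition is literally
Hermitian symmetry. -/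
theorem hermitian_of_realTypeI {R : Mat2 n} (hR : IsRealTypeI R) :
    ((permP n * R).map conjK).transpose = permP n * R := by
  refine Matrix.ext fun x y => ?_
  rw [Matrix.transpose_apply, Matrix.map_apply, permP_mul, permP_mul]
  exact hR _ _ _ _

/-- Both `PR` and `PR'` are Hermitian, so taking the adjoint reverses the order of the two factors.
-/
theorem braided_add_conj {R R' : Mat2 n} (hR : IsRealTypeI R) (hR' : IsRealTypeI R')
    (hadd : (permP n * R + 1) * (permP n * R' - 1) = 0) :
    (permP n * R' - 1) * (permP n * R + 1) = 0 := by
  have h₂ := congrArg (fun N => (Matrix.map N conjK).transpose) hadd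
  have h₃ : ∀ M N : Mat2 n, (M * N).map conjK = M.map conjK * N.map conjK := fun M N => Matrix.map_mul
  have h₄ : ((permP n * R + 1).map conjK).transpose = permP n * R + 1 := by
    refine Matrix.ext fun x y => ?_
    have := congrFun (congrFun (hermitian_of_realTypeI hR) x) y
    simp only [Matrix.transpose_apply, Matrix.map_apply, Matrix.add_apply, map_add] at this ⊢
    rw [this, Matrix.one_apply, Matrix.one_apply]
    simp [eq_comm]
  have h₅ : ((permP n * R' - 1).map conjK).transpose = permP n * R' - 1 := by
    refine Matrix.ext fun x y => ?_
    have := congrFun (congrFun (hermitian_of_realTypeI hR') x) y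
    simp only [Matrix.transpose_apply, Matrix.map_apply, Matrix.sub_apply, map_sub] at this ⊢
    rw [this, Matrix.one_apply, Matrix.one_apply]
    simp [eq_comm]
  simp only [h₃, Matrix.transpose_mul, h₄, h₅] at h₂
  rw [h₂]
  refine Matrix.ext fun x y => ?_
  simp

theorem sum_braided {R R' : Mat2 n} (hR : IsRealTypeI R) (hR' : IsRealTypeI R')
    (hadd : (permP n * R + 1) * (permP n * R' - 1) = 0) (i k a b : Fin n) :
    ∑ u, ∑ v, R' (i, k) (u, v) * R (v, u) (a, b) = R (i, k) (a, b) - R' (i, k) (a, b) +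
      if i = b ∧ k = a then 1 else 0 := by
  have := congrFun (congrFun (braided_add_conj hR hR' hadd) (k, i)) (a, b)
  rw [sub_mul, mul_add, one_mul, mul_one, Matrix.sub_apply, Matrix.add_apply, Matrix.add_apply,
    Matrix.mul_apply] at this
  simp only [permP_mul, Fintype.sum_prod_type, Prod.swap_prod_mk, Matrix.one_apply, Prod.mk.injEq,
    Matrix.zero_apply] at this
  have h₁ : (if i = b ∧ k = a then (1 : K) else 0) = if k = a ∧ i = b then 1 else 0 := by
    simp only [and_comm]
  rw [h₁]
  linear_combination this

/-- The Hecke relation expanded as `(PR)² = (q - q⁻¹) PR + 1`, in the index form in which it is met.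
-/
theorem sum_hecke {R : Mat2 n} {q : Kˣ} (hR : IsHecke q R) (i k a b : Fin n) :
    ∑ u, ∑ v, R (i, k) (u, v) * R (v, u) (a, b) = ((q : K) - ((q⁻¹ : Kˣ) : K)) * R (i, k) (a, b) +
      if i = b ∧ k = a then 1 else 0 := by
  have := congrFun (congrFun hR (k, i)) (a, b)
  rw [sub_mul, mul_add, Matrix.smul_mul, one_mul, Matrix.mul_smul, mul_one, Matrix.sub_apply,
    Matrix.add_apply, Matrix.smul_apply, Matrix.smul_apply, Matrix.add_apply, Matrix.smul_apply,
    Matrix.mul_apply] at this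
  simp only [permP_mul, Fintype.sum_prod_type, Prod.swap_prod_mk, Matrix.one_apply, Prod.mk.injEq,
    Matrix.zero_apply, smul_eq_mul] at this
  have h₁ : (if i = b ∧ k = a then (1 : K) else 0) = if k = a ∧ i = b then 1 else 0 := by
    simp only [and_comm]
  have h₂ : (q : K) * ((q⁻¹ : Kˣ) : K) = 1 := Units.mul_inv q
  rw [h₁]
  linear_combination this + (if k = a ∧ i = b then (1 : K) else 0) * h₂

end Matrices

end QStar
namespace QStar

/-! ### The vectorial case -/

section Vectorial

variable {H : Type*} [Ring H] [Algebra K H] [IsAdicComplete tIdeal H] {h : Hopf H} {q : QT h}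
  {s : RealStar q} {n : ℕ} {R R' : Mat2 n} {ν : K} {f : Fin n → Fin n → H →ₗ[K] K}
  {ρ : Fin n → Fin n → H →ₗ[K] K} {ℓ : tIdeal}

/-- The coefficients of the relations of the braided vectors. -/
def vecCoeff (R' : Mat2 n) (k : Fin n × Fin n) (i j : Fin n) : K :=
  (if k.1 = i ∧ k.2 = j then 1 else 0) - R' k (j, i)

theorem quadSum_vecCoeff {M : Type*} [AddCommGroup M] [Module K M] (k : Fin n × Fin n)
    (F : Fin n → Fin n → M) :
    quadSum (vecCoeff R' k) F = F k.1 k.2 - ∑ a, ∑ b, R' k (a, b) • F b a := by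
  have h₁ : ∑ i, ∑ j, (if k.1 = i ∧ k.2 = j then (1 : K) else 0) • F i j = F k.1 k.2 := by
    simp [ite_and]
  simp only [quadSum, vecCoeff, sub_smul, Finset.sum_sub_distrib, h₁]
  rw [Finset.sum_comm]

theorem isQuadratic_vecRel : IsQuadratic (VecRel R') (vecCoeff R') where
  of_rel a b hab := by
    obtain ⟨i, k, rfl, rfl⟩ := hab
    exact ⟨(i, k), (quadSum_vecCoeff (i, k) fun i j => FreeAlgebra.ι K i * FreeAlgebra.ι K j).symm⟩
  to_rel k := ⟨_, _, ⟨k.1, k.2, rfl, rfl⟩,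
    (quadSum_vecCoeff k fun i j => FreeAlgebra.ι K i * FreeAlgebra.ι K j).symm⟩

theorem FRT.isRep_vec (F : FRT s R ν f) (hρ : ∀ i j, ρ i j = (f i j).comp h.S) : IsRep ρ where
  one i j := by rw [hρ, LinearMap.comp_apply, h.S_one, F.one]
  mul i j x y := by simp only [hρ, LinearMap.comp_apply, h.S_mul, F.mul]

/-- The action uses `S t`, but `(S ⊗ S)𝓡 = 𝓡`, so `𝓡` still evaluates to `ν R`. With `λ = ν`, the
braiding condition on the rows of `1 - R'` is `(PR' - 1)(PR + 1) = 0`. -/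
theorem FRT.isCompatible_vec (F : FRT s R (cexp ℓ (1 : K)) f) (hρ : ∀ i j, ρ i j = (f i j).comp h.S)
    (hint : IsIntertwiner h R' f) (hR : IsRealTypeI R) (hR' : IsRealTypeI R')
    (hadd : (permP n * R + 1) * (permP n * R' - 1) = 0) : IsCompatible q ρ (vecCoeff R') ℓ := by
  refine IsCompatible.of (F.isRep_vec hρ) ⟨fun k l => h.dconv (ρ k.1 l.1) (ρ k.2 l.2), ?_⟩ ?_
  · intro k a b x
    have h₁ := FRT.intertwiner_S hint k.1 b k.2 a x
    rw [quadSum_vecCoeff]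
    simp only [hρ, smul_eq_mul]
    rw [h₁]
    simp only [Fintype.sum_prod_type, vecCoeff, sub_mul, Finset.sum_sub_distrib]
    congr 1
    · simp [ite_and, ite_mul]
    · exact Finset.sum_congr rfl fun u _ => Finset.sum_congr rfl fun v _ => mul_comm _ _
  · intro k a b
    have h₁ : ∀ i j u v, evalRep ρ q.R (i, j) (u, v) = cexp ℓ (1 : K) * R (i, j) (u, v) :=
      fun i j u v => by
        simp only [evalRep, hρ]
        exact F.eval_S_S i u j v
    rw [quadSum_vecCoeff]
    simp only [h₁, smul_eq_mul, mul_left_comm _ (cexp ℓ (1 : K)), ← Finset.mul_sum]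
    rw [sum_braided hR hR' hadd k.1 k.2 b a, vecCoeff]
    ring

theorem FRT.isStarAction_vec (F : FRT s R ν f) (hρ : ∀ i j, ρ i j = (f i j).comp h.S)
    {η : Matrix (Fin n) (Fin n) K} (hη : ∀ i b x, ∑ a, f a i x * η a b = ∑ a, η i a * f a b (h.S x))
    (hη' : η.map conjK * η = 1) : IsStarAction s ρ η where
  conj_rep i b x := by
    simp only [hρ, LinearMap.comp_apply, F.conj, hη]
  invol i b := by
    have := congrFun (congrFun hη' i) b
    simpa [Matrix.mul_apply, Matrix.one_apply] using this

/-- By reality of `R'`, the conjugated vector relations with factors reversed are covector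
relations. The elements `∑ a, η i a p a` satisfy these, because `p_i ↦ η_{ia} p^a` is an algebra map
out of the braided covectors. -/
theorem star_mom_vec (hR' : IsRealTypeI R') {η : Matrix (Fin n) (Fin n) K}
    {e : RingQuot (CovRel R') →ₐ[K] RingQuot (VecRel R')}
    (he : ∀ i, e (RingQuot.mkAlgHom K (CovRel R') (FreeAlgebra.ι K i)) =
      ∑ a, η i a • RingQuot.mkAlgHom K (VecRel R') (FreeAlgebra.ι K a))
    {Z : Type*} [Ring Z] [Algebra K Z] (d : BosData h ρ (vecCoeff R') Z) (k : Fin n × Fin n) :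
    quadSum (fun i j => conjK (vecCoeff R' k i j)) (fun i j => d.starP η j * d.starP η i) = 0 := by
  let g : RingQuot (VecRel R') →ₐ[K] Z := RingQuot.liftAlgHom K ⟨FreeAlgebra.lift K d.P, by
    rintro x y ⟨i, k, rfl, rfl⟩
    have : quadSum (vecCoeff R' (i, k)) (fun i j => d.P i * d.P j) = 0 := d.mom (i, k)
    rw [quadSum_vecCoeff, sub_eq_zero] at this
    simpa using this⟩
  have hg : ∀ i, (g.comp e) (RingQuot.mkAlgHom K (CovRel R') (FreeAlgebra.ι K i)) = d.starP η i :=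
    fun i => by simp [he, g, BosData.starP]
  have h₁ : ∀ i k, d.starP η i * d.starP η k =
      ∑ a, ∑ b, R' (a, b) (i, k) • (d.starP η b * d.starP η a) := fun i k => by
    have := congrArg (g.comp e) (RingQuot.mkAlgHom_rel K (⟨i, k, rfl, rfl⟩ : CovRel R' _ _))
    simpa only [map_mul, map_sum, map_smul, hg] using this
  have h₂ : ∀ i j, conjK (vecCoeff R' k i j) =
      (if k.1 = i ∧ k.2 = j then 1 else 0) - R' (i, j) (k.2, k.1) := fun i j => by
    rw [vecCoeff, map_sub, hR' k.1 j k.2 i]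
    split_ifs <;> simp
  simp only [quadSum, h₂, sub_smul, Finset.sum_sub_distrib]
  rw [sub_eq_zero, ← h₁]
  simp [ite_and]

end Vectorial

end QStar
namespace QStar

/-! ### Matrix momenta -/

section Matrix

open Sq

variable {n : ℕ} {R : Mat2 n}

/-- The coefficients of the relations `R₂₁ p₁ p₂ = p₂ p₁ R`. -/
def eucCoeff (R : Mat2 n) (k : (Fin n × Fin n) × Fin n × Fin n) (x y : Fin n × Fin n) : K :=
  R k.1.swap (y.1, x.1) * ((if k.2.1 = x.2 then 1 else 0) * if k.2.2 = y.2 then 1 else 0) -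
    ((if k.1.2 = x.1 then 1 else 0) * if k.1.1 = y.1 then 1 else 0) * R (y.2, x.2) k.2

theorem quadSum_eucCoeff {M : Type*} [AddCommGroup M] [Module K M]
    (k : (Fin n × Fin n) × Fin n × Fin n) (F : Fin n × Fin n → Fin n × Fin n → M) :
    quadSum (eucCoeff R k) F =
      ∑ a, ∑ b, R k.1.swap (b, a) • F (a, k.2.1) (b, k.2.2) -
        ∑ a, ∑ b, R (b, a) k.2 • F (k.1.2, a) (k.1.1, b) := by
  simp only [quadSum, eucCoeff, sub_smul, Finset.sum_sub_distrib, Fintype.sum_prod_type]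
  congr 1
  · simp
  · simp [Finset.sum_ite_irrel]

section Legs

variable {B : Type*} [Ring B] (p : Matrix (Fin n) (Fin n) B)
  (M : Matrix (Fin n × Fin n) (Fin n × Fin n) B) (u v : Fin n × Fin n)

theorem mul_leg1 : (M * leg1 p) u v = ∑ a, M u (a, v.2) * p a v.1 := by
  simp [Matrix.mul_apply, Fintype.sum_prod_type, leg1, Matrix.kroneckerMap_apply, Matrix.one_apply]

theorem mul_leg2 : (M * leg2 p) u v = ∑ b, M u (v.1, b) * p b v.2 := by
  simp [Matrix.mul_apply, Fintype.sum_prod_type, leg2, Matrix.kroneckerMap_apply, Matrix.one_apply,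
    Finset.sum_ite_irrel]

theorem leg1_mul : (leg1 p * M) u v = ∑ a, p u.1 a * M (a, u.2) v := by
  simp [Matrix.mul_apply, Fintype.sum_prod_type, leg1, Matrix.kroneckerMap_apply, Matrix.one_apply]

theorem leg2_mul : (leg2 p * M) u v = ∑ b, p u.2 b * M (u.1, b) v := by
  simp [Matrix.mul_apply, Fintype.sum_prod_type, leg2, Matrix.kroneckerMap_apply, Matrix.one_apply,
    Finset.sum_ite_irrel]

end Legs

theorem eucRel_sub (u v : Fin n × Fin n) :
    (toAlg (FreeAlgebra K (Fin n × Fin n)) (R21 R) * leg1 (genMat n) * leg2 (genMat n)) u v -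
      (leg2 (genMat n) * leg1 (genMat n) * toAlg (FreeAlgebra K (Fin n × Fin n)) R) u v =
    quadSum (eucCoeff R (u, v)) (fun i j => FreeAlgebra.ι K i * FreeAlgebra.ι K j) := by
  rw [quadSum_eucCoeff, mul_leg2, mul_assoc (leg2 _), leg2_mul]
  simp only [mul_leg1, leg1_mul, toAlg, Matrix.map_apply, R21, Matrix.submatrix_apply, genMat,
    Finset.sum_mul, Finset.mul_sum]
  congr 1
  · rw [Finset.sum_comm]
    simp [Algebra.smul_def, mul_assoc]
  · simp [Algebra.smul_def, mul_assoc, Algebra.commutes]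

theorem isQuadratic_eucRel : IsQuadratic (EucRel R) (eucCoeff R) where
  of_rel a b hab := by
    obtain ⟨u, v, rfl, rfl⟩ := hab
    exact ⟨(u, v), eucRel_sub u v⟩
  to_rel k := ⟨_, _, ⟨k.1, k.2, rfl, rfl⟩, eucRel_sub k.1 k.2⟩

/-- The coefficients of the relations `R₂₁ p₁ R p₂ = p₂ R₂₁ p₁ R`. -/
def minkCoeff (R : Mat2 n) (k : (Fin n × Fin n) × Fin n × Fin n) (x y : Fin n × Fin n) : K :=
  (∑ e, R k.1.swap (e, x.1) * R (x.2, e) (k.2.1, y.1)) * (if k.2.2 = y.2 then 1 else 0) -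
    (if k.1.2 = x.1 then 1 else 0) * ∑ e, R (x.2, k.1.1) (e, y.1) * R (y.2, e) k.2

theorem quadSum_minkCoeff {M : Type*} [AddCommGroup M] [Module K M]
    (k : (Fin n × Fin n) × Fin n × Fin n) (F : Fin n × Fin n → Fin n × Fin n → M) :
    quadSum (minkCoeff R k) F =
      ∑ a, ∑ b, ∑ c, (∑ e, R k.1.swap (e, a) * R (b, e) (k.2.1, c)) • F (a, b) (c, k.2.2) -
        ∑ a, ∑ b, ∑ c, (∑ e, R (a, k.1.1) (e, b) * R (c, e) k.2) • F (k.1.2, a) (b, c) := by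
  simp only [quadSum, minkCoeff, sub_smul, Finset.sum_sub_distrib, Fintype.sum_prod_type]
  congr 1
  · simp
  · simp [Finset.sum_ite_irrel]

theorem sum_comm_last {α M : Type*} [Fintype α] [AddCommMonoid M] (T : α → α → α → M) :
    ∑ a, ∑ b, ∑ c, T a b c = ∑ c, ∑ a, ∑ b, T a b c := by
  rw [Finset.sum_comm]
  refine (Finset.sum_congr rfl fun b _ => Finset.sum_comm).trans ?_
  rw [Finset.sum_comm]
  exact Finset.sum_congr rfl fun c _ => Finset.sum_comm

theorem mink_left {B : Type*} [Ring B] [Algebra K B] (p : Matrix (Fin n) (Fin n) B)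
    (u v : Fin n × Fin n) :
    (toAlg B (R21 R) * leg1 p * toAlg B R * leg2 p) u v =
      ∑ a, ∑ b, ∑ c, (∑ e, R u.swap (e, a) * R (b, e) (v.1, c)) • (p a b * p c v.2) := by
  have h₁ : (toAlg B (R21 R) * leg1 p * toAlg B R * leg2 p) u v =
      ∑ c, ∑ b, ∑ e, ∑ a, (R u.swap (e, a) * R (b, e) (v.1, c)) • (p a b * p c v.2) := by
    rw [mul_leg2]
    refine Finset.sum_congr rfl fun c _ => ?_
    rw [Matrix.mul_apply, Fintype.sum_prod_type, Finset.sum_mul]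
    refine Finset.sum_congr rfl fun b _ => ?_
    rw [Finset.sum_mul]
    refine Finset.sum_congr rfl fun e _ => ?_
    rw [mul_leg1, Finset.sum_mul, Finset.sum_mul]
    refine Finset.sum_congr rfl fun a _ => ?_
    change algebraMap K B (R u.swap (e, a)) * p a b * algebraMap K B (R (b, e) (v.1, c)) * p c v.2 = _
    rw [Algebra.smul_def, map_mul, mul_assoc (algebraMap K B (R u.swap (e, a))),
      ← Algebra.commutes (R (b, e) (v.1, c))]
    simp only [mul_assoc]
  rw [h₁, Finset.sum_comm]
  refine (Finset.sum_congr rfl fun b _ => sum_comm_last _).trans ?_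
  rw [Finset.sum_comm]
  simp only [Finset.sum_smul]

theorem mink_right {B : Type*} [Ring B] [Algebra K B] (p : Matrix (Fin n) (Fin n) B)
    (u v : Fin n × Fin n) :
    (leg2 p * toAlg B (R21 R) * leg1 p * toAlg B R) u v =
      ∑ a, ∑ b, ∑ c, (∑ e, R (a, u.1) (e, b) * R (c, e) v) • (p u.2 a * p b c) := by
  have h₁ : (leg2 p * toAlg B (R21 R) * leg1 p * toAlg B R) u v =
      ∑ a, ∑ c, ∑ e, ∑ b, (R (a, u.1) (e, b) * R (c, e) v) • (p u.2 a * p b c) := by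
    rw [mul_assoc (leg2 _), mul_assoc (leg2 _), leg2_mul]
    refine Finset.sum_congr rfl fun a _ => ?_
    rw [Matrix.mul_apply, Fintype.sum_prod_type, Finset.mul_sum]
    refine Finset.sum_congr rfl fun c _ => ?_
    rw [Finset.mul_sum]
    refine Finset.sum_congr rfl fun e _ => ?_
    rw [mul_leg1, Finset.sum_mul, Finset.mul_sum]
    refine Finset.sum_congr rfl fun b _ => ?_
    change p u.2 a * (algebraMap K B (R (a, u.1) (e, b)) * p b c * algebraMap K B (R (c, e) v)) = _
    rw [← Algebra.commutes (R (c, e) v), ← Algebra.smul_def, ← Algebra.smul_def, smul_smul,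
      mul_smul_comm, mul_comm (R (c, e) v)]
  rw [h₁]
  refine (Finset.sum_congr rfl fun b _ => sum_comm_last _).trans ?_
  simp only [Finset.sum_smul]

theorem minkRel_sub (u v : Fin n × Fin n) :
    (toAlg (FreeAlgebra K (Fin n × Fin n)) (R21 R) * leg1 (genMat n) *
        toAlg (FreeAlgebra K (Fin n × Fin n)) R * leg2 (genMat n)) u v -
      (leg2 (genMat n) * toAlg (FreeAlgebra K (Fin n × Fin n)) (R21 R) * leg1 (genMat n) *
        toAlg (FreeAlgebra K (Fin n × Fin n)) R) u v =
    quadSum (minkCoeff R (u, v)) (fun i j => FreeAlgebra.ι K i * FreeAlgebra.ι K j) := by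
  rw [quadSum_minkCoeff, mink_left, mink_right]
  rfl

theorem isQuadratic_minkRel : IsQuadratic (MinkRel R) (minkCoeff R) where
  of_rel a b hab := by
    obtain ⟨u, v, rfl, rfl⟩ := hab
    exact ⟨(u, v), minkRel_sub u v⟩
  to_rel k := ⟨_, _, ⟨k.1, k.2, rfl, rfl⟩, minkRel_sub k.1 k.2⟩

/-- Real type I says that the Hermitian adjoint of `R` is `R₂₁`. For a Hermitian matrix `p`, taking
adjoints therefore exchanges the two sides of `R₂₁ p₁ R p₂ = p₂ R₂₁ p₁ R`, with row and column
indices interchanged. -/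
theorem conj_minkCoeff (hR : IsRealTypeI R) (u v a b : Fin n × Fin n) :
    conjK (minkCoeff R (u, v) b.swap a.swap) = -minkCoeff R (v, u) a b := by
  have h₁ : ∀ x y z w, conjK (R (x, y) (z, w)) = R (w, z) (y, x) := fun x y z w => hR x z y w
  have h₂ : ∀ p : Prop, ∀ [Decidable p], conjK (if p then 1 else 0) = if p then 1 else 0 :=
    fun p _ => by split_ifs <;> simp
  obtain ⟨u₁, u₂⟩ := u
  obtain ⟨v₁, v₂⟩ := v
  simp only [minkCoeff, map_sub, map_mul, map_sum, h₂, Prod.swap_prod_mk, Prod.fst_swap,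
    Prod.snd_swap, h₁]
  have h₃ : ∀ e, R (b.2, e) (u₁, u₂) * R (a.2, v₁) (e, b.1) =
    R (a.2, v₁) (e, b.1) * R (b.2, e) (u₁, u₂) := fun e => mul_comm _ _
  have h₄ : ∀ e, R (a.2, e) (u₁, b.1) * R (v₂, v₁) (e, a.1) =
    R (v₂, v₁) (e, a.1) * R (a.2, e) (u₁, b.1) := fun e => mul_comm _ _
  simp only [h₃, h₄]
  ring

end Matrix

end QStar
namespace QStar

/-! ### Covariance and braiding for matrix momenta -/

section MatrixRep

open Sq

variable {H : Type*} [Ring H] [Algebra K H] [IsAdicComplete tIdeal H] {h : Hopf H} {q : QT h}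
  {s : RealStar q} {n : ℕ} {R : Mat2 n} {ν : K} {f : Fin n → Fin n → H →ₗ[K] K}
  {ρ : Fin n × Fin n → Fin n × Fin n → Sq H →ₗ[K] K} {ℓ : tIdeal}

/-- `x ⊗ y ↦ φ(x) ψ(y)` on the tensor square. -/
def Sq.eval (φ ψ : H →ₗ[K] K) : Sq H →ₗ[K] K := CT.eval (A := H) (B := H) φ ψ

theorem Sq.eval_tm (φ ψ : H →ₗ[K] K) (a b : H) : Sq.eval φ ψ (i1 a * i2 b) = φ a * ψ b := by
  rw [← tm_eq]
  exact CT.eval_tm φ ψ a b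

theorem Sq.tm_mul (a b a' b' : H) : (i1 a * i2 b) * (i1 a' * i2 b') = i1 (a * a') * i2 (b * b') := by
  rw [map_mul, map_mul, mul_assoc, ← mul_assoc (i2 b), ← (i1_commute a' b).eq]
  simp only [mul_assoc]

variable (h f ρ) in
/-- The action of the tensor square on matrices. -/
def IsMatrixAction : Prop :=
  ∀ x y a b, ρ x y (i1 a * i2 b) = f x.1 y.1 (h.S a) * f y.2 x.2 b

theorem FRT.isRep_mat (F : FRT s R ν f) (hρ : IsMatrixAction h f ρ) : IsRep ρ where
  one x y := by
    have : (1 : Sq H) = i1 1 * i2 1 := by simp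
    rw [this, hρ, h.S_one, F.one, F.one]
    simp only [Prod.ext_iff, eq_comm (a := y.2)]
    split_ifs <;> simp_all
  mul i j z w := by
    have : (LinearMap.mul K (Sq H)).compr₂ (ρ i j) =
        ∑ a, (LinearMap.mul K K).flip.compl₁₂ (ρ a j) (ρ i a) := by
      refine Sq.linear_ext fun a b => Sq.linear_ext fun a' b' => ?_
      simp only [LinearMap.compr₂_apply, LinearMap.mul_apply', Sq.tm_mul, hρ i j, h.S_mul, F.mul,
        LinearMap.sum_apply, LinearMap.compl₁₂_apply, LinearMap.flip_apply, Finset.sum_mul_sum,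
        Fintype.sum_prod_type, hρ _ j, hρ i]
      exact Finset.sum_congr rfl fun i _ => Finset.sum_congr rfl fun j _ => by ring
    have h₁ := LinearMap.congr_fun₂ this z w
    simpa [mul_comm] using h₁

theorem IsMatrixAction.eval_mul (hρ : IsMatrixAction h f ρ) (x a y b : Fin n × Fin n) (z w : CT H H) :
    CT.eval (ρ x a) (ρ y b) (CT.map i1 i1 z * CT.map i2 i2 w) =
      CT.eval ((f x.1 a.1).comp h.S) ((f y.1 b.1).comp h.S) z * CT.eval (f a.2 x.2) (f b.2 y.2) w := by
  have : ((LinearMap.mul K (CT (Sq H) (Sq H))).compl₁₂ (CT.map i1 i1).toLinearMap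
      (CT.map i2 i2).toLinearMap).compr₂ (CT.eval (ρ x a) (ρ y b)) =
      (LinearMap.mul K K).compl₁₂ (CT.eval ((f x.1 a.1).comp h.S) ((f y.1 b.1).comp h.S))
        (CT.eval (f a.2 x.2) (f b.2 y.2)) := by
    refine CT.linear_ext (LinearMap.ext₂ fun u v => CT.linear_ext (LinearMap.ext₂ fun u' v' => ?_))
    simp only [LinearMap.compr₂_apply, LinearMap.compl₁₂_apply, LinearMap.mul_apply',
      AlgHom.toLinearMap_apply, CT.map_tm, tm_mul_tm, CT.eval_tm, hρ x a, hρ y b, LinearMap.comp_apply]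
    ring
  exact LinearMap.congr_fun₂ this z w

theorem IsMatrixAction.apply_i1 (hρ : IsMatrixAction h f ρ) (F : FRT s R ν f) (x y : Fin n × Fin n) (a : H) :
    ρ x y (i1 a) = f x.1 y.1 (h.S a) * if y.2 = x.2 then 1 else 0 := by
  have := hρ x y a 1
  rwa [map_one, mul_one, F.one] at this

theorem IsMatrixAction.apply_i2 (hρ : IsMatrixAction h f ρ) (F : FRT s R ν f) (x y : Fin n × Fin n) (a : H) :
    ρ x y (i2 a) = (if x.1 = y.1 then 1 else 0) * f y.2 x.2 a := by
  have := hρ x y 1 a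
  rwa [map_one, one_mul, h.S_one, F.one] at this

theorem IsMatrixAction.eval_i2_i1 (hρ : IsMatrixAction h f ρ) (F : FRT s R ν f)
    (x a y b : Fin n × Fin n) (z : CT H H) : CT.eval (ρ x a) (ρ y b) (CT.map i2 i1 z) =
      (if x.1 = a.1 then 1 else 0) * (if b.2 = y.2 then 1 else 0) *
        CT.eval (f a.2 x.2) ((f y.1 b.1).comp h.S) z := by
  have : (CT.eval (ρ x a) (ρ y b)).comp (CT.map i2 i1).toLinearMap =
      ((if x.1 = a.1 then (1 : K) else 0) * (if b.2 = y.2 then 1 else 0)) •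
        CT.eval (f a.2 x.2) ((f y.1 b.1).comp h.S) := by
    refine CT.linear_ext (LinearMap.ext₂ fun u v => ?_)
    simp only [LinearMap.compr₂_apply, LinearMap.comp_apply,
      AlgHom.toLinearMap_apply, CT.map_tm, CT.eval_tm, LinearMap.smul_apply, smul_eq_mul,
      hρ.apply_i2 F, hρ.apply_i1 F]
    ring
  exact LinearMap.congr_fun this z

theorem sum_eucCoeff (a b : Fin n × Fin n) (G : Fin n × Fin n → Fin n × Fin n → K) :
    ∑ l : (Fin n × Fin n) × Fin n × Fin n, eucCoeff R l a b * G l.1 l.2 =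
      ∑ u, ∑ v, R (v, u) (b.1, a.1) * G (u, v) (a.2, b.2) -
        ∑ u, ∑ v, R (b.2, a.2) (u, v) * G (b.1, a.1) (u, v) := by
  simp only [eucCoeff, sub_mul, Finset.sum_sub_distrib, Fintype.sum_prod_type]
  congr 1
  · simp
  · simp [Finset.sum_ite_irrel]

/-- The row index of `p` transforms by `S t` and the column index by `t`, independently. Each of the
two terms of the relation needs the FRT relation in only one of these factors. -/
theorem IsMatrixAction.isCovariant_euc (hρ : IsMatrixAction h f ρ)
    (hint : IsIntertwiner h R f) : IsCovariant h.square ρ (eucCoeff R) := by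
  refine ⟨fun k l => Sq.eval
    (h.dconv ((f k.1.2 l.1.2).comp h.S) ((f k.1.1 l.1.1).comp h.S))
    (h.dconv (f l.2.1 k.2.1) (f l.2.2 k.2.2)), fun k a b z => ?_⟩
  have h₀ : ∀ x y u v, h.square.dconv (ρ x a) (ρ y b) (i1 u * i2 v) =
      h.dconv ((f x.1 a.1).comp h.S) ((f y.1 b.1).comp h.S) u * h.dconv (f a.2 x.2) (f b.2 y.2) v :=
    fun x y u v => by
      rw [h.dconv_apply, h.dconv_apply, ← hρ.eval_mul, ← h.sqΔ_i1, ← h.sqΔ_i2, ← map_mul]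
      rfl
  suffices h₁ : quadSum (eucCoeff R k) (fun i j => h.square.dconv (ρ i a) (ρ j b)) =
      ∑ l : (Fin n × Fin n) × Fin n × Fin n, eucCoeff R l a b • Sq.eval
        (h.dconv ((f k.1.2 l.1.2).comp h.S) ((f k.1.1 l.1.1).comp h.S))
        (h.dconv (f l.2.1 k.2.1) (f l.2.2 k.2.2)) by
    have := LinearMap.congr_fun h₁ z
    simpa [quadSum] using this
  refine Sq.linear_ext fun u v => ?_
  rw [quadSum_eucCoeff]
  simp only [LinearMap.sub_apply, LinearMap.sum_apply, LinearMap.smul_apply, h₀, smul_eq_mul,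
    Sq.eval_tm]
  rw [sum_eucCoeff a b fun w z => h.dconv ((f k.1.2 w.2).comp h.S) ((f k.1.1 w.1).comp h.S) u *
    h.dconv (f z.1 k.2.1) (f z.2 k.2.2) v]
  -- The relation for `S t` serves the term with `R₂₁` on the left, the relation for `t` the term
  -- with `R` on the right.
  have e₁ := FRT.intertwiner_S hint k.1.2 b.1 k.1.1 a.1 u
  have e₂ := hint b.2 k.2.1 a.2 k.2.2 v
  congr 1
  · simp only [← mul_assoc, ← Finset.sum_mul]
    rw [Finset.sum_comm, Finset.sum_comm (f := fun x i => R (i, x) (b.1, a.1) * _)]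
    refine congrArg (· * _) (e₁.trans ?_)
    exact Finset.sum_congr rfl fun _ _ => Finset.sum_congr rfl fun _ _ => mul_comm _ _
  · simp only [mul_left_comm _ (h.dconv ((f k.1.2 a.1).comp h.S) ((f k.1.1 b.1).comp h.S) u),
      ← Finset.mul_sum]
    rw [Finset.sum_comm, e₂]
    refine congrArg (_ * ·) ?_
    exact Finset.sum_congr rfl fun _ _ => Finset.sum_congr rfl fun _ _ => mul_comm _ _

theorem FRT.evalRep_mat (F : FRT s R ν f) (hρ : IsMatrixAction h f ρ) (x y a b : Fin n × Fin n) :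
    evalRep ρ q.square.R (x, y) (a, b) =
      ν * ν * (R (x.1, y.1) (a.1, b.1) * R (a.2, b.2) (x.2, y.2)) := by
  refine (hρ.eval_mul x a y b q.R q.R).trans ?_
  rw [F.eval_S_S, F.eval]
  ring

/-- The Hecke relation is applied to the row indices in one term and to the column indices in the
other. The contributions proportional to `q - q⁻¹` are equal and cancel in the difference; the
permutation parts give back the coefficients with the opposite sign. -/
theorem FRT.braided_euc {q' : Kˣ} (F : FRT s R ν f) (hρ : IsMatrixAction h f ρ) (hR : IsHecke q' R)
    (k : (Fin n × Fin n) × Fin n × Fin n) (a b : Fin n × Fin n) :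
    quadSum (eucCoeff R k) (fun i j => evalRep ρ q.square.R (i, j) (b, a)) =
      -(ν * ν * eucCoeff R k a b) := by
  rw [quadSum_eucCoeff]
  simp only [F.evalRep_mat hρ, smul_eq_mul]
  have e₁ := sum_hecke hR k.1.2 k.1.1 b.1 a.1
  have e₂ := sum_hecke hR b.2 a.2 k.2.1 k.2.2
  have h₁ : ∀ i j, R k.1.swap (j, i) * (ν * ν * (R (i, j) (b.1, a.1) * R (b.2, a.2) (k.2.1, k.2.2))) =
      R (k.1.2, k.1.1) (j, i) * R (i, j) (b.1, a.1) * (ν * ν * R (b.2, a.2) (k.2.1, k.2.2)) :=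
    fun i j => by
      simp only [Prod.swap]
      ring
  have h₂ : ∀ i j, R (j, i) k.2 * (ν * ν * (R (k.1.2, k.1.1) (b.1, a.1) * R (b.2, a.2) (i, j))) =
      R (b.2, a.2) (i, j) * R (j, i) (k.2.1, k.2.2) * (ν * ν * R (k.1.2, k.1.1) (b.1, a.1)) :=
    fun i j => by
      simp only [Prod.mk.eta]
      ring
  simp only [h₁, h₂, ← Finset.sum_mul]
  rw [Finset.sum_comm, e₁, e₂, eucCoeff]
  simp only [Prod.swap, Prod.mk.eta, eq_comm (a := b.2), eq_comm (a := a.2), ite_and]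
  split_ifs <;> ring

/-- The square has two copies of `𝓡`, each normalised by `ν`, so `λ = ν²`, that is `ℓ + ℓ`. -/
theorem FRT.isCompatible_euc {q' : Kˣ} (F : FRT s R (cexp ℓ (1 : K)) f) (hρ : IsMatrixAction h f ρ)
    (hint : IsIntertwiner h R f) (hR : IsHecke q' R) :
    IsCompatible q.square ρ (eucCoeff R) (ℓ + ℓ) :=
  IsCompatible.of (F.isRep_mat hρ) (hρ.isCovariant_euc hint) fun k a b => by
    rw [F.braided_euc hρ hR, cexp_add_left, cexp_add ℓ (Commute.refl 1)]

theorem FRT.evalRep_bowtieχ (F : FRT s R ν f) (hρ : IsMatrixAction h f ρ) (x y a b : Fin n × Fin n) :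
    evalRep ρ q.bowtie.χ.val (x, y) (a, b) =
      (if x.1 = a.1 then 1 else 0) * (if b.2 = y.2 then 1 else 0) * (ν * R (a.2, y.1) (x.2, b.1)) := by
  refine (hρ.eval_i2_i1 F x a y b q.Rinv).trans ?_
  rw [F.eval_id_S]

/-- The cocycle contributes a factor `R` between the column index of the first momentum and the row
index of the second, which turns the relations of `Ā(R)` into those of `B(R)`. Its normalisation `ν`
is removed by the scalar `e^{-ℓ}`. -/
theorem FRT.coeffMat_mink (F : FRT s R (cexp ℓ (1 : K)) f) (hρ : IsMatrixAction h f ρ) :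
    coeffMat (minkCoeff R) =
      cexp ℓ (-1 : K) • (coeffMat (eucCoeff R) * evalRep ρ q.bowtie.χ.val) := by
  refine Matrix.ext fun k ab => ?_
  obtain ⟨a, b⟩ := ab
  rw [Matrix.smul_apply, ← quadSum_eq_mul, quadSum_eucCoeff]
  simp only [F.evalRep_bowtieχ hρ, smul_eq_mul, coeffMat, minkCoeff]
  have h₁ : cexp ℓ (-1 : K) * cexp ℓ (1 : K) = 1 := cexp_neg_mul ℓ 1
  have h₂ : ∀ i j, R k.1.swap (j, i) * ((if i = a.1 then 1 else 0) * (if b.2 = k.2.2 then 1 else 0) *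
      (cexp ℓ (1 : K) * R (a.2, j) (k.2.1, b.1))) = cexp ℓ (1 : K) * ((if i = a.1 then
        R k.1.swap (j, i) * R (a.2, j) (k.2.1, b.1) else 0) * if k.2.2 = b.2 then 1 else 0) :=
    fun i j => by
      simp only [eq_comm (a := b.2)]
      split_ifs <;> ring
  have h₃ : ∀ i j, R (j, i) k.2 * ((if k.1.2 = a.1 then 1 else 0) * (if b.2 = j then 1 else 0) *
      (cexp ℓ (1 : K) * R (a.2, k.1.1) (i, b.1))) = cexp ℓ (1 : K) * ((if k.1.2 = a.1 then 1 else 0) *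
        if b.2 = j then R (a.2, k.1.1) (i, b.1) * R (j, i) k.2 else 0) := fun i j => by
      split_ifs <;> ring
  simp only [h₂, h₃, ← Finset.mul_sum, ← Finset.sum_mul, ← mul_sub]
  rw [← mul_assoc, h₁, one_mul]
  congr 1
  · rw [Finset.sum_comm]
    simp
  · simp

/-- Nothing is verified anew for the braided matrices: they are the twist of the Euclidean case. -/
theorem FRT.isCompatible_mink {q' : Kˣ} (F : FRT s R (cexp ℓ (1 : K)) f) (hρ : IsMatrixAction h f ρ)
    (hint : IsIntertwiner h R f) (hR : IsHecke q' R) :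
    IsCompatible (q.bowtie.qt q.square) ρ (minkCoeff R) (ℓ + ℓ) :=
  IsCompatible.twist q.bowtie (F.isRep_mat hρ) (hρ.isCovariant_euc hint) (fun k a b => by
    rw [F.braided_euc hρ hR, cexp_add_left, cexp_add ℓ (Commute.refl 1)]) (F.coeffMat_mink hρ)

end MatrixRep

end QStar
namespace QStar

/-! ### Adjoints of matrix momenta -/

section MatrixStar

open Sq

variable {H : Type*} [Ring H] [Algebra K H] [IsAdicComplete tIdeal H] {h : Hopf H} {q : QT h}
  {s : RealStar q} {n : ℕ} {R : Mat2 n} {ν : K} {f : Fin n → Fin n → H →ₗ[K] K}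
  {ρ : Fin n × Fin n → Fin n × Fin n → Sq H →ₗ[K] K}

/-- Conjugation as a conjugate-linear map. -/
def conjL : K →ₛₗ[conjK] K := ⟨⟨conjK, map_add conjK⟩, fun a b => map_mul conjK a b⟩

theorem conjL_apply (a : K) : conjL a = conjK a := rfl

theorem IsStarAction.of_square {h' : Hopf (Sq H)} {q' : QT h'} {s' : RealStar q'}
    {m : Fin n × Fin n → Fin n × Fin n → K}
    (conj_rep : ∀ i b u v, ∑ a, conjK (ρ i a (i1 u * i2 v)) * m a b =
      ∑ a, m i a * ρ a b (s'.st (h'.S (i1 u * i2 v))))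
    (invol : ∀ i b, ∑ a, conjK (m i a) * m a b = if i = b then 1 else 0) :
    IsStarAction s' ρ m where
  conj_rep i b x := by
    have : ∑ a, m a b • conjL.comp (ρ i a) = ∑ a, m i a • (ρ a b).comp (s'.st.comp h'.S) :=
      Sq.conj_ext fun u v => by
        simpa [conjL_apply, mul_comm] using conj_rep i b u v
    have h₁ := LinearMap.congr_fun this x
    simpa [conjL_apply, mul_comm] using h₁
  invol := invol

/-! #### Exchange of the two factors -/

/-- Both the twisted antipode and the twisted `*` are conjugates by `U`, and `U` is self-adjoint, so
the conjugations cancel. The condition on the action can be checked in the untwisted square. -/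
theorem bowtie_st_S (x : Sq H) :
    (QT.bowtieRealStar s).st (q.bowtie.hopf.S x) = s.exchange.st (h.sqS x) := by
  have h₁ : s.exchange.st q.bowtie.U.val = q.bowtie.U.val :=
    (QT.exchange_swapSq s q.R).trans (by rw [s.real, Twist.swap_swap]; rfl)
  have h₂ : s.exchange.st q.bowtie.U⁻¹.val = q.bowtie.U⁻¹.val :=
    (QT.exchange_swapSq s q.Rinv).trans (by rw [s.star_Rinv, Twist.swap_swap]; rfl)
  change q.bowtie.U.val * s.exchange.st (q.bowtie.U.val * h.sqS x * q.bowtie.U⁻¹.val) *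
    q.bowtie.U⁻¹.val = _
  rw [s.exchange.st_mul, s.exchange.st_mul, h₁, h₂]
  simp [mul_assoc]

theorem FRT.isStarAction_mink (F : FRT s R ν f) (hρ : IsMatrixAction h f ρ) :
    IsStarAction (QT.bowtieRealStar s) ρ (fun x y => if y = x.swap then 1 else 0) := by
  have hsw : ∀ a b : Fin n × Fin n, b = a.swap ↔ a = b.swap := fun a b =>
    ⟨fun e => by rw [e, Prod.swap_swap], fun e => by rw [e, Prod.swap_swap]⟩
  refine IsStarAction.of_square (fun i b u v => ?_) fun i b => ?_
  · rw [bowtie_st_S, h.sqS_tm, s.exchange_st, Sq.exchangeConj_tm, ← (i1_commute _ _).eq]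
    simp only [mul_ite, mul_one, mul_zero, ite_mul, one_mul, zero_mul, Finset.sum_ite_eq',
      Finset.mem_univ, if_true, hsw _ b]
    rw [hρ, hρ, map_mul, F.conj, F.conj, F.S_st_S, mul_comm]
    rfl
  · simp [hsw _ b, eq_comm, apply_ite conjK]

/-- The adjoint of the relation labelled `(u, v)` is minus the relation labelled `(v, u)`, once the
summation indices are relabelled by transposition. -/
theorem star_mom_mink (hR : IsRealTypeI R) {h' : Hopf (Sq H)} {Z : Type*} [Ring Z] [Algebra K Z]
    (d : BosData h' ρ (minkCoeff R) Z) (k : (Fin n × Fin n) × Fin n × Fin n) :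
    quadSum (fun i j => conjK (minkCoeff R k i j)) (fun i j =>
      d.starP (fun x y => if y = x.swap then 1 else 0) j *
        d.starP (fun x y => if y = x.swap then 1 else 0) i) = 0 := by
  have h₁ : ∀ i, d.starP (fun x y => if y = x.swap then 1 else 0) i = d.P i.swap := fun i => by
    simp [BosData.starP]
  simp only [quadSum, h₁]
  have h₂ := d.mom k.swap
  rw [← neg_eq_zero, ← Finset.sum_neg_distrib, ← h₂, Finset.sum_comm,
    ← Equiv.sum_comp (Equiv.prodComm (Fin n) (Fin n))]
  refine Finset.sum_congr rfl fun a _ => ?_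
  rw [← Finset.sum_neg_distrib, ← Equiv.sum_comp (Equiv.prodComm (Fin n) (Fin n))]
  refine Finset.sum_congr rfl fun b _ => ?_
  have h₃ := conj_minkCoeff hR k.1 k.2 b a
  simp only [Equiv.prodComm_apply, Prod.swap_swap]
  rw [← neg_smul, h₃, neg_neg]
  rfl

/-! #### Spinor metrics -/

variable {ε ε' : Matrix (Fin n) (Fin n) K}

theorem spinor_mat (hε : ∀ i j x, f j i (h.S x) = ∑ a, ∑ b, (ε' i a * ε b j) * f a b x) (z : H) :
    (Matrix.of fun i j => f j i (h.S z)) = ε' * (Matrix.of fun a b => f a b z) * ε := by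
  refine Matrix.ext fun i j => ?_
  rw [Matrix.of_apply, hε, Matrix.mul_apply]
  simp only [Matrix.mul_apply, Matrix.of_apply, Finset.sum_mul]
  rw [Finset.sum_comm]
  exact Finset.sum_congr rfl fun _ _ => Finset.sum_congr rfl fun _ _ => by ring

theorem spinor_left (hε : ∀ i j x, f j i (h.S x) = ∑ a, ∑ b, (ε' i a * ε b j) * f a b x)
    (h₁ : ε * ε' = 1) (i b : Fin n) (z : H) :
    ∑ a, f a i (h.S z) * ε' a b = ∑ a, ε' i a * f a b z := by
  have h₃ := congrArg (· * ε') (spinor_mat hε z)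
  simp only [Matrix.mul_assoc, h₁, Matrix.mul_one] at h₃
  have := congrFun (congrFun h₃ i) b
  simpa [Matrix.mul_apply] using this

theorem spinor_right (hε : ∀ i j x, f j i (h.S x) = ∑ a, ∑ b, (ε' i a * ε b j) * f a b x)
    (h₁ : ε * ε' = 1) (i b : Fin n) (z : H) :
    ∑ a, f i a (h.S z) * ε b a = ∑ a, ε a i * f b a z := by
  have h₃ := congrArg (ε * ·) (spinor_mat hε z)
  simp only [← Matrix.mul_assoc, h₁, Matrix.one_mul] at h₃
  have := congrFun (congrFun h₃ b) i
  simpa [Matrix.mul_apply, mul_comm] using this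

/-- The `*`-structure `(h ⊗ g)^* = (S² h)^* ⊗ g^*`. -/
def FRT.eucStar (F : FRT s R ν f) : RealStar q.square :=
  (s.sqAntipode fun x => by rw [F.S_st_S, s.st_st]).tensor s

theorem FRT.eucStar_tm (F : FRT s R ν f) (u v : H) :
    F.eucStar.st (i1 u * i2 v) = i1 (s.st (h.S (h.S u))) * i2 (s.st v) :=
  Sq.tensorConj_tm _ _ u v

theorem FRT.isStarAction_euc (F : FRT s R ν f) (hρ : IsMatrixAction h f ρ)
    (hε : ∀ i j x, f j i (h.S x) = ∑ a, ∑ b, (ε' i a * ε b j) * f a b x) (h₁ : ε * ε' = 1)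
    (hε' : ∃ c : K, ε * ε.map conjK = c • (1 : Matrix (Fin n) (Fin n) K)) :
    IsStarAction F.eucStar ρ (fun x y => ε' x.1 y.1 * ε y.2 x.2) := by
  refine IsStarAction.of_square (fun i b u v => ?_) fun i b => ?_
  · have hS : h.square.S (i1 u * i2 v) = i1 (h.S u) * i2 (h.S v) := h.sqS_tm u v
    rw [hS, F.eucStar_tm]
    -- For `z = (S² u)^*` one has `S z = (S u)^*`, which is the conjugate of the action of `u` on
    -- the row index. The factor `S²` in the `*`-structure of the first copy is there for this.
    have e₁ := spinor_left hε h₁ i.1 b.1 (s.st (h.S (h.S u)))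
    have e₂ := spinor_right hε h₁ i.2 b.2 (s.st (h.S v))
    rw [F.S_st_S] at e₁ e₂
    simp only [hρ _ _, map_mul, F.conj, F.S_st_S, Fintype.sum_prod_type]
    calc _ = (∑ a, f a i.1 (s.st (h.S u)) * ε' a b.1) * ∑ a, f i.2 a (s.st v) * ε b.2 a := by
          rw [Finset.sum_mul_sum]
          exact Finset.sum_congr rfl fun _ _ => Finset.sum_congr rfl fun _ _ => by ring
      _ = _ := by
          rw [e₁, e₂, Finset.sum_mul_sum]
          exact Finset.sum_congr rfl fun _ _ => Finset.sum_congr rfl fun _ _ => by ring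
  -- The matrix is `ε⁻¹` on rows and `ε` on columns; the scalar `c` produced by the columns is
  -- exactly what the rows need to give the identity.
  · obtain ⟨c, hc⟩ := hε'
    have h₂ : ε' * ε = 1 := mul_eq_one_comm.mp h₁
    have h₃ : ε'.map conjK * ε.map conjK = 1 := by
      rw [← Matrix.map_mul, h₂]
      simp
    have h₄ : c • (ε'.map conjK * ε') = 1 := by
      have : ε'.map conjK * ε' * (ε * ε.map conjK) = 1 := by
        rw [Matrix.mul_assoc, ← Matrix.mul_assoc ε', h₂, Matrix.one_mul, h₃]
      rwa [hc, Matrix.mul_smul, Matrix.mul_one] at this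
    have e₁ := congrFun (congrFun h₄ i.1) b.1
    have e₂ := congrFun (congrFun hc b.2) i.2
    simp only [Matrix.smul_apply, Matrix.mul_apply, Matrix.map_apply, smul_eq_mul] at e₁ e₂
    simp only [map_mul, Fintype.sum_prod_type]
    calc _ = (∑ a, conjK (ε' i.1 a) * ε' a b.1) * ∑ a, ε b.2 a * conjK (ε a i.2) := by
          rw [Finset.sum_mul_sum]
          exact Finset.sum_congr rfl fun _ _ => Finset.sum_congr rfl fun _ _ => by ring
      _ = (1 : Matrix (Fin n) (Fin n) K) i.1 b.1 * (1 : Matrix (Fin n) (Fin n) K) b.2 i.2 := by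
          rw [e₂, ← e₁]
          ring
      _ = _ := by
          simp only [Matrix.one_apply, Prod.ext_iff, eq_comm (a := b.2)]
          split_ifs <;> simp_all

/-- Evaluate the invariance `(S ⊗ S)𝓡 = 𝓡` on transposed matrix entries, where `S` acts by
conjugation with `ε`, and cancel `ν`. -/
theorem FRT.spinor_R (F : FRT s R ν f) (hν : IsUnit ν)
    (hε : ∀ i j x, f j i (h.S x) = ∑ a, ∑ b, (ε' i a * ε b j) * f a b x) :
    R.transpose = (ε' ⊗ₖ ε') * R * (ε ⊗ₖ ε) := by
  have h₁ : ∀ x y, CT.eval ((f y.1 x.1).comp h.S) ((f y.2 x.2).comp h.S) = ∑ p, ∑ r,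
      ((ε' ⊗ₖ ε') x p * (ε ⊗ₖ ε) r y) • CT.eval (f p.1 r.1) (f p.2 r.2) := fun x y => by
    refine CT.linear_ext (LinearMap.ext₂ fun a b => ?_)
    have h₂ : (Matrix.of fun i j => f j i (h.S a)) ⊗ₖ (Matrix.of fun i j => f j i (h.S b)) =
        (ε' ⊗ₖ ε') * ((Matrix.of fun i j => f i j a) ⊗ₖ (Matrix.of fun i j => f i j b)) *
          (ε ⊗ₖ ε) := by
      rw [spinor_mat hε, spinor_mat hε, Matrix.mul_kronecker_mul, Matrix.mul_kronecker_mul]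
    have h₃ := congrFun (congrFun h₂ x) y
    rw [Matrix.mul_apply] at h₃
    simp only [Matrix.mul_apply, Finset.sum_mul] at h₃
    rw [Finset.sum_comm] at h₃
    simp only [LinearMap.compr₂_apply, LinearMap.sum_apply, LinearMap.smul_apply, CT.eval_tm]
    refine h₃.trans (Finset.sum_congr rfl fun p _ => Finset.sum_congr rfl fun r _ => ?_)
    simp only [Matrix.kroneckerMap_apply, Matrix.of_apply, smul_eq_mul]
    ring
  refine Matrix.ext fun x y => hν.mul_left_cancel ?_
  have h₂ := F.eval_S_S y.1 x.1 y.2 x.2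
  rw [h₁] at h₂
  rw [Matrix.transpose_apply]
  refine h₂.symm.trans ?_
  rw [Matrix.mul_apply]
  simp only [LinearMap.sum_apply, LinearMap.smul_apply, F.eval, Matrix.mul_apply, Finset.sum_mul,
    Finset.mul_sum, smul_eq_mul, Prod.mk.eta]
  rw [Finset.sum_comm]
  exact Finset.sum_congr rfl fun _ _ => Finset.sum_congr rfl fun _ _ => by ring

theorem quadSum_conj_eucCoeff (hR : IsRealTypeI R) (k : (Fin n × Fin n) × Fin n × Fin n)
    (F : Fin n × Fin n → Fin n × Fin n → K) :
    quadSum (fun i j => conjK (eucCoeff R k i j)) F =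
      ∑ a, ∑ b, R (a, b) k.1 * F (a, k.2.1) (b, k.2.2) -
        ∑ a, ∑ b, R k.2.swap (a, b) * F (k.1.2, a) (k.1.1, b) := by
  have h₁ : ∀ x y z w, conjK (R (x, y) (z, w)) = R (w, z) (y, x) := fun x y z w => hR x z y w
  have h₂ : ∀ p : Prop, ∀ [Decidable p], conjK (if p then 1 else 0) = if p then 1 else 0 :=
    fun p _ => by split_ifs <;> simp
  obtain ⟨⟨u₁, u₂⟩, v₁, v₂⟩ := k
  simp only [quadSum, eucCoeff, map_sub, map_mul, h₂, Prod.swap_prod_mk, h₁, smul_eq_mul, sub_mul,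
    Finset.sum_sub_distrib, Fintype.sum_prod_type]
  congr 1
  · simp
  · simp [Finset.sum_ite_irrel]

/-- Conjugation replaces `R` by its transpose up to flips, and the transpose is `R` conjugated by `ε
⊗ ε`. So the adjoint relations are the relations with all four free indices transformed by `ε` and
its inverse. -/
theorem star_mom_euc (hR : IsRealTypeI R) (hRT : R.transpose = (ε' ⊗ₖ ε') * R * (ε ⊗ₖ ε))
    (h₁ : ε * ε' = 1) {h' : Hopf (Sq H)} {Z : Type*} [Ring Z] [Algebra K Z]
    (d : BosData h' ρ (eucCoeff R) Z) (k : (Fin n × Fin n) × Fin n × Fin n) :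
    quadSum (fun i j => conjK (eucCoeff R k i j)) (fun i j =>
      d.starP (fun x y => ε' x.1 y.1 * ε y.2 x.2) j * d.starP (fun x y => ε' x.1 y.1 * ε y.2 x.2) i) =
        0 := by
  have hE : (ε ⊗ₖ ε) * (ε' ⊗ₖ ε') = 1 := by
    rw [← Matrix.mul_kronecker_mul, h₁, Matrix.one_kronecker_one]
  -- The coefficients transform the row labels by `ε'` and the column labels by `ε`, with both pairs
  -- flipped because `*` reverses the order of the momenta.
  refine star_mom_of d (fun k l => ε' k.1.1 l.1.2 * ε' k.1.2 l.1.1 * (ε l.2.2 k.2.1 * ε l.2.1 k.2.2))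
    (fun k a b => ?_) k
  rw [quadSum_conj_eucCoeff hR]
  have h₂ : R.transpose * (ε' ⊗ₖ ε') = (ε' ⊗ₖ ε') * R := by
    rw [hRT, Matrix.mul_assoc, hE, Matrix.mul_one]
  have h₃ : (ε ⊗ₖ ε) * R.transpose = R * (ε ⊗ₖ ε) := by
    rw [hRT, ← Matrix.mul_assoc, ← Matrix.mul_assoc, hE, Matrix.one_mul]
  have e₂ := congrFun (congrFun h₂ k.1) (b.1, a.1)
  have e₃ := congrFun (congrFun h₃ (b.2, a.2)) k.2.swap
  simp only [Matrix.mul_apply, Matrix.transpose_apply, Fintype.sum_prod_type,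
    Matrix.kroneckerMap_apply, Prod.fst_swap, Prod.snd_swap] at e₂ e₃
  have h₄ := sum_eucCoeff (R := R) a b fun w z =>
    ε' k.1.1 w.2 * ε' k.1.2 w.1 * (ε z.2 k.2.1 * ε z.1 k.2.2)
  refine Eq.trans ?_ (h₄.symm.trans (Finset.sum_congr rfl fun _ _ => mul_comm _ _))
  congr 1
  · calc _ = (∑ x, ∑ y, R (x, y) k.1 * (ε' x b.1 * ε' y a.1)) * (ε b.2 k.2.1 * ε a.2 k.2.2) := by
          simp only [Finset.sum_mul]
          exact Finset.sum_congr rfl fun _ _ => Finset.sum_congr rfl fun _ _ => by ring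
      _ = _ := by
          rw [e₂, Finset.sum_comm]
          simp only [Finset.sum_mul]
          exact Finset.sum_congr rfl fun _ _ => Finset.sum_congr rfl fun _ _ => by ring
  · calc _ = (ε' k.1.1 a.1 * ε' k.1.2 b.1) * ∑ x, ∑ y, ε b.2 x * ε a.2 y * R k.2.swap (x, y) := by
          simp only [Finset.mul_sum]
          exact Finset.sum_congr rfl fun _ _ => Finset.sum_congr rfl fun _ _ => by ring
      _ = _ := by
          rw [e₃]
          simp only [Finset.mul_sum]
          exact Finset.sum_congr rfl fun _ _ => Finset.sum_congr rfl fun _ _ => by ring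

end MatrixStar

end QStar
namespace QStar

open Sq

/-! ### Quantum groups of FRT type -/

section QuantumGroup

variable {n : ℕ} {H A : Type*} [Ring H] [Algebra K H] [IsAdicComplete tIdeal H]
  [Ring A] [HopfAlgebra K A] {D : HopfData H} {RR : (CTensor H H)ˣ} {st : H →ₛₗ[conjK] H}
  {t : Matrix (Fin n) (Fin n) A} {stA : A →ₛₗ[conjK] A} {pair : H →ₗ[K] A →ₗ[K] K}
  {R : Mat2 n} {ν : K}

namespace IsQuantumGroup

/-- The bundled Hopf algebra. -/
abbrev toHopf (hQ : IsQuantumGroup D RR st t stA pair R ν) : Hopf H := Hopf.ofData D hQ.hopf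

/-- The bundled quasitriangular structure. -/
abbrev toQT (hQ : IsQuantumGroup D RR st t stA pair R ν) : QT hQ.toHopf :=
  QT.ofData hQ.hopf hQ.quasitriangular

/-- The bundled `*`-structure. -/
abbrev toRealStar (hQ : IsQuantumGroup D RR st t stA pair R ν) : RealStar hQ.toQT :=
  RealStar.ofData hQ.hopf hQ.quasitriangular hQ.hopfStar hQ.real

theorem S_st_S (hQ : IsQuantumGroup D RR st t stA pair R ν)
    (x : H) : D.antipode (st (D.antipode x)) = st x := by
  have := hQ.hopfStar.antipode_star (st x)
  rwa [hQ.hopfStar.star_star] at this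

theorem isFRT (hQ : IsQuantumGroup D RR st t stA pair R ν) :
    FRT hQ.toRealStar R ν (fun i j => pair.flip (t i j)) where
  one i j := by rw [LinearMap.flip_apply, hQ.one_pair, hQ.counit_t]
  mul i j x y := by
    simp only [LinearMap.flip_apply, hQ.mul_pair, hQ.comul_t, map_sum, TensorProduct.map_tmul,
      LinearMap.mul'_apply]
  eval i j k l := (evalT_eq _ _ _).symm.trans (hQ.pair_R i j k l)
  -- The compact form `t_{ij}^* = S t_{ji}` moves an antipode to the other side of the pairing,
  -- where `S((S x)^*) = x^*`.
  conj i j x := by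
    rw [LinearMap.flip_apply, LinearMap.flip_apply, hQ.pair_star, hQ.starA_t, hQ.pair_antipode,
      hQ.S_st_S]
    rfl
  S_st_S := hQ.S_st_S

theorem pair_mul_eq (hQ : IsQuantumGroup D RR st t stA pair R ν) (x : H) (a b : A) :
    pair x (a * b) = hQ.toHopf.dconv (pair.flip a) (pair.flip b) x :=
  (hQ.pair_mul x a b).trans (evalT_eq _ _ _)

theorem isIntertwiner (hQ : IsQuantumGroup D RR st t stA pair R ν) {R' : Mat2 n}
    (hR' : toAlg A R' * leg1 t * leg2 t = leg2 t * leg1 t * toAlg A R') :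
    IsIntertwiner hQ.toHopf R' (fun i j => pair.flip (t i j)) := by
  intro i j k l x
  have h₁ : (toAlg A R' * leg1 t * leg2 t) (i, k) (j, l) =
      ∑ a, ∑ b, R' (i, k) (a, b) • (t a j * t b l) := by
    rw [mul_leg2, Finset.sum_comm]
    refine Finset.sum_congr rfl fun b _ => ?_
    rw [mul_leg1, Finset.sum_mul]
    refine Finset.sum_congr rfl fun a _ => ?_
    rw [toAlg, Matrix.map_apply, mul_assoc, Algebra.smul_def]
  have h₂ : (leg2 t * leg1 t * toAlg A R') (i, k) (j, l) =
      ∑ a, ∑ b, R' (a, b) (j, l) • (t k b * t i a) := by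
    rw [Matrix.mul_assoc, leg2_mul, Finset.sum_comm]
    refine Finset.sum_congr rfl fun b _ => ?_
    rw [leg1_mul, Finset.mul_sum]
    refine Finset.sum_congr rfl fun a _ => ?_
    rw [toAlg, Matrix.map_apply, ← mul_assoc, Algebra.smul_def, Algebra.commutes]
  have h₃ := congrArg (pair x) (h₁.symm.trans ((congrFun (congrFun hR' _) _).trans h₂))
  simp only [map_sum, map_smul, smul_eq_mul, hQ.pair_mul_eq] at h₃
  rw [h₃]
  simp only [mul_comm]

theorem vecAct_eq (hQ : IsQuantumGroup D RR st t stA pair R ν) (i j : Fin n) :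
    vecAct t pair i j = (pair.flip (t i j)).comp hQ.toHopf.S :=
  LinearMap.ext fun x => hQ.pair_antipode x _

theorem isMatrixAction (hQ : IsQuantumGroup D RR st t stA pair R ν) :
    IsMatrixAction hQ.toHopf (fun i j => pair.flip (t i j)) (matAct t pair) := by
  intro x y a b
  have h₁ := evalT_of (pair.flip (HopfAlgebra.antipode K (t x.1 y.1))) (pair.flip (t y.2 x.2)) a b
  refine (congrArg (matAct t pair x y) (tm_eq a b).symm).trans (h₁.trans ?_)
  rw [LinearMap.flip_apply, hQ.pair_antipode]
  rfl

theorem lPlus_eq (hQ : IsQuantumGroup D RR st t stA pair R ν) (i j : Fin n) :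
    lPlus RR t pair i j = CT.sliceR (pair.flip (t i j)) hQ.toQT.R := sliceRight_eq _ _

theorem lMinus_eq (hQ : IsQuantumGroup D RR st t stA pair R ν) (i j : Fin n) :
    lMinus RR t pair i j = CT.sliceL (pair.flip (t i j)) hQ.toQT.Rinv := sliceLeft_eq _ _

theorem st_lPlus (hQ : IsQuantumGroup D RR st t stA pair R ν) (i j : Fin n) :
    st (lPlus RR t pair i j) = D.antipode (lMinus RR t pair j i) := by
  rw [hQ.lPlus_eq, hQ.lMinus_eq]
  exact hQ.isFRT.st_lPlus i j

theorem st_lMinus (hQ : IsQuantumGroup D RR st t stA pair R ν) (i j : Fin n) :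
    st (lMinus RR t pair i j) = D.antipode (lPlus RR t pair j i) := by
  rw [hQ.lPlus_eq, hQ.lMinus_eq]
  exact hQ.isFRT.st_lMinus i j

theorem sum_t_mul_antipode (hQ : IsQuantumGroup D RR st t stA pair R ν) (i j : Fin n) :
    ∑ a, t i a * HopfAlgebra.antipode K (t a j) = if i = j then 1 else 0 := by
  have := HopfAlgebra.mul_antipode_lTensor_comul_apply (R := K) (t i j)
  rw [hQ.comul_t, hQ.counit_t, map_sum, map_sum] at this
  simpa [apply_ite (algebraMap K A)] using this

/-- Multiplying the invariance of `η` on the right by the antipode of `t` leaves a single `t` on one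
side and `S t` on the other; pairing with `x` gives the condition on the action. -/
theorem metric_eq (hQ : IsQuantumGroup D RR st t stA pair R ν)
    {R' : Mat2 n} {η : Matrix (Fin n) (Fin n) K} (hη : IsQuantumMetric t R' η)
    (i b : Fin n) (x : H) :
    ∑ a, pair.flip (t a i) x * η a b =
      ∑ a, η i a * pair.flip (t a b) (hQ.toHopf.S x) := by
  have h₁ : ∑ a, η a b • t a i = ∑ j, η i j • HopfAlgebra.antipode K (t j b) := by
    -- Insert `∑ j, t c j * S(t j b) = δ_{cb}` so that the invariance can be applied to the product
    -- `t a i * t c j`.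
    calc _ = ∑ a, ∑ c, η a c • (t a i * ∑ j, t c j * HopfAlgebra.antipode K (t j b)) := by
          simp [hQ.sum_t_mul_antipode]
      _ = ∑ j, (∑ a, ∑ c, η a c • (t a i * t c j)) * HopfAlgebra.antipode K (t j b) := by
          simp only [Finset.mul_sum, Finset.sum_mul, Finset.smul_sum, smul_mul_assoc, mul_assoc]
          exact (Finset.sum_congr rfl fun _ _ => Finset.sum_comm).trans Finset.sum_comm
      _ = _ := Finset.sum_congr rfl fun j _ => by rw [hη.invariant, Algebra.smul_def]
  have h₂ := congrArg (pair x) h₁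
  simp only [map_sum, map_smul, smul_eq_mul, hQ.pair_antipode] at h₂
  simp only [LinearMap.flip_apply, mul_comm _ (η _ b)]
  exact h₂

/-- Compares the two expressions for the adjoint of `t`: the antipode of its transpose and
conjugation by `ε`. -/
theorem spinor_eq (hQ : IsQuantumGroup D RR st t stA pair R ν)
    {ε : Matrix (Fin n) (Fin n) K} (hε : IsSpinorMetric t stA ε) (i j : Fin n) (x : H) :
    pair.flip (t j i) (hQ.toHopf.S x) = ∑ a, ∑ b, (ε⁻¹ i a * ε b j) * pair.flip (t a b) x := by
  have h₁ := congrArg (pair x) ((hQ.starA_t i j).symm.trans (hε.star_t i j))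
  simp only [map_sum, map_smul, smul_eq_mul, hQ.pair_antipode] at h₁
  exact h₁

end IsQuantumGroup

/-! ### The double cross product, in terms of its bundled form -/

theorem square_toData_ofData (hD : D.IsHopf) : (Hopf.ofData D hD).square.toData = D.square :=
  (Hopf.ofData D hD).square_toData

theorem bowtie_toData (hD : D.IsHopf) (hR : D.IsQuasitriangular RR) :
    (QT.ofData hD hR).bowtie.hopf.toData = D.bowtie RR :=
  (QT.ofData hD hR).bowtie.toData_hopf.trans (QT.bowtie_toData_aux (square_toData_ofData hD)
    (QT.leg23Square_eq RR⁻¹.val).symm (QT.leg23Square_eq RR.val).symm)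

theorem bowtieR_eq (hD : D.IsHopf) (hR : D.IsQuasitriangular RR) :
    ((QT.ofData hD hR).bowtie.qt (QT.ofData hD hR).square).R = bowtieR RR := by
  have h₁ : flip (leg23Square RR⁻¹.val) = CT.swap (QT.ofData hD hR).bowtie.χ.val :=
    (congrArg flip (QT.leg23Square_eq RR⁻¹.val)).trans (flip_eq _)
  exact congrArg₂ (fun x y : CT (Sq H) (Sq H) => x * y)
    (congrArg₂ (fun x y : CT (Sq H) (Sq H) => x * y) h₁.symm (QT.ofData hD hR).square_R)
    (QT.leg23Square_eq RR.val).symm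

theorem twistU_eq (hD : D.IsHopf) (hR : D.IsQuasitriangular RR) :
    D.square.twistU (leg23Square RR⁻¹.val) = (QT.ofData hD hR).bowtie.U.val := by
  rw [← square_toData_ofData hD, ← (QT.ofData hD hR).bowtie.U_eq]
  refine (congrArg _ (QT.leg23Square_eq RR⁻¹.val)).trans ?_
  exact (congrArg (uncpl (Sq H)) (cmul_map_eq LinearMap.id _ _)).trans (uncpl_of _)

theorem twistUinv_eq (hD : D.IsHopf) (hR : D.IsQuasitriangular RR) :
    D.square.twistUinv (leg23Square RR.val) = (QT.ofData hD hR).bowtie.U⁻¹.val := by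
  rw [← square_toData_ofData hD, ← (QT.ofData hD hR).bowtie.Uinv_eq]
  refine (congrArg _ (QT.leg23Square_eq RR.val)).trans ?_
  exact (congrArg (uncpl (Sq H)) (cmul_map_eq _ LinearMap.id _)).trans (uncpl_of _)

theorem bowtieStar_eq (hD : D.IsHopf) (hR : D.IsQuasitriangular RR) (hst : D.IsHopfStar st)
    (real : starT st RR.val = flip RR.val) :
    (QT.bowtieRealStar (RealStar.ofData hD hR hst real)).st = bowtieStar D RR st := by
  rw [bowtieStar, twistU_eq hD hR, twistUinv_eq hD hR]
  rfl

theorem squareStar_eq (hQ : IsQuantumGroup D RR st t stA pair R ν) :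
    hQ.isFRT.eucStar.st = squareStar D st := rfl

/-- Both sides are conjugates by the same `U` of the same element of the second copy of `H`. -/
theorem bowtieStar_inl (hQ : IsQuantumGroup D RR st t stA pair R ν) {x y : H}
    (h : st x = D.antipode y) : bowtieStar D RR st (inl x) = (D.bowtie RR).antipode (inr y) := by
  rw [← bowtieStar_eq hQ.hopf hQ.quasitriangular hQ.hopfStar hQ.real,
    ← bowtie_toData hQ.hopf hQ.quasitriangular]
  refine congrArg (mulLR _ _) ((hQ.toRealStar.exchange_i1 x).trans ?_)
  exact (congrArg i2 h).trans (hQ.toHopf.sqS_i2 y).symm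

theorem bowtieStar_inr (hQ : IsQuantumGroup D RR st t stA pair R ν) {x y : H}
    (h : st x = D.antipode y) : bowtieStar D RR st (inr x) = (D.bowtie RR).antipode (inl y) := by
  rw [← bowtieStar_eq hQ.hopf hQ.quasitriangular hQ.hopfStar hQ.real,
    ← bowtie_toData hQ.hopf hQ.quasitriangular]
  refine congrArg (mulLR _ _) ((hQ.toRealStar.exchange_i2 x).trans ?_)
  exact (congrArg i1 h).trans (hQ.toHopf.sqS_i1 y).symm

theorem square_antipode_inl (hD : D.IsHopf) (x : H) : D.square.antipode (inl x) = inl (D.antipode x) := by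
  rw [← square_toData_ofData hD]
  exact (Hopf.ofData D hD).sqS_i1 x

theorem square_antipode_inr (hD : D.IsHopf) (x : H) : D.square.antipode (inr x) = inr (D.antipode x) := by
  rw [← square_toData_ofData hD]
  exact (Hopf.ofData D hD).sqS_i2 x

theorem squareStar_inl (hQ : IsQuantumGroup D RR st t stA pair R ν) (x : H) :
    squareStar D st (inl x) = inl (st (D.antipode (D.antipode x))) := by
  have h₁ := hQ.isFRT.eucStar_tm x 1
  rw [map_one, mul_one] at h₁
  refine h₁.trans ((congrArg (_ * i2 ·) hQ.toRealStar.st_one).trans ?_)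
  rw [map_one, mul_one]
  rfl

theorem squareStar_inr (hQ : IsQuantumGroup D RR st t stA pair R ν) (x : H) :
    squareStar D st (inr x) = inr (st x) := by
  have h₁ := hQ.isFRT.eucStar_tm 1 x
  rw [map_one, one_mul, hQ.toHopf.S_one, hQ.toHopf.S_one, hQ.toRealStar.st_one, map_one, one_mul] at h₁
  exact h₁

end QuantumGroup

end QStar
namespace QStar

/-! ### The inhomogeneous quantum groups -/

namespace IsQuantumGroup

variable {n : ℕ} {H A : Type*} [Ring H] [Algebra K H] [IsAdicComplete tIdeal H]
  [Ring A] [HopfAlgebra K A] {D : HopfData H} {RR : (CTensor H H)ˣ} {st : H →ₛₗ[conjK] H}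
  {t : Matrix (Fin n) (Fin n) A} {stA : A →ₛₗ[conjK] A} {pair : H →ₗ[K] A →ₗ[K] K}
  {R : Mat2 n} {ℓ : tIdeal}

/-- By definition the normalisation `ν` is the exponential of `ℓ` at `1`, the scalar that also
governs the commutation of `λ^ξ` with momenta. -/
theorem isFRT_cexp (hQ : IsQuantumGroup D RR st t stA pair R (expK ℓ)) :
    FRT hQ.toRealStar R (cexp ℓ (1 : K)) (fun i j => pair.flip (t i j)) := hQ.isFRT

theorem conjK_add_self (hℓ : conjK (ℓ : K) = ℓ) : conjK ((ℓ + ℓ : tIdeal) : K) = (ℓ + ℓ : tIdeal) := by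
  rw [Submodule.coe_add, map_add, hℓ]

theorem exists_minkowski (hQ : IsQuantumGroup D RR st t stA pair R (expK ℓ))
    (hℓ : conjK (ℓ : K) = ℓ) (hR : IsRealTypeI R) {q : Kˣ} (hq : IsHecke q R) :
    ∃ (E : HopfData (Bos (D.bowtie RR) (matAct t pair) (MinkRel R)))
      (s : Bos (D.bowtie RR) (matAct t pair) (MinkRel R) →ₛₗ[conjK]
        Bos (D.bowtie RR) (matAct t pair) (MinkRel R)),
      IsQuasiStarBosonisation (D.bowtie RR) (matAct t pair) (MinkRel R)
        (bowtieR RR) (ℓ + ℓ) (bowtieStar D RR st) E s ∧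
      (∀ i j, s (bgMap _ _ _ (inl (lPlus RR t pair i j))) =
        E.antipode (bgMap _ _ _ (inr (lMinus RR t pair j i)))) ∧
      (∀ i j, s (bgMap _ _ _ (inl (lMinus RR t pair i j))) =
        E.antipode (bgMap _ _ _ (inr (lPlus RR t pair j i)))) ∧
      (∀ i j, s (bgMap _ _ _ (inr (lPlus RR t pair i j))) =
        E.antipode (bgMap _ _ _ (inl (lMinus RR t pair j i)))) ∧
      (∀ i j, s (bgMap _ _ _ (inr (lMinus RR t pair i j))) =
        E.antipode (bgMap _ _ _ (inl (lPlus RR t pair j i)))) ∧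
      (∀ i j, s (bosP _ _ _ (i, j)) = bosP _ _ _ (j, i)) ∧
      s (bosXi _ _ _) = -bosXi _ _ _ := by
  obtain ⟨E, s, hE, hS, hP, hΞ⟩ := exists_quasiStar isQuadratic_minkRel
    (hQ.isFRT_cexp.isCompatible_mink hQ.isMatrixAction (hQ.isIntertwiner hQ.frt) hq)
    (QT.bowtieRealStar hQ.toRealStar) (hQ.isFRT_cexp.isStarAction_mink hQ.isMatrixAction)
    (star_mom_mink hR _) (conjK_add_self hℓ) (bowtie_toData hQ.hopf hQ.quasitriangular)
    (bowtieR_eq hQ.hopf hQ.quasitriangular)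
    (bowtieStar_eq hQ.hopf hQ.quasitriangular hQ.hopfStar hQ.real)
  refine ⟨E, s, hE, fun i j => ?_, fun i j => ?_, fun i j => ?_, fun i j => ?_, fun i j => ?_, hΞ⟩
  · rw [hE.star_bg, hS, bowtieStar_inl hQ (hQ.st_lPlus i j)]
  · rw [hE.star_bg, hS, bowtieStar_inl hQ (hQ.st_lMinus i j)]
  · rw [hE.star_bg, hS, bowtieStar_inr hQ (hQ.st_lPlus i j)]
  · rw [hE.star_bg, hS, bowtieStar_inr hQ (hQ.st_lMinus i j)]
  · rw [hP]
    simp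

theorem exists_vectorial (hQ : IsQuantumGroup D RR st t stA pair R (expK ℓ))
    (hℓ : conjK (ℓ : K) = ℓ) (hR : IsRealTypeI R) {R' : Mat2 n} {η : Matrix (Fin n) (Fin n) K}
    (hB : IsBraidedData R' R) (hR' : IsRealTypeI R')
    (hint : toAlg A R' * leg1 t * leg2 t = leg2 t * leg1 t * toAlg A R')
    (hη : IsQuantumMetric t R' η) :
    ∃ (E : HopfData (Bos D (vecAct t pair) (VecRel R')))
      (s : Bos D (vecAct t pair) (VecRel R') →ₛₗ[conjK] Bos D (vecAct t pair) (VecRel R')),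
      IsQuasiStarBosonisation D (vecAct t pair) (VecRel R') RR.val ℓ st E s ∧
      (∀ i j, s (bgMap _ _ _ (lPlus RR t pair i j)) =
        E.antipode (bgMap _ _ _ (lMinus RR t pair j i))) ∧
      (∀ i j, s (bgMap _ _ _ (lMinus RR t pair i j)) =
        E.antipode (bgMap _ _ _ (lPlus RR t pair j i))) ∧
      (∀ i, s (bosP _ _ _ i) = ∑ a, η i a • bosP _ _ _ a) ∧
      s (bosXi _ _ _) = -bosXi _ _ _ := by
  obtain ⟨e, he⟩ := hη.iso
  obtain ⟨E, s, hE, hS, hP, hΞ⟩ := exists_quasiStar isQuadratic_vecRel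
    (hQ.isFRT_cexp.isCompatible_vec hQ.vecAct_eq (hQ.isIntertwiner hint) hR hR' hB.add)
    hQ.toRealStar (hQ.isFRT_cexp.isStarAction_vec hQ.vecAct_eq (hQ.metric_eq hη)
      (by rw [hη.real, Matrix.nonsing_inv_mul _ hη.isUnit]))
    (star_mom_vec hR' (e := e.toAlgHom) he _) hℓ (D := D) rfl (R' := RR.val) rfl (st' := st) rfl
  refine ⟨E, s, hE, fun i j => ?_, fun i j => ?_, hP, hΞ⟩
  · rw [hE.star_bg, hS, hQ.st_lPlus i j]
  · rw [hE.star_bg, hS, hQ.st_lMinus i j]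

theorem exists_euclidean (hQ : IsQuantumGroup D RR st t stA pair R (expK ℓ))
    (hℓ : conjK (ℓ : K) = ℓ) (hR : IsRealTypeI R) {q : Kˣ} {ε : Matrix (Fin n) (Fin n) K}
    (hq : IsHecke q R) (hε : IsSpinorMetric t stA ε) :
    ∃ (E : HopfData (Bos D.square (matAct t pair) (EucRel R)))
      (s : Bos D.square (matAct t pair) (EucRel R) →ₛₗ[conjK]
        Bos D.square (matAct t pair) (EucRel R)),
      IsQuasiStarBosonisation D.square (matAct t pair) (EucRel R)
        (squareR RR.val) (ℓ + ℓ) (squareStar D st) E s ∧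
      (∀ i j, E.antipode (s (bgMap _ _ _ (inl (lPlus RR t pair i j)))) =
        bgMap _ _ _ (inl (lMinus RR t pair j i))) ∧
      (∀ i j, E.antipode (s (bgMap _ _ _ (inl (lMinus RR t pair i j)))) =
        bgMap _ _ _ (inl (lPlus RR t pair j i))) ∧
      (∀ i j, s (bgMap _ _ _ (inr (lPlus RR t pair i j))) =
        E.antipode (bgMap _ _ _ (inr (lMinus RR t pair j i)))) ∧
      (∀ i j, s (bgMap _ _ _ (inr (lMinus RR t pair i j))) =
        E.antipode (bgMap _ _ _ (inr (lPlus RR t pair j i)))) ∧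
      (∀ i j, s (bosP _ _ _ (i, j)) = ∑ a, ∑ b, (invT ε a i * ε b j) • bosP _ _ _ (a, b)) ∧
      s (bosXi _ _ _) = -bosXi _ _ _ := by
  have h₁ : ε * ε⁻¹ = 1 := Matrix.mul_nonsing_inv _ hε.isUnit
  have hν : IsUnit (cexp ℓ (1 : K)) := IsUnit.of_mul_eq_one _ (cexp_mul_neg ℓ 1)
  obtain ⟨E, s, hE, hS, hP, hΞ⟩ := exists_quasiStar isQuadratic_eucRel
    (hQ.isFRT_cexp.isCompatible_euc hQ.isMatrixAction (hQ.isIntertwiner hQ.frt) hq)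
    hQ.isFRT_cexp.eucStar
    (hQ.isFRT_cexp.isStarAction_euc hQ.isMatrixAction (hQ.spinor_eq hε) h₁ hε.real)
    (star_mom_euc hR (hQ.isFRT_cexp.spinor_R hν (hQ.spinor_eq hε)) h₁ _) (conjK_add_self hℓ)
    (square_toData_ofData hQ.hopf) hQ.toQT.square_R (squareStar_eq hQ)
  -- On the first copy `S((S² y)^*) = (S y)^* = x`. The value `l^* = S⁻¹(·)` is therefore proved in
  -- the form with `S` applied to `l^*`.
  have h₂ : ∀ x y, st x = D.antipode y → E.antipode (s (bgMap _ _ _ (inl y))) =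
      bgMap _ _ _ (inl x) := fun x y h => by
    rw [hE.star_bg, hS, squareStar_inl hQ, square_antipode_inl hQ.hopf, hQ.S_st_S, ← h,
      hQ.hopfStar.star_star]
  refine ⟨E, s, hE, fun i j => h₂ _ _ (hQ.st_lMinus j i), fun i j => h₂ _ _ (hQ.st_lPlus j i),
    fun i j => ?_, fun i j => ?_, fun i j => ?_, hΞ⟩
  · rw [hE.star_bg, hS, squareStar_inr hQ, square_antipode_inr hQ.hopf, hQ.st_lPlus]
  · rw [hE.star_bg, hS, squareStar_inr hQ, square_antipode_inr hQ.hopf, hQ.st_lMinus]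
  · rw [hP, Fintype.sum_prod_type]
    rfl

end IsQuantumGroup

end QStar

theorem proposition3p7 {n : ℕ} {H A : Type*} [Ring H] [Algebra K H] [IsAdicComplete tIdeal H]
    [Ring A] [HopfAlgebra K A]
    (D : HopfData H) (RR : (CTensor H H)ˣ) (st : H →ₛₗ[conjK] H)
    (t : Matrix (Fin n) (Fin n) A) (stA : A →ₛₗ[conjK] A) (pair : H →ₗ[K] A →ₗ[K] K)
    (R : Mat2 n) (ℓ : tIdeal) (hℓ : conjK (ℓ : K) = ℓ) (hR : IsRealTypeI R)
    (hQ : IsQuantumGroup D RR st t stA pair R (expK ℓ)) :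
    -- the `q`-Minkowski case
    (∀ q : Kˣ, IsHecke q R →
      ∃ (E : HopfData (Bos (D.bowtie RR) (matAct t pair) (MinkRel R)))
        (s : Bos (D.bowtie RR) (matAct t pair) (MinkRel R) →ₛₗ[conjK]
          Bos (D.bowtie RR) (matAct t pair) (MinkRel R)),
        IsQuasiStarBosonisation (D.bowtie RR) (matAct t pair) (MinkRel R)
          (bowtieR RR) (ℓ + ℓ) (bowtieStar D RR st) E s ∧
        (∀ i j, s (bgMap _ _ _ (inl (lPlus RR t pair i j))) =
          E.antipode (bgMap _ _ _ (inr (lMinus RR t pair j i)))) ∧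
        (∀ i j, s (bgMap _ _ _ (inl (lMinus RR t pair i j))) =
          E.antipode (bgMap _ _ _ (inr (lPlus RR t pair j i)))) ∧
        (∀ i j, s (bgMap _ _ _ (inr (lPlus RR t pair i j))) =
          E.antipode (bgMap _ _ _ (inl (lMinus RR t pair j i)))) ∧
        (∀ i j, s (bgMap _ _ _ (inr (lMinus RR t pair i j))) =
          E.antipode (bgMap _ _ _ (inl (lPlus RR t pair j i)))) ∧
        (∀ i j, s (bosP _ _ _ (i, j)) = bosP _ _ _ (j, i)) ∧
        s (bosXi _ _ _) = -bosXi _ _ _) ∧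
    -- the vectorial case
    (∀ (R' : Mat2 n) (η : Matrix (Fin n) (Fin n) K), IsBraidedData R' R → IsRealTypeI R' →
      toAlg A R' * leg1 t * leg2 t = leg2 t * leg1 t * toAlg A R' →
      IsQuantumMetric t R' η →
      ∃ (E : HopfData (Bos D (vecAct t pair) (VecRel R')))
        (s : Bos D (vecAct t pair) (VecRel R') →ₛₗ[conjK] Bos D (vecAct t pair) (VecRel R')),
        IsQuasiStarBosonisation D (vecAct t pair) (VecRel R') RR.val ℓ st E s ∧
        (∀ i j, s (bgMap _ _ _ (lPlus RR t pair i j)) =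
          E.antipode (bgMap _ _ _ (lMinus RR t pair j i))) ∧
        (∀ i j, s (bgMap _ _ _ (lMinus RR t pair i j)) =
          E.antipode (bgMap _ _ _ (lPlus RR t pair j i))) ∧
        (∀ i, s (bosP _ _ _ i) = ∑ a, η i a • bosP _ _ _ a) ∧
        s (bosXi _ _ _) = -bosXi _ _ _) ∧
    -- the spinorial `q`-Euclidean case
    (∀ (q : Kˣ) (ε : Matrix (Fin n) (Fin n) K), IsHecke q R → IsSpinorMetric t stA ε →
      ∃ (E : HopfData (Bos D.square (matAct t pair) (EucRel R)))
        (s : Bos D.square (matAct t pair) (EucRel R) →ₛₗ[conjK]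
          Bos D.square (matAct t pair) (EucRel R)),
        IsQuasiStarBosonisation D.square (matAct t pair) (EucRel R)
          (squareR RR.val) (ℓ + ℓ) (squareStar D st) E s ∧
        (∀ i j, E.antipode (s (bgMap _ _ _ (inl (lPlus RR t pair i j)))) =
          bgMap _ _ _ (inl (lMinus RR t pair j i))) ∧
        (∀ i j, E.antipode (s (bgMap _ _ _ (inl (lMinus RR t pair i j)))) =
          bgMap _ _ _ (inl (lPlus RR t pair j i))) ∧
        (∀ i j, s (bgMap _ _ _ (inr (lPlus RR t pair i j))) =
          E.antipode (bgMap _ _ _ (inr (lMinus RR t pair j i)))) ∧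
        (∀ i j, s (bgMap _ _ _ (inr (lMinus RR t pair i j))) =
          E.antipode (bgMap _ _ _ (inr (lPlus RR t pair j i)))) ∧
        (∀ i j, s (bosP _ _ _ (i, j)) = ∑ a, ∑ b, (invT ε a i * ε b j) • bosP _ _ _ (a, b)) ∧
        s (bosXi _ _ _) = -bosXi _ _ _) :=
  ⟨fun _ hq => hQ.exists_minkowski hℓ hR hq,
    fun _ _ hB hR' hint hη => hQ.exists_vectorial hℓ hR hB hR' hint hη,
    fun _ _ hq hε => hQ.exists_euclidean hℓ hR hq hε⟩
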